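/- Let $(M^n,g)$ be a closed connected Riemannian manifold with Laplacian $\Delta=\operatorname{div}\nabla$, and let $F:M\to[t_0,t_1]$ (with $t_0=\min F<t_1=\max F$) be a smooth isoparametric function: $|\nabla F|^2$ and $\Delta F$ are smooth functions of $F$ on $[t_0,t_1]$. Let $M_0=F^{-1}(t_0)$, $M_1=F^{-1}(t_1)$ be the focal sets, ${\bf d}(x)=d_g(M_0,x)$, $D=d_g(M_0,M_1)$, and for $0<t<D$ let $h(t)$ be the mean curvature of the hypersurface ${\bf d}^{-1}(t)$, i.e. $h({\bf d}(x))=\Delta {\bf d}(x)$ off $M_0\cup M_1$. Fix $\theta\in(0,1)$ and $q>1$, and put $$\mathcal B_2=\{u\in C^{2,\theta}([0,D]): u'(0)=u'(D)=0\},\qquad \mathcal B_4=\{u\in C^{4,\theta}([0,D]): u'(0)=u'''(0)=u'(D)=u'''(D)=0\},$$ and $L(u)=u''+hu'$ on $\mathcal B_2$. Let ${\bf a},{\bf b}:(0,\infty)\to(0,\infty)$ be smooth increasing functions with ${\bf a}^2>4{\bf b}$, $\lim_{t\to0}{\bf a}=\lim_{t\to0}{\bf b}=0$, $\lim_{t\to\infty}{\bf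 a}=\lim_{t\to\infty}{\bf b}=\infty$, and assume that $$\phi(t)=\tfrac12\Big({\bf a}(t)-\sqrt{{\bf a}(t)^2+4{\bf b}(t)(q-1)}\Big)$$ is strictly decreasing with $\lim_{t\to0}\phi(t)=0$ and $\lim_{t\to\infty}\phi(t)=-\infty$. For $u\in\mathcal B_4$, $t\in(0,\infty)$ let $$H(u,t)=u''''+2hu'''+(2h'+h^2-{\bf a}(t))u''+(h''+hh'-{\bf a}(t)h)u'+{\bf b}(t)(u-u^q).$$ Solutions of $H(u,t)=0$ are pairs $(u,t)\in\mathcal B_4\times(0,\infty)$ with $u>0$; the solutions $(1,t)$ are trivial, those with $u\not\equiv1$ nontrivial, and $(1,t)$ is a bifurcation point if it lies in the closure in $\mathcal B_4\times(0,\infty)$ of the set of nontrivial solutions. Assume the transversality condition: $-{\bf a}'(t)\phi(t)+{\bf b}'(t)(1-q)\ne0$ for every $t>0$ such that $\phi(t)$ is an eigenvalue of $L$. Then the eigenvalues of $L$ form a sequence $0=\lambda_0>\lambda_1>\lambda_2>\cdots\to-\infty$; for each $i\ge1$ there is a unique $t_i>0$ with $\phi(t_i)=\lambda_i$, and $0<t_1<t_2<\cdots\to\infty$;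 and the set of bifurcation points is exactly $\{(1,t_i):i\ge1\}$. Moreover, for each $i\ge1$ and each eigenfunction $\varphi_i\neq 0$ of $L$ with eigenvalue $\lambda_i$: (1) The bifurcation point $(1,t_i)$ is simple: $\varphi_i\in\mathcal B_4$, the kernel of $D_uH(1,t_i):\mathcal B_4\to C^{0,\theta}([0,D])$ is $\mathbb R\varphi_i$, its range has codimension one, and $D^2_{u,t}H(1,t_i)[\varphi_i]=-{\bf a}'(t_i)L\varphi_i+{\bf b}'(t_i)(1-q)\varphi_i$ is not in the range. (2) The nontrivial solutions near $(1,t_i)$ are given by a continuous path $s\mapsto(u_i(s),t_i(s))\in\mathcal B_4\times(0,\infty)$, $|s|<\varepsilon$, with $(u_i(0),t_i(0))=(1,t_i)$ and $u_i(s)=1+s\varphi_i+O(s^2)$ in $C^{4,\theta}([0,D])$: for $s\ne0$ the point $(u_i(s),t_i(s))$ is a nontrivial solution, and every nontrivial solution close enough to $(1,t_i)$ equals $(u_i(s),t_i(s))$ for exactly one $s\neq 0$. (3) $\varphi_i$, and also $u_i(s)$ for $s\ne0$ close to $0$, has exactly $i+1$ critical points in $[0,D]$ (counting $0$ and $D$),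 all nondegenerate. -/

import Mathlib

open Set Filter Topology
open scoped Manifold ContDiff Bundle NNReal ENNReal

namespace PaneitzBifurcation

noncomputable section Geometry

variable {n : ℕ} {M : Type*} [MetricSpace M] [ChartedSpace (EuclideanSpace ℝ (Fin n)) M]

/-- The `i`-th partial derivative of a real function on `ℝⁿ`. -/
def partialDeriv (i : Fin n) (f : EuclideanSpace ℝ (Fin n) → ℝ)
    (y : EuclideanSpace ℝ (Fin n)) : ℝ :=
  fderiv ℝ f y (EuclideanSpace.single i 1)

/-- A function on `M` read in the preferred chart at `x`. -/
def inChart (x : M) (f : M → ℝ) (y : EuclideanSpace ℝ (Fin n)) : ℝ :=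
  f ((extChartAt (𝓡 n) x).symm y)

/-- The coordinate vector field `∂/∂yᵢ` of the preferred chart at `x`, at the point with
coordinates `y`. -/
def coordVector (x : M) (i : Fin n) (y : EuclideanSpace ℝ (Fin n)) :
    TangentSpace (𝓡 n) ((extChartAt (𝓡 n) x).symm y) :=
  mfderiv (𝓡 n) (𝓡 n) (extChartAt (𝓡 n) x).symm y
    (EuclideanSpace.single i (1 : ℝ) : EuclideanSpace ℝ (Fin n))

variable [Bundle.RiemannianBundle (fun x : M ↦ TangentSpace (𝓡 n) x)]

/-- The matrix `(g i j)` of the Riemannian metric in the preferred chart at `x`. -/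
def metricMatrix (x : M) (y : EuclideanSpace ℝ (Fin n)) : Matrix (Fin n) (Fin n) ℝ :=
  Matrix.of fun i j ↦ inner ℝ (coordVector x i y) (coordVector x j y)

/-- `|∇ f|²` at `x`, that is `∑ gⁱʲ ∂ᵢ f ∂ⱼ f`. -/
def gradNormSq (f : M → ℝ) (x : M) : ℝ :=
  ∑ i, ∑ j, (metricMatrix x (extChartAt (𝓡 n) x x))⁻¹ i j *
    partialDeriv i (inChart x f) (extChartAt (𝓡 n) x x) *
    partialDeriv j (inChart x f) (extChartAt (𝓡 n) x x)

/-- The (non-positive) Laplace operator `Δ f = div ∇ f` at `x`, that is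
`(det g)^(-1/2) ∑ ∂ᵢ ((det g)^(1/2) gⁱʲ ∂ⱼ f)`. -/
def laplacian (f : M → ℝ) (x : M) : ℝ :=
  (√(metricMatrix x (extChartAt (𝓡 n) x x)).det)⁻¹ *
    ∑ i, partialDeriv i
      (fun y ↦ √(metricMatrix x y).det *
        ∑ j, (metricMatrix x y)⁻¹ i j * partialDeriv j (inChart x f) y)
      (extChartAt (𝓡 n) x x)

/-- `F : M → [t₀, t₁]` is an isoparametric function with minimum `t₀` and maximum `t₁`:
it is smooth and non-constant, `|∇ F|² = b(F)` and `Δ F = a(F)` with `a`, `b` smooth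
on `[t₀, t₁]`. -/
structure IsIsoparametric (F : M → ℝ) (t₀ t₁ : ℝ) : Prop where
  lt : t₀ < t₁
  range_eq : range F = Icc t₀ t₁
  smooth : ContMDiff (𝓡 n) 𝓘(ℝ, ℝ) ∞ F
  gradient : ∃ b : ℝ → ℝ, ContDiffOn ℝ ∞ b (Icc t₀ t₁) ∧
    ∀ x, gradNormSq (n := n) F x = b (F x)
  laplace : ∃ a : ℝ → ℝ, ContDiffOn ℝ ∞ a (Icc t₀ t₁) ∧
    ∀ x, laplacian (n := n) F x = a (F x)

/-- The distance `d(x) = dist(M₀, x)` to the focal set `M₀ = F⁻¹(t₀)`. -/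
def focalDist (F : M → ℝ) (t₀ : ℝ) (x : M) : ℝ :=
  Metric.infDist x (F ⁻¹' {t₀})

/-- The distance `D` between the focal sets `M₀ = F⁻¹(t₀)` and `M₁ = F⁻¹(t₁)`. -/
def focalWidth (F : M → ℝ) (t₀ t₁ : ℝ) : ℝ :=
  sInf {r | ∃ x y, F x = t₀ ∧ F y = t₁ ∧ r = dist x y}

open Classical in
/-- The mean curvature `h(t)` of the hypersurface `d⁻¹(t)`, computed as `Δ d` at a point of the
hypersurface (for an isoparametric function and `0 < t < D`, the hypersurface is nonempty and
`Δ d` is constant on it). -/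
def meanCurvature (F : M → ℝ) (t₀ t : ℝ) : ℝ :=
  if hx : ∃ x : M, focalDist F t₀ x = t then
    laplacian (n := n) (focalDist F t₀) hx.choose
  else 0

end Geometry

noncomputable section Equation

/-- The `k`-th derivative of `u` on the closed interval `[0, D]` (one-sided at the endpoints). -/
def derivOn (D : ℝ) (k : ℕ) (u : ℝ → ℝ) (x : ℝ) : ℝ :=
  iteratedDerivWithin k u (Icc 0 D) x

/-- `u ∈ C^{k,θ}([0, D])`. -/
def MemC (D : ℝ) (θ : ℝ≥0) (k : ℕ) (u : ℝ → ℝ) : Prop :=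
  ContDiffOn ℝ k u (Icc 0 D) ∧ MemHolder θ (fun x : Icc 0 D ↦ derivOn D k u x)

/-- The norm of `C^{k,θ}([0, D])`: the sum of the suprema of the derivatives of order at most `k`
and of the `θ`-Hölder seminorm of the `k`-th derivative. -/
def normC (D : ℝ) (θ : ℝ≥0) (k : ℕ) (u : ℝ → ℝ) : ℝ≥0∞ :=
  (∑ j ∈ Finset.range (k + 1), ⨆ x : Icc 0 D, ‖derivOn D j u x‖ₑ) +
    eHolderNorm θ (fun x : Icc 0 D ↦ derivOn D k u x)

/-- The space `B₂` of `u ∈ C^{2,θ}([0, D])` with `u'(0) = u'(D) = 0`. -/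
def MemB₂ (D : ℝ) (θ : ℝ≥0) (u : ℝ → ℝ) : Prop :=
  MemC D θ 2 u ∧ derivOn D 1 u 0 = 0 ∧ derivOn D 1 u D = 0

/-- The space `B₄` of `u ∈ C^{4,θ}([0, D])` with `u'(0) = u'''(0) = u'(D) = u'''(D) = 0`. -/
def MemB₄ (D : ℝ) (θ : ℝ≥0) (u : ℝ → ℝ) : Prop :=
  MemC D θ 4 u ∧ derivOn D 1 u 0 = 0 ∧ derivOn D 3 u 0 = 0 ∧
    derivOn D 1 u D = 0 ∧ derivOn D 3 u D = 0

/-- The operator `L u = u'' + h u'`. -/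
def opL (h : ℝ → ℝ) (D : ℝ) (u : ℝ → ℝ) (x : ℝ) : ℝ :=
  derivOn D 2 u x + h x * derivOn D 1 u x

/-- `u'''' + 2 h u''' + (2 h' + h² - α) u'' + (h'' + h h' - α h) u'`. -/
def linearPart (h : ℝ → ℝ) (D α : ℝ) (u : ℝ → ℝ) (x : ℝ) : ℝ :=
  derivOn D 4 u x + 2 * h x * derivOn D 3 u x +
    (2 * deriv h x + h x ^ 2 - α) * derivOn D 2 u x +
    (iteratedDeriv 2 h x + h x * deriv h x - α * h x) * derivOn D 1 u x

/-- The nonlinear map `H(u, t)`. -/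
def opH (h : ℝ → ℝ) (D q : ℝ) (a b : ℝ → ℝ) (u : ℝ → ℝ) (t x : ℝ) : ℝ :=
  linearPart h D (a t) u x + b t * (u x - u x ^ q)

/-- The linearization `D_u H(1, t)[v]` at the trivial solution. -/
def opDH (h : ℝ → ℝ) (D q : ℝ) (a b : ℝ → ℝ) (t : ℝ) (v : ℝ → ℝ) (x : ℝ) : ℝ :=
  linearPart h D (a t) v x + b t * (1 - q) * v x

/-- The mixed derivative `D²_{u,t} H(1, t)[v] = -a'(t) L v + b'(t) (1 - q) v`. -/
def opMixed (h : ℝ → ℝ) (D q : ℝ) (a b : ℝ → ℝ) (t : ℝ) (v : ℝ → ℝ) (x : ℝ) : ℝ :=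
  -deriv a t * opL h D v x + deriv b t * (1 - q) * v x

/-- `φ(t) = (a(t) - √(a(t)² + 4 b(t) (q - 1))) / 2`. -/
def phi (q : ℝ) (a b : ℝ → ℝ) (t : ℝ) : ℝ :=
  1 / 2 * (a t - √(a t ^ 2 + 4 * b t * (q - 1)))

/-- `v ∈ B₂` is an eigenfunction of `L`: `v ≠ 0` and `L v = μ v`. -/
def IsEigenfunction (h : ℝ → ℝ) (D : ℝ) (θ : ℝ≥0) (μ : ℝ) (v : ℝ → ℝ) : Prop :=
  MemB₂ D θ v ∧ (∃ x ∈ Icc 0 D, v x ≠ 0) ∧ ∀ x ∈ Ioo 0 D, opL h D v x = μ * v x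

/-- `μ` is an eigenvalue of `L` on `B₂`. -/
def IsEigenvalue (h : ℝ → ℝ) (D : ℝ) (θ : ℝ≥0) (μ : ℝ) : Prop :=
  ∃ v, IsEigenfunction h D θ μ v

/-- `(u, t) ∈ B₄ × (0, ∞)` solves `H(u, t) = 0`, with `u > 0`. -/
def IsSolution (h : ℝ → ℝ) (D : ℝ) (θ : ℝ≥0) (q : ℝ) (a b : ℝ → ℝ) (u : ℝ → ℝ) (t : ℝ) : Prop :=
  0 < t ∧ MemB₄ D θ u ∧ (∀ x ∈ Icc 0 D, 0 < u x) ∧ ∀ x ∈ Ioo 0 D, opH h D q a b u t x = 0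

/-- A solution `(u, t)` with `u ≠ 1`. -/
def IsNontrivialSolution (h : ℝ → ℝ) (D : ℝ) (θ : ℝ≥0) (q : ℝ) (a b : ℝ → ℝ)
    (u : ℝ → ℝ) (t : ℝ) : Prop :=
  IsSolution h D θ q a b u t ∧ ∃ x ∈ Icc 0 D, u x ≠ 1

/-- `(1, t)` is a bifurcation point: it lies in the closure, in `B₄ × (0, ∞)`, of the set of
nontrivial solutions. -/
def IsBifurcationPoint (h : ℝ → ℝ) (D : ℝ) (θ : ℝ≥0) (q : ℝ) (a b : ℝ → ℝ) (t : ℝ) : Prop :=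
  0 < t ∧ ∀ ε : ℝ, 0 < ε → ∃ u s, IsNontrivialSolution h D θ q a b u s ∧
    normC D θ 4 (fun x ↦ u x - 1) < ENNReal.ofReal ε ∧ |s - t| < ε

/-- The bifurcation point `(1, t)` is simple, with kernel spanned by `v`: with
`T = D_u H(1, t) : B₄ → C^{0,θ}([0, D])`, the kernel of `T` is the line spanned by `v`, the
range of `T` has codimension one, and `D²_{u,t} H(1, t)[v]` is not in the range of `T`. -/
def IsSimpleWithKernel (h : ℝ → ℝ) (D : ℝ) (θ : ℝ≥0) (q : ℝ) (a b : ℝ → ℝ) (t : ℝ)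
    (v : ℝ → ℝ) : Prop :=
  (MemB₄ D θ v ∧ ∃ x ∈ Icc 0 D, v x ≠ 0) ∧
  (∀ w, MemB₄ D θ w →
    ((∀ x ∈ Ioo 0 D, opDH h D q a b t w x = 0) ↔ ∃ c : ℝ, ∀ x ∈ Icc 0 D, w x = c * v x)) ∧
  (¬ ∃ w, MemB₄ D θ w ∧ ∀ x ∈ Ioo 0 D, opDH h D q a b t w x = opMixed h D q a b t v x) ∧
  (∀ f, MemC D θ 0 f → ∃ w, MemB₄ D θ w ∧ ∃ c : ℝ,
    ∀ x ∈ Ioo 0 D, f x = opDH h D q a b t w x + c * opMixed h D q a b t v x)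

/-- `u` has exactly `k` critical points in `[0, D]` (endpoints included), all nondegenerate. -/
def HasNondegenerateCriticalPoints (D : ℝ) (k : ℕ) (u : ℝ → ℝ) : Prop :=
  {x ∈ Icc 0 D | derivOn D 1 u x = 0}.encard = k ∧
    ∀ x ∈ Icc 0 D, derivOn D 1 u x = 0 → derivOn D 2 u x ≠ 0

/-- The nontrivial solutions near `(1, t)` form a path `s ↦ (U s, T s)`, `|s| < ε`, `s ≠ 0`,
continuous in `B₄ × (0, ∞)`, with `(U 0, T 0) = (1, t)` and `U s = 1 + s v + O(s²)` in
`C^{4,θ}([0, D])`; each such solution is `(U s, T s)` for exactly one `s`. -/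
def IsBifurcationCurve (h : ℝ → ℝ) (D : ℝ) (θ : ℝ≥0) (q : ℝ) (a b : ℝ → ℝ) (t : ℝ)
    (v : ℝ → ℝ) (ε : ℝ) (U : ℝ → ℝ → ℝ) (T : ℝ → ℝ) : Prop :=
  (∀ x ∈ Icc 0 D, U 0 x = 1) ∧ T 0 = t ∧
  (∀ s ∈ Ioo (-ε) ε, s ≠ 0 → IsNontrivialSolution h D θ q a b (U s) (T s)) ∧
  ContinuousOn T (Ioo (-ε) ε) ∧
  (∀ s ∈ Ioo (-ε) ε,
    Tendsto (fun r ↦ normC D θ 4 (fun x ↦ U r x - U s x)) (𝓝 s) (𝓝 0)) ∧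
  (∃ C : ℝ, ∀ s ∈ Ioo (-ε) ε,
    normC D θ 4 (fun x ↦ U s x - 1 - s * v x) ≤ ENNReal.ofReal (C * s ^ 2)) ∧
  (∃ δ : ℝ, 0 < δ ∧ ∀ u r, IsNontrivialSolution h D θ q a b u r →
    normC D θ 4 (fun x ↦ u x - 1) < ENNReal.ofReal δ → |r - t| < δ →
    ∃! s, s ∈ Ioo (-ε) ε ∧ s ≠ 0 ∧ T s = r ∧ EqOn (U s) u (Icc 0 D))

end Equation

end PaneitzBifurcation

/-!
The theorem reduces to an ordinary differential operator on `[0, D]` whose coefficient `h` has known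
poles at the endpoints; bifurcation theory is then done in the Banach space `C([0, D])`.

*Geometry.* Write `|∇F|² = β(F)` and `ΔF = α(F)`. The zeros of `β` on `[t₀, t₁]` are simple, since
otherwise `log (F - s)` would be Lipschitz (`IsoData.not_double_zero`); hence `β > 0` between the
endpoints and `∫ β^(-1/2)` converges. It equals the distance to `M₀` (`IsoData.focalDist_eq`):
the integral is a `1`-Lipschitz function of the point, and it can be decreased at rate almost `1`
off the focal sets. Thus `d` is a function of `F` and `h = (α - β' / 2) / √β`. At a boundary
point of `M₀`, differentiating `|∇F|² = β(F)` shows that the Hessian `A` satisfies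
`A G⁻¹ A = k A` with `k = β'(t₀) / 2 > 0`, so `k⁻¹ G⁻¹ A` is idempotent and `α(t₀) = k r` with `r` its
rank (`IsoData.exists_rank_of_frontier`). This makes the residue of `h` an integer. With the same at
`M₁`, `h(t) = m₀ / t - m₁ / (D - t) + κ(t)` with natural numbers `m₀`, `m₁` and a smooth `κ`, which is
the notion of a `Profile` (`IsoData.exists_profile`).

*The operator `L`.* With the weight `p = t^m₀ (D - t)^m₁ exp (∫ κ)` one has `L u = p⁻¹ (p u')'`, and
`L` is inverted modulo constants by two integrations. The resulting compact operator `S` on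
`C([0, D])` gains two derivatives in the Hölder scale (`Profile.exists_resolvent`). Its spectrum and
the number of critical points of the eigenfunctions come from Prüfer angles: the solutions of
`L u = -ξ² u` regular at `0` and at `D` have angles increasing in `ξ`, and `-ξ²` is an eigenvalue
exactly when the two angles at `D / 2` add up to `i π`; the angle crosses multiples of `π` only
upwards, so `u'` has `i + 1` zeros, all simple (`Profile.exists_spectrum`).

*Bifurcation.* Writing `u = 1 + S² g` turns `H(u, t) = 0` into
`A(t) g + b(t) 𝒩(S² g) = 0` in `C([0, D])`, where `A(t)` is bounded, affine in `a(t)` and `b(t)`, and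
`𝒩` is quadratic at `0` (`ResolventData.isNontrivialSolution_iff`). The linearization factors as
`L² - a L - b (q - 1) = (L - φ(t)) (L - μ')` with `μ' > 0`, so it is singular exactly when `φ(t)` is
a negative eigenvalue, with kernel spanned by `g = λᵢ² φᵢ`. Elsewhere the trivial solution is
isolated; at such `t` the bordered operator is invertible by transversality, and a contraction
gives the whole solution set near `(1, tᵢ)` (`exists_branch`). The equation
expresses `g'` through `g` (`derG`), which upgrades uniform estimates to estimates of `u` in `C^{4,θ}`.
Finally `(u - 1) / s` is `C²`-close to `φᵢ`, which has nondegenerate critical points, two of them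
at the endpoints, and their number is stable (`exists_encard_zeros_eq`). `Profile.bifurcation` combines
these facts.
-/

namespace PaneitzBifurcation

/-! ### Quantitative `C^{k,θ}` bounds -/

section HolderBounds

/-- `CBound θ S k R f`: on the set `S` the derivatives of `f` of order at most `k` (taken within
`S`) are bounded by `R`, and the `k`-th one is `θ`-Hölder with constant `R`. -/
def CBound (θ : ℝ) (S : Set ℝ) : ℕ → ℝ → (ℝ → ℝ) → Prop
  | 0, R, f => (∀ x ∈ S, |f x| ≤ R) ∧ ∀ x ∈ S, ∀ y ∈ S, |f x - f y| ≤ R * |x - y| ^ θ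
  | k + 1, R, f => (∀ x ∈ S, |f x| ≤ R) ∧
      ∃ f', (∀ x ∈ S, HasDerivWithinAt f (f' x) S x) ∧ CBound θ S k R f'

variable {θ : ℝ} {S S' : Set ℝ} {a b : ℝ} {k : ℕ} {R R' c : ℝ} {f g : ℝ → ℝ}

lemma CBound.bound (hf : CBound θ S k R f) : ∀ x ∈ S, |f x| ≤ R := by
  cases k with
  | zero => exact hf.1
  | succ k => exact hf.1

lemma CBound.nonneg (hS : S.Nonempty) (hf : CBound θ S k R f) : 0 ≤ R :=
  (abs_nonneg _).trans (hf.bound _ hS.some_mem)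

lemma CBound.mono (h : R ≤ R') (hf : CBound θ S k R f) : CBound θ S k R' f := by
  induction k generalizing f with
  | zero =>
    refine ⟨fun x hx ↦ (hf.1 x hx).trans h, fun x hx y hy ↦ (hf.2 x hx y hy).trans ?_⟩
    gcongr
  | succ k ih =>
    obtain ⟨h1, f', h2, h3⟩ := hf
    exact ⟨fun x hx ↦ (h1 x hx).trans h, f', h2, ih h3⟩

lemma CBound.congr (hf : CBound θ S k R f) (h : EqOn g f S) : CBound θ S k R g := by
  cases k with
  | zero =>
    refine ⟨fun x hx ↦ by rw [h hx]; exact hf.1 x hx, fun x hx y hy ↦ ?_⟩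
    rw [h hx, h hy]; exact hf.2 x hx y hy
  | succ k =>
    obtain ⟨h1, f', h2, h3⟩ := hf
    exact ⟨fun x hx ↦ by rw [h hx]; exact h1 x hx, f',
      fun x hx ↦ (h2 x hx).congr h (h hx), h3⟩

lemma CBound.restrict (h : S' ⊆ S) (hf : CBound θ S k R f) : CBound θ S' k R f := by
  induction k generalizing f with
  | zero => exact ⟨fun x hx ↦ hf.1 x (h hx), fun x hx y hy ↦ hf.2 x (h hx) y (h hy)⟩
  | succ k ih =>
    obtain ⟨h1, f', h2, h3⟩ := hf
    exact ⟨fun x hx ↦ h1 x (h hx), f', fun x hx ↦ (h2 x (h hx)).mono h, ih h3⟩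

lemma CBound.add (hf : CBound θ S k R f) (hg : CBound θ S k R' g) :
    CBound θ S k (R + R') (fun x ↦ f x + g x) := by
  induction k generalizing f g with
  | zero =>
    refine ⟨fun x hx ↦ (abs_add_le _ _).trans (add_le_add (hf.1 x hx) (hg.1 x hx)),
      fun x hx y hy ↦ ?_⟩
    calc |f x + g x - (f y + g y)| = |(f x - f y) + (g x - g y)| := by ring_nf
      _ ≤ |f x - f y| + |g x - g y| := abs_add_le _ _
      _ ≤ R * |x - y| ^ θ + R' * |x - y| ^ θ := add_le_add (hf.2 x hx y hy) (hg.2 x hx y hy)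
      _ = _ := by ring
  | succ k ih =>
    obtain ⟨h1, f', h2, h3⟩ := hf
    obtain ⟨k1, g', k2, k3⟩ := hg
    exact ⟨fun x hx ↦ (abs_add_le _ _).trans (add_le_add (h1 x hx) (k1 x hx)), _,
      fun x hx ↦ (h2 x hx).add (k2 x hx), ih h3 k3⟩

lemma CBound.const_mul (c : ℝ) (hf : CBound θ S k R f) :
    CBound θ S k (|c| * R) (fun x ↦ c * f x) := by
  induction k generalizing f with
  | zero =>
    refine ⟨fun x hx ↦ ?_, fun x hx y hy ↦ ?_⟩
    · rw [abs_mul]; gcongr; exact hf.1 x hx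
    · rw [← mul_sub, abs_mul, mul_assoc]; gcongr; exact hf.2 x hx y hy
  | succ k ih =>
    obtain ⟨h1, f', h2, h3⟩ := hf
    refine ⟨fun x hx ↦ ?_, _, fun x hx ↦ (h2 x hx).const_mul c, ih h3⟩
    rw [abs_mul]; gcongr; exact h1 x hx

lemma CBound.neg (hf : CBound θ S k R f) : CBound θ S k R (fun x ↦ - f x) := by
  simpa using hf.const_mul (-1)

lemma CBound.sub (hf : CBound θ S k R f) (hg : CBound θ S k R' g) :
    CBound θ S k (R + R') (fun x ↦ f x - g x) := by
  simpa [sub_eq_add_neg] using hf.add hg.neg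

lemma CBound.const (c : ℝ) : CBound θ S k |c| (fun _ ↦ c) := by
  induction k generalizing c with
  | zero => exact ⟨fun _ _ ↦ le_rfl, fun x _ y _ ↦ by simp; positivity⟩
  | succ k ih =>
    refine ⟨fun _ _ ↦ le_rfl, fun _ ↦ 0, fun x _ ↦ hasDerivWithinAt_const _ _ _, ?_⟩
    exact (ih 0).mono (by simp)

lemma CBound.continuousOn (hθ : 0 < θ) (hf : CBound θ S k R f) : ContinuousOn f S := by
  cases k with
  | succ k => exact fun x hx ↦ (hf.2.choose_spec.1 x hx).continuousWithinAt
  | zero =>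
    intro x hx
    have h0 : Tendsto (fun y ↦ R * |y - x| ^ θ) (𝓝[S] x) (𝓝 0) := by
      have : ContinuousAt (fun y ↦ R * |y - x| ^ θ) x := by
        apply ContinuousAt.mul continuousAt_const
        apply ContinuousAt.rpow_const (by fun_prop) (Or.inr hθ.le)
      have h := this.tendsto
      simp only [sub_self, abs_zero, Real.zero_rpow hθ.ne', mul_zero] at h
      exact h.mono_left nhdsWithin_le_nhds
    rw [ContinuousWithinAt, tendsto_iff_dist_tendsto_zero]
    refine squeeze_zero' (Eventually.of_forall fun _ ↦ dist_nonneg) ?_ h0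
    filter_upwards [self_mem_nhdsWithin] with y hy
    exact hf.2 y hy x hx

/-- On an interval of length `b - a`, a Lipschitz bound is a Hölder bound. -/
lemma abs_sub_le_holder (hθ : θ ≤ 1) (hR : 0 ≤ R) {x y : ℝ} (hx : x ∈ Icc a b) (hy : y ∈ Icc a b) :
    R * |x - y| ≤ (max 1 ((b - a) ^ (1 - θ)) * R) * |x - y| ^ θ := by
  rcases eq_or_ne x y with rfl | hne
  · simp; positivity
  have h0 : 0 < |x - y| := abs_pos.2 (sub_ne_zero.2 hne)
  have h1 : |x - y| ≤ b - a := by rw [abs_le]; constructor <;> linarith [hx.1, hx.2, hy.1, hy.2]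
  calc R * |x - y| = R * (|x - y| ^ (1 - θ) * |x - y| ^ θ) := by
        rw [← Real.rpow_add h0]; simp
    _ ≤ R * ((b - a) ^ (1 - θ) * |x - y| ^ θ) := by
        gcongr
    _ ≤ R * (max 1 ((b - a) ^ (1 - θ)) * |x - y| ^ θ) := by gcongr; exact le_max_right _ _
    _ = _ := by ring

lemma abs_sub_le_of_hasDerivWithinAt {f' : ℝ → ℝ} (hR : ∀ x ∈ Icc a b, |f' x| ≤ R)
    (hf : ∀ x ∈ Icc a b, HasDerivWithinAt f (f' x) (Icc a b) x) {x y : ℝ} (hx : x ∈ Icc a b)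
    (hy : y ∈ Icc a b) : |f x - f y| ≤ R * |x - y| := by
  have := (convex_Icc a b).norm_image_sub_le_of_norm_hasDerivWithin_le hf
    (fun x hx ↦ hR x hx) hy hx
  simpa using this

lemma CBound.of_hasDerivWithinAt (hθ : θ ≤ 1) {f' : ℝ → ℝ} (hf0 : ∀ x ∈ Icc a b, |f x| ≤ R)
    (hR : ∀ x ∈ Icc a b, |f' x| ≤ R)
    (hf : ∀ x ∈ Icc a b, HasDerivWithinAt f (f' x) (Icc a b) x) :
    CBound θ (Icc a b) 0 (max 1 ((b - a) ^ (1 - θ)) * R) f := by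
  refine ⟨fun x hx ↦ ?_, fun x hx y hy ↦ ?_⟩
  · refine (hf0 x hx).trans (le_mul_of_one_le_left ?_ (le_max_left _ _))
    exact (abs_nonneg _).trans (hf0 x hx)
  · exact (abs_sub_le_of_hasDerivWithinAt hR hf hx hy).trans
      (abs_sub_le_holder hθ ((abs_nonneg _).trans (hf0 x hx)) hx hy)

lemma CBound.pred (hθ : θ ≤ 1) (hf : CBound θ (Icc a b) (k + 1) R f) :
    CBound θ (Icc a b) k (max 1 ((b - a) ^ (1 - θ)) * R) f := by
  induction k generalizing f with
  | zero =>
    obtain ⟨h1, f', h2, h3⟩ := hf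
    exact CBound.of_hasDerivWithinAt hθ h1 h3.1 h2
  | succ k ih =>
    obtain ⟨h1, f', h2, h3⟩ := hf
    refine ⟨fun x hx ↦ (h1 x hx).trans (le_mul_of_one_le_left ?_ (le_max_left _ _)), f', h2, ih h3⟩
    exact (abs_nonneg _).trans (h1 x hx)

lemma CBound.exists_mul (hθ : θ ≤ 1) (hab : a ≤ b) (k : ℕ) :
    ∃ C, 0 ≤ C ∧ ∀ R R' f g, CBound θ (Icc a b) k R f → CBound θ (Icc a b) k R' g →
      CBound θ (Icc a b) k (C * (R * R')) (fun x ↦ f x * g x) := by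
  have hne : (Icc a b).Nonempty := nonempty_Icc.2 hab
  induction k with
  | zero =>
    refine ⟨2, by norm_num, fun R R' f g hf hg ↦ ?_⟩
    have hR := hf.nonneg hne
    have hR' := hg.nonneg hne
    refine ⟨fun x hx ↦ ?_, fun x hx y hy ↦ ?_⟩
    · rw [abs_mul]
      have : |f x| * |g x| ≤ R * R' := mul_le_mul (hf.1 x hx) (hg.1 x hx) (abs_nonneg _) hR
      nlinarith [mul_nonneg hR hR']
    · calc |f x * g x - f y * g y| = |f x * (g x - g y) + (f x - f y) * g y| := by ring_nf
        _ ≤ |f x| * |g x - g y| + |f x - f y| * |g y| := by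
          rw [← abs_mul, ← abs_mul]; exact abs_add_le _ _
        _ ≤ R * (R' * |x - y| ^ θ) + R * |x - y| ^ θ * R' := by
          gcongr
          exacts [hf.1 x hx, hg.2 x hx y hy, hf.2 x hx y hy, hg.1 y hy]
        _ = _ := by ring
  | succ k ih =>
    obtain ⟨C, hC, h⟩ := ih
    set M := max 1 ((b - a) ^ (1 - θ)) with hM
    refine ⟨max 1 (C * M + C * M), by positivity, fun R R' f g hf hg ↦ ?_⟩
    have hR := hf.nonneg hne
    have hR' := hg.nonneg hne
    have hf0 := hf.pred hθ
    have hg0 := hg.pred hθ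
    obtain ⟨h1, f', h2, h3⟩ := hf
    obtain ⟨k1, g', k2, k3⟩ := hg
    refine ⟨fun x hx ↦ ?_, _, fun x hx ↦ (h2 x hx).mul (k2 x hx), ?_⟩
    · rw [abs_mul]
      have : |f x| * |g x| ≤ R * R' := mul_le_mul (h1 x hx) (k1 x hx) (abs_nonneg _) hR
      exact this.trans (le_mul_of_one_le_left (by positivity) (le_max_left _ _))
    · refine ((h _ _ _ _ h3 hg0).add (h _ _ _ _ hf0 k3)).mono ?_
      calc C * (R * (M * R')) + C * (M * R * R') = (C * M + C * M) * (R * R') := by ring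
        _ ≤ _ := by gcongr; exact le_max_right _ _

lemma exists_CBound_of_contDiffOn (hθ : θ ≤ 1) (hab : a < b)
    (hf : ContDiffOn ℝ (k + 1) f (Icc a b)) : ∃ R, CBound θ (Icc a b) k R f := by
  have hu : UniqueDiffOn ℝ (Icc a b) := uniqueDiffOn_Icc hab
  have hb : ∀ {g : ℝ → ℝ}, ContinuousOn g (Icc a b) → ∃ R, ∀ x ∈ Icc a b, |g x| ≤ R :=
    fun hg ↦ isCompact_Icc.exists_bound_of_continuousOn hg
  induction k generalizing f with
  | zero =>
    have hd : ∀ x ∈ Icc a b, HasDerivWithinAt f (derivWithin f (Icc a b) x) (Icc a b) x :=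
      fun x hx ↦ (hf.differentiableOn (by simp) x hx).hasDerivWithinAt
    obtain ⟨R, hR⟩ := hb hf.continuousOn
    obtain ⟨R', hR'⟩ := hb (hf.continuousOn_derivWithin hu (by simp))
    exact ⟨_, CBound.of_hasDerivWithinAt hθ (R := max R R')
      (fun x hx ↦ (hR x hx).trans (le_max_left _ _))
      (fun x hx ↦ (hR' x hx).trans (le_max_right _ _)) hd⟩
  | succ k ih =>
    have hd : ∀ x ∈ Icc a b, HasDerivWithinAt f (derivWithin f (Icc a b) x) (Icc a b) x :=
      fun x hx ↦ (hf.differentiableOn (by norm_cast) x hx).hasDerivWithinAt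
    obtain ⟨R, hR⟩ := hb hf.continuousOn
    obtain ⟨R', hR'⟩ := ih (hf.derivWithin hu (m := (k + 1 : ℕ)) (by norm_cast))
    exact ⟨max R R', fun x hx ↦ (hR x hx).trans (le_max_left _ _), _, hd,
      hR'.mono (le_max_right _ _)⟩

lemma CBound.contDiffOn (hθ : 0 < θ) (hab : a < b) (hf : CBound θ (Icc a b) k R f) :
    ContDiffOn ℝ k f (Icc a b) := by
  have hu : UniqueDiffOn ℝ (Icc a b) := uniqueDiffOn_Icc hab
  induction k generalizing f with
  | zero => exact contDiffOn_zero.2 (hf.continuousOn hθ)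
  | succ k ih =>
    obtain ⟨h1, f', h2, h3⟩ := hf
    push_cast
    rw [contDiffOn_succ_iff_derivWithin hu]
    refine ⟨fun x hx ↦ (h2 x hx).differentiableWithinAt, by simp, ?_⟩
    exact (ih h3).congr fun x hx ↦ (h2 x hx).derivWithin (hu x hx)

/-- Reflection of the interval preserves the bounds. -/
lemma CBound.reflect {D : ℝ} (hf : CBound θ (Icc a b) k R f) :
    CBound θ (Icc (D - b) (D - a)) k R (fun x ↦ f (D - x)) := by
  have hm : ∀ x ∈ Icc (D - b) (D - a), D - x ∈ Icc a b :=
    fun x hx ↦ ⟨by linarith [hx.2], by linarith [hx.1]⟩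
  induction k generalizing f with
  | zero =>
    refine ⟨fun x hx ↦ hf.1 _ (hm x hx), fun x hx y hy ↦ ?_⟩
    have := hf.2 _ (hm x hx) _ (hm y hy)
    rwa [sub_sub_sub_cancel_left, abs_sub_comm y x] at this
  | succ k ih =>
    obtain ⟨h1, f', h2, h3⟩ := hf
    refine ⟨fun x hx ↦ h1 _ (hm x hx), fun x ↦ - f' (D - x), fun x hx ↦ ?_, (ih h3).neg⟩
    have h5 : HasDerivWithinAt (fun y ↦ D - y) (-1) (Icc (D - b) (D - a)) x := by
      simpa using (hasDerivWithinAt_id x _).const_sub D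
    have := (h2 _ (hm x hx)).scomp x h5 (fun y hy ↦ hm y hy)
    simpa [Function.comp_def] using this

/-- Bounds on two overlapping intervals give a bound on their union. -/
lemma CBound.exists_glue {c d : ℝ} (hac : a < c) (hcd : c < d) (hdb : d < b) (k : ℕ) (hθ : 0 < θ) :
    ∃ C, 0 ≤ C ∧ ∀ R f, CBound θ (Icc a d) k R f → CBound θ (Icc c b) k R f →
      CBound θ (Icc a b) k (C * R) f := by
  refine ⟨max 1 (2 / (d - c) ^ θ), by positivity, ?_⟩
  have hdc : 0 < (d - c) ^ θ := Real.rpow_pos_of_pos (by linarith) _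
  induction k with
  | zero =>
    intro R f hf hg
    have hR : 0 ≤ R := hf.nonneg (nonempty_Icc.2 (by linarith))
    have hbd : ∀ x ∈ Icc a b, |f x| ≤ R := fun x hx ↦ by
      rcases le_total x d with h | h
      · exact hf.1 x ⟨hx.1, h⟩
      · exact hg.1 x ⟨by linarith, hx.2⟩
    refine ⟨fun x hx ↦ (hbd x hx).trans (le_mul_of_one_le_left hR (le_max_left _ _)), ?_⟩
    -- two points that do not lie in a common piece are at distance at least `d - c`
    have key : ∀ x ∈ Icc a b, ∀ y ∈ Icc a b, x ≤ y →
        |f x - f y| ≤ (max 1 (2 / (d - c) ^ θ) * R) * |x - y| ^ θ := by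
      intro x hx y hy hxy
      have h1 : R * |x - y| ^ θ ≤ (max 1 (2 / (d - c) ^ θ) * R) * |x - y| ^ θ := by
        gcongr
        exact le_mul_of_one_le_left hR (le_max_left _ _)
      rcases le_or_gt y d with h | h
      · exact (hf.2 x ⟨hx.1, by linarith⟩ y ⟨hy.1, h⟩).trans h1
      rcases le_or_gt c x with h' | h'
      · exact (hg.2 x ⟨h', hx.2⟩ y ⟨by linarith, hy.2⟩).trans h1
      have h2 : d - c ≤ |x - y| := by
        rw [abs_sub_comm]
        exact (by linarith : d - c ≤ y - x).trans (le_abs_self _)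
      calc |f x - f y| ≤ |f x| + |f y| := abs_sub _ _
        _ ≤ R + R := add_le_add (hbd x hx) (hbd y hy)
        _ = (2 / (d - c) ^ θ * R) * (d - c) ^ θ := by field_simp; ring
        _ ≤ _ := by
          gcongr
          · exact le_max_right _ _
    intro x hx y hy
    rcases le_total x y with h | h
    · exact key x hx y hy h
    · rw [abs_sub_comm (f x), abs_sub_comm x]; exact key y hy x hx h
  | succ k ih =>
    intro R f hf hg
    have hR : 0 ≤ R := hf.nonneg (nonempty_Icc.2 (by linarith))
    obtain ⟨h1, f', h2, h3⟩ := hf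
    obtain ⟨k1, g', k2, k3⟩ := hg
    have heq : EqOn f' g' (Icc c d) := by
      intro x hx
      have hu : UniqueDiffWithinAt ℝ (Icc c d) x := uniqueDiffOn_Icc hcd x hx
      exact hu.eq_deriv _ ((h2 x ⟨by linarith [hx.1], hx.2⟩).mono (Icc_subset_Icc_left hac.le))
        ((k2 x ⟨hx.1, by linarith [hx.2]⟩).mono (Icc_subset_Icc_right hdb.le))
    set F : ℝ → ℝ := fun x ↦ if x ≤ d then f' x else g' x with hF
    have hF1 : EqOn F f' (Icc a d) := fun x hx ↦ if_pos hx.2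
    have hF2 : EqOn F g' (Icc c b) := fun x hx ↦ by
      by_cases h : x ≤ d
      · rw [hF]; simp only [h, if_true]; exact heq ⟨hx.1, h⟩
      · exact if_neg h
    refine ⟨fun x hx ↦ ?_, F, fun x hx ↦ ?_, ih _ _ (h3.congr hF1) (k3.congr hF2)⟩
    · refine le_trans ?_ (le_mul_of_one_le_left hR (le_max_left _ _))
      rcases le_total x d with h | h
      · exact h1 x ⟨hx.1, h⟩
      · exact k1 x ⟨by linarith, hx.2⟩
    · rcases lt_or_ge x d with h | h
      · rw [hF1 ⟨hx.1, h.le⟩]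
        refine (h2 x ⟨hx.1, h.le⟩).mono_of_mem_nhdsWithin ?_
        filter_upwards [self_mem_nhdsWithin, mem_nhdsWithin_of_mem_nhds (Iio_mem_nhds h)]
          with y hy hy' using ⟨hy.1, le_of_lt hy'⟩
      · rw [hF2 ⟨by linarith, hx.2⟩]
        refine (k2 x ⟨by linarith, hx.2⟩).mono_of_mem_nhdsWithin ?_
        filter_upwards [self_mem_nhdsWithin,
          mem_nhdsWithin_of_mem_nhds (Ioi_mem_nhds (hcd.trans_le h))]
          with y hy hy' using ⟨le_of_lt hy', hy.2⟩

end HolderBounds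


/-! ### Weighted averages -/

section Average

open MeasureTheory intervalIntegral

variable {θ : ℝ} {k : ℕ} {R c : ℝ} {f : ℝ → ℝ}

/-- The weighted average `∫₀¹ σ^m f(tσ) dσ`, so that `∫₀ᵗ s^m f(s) ds = t^(m+1) avg m f t`. It
carries the division by the singular weight `t^m`: unlike the quotient it is visibly as
differentiable as `f`. -/
noncomputable def avg (m : ℕ) (f : ℝ → ℝ) (t : ℝ) : ℝ := ∫ σ in (0 : ℝ)..1, σ ^ m * f (t * σ)

lemma mul_mem_Icc_of_mem {t σ : ℝ} (ht : t ∈ Icc 0 c) (hσ : σ ∈ Icc (0 : ℝ) 1) :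
    t * σ ∈ Icc 0 c :=
  ⟨mul_nonneg ht.1 hσ.1, (mul_le_of_le_one_right ht.1 hσ.2).trans ht.2⟩

lemma avg_congr {g : ℝ → ℝ} (m : ℕ) (h : EqOn f g (Icc 0 c)) :
    EqOn (avg m f) (avg m g) (Icc 0 c) := by
  intro t ht
  refine integral_congr fun σ hσ ↦ ?_
  rw [uIcc_of_le zero_le_one] at hσ
  simp only [h (mul_mem_Icc_of_mem ht hσ)]

lemma continuousOn_avg_integrand (m : ℕ) (hf : ContinuousOn f (Icc 0 c)) {t : ℝ}
    (ht : t ∈ Icc 0 c) : ContinuousOn (fun σ ↦ σ ^ m * f (t * σ)) (Icc 0 1) :=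
  (continuousOn_id.pow m).mul (hf.comp (by fun_prop) fun _ hσ ↦ mul_mem_Icc_of_mem ht hσ)

lemma avg_intervalIntegrable (m : ℕ) (hf : ContinuousOn f (Icc 0 c)) {t : ℝ}
    (ht : t ∈ Icc 0 c) : IntervalIntegrable (fun σ ↦ σ ^ m * f (t * σ)) volume 0 1 :=
  (continuousOn_avg_integrand m hf ht).intervalIntegrable_of_Icc zero_le_one

lemma abs_avg_le (m : ℕ) {t : ℝ} (ht : t ∈ Icc 0 c) (hf : ∀ x ∈ Icc 0 c, |f x| ≤ R) :
    |avg m f t| ≤ R := by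
  have := norm_integral_le_of_norm_le_const (a := (0 : ℝ)) (b := 1) (C := R)
    (f := fun σ ↦ σ ^ m * f (t * σ)) fun σ hσ ↦ by
      rw [uIoc_of_le zero_le_one] at hσ
      rw [norm_mul, norm_pow, Real.norm_eq_abs, Real.norm_eq_abs, abs_of_pos hσ.1]
      have h1 : σ ^ m ≤ 1 := pow_le_one₀ hσ.1.le hσ.2
      have h2 := hf _ (mul_mem_Icc_of_mem ht ⟨hσ.1.le, hσ.2⟩)
      exact (mul_le_of_le_one_left (abs_nonneg _) h1).trans h2
  simpa [avg] using this

lemma avg_zero (m : ℕ) : avg m f 0 = f 0 / (m + 1) := by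
  simp [avg, intervalIntegral.integral_mul_const, integral_pow]
  ring

lemma integral_pow_mul (m : ℕ) (f : ℝ → ℝ) (t : ℝ) :
    ∫ s in (0 : ℝ)..t, s ^ m * f s = t ^ (m + 1) * avg m f t := by
  have h := smul_integral_comp_mul_left (a := 0) (b := 1) (fun s ↦ s ^ m * f s) t
  simp only [mul_zero, mul_one, smul_eq_mul] at h
  rw [← h, avg, pow_succ', mul_assoc, ← intervalIntegral.integral_const_mul (t ^ m)]
  congr 1
  exact integral_congr fun σ _ ↦ by simp only [mul_pow]; ring

/-- Differentiation under the integral sign. -/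
lemma hasDerivAt_avg {f' : ℝ → ℝ} (m : ℕ) (hf : ∀ x, HasDerivAt f (f' x) x) (hc : Continuous f')
    (hR : ∀ x, |f' x| ≤ R) (t : ℝ) : HasDerivAt (avg m f) (avg (m + 1) f' t) t := by
  have hcf : Continuous f := continuous_iff_continuousAt.2 fun x ↦ (hf x).continuousAt
  refine (hasDerivAt_integral_of_dominated_loc_of_deriv_le (μ := volume) (a := 0) (b := 1)
    (F := fun x σ ↦ σ ^ m * f (x * σ)) (F' := fun x σ ↦ σ ^ (m + 1) * f' (x * σ))
    (bound := fun _ ↦ R) univ_mem (Eventually.of_forall fun x ↦ ?_) ?_ ?_ ?_ ?_ ?_).2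
  · exact (by fun_prop : Continuous fun σ ↦ σ ^ m * f (x * σ)).aestronglyMeasurable
  · exact (by fun_prop : Continuous fun σ ↦ σ ^ m * f (t * σ)).intervalIntegrable _ _
  · exact (by fun_prop : Continuous fun σ ↦ σ ^ (m + 1) * f' (t * σ)).aestronglyMeasurable
  · refine Eventually.of_forall fun σ hσ x _ ↦ ?_
    rw [uIoc_of_le zero_le_one] at hσ
    rw [norm_mul, norm_pow, Real.norm_eq_abs, Real.norm_eq_abs, abs_of_pos hσ.1]
    exact (mul_le_of_le_one_left (abs_nonneg _) (pow_le_one₀ hσ.1.le hσ.2)).trans (hR _)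
  · exact intervalIntegrable_const
  · refine Eventually.of_forall fun σ _ x _ ↦ ?_
    have h1 : HasDerivAt (fun x ↦ x * σ) σ x := by simpa using (hasDerivAt_id x).mul_const σ
    have := ((hf (x * σ)).comp x h1).const_mul (σ ^ m)
    convert! this using 1
    simp only [pow_succ]
    ring

/-- A `C¹` function on an interval extends to a `C¹` function on the line. -/
lemma exists_extend_deriv {a b : ℝ} (hab : a ≤ b) {f' : ℝ → ℝ} (hc : ContinuousOn f' (Icc a b))
    (hf : ∀ x ∈ Icc a b, HasDerivWithinAt f (f' x) (Icc a b) x) :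
    ∃ g g' : ℝ → ℝ, (∀ x, HasDerivAt g (g' x) x) ∧ Continuous g' ∧ EqOn g f (Icc a b) ∧
      EqOn g' f' (Icc a b) ∧ ∃ R, ∀ x, |g' x| ≤ R := by
  set g' : ℝ → ℝ := IccExtend hab ((Icc a b).domRestrict f') with hg'
  have hgc : Continuous g' := (continuousOn_iff_continuous_domRestrict.1 hc).Icc_extend'
  have hg'e : EqOn g' f' (Icc a b) := fun x hx ↦ by
    rw [hg', IccExtend_of_mem _ _ hx]; rfl
  refine ⟨fun x ↦ f a + ∫ s in a..x, g' s, g', fun x ↦ ?_, hgc, fun x hx ↦ ?_, hg'e, ?_⟩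
  · exact (hgc.integral_hasStrictDerivAt a x).hasDerivAt.const_add _
  · have h1 : ∫ s in a..x, g' s = f x - f a := by
      refine integral_eq_sub_of_hasDerivAt_of_le hx.1 ?_ (fun s hs ↦ ?_)
        (hgc.intervalIntegrable _ _)
      · exact fun s hs ↦ ((hf s ⟨hs.1, hs.2.trans hx.2⟩).continuousWithinAt).mono
          (Icc_subset_Icc_right hx.2)
      · have hs' : s ∈ Icc a b := ⟨hs.1.le, (hs.2.trans_le hx.2).le⟩
        rw [hg'e hs']
        exact (hf s hs').hasDerivAt (Icc_mem_nhds hs.1 (hs.2.trans_le hx.2))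
    simp only [h1]; ring
  · obtain ⟨R, hR⟩ := isCompact_Icc.exists_bound_of_continuousOn hc
    exact ⟨R, fun x ↦ hR _ (projIcc a b hab x).2⟩

lemma hasDerivWithinAt_avg (hc : 0 ≤ c) {f' : ℝ → ℝ} (m : ℕ) (hf' : ContinuousOn f' (Icc 0 c))
    (hf : ∀ x ∈ Icc 0 c, HasDerivWithinAt f (f' x) (Icc 0 c) x) {t : ℝ} (ht : t ∈ Icc 0 c) :
    HasDerivWithinAt (avg m f) (avg (m + 1) f' t) (Icc 0 c) t := by
  obtain ⟨g, g', h1, h2, h3, h4, R, h5⟩ := exists_extend_deriv hc hf' hf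
  rw [avg_congr (m + 1) h4.symm ht]
  exact ((hasDerivAt_avg m h1 h2 h5 t).hasDerivWithinAt).congr (avg_congr m h3.symm)
    (avg_congr m h3.symm ht)

lemma CBound.avg (hθ : 0 < θ) (hc : 0 ≤ c) (m : ℕ) (hf : CBound θ (Icc 0 c) k R f) :
    CBound θ (Icc 0 c) k R (avg m f) := by
  have hb : ∀ x ∈ Icc 0 c, |PaneitzBifurcation.avg m f x| ≤ R :=
    fun x hx ↦ abs_avg_le m hx hf.bound
  induction k generalizing m f with
  | zero =>
    have hcf := hf.continuousOn hθ
    have hR := hf.nonneg (nonempty_Icc.2 hc)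
    refine ⟨hb, fun x hx y hy ↦ ?_⟩
    rw [PaneitzBifurcation.avg, PaneitzBifurcation.avg,
      ← integral_sub (avg_intervalIntegrable m hcf hx) (avg_intervalIntegrable m hcf hy)]
    have := norm_integral_le_of_norm_le_const (a := (0 : ℝ)) (b := 1) (C := R * |x - y| ^ θ)
      (f := fun σ ↦ σ ^ m * f (x * σ) - σ ^ m * f (y * σ)) fun σ hσ ↦ by
        rw [uIoc_of_le zero_le_one] at hσ
        rw [← mul_sub, norm_mul, norm_pow, Real.norm_eq_abs, Real.norm_eq_abs, abs_of_pos hσ.1]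
        have h1 : σ ^ m ≤ 1 := pow_le_one₀ hσ.1.le hσ.2
        have h2 := hf.2 _ (mul_mem_Icc_of_mem hx ⟨hσ.1.le, hσ.2⟩) _
          (mul_mem_Icc_of_mem hy ⟨hσ.1.le, hσ.2⟩)
        refine (mul_le_of_le_one_left (abs_nonneg _) h1).trans (h2.trans ?_)
        rw [← sub_mul, abs_mul, abs_of_pos hσ.1]
        gcongr
        · exact mul_nonneg (abs_nonneg _) hσ.1.le
        · exact mul_le_of_le_one_right (abs_nonneg _) hσ.2
    simpa using this
  | succ k ih =>
    obtain ⟨h1, f', h2, h3⟩ := hf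
    exact ⟨hb, _, fun x hx ↦ hasDerivWithinAt_avg hc m (h3.continuousOn hθ) h2 hx,
      ih (m + 1) h3 fun x hx ↦ abs_avg_le _ hx h3.bound⟩

lemma continuousOn_avg (hc : 0 ≤ c) (m : ℕ) (hf : ContinuousOn f (Icc 0 c)) :
    ContinuousOn (avg m f) (Icc 0 c) := by
  set g : ℝ → ℝ := IccExtend hc ((Icc 0 c).domRestrict f) with hg
  have hgc : Continuous g := (continuousOn_iff_continuous_domRestrict.1 hf).Icc_extend'
  have hge : EqOn f g (Icc 0 c) := fun x hx ↦ by
    rw [hg, IccExtend_of_mem _ _ hx]; rfl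
  have : Continuous (avg m g) := by
    unfold avg
    exact continuous_parametric_intervalIntegral_of_continuous' (by fun_prop) 0 1
  exact this.continuousOn.congr (avg_congr m hge)

end Average

/-! ### Comparison with the Hölder spaces of the statement -/

section Bridge

variable {D : ℝ} {θ : ℝ≥0} {k : ℕ} {R : ℝ} {u u' : ℝ → ℝ}

lemma derivOn_zero (x : ℝ) : derivOn D 0 u x = u x := by simp [derivOn]

lemma derivOn_succ (hD : 0 < D) (hu : ∀ x ∈ Icc 0 D, HasDerivWithinAt u (u' x) (Icc 0 D) x)
    (k : ℕ) : ∀ x ∈ Icc 0 D, derivOn D (k + 1) u x = derivOn D k u' x := by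
  intro x hx
  rw [derivOn, iteratedDerivWithin_succ']
  exact iteratedDerivWithin_congr
    (fun y hy ↦ (hu y hy).derivWithin (uniqueDiffOn_Icc hD y hy)) hx

lemma derivOn_congr {v : ℝ → ℝ} (h : EqOn u v (Icc 0 D)) (k : ℕ) :
    EqOn (derivOn D k u) (derivOn D k v) (Icc 0 D) :=
  fun _ hx ↦ iteratedDerivWithin_congr h hx

lemma CBound.abs_derivOn_le (hD : 0 < D) (hu : CBound θ (Icc 0 D) k R u) {j : ℕ} (hj : j ≤ k) :
    ∀ x ∈ Icc 0 D, |derivOn D j u x| ≤ R := by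
  induction k generalizing u j with
  | zero =>
    obtain rfl : j = 0 := by omega
    simpa [derivOn_zero] using hu.1
  | succ k ih =>
    cases j with
    | zero => simpa [derivOn_zero] using hu.bound
    | succ j =>
      obtain ⟨h1, f', h2, h3⟩ := hu
      intro x hx
      rw [derivOn_succ hD h2 j x hx]
      exact ih h3 (by omega) x hx

lemma CBound.holderWith (hD : 0 < D) (hu : CBound θ (Icc 0 D) k R u) :
    HolderWith R.toNNReal θ (fun x : Icc 0 D ↦ derivOn D k u x) := by
  have hR := hu.nonneg (nonempty_Icc.2 hD.le)
  induction k generalizing u with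
  | zero =>
    intro x y
    have := hu.2 x x.2 y y.2
    simp only [derivOn_zero]
    rw [edist_dist, edist_dist, ENNReal.ofReal_rpow_of_nonneg dist_nonneg (NNReal.coe_nonneg θ),
      ENNReal.ofNNReal_toNNReal, ← ENNReal.ofReal_mul hR]
    exact ENNReal.ofReal_le_ofReal this
  | succ k ih =>
    obtain ⟨h1, f', h2, h3⟩ := hu
    have : (fun x : Icc 0 D ↦ derivOn D (k + 1) u x) = fun x : Icc 0 D ↦ derivOn D k f' x :=
      funext fun x ↦ derivOn_succ hD h2 k x x.2
    rw [this]
    exact ih h3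

lemma CBound.memC (hD : 0 < D) (hθ : 0 < θ) (hu : CBound θ (Icc 0 D) k R u) : MemC D θ k u :=
  ⟨hu.contDiffOn (by exact_mod_cast hθ) hD, _, hu.holderWith hD⟩

lemma CBound.normC_le (hD : 0 < D) (hu : CBound θ (Icc 0 D) k R u) :
    normC D θ k u ≤ ENNReal.ofReal ((k + 2) * R) := by
  have hR := hu.nonneg (nonempty_Icc.2 hD.le)
  have h1 : ∑ j ∈ Finset.range (k + 1), ⨆ x : Icc 0 D, ‖derivOn D j u x‖ₑ
      ≤ ∑ j ∈ Finset.range (k + 1), ENNReal.ofReal R := by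
    refine Finset.sum_le_sum fun j hj ↦ iSup_le fun x ↦ ?_
    rw [← ofReal_norm]
    exact ENNReal.ofReal_le_ofReal (hu.abs_derivOn_le hD (by simpa [Nat.lt_succ_iff] using hj) x x.2)
  have h2 : eHolderNorm θ (fun x : Icc 0 D ↦ derivOn D k u x) ≤ ENNReal.ofReal R :=
    (hu.holderWith hD).eHolderNorm_le
  refine (add_le_add h1 h2).trans_eq ?_
  rw [Finset.sum_const, Finset.card_range, nsmul_eq_mul, ENNReal.ofReal_mul (by positivity),
    ENNReal.ofReal_add (by positivity) (by positivity)]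
  simp only [ENNReal.ofReal_natCast, ENNReal.ofReal_ofNat]
  push_cast
  ring

lemma MemC.exists_CBound (hD : 0 < D) (hu : MemC D θ k u) : ∃ R, CBound θ (Icc 0 D) k R u := by
  have hU := uniqueDiffOn_Icc hD
  obtain ⟨h1, C, h2⟩ := hu
  induction k generalizing u with
  | zero =>
    obtain ⟨R, hR⟩ := isCompact_Icc.exists_bound_of_continuousOn h1.continuousOn
    refine ⟨max R C, CBound.mono (le_refl _) ⟨fun x hx ↦ (hR x hx).trans (le_max_left _ _),
      fun x hx y hy ↦ ?_⟩⟩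
    have := h2.dist_le ⟨x, hx⟩ ⟨y, hy⟩
    simp only [derivOn_zero] at this
    refine this.trans ?_
    rw [Subtype.dist_eq, Real.dist_eq]
    gcongr
    exact le_max_right _ _
  | succ k ih =>
    have hd : ∀ x ∈ Icc 0 D, HasDerivWithinAt u (derivWithin u (Icc 0 D) x) (Icc 0 D) x :=
      fun x hx ↦ (h1.differentiableOn (by simp) x hx).hasDerivWithinAt
    obtain ⟨R, hR⟩ := isCompact_Icc.exists_bound_of_continuousOn h1.continuousOn
    have h2' : HolderWith C θ (fun x : Icc 0 D ↦ derivOn D k (derivWithin u (Icc 0 D)) x) := by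
      have : (fun x : Icc 0 D ↦ derivOn D (k + 1) u x) =
          fun x : Icc 0 D ↦ derivOn D k (derivWithin u (Icc 0 D)) x :=
        funext fun x ↦ derivOn_succ hD hd k x x.2
      rwa [this] at h2
    obtain ⟨R', hR'⟩ := ih (h1.derivWithin hU (by norm_cast)) h2'
    exact ⟨max R R', fun x hx ↦ (hR x hx).trans (le_max_left _ _), _, hd,
      hR'.mono (le_max_right _ _)⟩

lemma abs_derivOn_le_of_normC_le {j : ℕ} (hR : 0 ≤ R) (h : normC D θ k u ≤ ENNReal.ofReal R)
    (hj : j ≤ k) : ∀ x ∈ Icc 0 D, |derivOn D j u x| ≤ R := by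
  intro x hx
  have h1 : ‖derivOn D j u x‖ₑ ≤ ENNReal.ofReal R := by
    refine le_trans ?_ (le_self_add.trans h)
    refine le_trans ?_ (Finset.single_le_sum (fun _ _ ↦ zero_le)
      (Finset.mem_range.2 (Nat.lt_succ_of_le hj)))
    exact le_iSup (fun x : Icc 0 D ↦ ‖derivOn D j u x‖ₑ) ⟨x, hx⟩
  rw [← ofReal_norm] at h1
  exact (ENNReal.ofReal_le_ofReal_iff hR).1 h1

end Bridge


/-! ### The operator near a singular endpoint -/

section HalfProblem

open MeasureTheory intervalIntegral

/-- The weight `t^m e(t)` on `[0, c]`, whose logarithmic derivative is `m / t + h₀(t)`: `e` is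
positive and smooth up to the endpoints, and `h₀` vanishes at the singular endpoint. -/
structure HalfWeight (c : ℝ) (m : ℕ) (e h₀ : ℝ → ℝ) : Prop where
  c_pos : 0 < c
  e_pos : ∀ t ∈ Icc 0 c, 0 < e t
  e_smooth : ContDiffOn ℝ ∞ e (Icc 0 c)
  h_smooth : ContDiffOn ℝ ∞ h₀ (Icc 0 c)
  deriv_e : ∀ t ∈ Icc 0 c, HasDerivWithinAt e (h₀ t * e t) (Icc 0 c) t
  h_zero : h₀ 0 = 0

/-- `u' / t` for the solution of `u'' + (m / t + h₀) u' = f`, `u'(0) = 0`. -/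
noncomputable def halfPsi (m : ℕ) (e f : ℝ → ℝ) (t : ℝ) : ℝ := avg m (fun s ↦ e s * f s) t / e t

/-- `u'` for the solution of `u'' + (m / t + h₀) u' = f`, `u'(0) = 0`. -/
noncomputable def halfDer (m : ℕ) (e f : ℝ → ℝ) (t : ℝ) : ℝ := t * halfPsi m e f t

variable {c : ℝ} {m : ℕ} {e h₀ f : ℝ → ℝ} {θ : ℝ} {k : ℕ} {R : ℝ}

lemma halfDer_zero : halfDer m e f 0 = 0 := by simp [halfDer]

lemma HalfWeight.continuousOn_e (hw : HalfWeight c m e h₀) : ContinuousOn e (Icc 0 c) :=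
  hw.e_smooth.continuousOn

lemma HalfWeight.continuousOn_halfPsi (hw : HalfWeight c m e h₀) (hf : ContinuousOn f (Icc 0 c)) :
    ContinuousOn (halfPsi m e f) (Icc 0 c) :=
  (continuousOn_avg hw.c_pos.le m (hw.continuousOn_e.mul hf)).div hw.continuousOn_e
    fun t ht ↦ (hw.e_pos t ht).ne'

lemma HalfWeight.continuousOn_halfDer (hw : HalfWeight c m e h₀) (hf : ContinuousOn f (Icc 0 c)) :
    ContinuousOn (halfDer m e f) (Icc 0 c) :=
  continuousOn_id.mul (hw.continuousOn_halfPsi hf)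

lemma HalfWeight.halfPsi_zero (hw : HalfWeight c m e h₀) : halfPsi m e f 0 = f 0 / (m + 1) := by
  have := (hw.e_pos 0 ⟨le_rfl, hw.c_pos.le⟩).ne'
  rw [halfPsi, avg_zero]
  field_simp

/-- The flux form of the equation. -/
lemma HalfWeight.weight_mul_halfDer (hw : HalfWeight c m e h₀) {t : ℝ} (ht : t ∈ Icc 0 c) :
    t ^ m * e t * halfDer m e f t = ∫ s in (0 : ℝ)..t, s ^ m * (e s * f s) := by
  have := (hw.e_pos t ht).ne'
  rw [integral_pow_mul, halfDer, halfPsi]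
  field_simp
  ring

lemma hasDerivWithinAt_integral {g : ℝ → ℝ} (hc : 0 ≤ c) (hg : ContinuousOn g (Icc 0 c)) {t : ℝ}
    (ht : t ∈ Icc 0 c) :
    HasDerivWithinAt (fun x ↦ ∫ s in (0 : ℝ)..x, g s) (g t) (Icc 0 c) t := by
  set G : ℝ → ℝ := IccExtend hc ((Icc 0 c).domRestrict g) with hG
  have hGc : Continuous G := (continuousOn_iff_continuous_domRestrict.1 hg).Icc_extend'
  have hGe : EqOn G g (Icc 0 c) := fun x hx ↦ by
    rw [hG, IccExtend_of_mem _ _ hx]; rfl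
  rw [← hGe ht]
  have h1 := (hGc.integral_hasStrictDerivAt 0 t).hasDerivAt.hasDerivWithinAt (s := Icc 0 c)
  have h2 : ∀ x ∈ Icc 0 c, ∫ s in (0 : ℝ)..x, g s = ∫ s in (0 : ℝ)..x, G s := fun x hx ↦
    integral_congr fun s hs ↦ by
      rw [uIcc_of_le hx.1] at hs
      exact (hGe ⟨hs.1, hs.2.trans hx.2⟩).symm
  exact h1.congr h2 (h2 t ht)

lemma HalfWeight.hasDerivWithinAt_weight (hw : HalfWeight c m e h₀) {t : ℝ} (ht : t ∈ Ioc 0 c) :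
    HasDerivWithinAt (fun s ↦ s ^ m * e s) ((m / t + h₀ t) * (t ^ m * e t)) (Icc 0 c) t := by
  have h := ((hasDerivWithinAt_id t (Icc 0 c)).pow m).mul
    (hw.deriv_e t ⟨ht.1.le, ht.2⟩)
  have ht0 := ht.1.ne'
  refine h.congr_deriv ?_
  simp only [id, Pi.pow_apply]
  cases m with
  | zero => simp
  | succ m =>
    simp only [Nat.add_sub_cancel]
    field_simp
    ring

/-- The solution operator does solve the equation. -/
lemma HalfWeight.hasDerivWithinAt_halfDer (hw : HalfWeight c m e h₀)
    (hf : ContinuousOn f (Icc 0 c)) {t : ℝ} (ht : t ∈ Icc 0 c) :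
    HasDerivWithinAt (halfDer m e f) (f t - m * halfPsi m e f t - h₀ t * halfDer m e f t)
      (Icc 0 c) t := by
  rcases ht.1.eq_or_lt with rfl | h0
  · rw [halfDer_zero, mul_zero, sub_zero, hw.halfPsi_zero]
    have h1 : HasDerivWithinAt (fun t ↦ t * halfPsi m e f t) (halfPsi m e f 0) (Icc 0 c) 0 := by
      rw [hasDerivWithinAt_iff_tendsto_slope]
      have h2 := (hw.continuousOn_halfPsi hf 0 ht).mono_left
        (nhdsWithin_mono (0 : ℝ) (sdiff_subset (s := Icc 0 c) (t := {0})))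
      refine h2.congr' ?_
      filter_upwards [self_mem_nhdsWithin] with s hs
      have : s ≠ 0 := hs.2
      simp [slope_def_field]
      field_simp
    refine h1.congr_deriv ?_
    rw [hw.halfPsi_zero]
    field_simp
    ring
  · have ht' : t ∈ Ioc 0 c := ⟨h0, ht.2⟩
    have hp : ∀ s ∈ Ioc 0 c, s ^ m * e s ≠ 0 := fun s hs ↦
      mul_ne_zero (pow_ne_zero _ hs.1.ne') (hw.e_pos s ⟨hs.1.le, hs.2⟩).ne'
    have hg : ContinuousOn (fun s ↦ s ^ m * (e s * f s)) (Icc 0 c) :=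
      (continuousOn_id.pow m).mul (hw.continuousOn_e.mul hf)
    have h1 := (hasDerivWithinAt_integral hw.c_pos.le hg ht).div (hw.hasDerivWithinAt_weight ht')
      (hp t ht')
    have h2 : ∀ s ∈ Ioc 0 c, halfDer m e f s =
        (∫ x in (0 : ℝ)..s, x ^ m * (e x * f x)) / (s ^ m * e s) := fun s hs ↦ by
      rw [← hw.weight_mul_halfDer ⟨hs.1.le, hs.2⟩, mul_div_cancel_left₀ _ (hp s hs)]
    have h3 := h1.congr_of_eventuallyEq (f₁ := halfDer m e f) ?_ (h2 t ht')
    · refine h3.congr_deriv ?_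
      rw [← hw.weight_mul_halfDer ht, div_eq_iff (pow_ne_zero 2 (hp t ht')), halfDer]
      field_simp
      ring
    · filter_upwards [self_mem_nhdsWithin, mem_nhdsWithin_of_mem_nhds (Ioi_mem_nhds h0)]
        with s hs hs' using h2 s ⟨hs', hs.2⟩

/-- Uniqueness for the equation with `u'(0) = 0`. -/
lemma HalfWeight.eqOn_halfDer (hw : HalfWeight c m e h₀) (hf : ContinuousOn f (Icc 0 c))
    {v : ℝ → ℝ} (hv : ContinuousOn v (Icc 0 c)) (hv0 : v 0 = 0)
    (hd : ∀ t ∈ Ioo 0 c, HasDerivAt v (f t - (m / t + h₀ t) * v t) t) :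
    EqOn v (halfDer m e f) (Icc 0 c) := by
  intro t ht
  rcases ht.1.eq_or_lt with rfl | h0
  · rw [hv0, halfDer_zero]
  have hp : t ^ m * e t ≠ 0 := mul_ne_zero (pow_ne_zero _ h0.ne') (hw.e_pos t ht).ne'
  have hg : ContinuousOn (fun s ↦ s ^ m * (e s * f s)) (Icc 0 c) :=
    (continuousOn_id.pow m).mul (hw.continuousOn_e.mul hf)
  have hpc : ContinuousOn (fun s ↦ s ^ m * e s) (Icc 0 c) :=
    (continuousOn_id.pow m).mul hw.continuousOn_e
  have h1 := integral_eq_sub_of_hasDerivAt_of_le (a := 0) (b := t)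
    (f := fun s ↦ s ^ m * e s * v s) (f' := fun s ↦ s ^ m * (e s * f s)) h0.le
    ((hpc.mul hv).mono (Icc_subset_Icc_right ht.2)) (fun s hs ↦ ?_)
    ((hg.mono (Icc_subset_Icc_right ht.2)).intervalIntegrable_of_Icc h0.le)
  · rw [← hw.weight_mul_halfDer ht] at h1
    simp only [hv0, mul_zero, sub_zero] at h1
    exact (mul_left_cancel₀ hp h1).symm
  · have hs' : s ∈ Ioo 0 c := ⟨hs.1, hs.2.trans_le ht.2⟩
    have h2 := (hw.hasDerivWithinAt_weight ⟨hs'.1, hs'.2.le⟩).hasDerivAt (Icc_mem_nhds hs'.1 hs'.2)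
    refine (h2.mul (hd s hs')).congr_deriv ?_
    ring

/-- Regularity: `u' / t` is as regular as `f`. -/
lemma HalfWeight.exists_CBound_halfPsi (hw : HalfWeight c m e h₀) (hθ0 : 0 < θ) (hθ : θ ≤ 1)
    (k : ℕ) : ∃ C, 0 ≤ C ∧ ∀ R f, CBound θ (Icc 0 c) k R f →
      CBound θ (Icc 0 c) k (C * R) (halfPsi m e f) := by
  have hc := hw.c_pos
  obtain ⟨M, hM0, hM⟩ := CBound.exists_mul (θ := θ) hθ hc.le k
  obtain ⟨A, hA⟩ := exists_CBound_of_contDiffOn (k := k) hθ hc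
    (hw.e_smooth.of_le (by exact_mod_cast le_top))
  obtain ⟨B, hB⟩ := exists_CBound_of_contDiffOn (k := k) (f := fun t ↦ (e t)⁻¹) hθ hc
    ((hw.e_smooth.inv fun t ht ↦ (hw.e_pos t ht).ne').of_le (by exact_mod_cast le_top))
  have hA0 := hA.nonneg (nonempty_Icc.2 hc.le)
  have hB0 := hB.nonneg (nonempty_Icc.2 hc.le)
  refine ⟨M * (M * A * B), by positivity, fun R f hf ↦ ?_⟩
  have h1 := hM _ _ _ _ ((hM _ _ _ _ hA hf).avg hθ0 hc.le m) hB
  refine (h1.mono (le_of_eq (by ring))).congr fun t _ ↦ ?_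
  rw [halfPsi, div_eq_mul_inv]

/-- Regularity of `u'` and of `u''`. -/
lemma HalfWeight.exists_CBound_halfDer (hw : HalfWeight c m e h₀) (hθ0 : 0 < θ) (hθ : θ ≤ 1)
    (k : ℕ) : ∃ C, 0 ≤ C ∧ ∀ R f, CBound θ (Icc 0 c) k R f →
      CBound θ (Icc 0 c) (k + 1) (C * R) (halfDer m e f) := by
  have hc := hw.c_pos
  obtain ⟨M, hM0, hM⟩ := CBound.exists_mul (θ := θ) hθ hc.le k
  obtain ⟨C, hC0, hC⟩ := hw.exists_CBound_halfPsi hθ0 hθ k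
  obtain ⟨A, hA⟩ := exists_CBound_of_contDiffOn (k := k) hθ hc
    (hw.h_smooth.of_le (by exact_mod_cast le_top))
  obtain ⟨B, hB⟩ := exists_CBound_of_contDiffOn (k := k) (f := fun t : ℝ ↦ t) hθ hc
    contDiffOn_id
  have hA0 := hA.nonneg (nonempty_Icc.2 hc.le)
  have hB0 := hB.nonneg (nonempty_Icc.2 hc.le)
  refine ⟨max (M * (B * C)) (1 + m * C + M * (A * (M * (B * C)))), by positivity,
    fun R f hf ↦ ?_⟩
  have hR := hf.nonneg (nonempty_Icc.2 hc.le)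
  have h1 := hC R f hf
  have h2 : CBound θ (Icc 0 c) k (M * (B * (C * R))) (halfDer m e f) := hM _ _ _ _ hB h1
  refine ⟨fun x hx ↦ (h2.bound x hx).trans ?_, _,
    fun x hx ↦ hw.hasDerivWithinAt_halfDer (hf.continuousOn hθ0) hx, ?_⟩
  · calc M * (B * (C * R)) = M * (B * C) * R := by ring
      _ ≤ _ := by gcongr; exact le_max_left _ _
  · refine ((hf.sub (h1.const_mul m)).sub (hM _ _ _ _ hA h2)).mono ?_
    rw [Nat.abs_cast]
    calc R + m * (C * R) + M * (A * (M * (B * (C * R))))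
        = (1 + m * C + M * (A * (M * (B * C)))) * R := by ring
      _ ≤ _ := by gcongr; exact le_max_right _ _

/-- The flux representation bounds `u'` by the integral of `f`. -/
lemma HalfWeight.exists_abs_halfDer_le_integral (hw : HalfWeight c m e h₀) :
    ∃ C, 0 < C ∧ ∀ f : ℝ → ℝ, ContinuousOn f (Icc 0 c) → ∀ t ∈ Icc 0 c,
      |halfDer m e f t| ≤ C * ∫ s in (0 : ℝ)..t, |f s| := by
  have hc := hw.c_pos
  have hne : (Icc 0 c).Nonempty := nonempty_Icc.2 hc.le
  obtain ⟨x₀, hx₀, hmin⟩ := isCompact_Icc.exists_isMinOn hne hw.continuousOn_e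
  obtain ⟨x₁, hx₁, hmax⟩ := isCompact_Icc.exists_isMaxOn hne hw.continuousOn_e
  have h0 := hw.e_pos x₀ hx₀
  have h1 := hw.e_pos x₁ hx₁
  refine ⟨e x₁ / e x₀, by positivity, fun f hf t ht ↦ ?_⟩
  rcases ht.1.eq_or_lt with rfl | ht0
  · simp [halfDer_zero]
  have htm : 0 < t ^ m := pow_pos ht0 m
  have het := hw.e_pos t ht
  have hsub : Icc 0 t ⊆ Icc 0 c := Icc_subset_Icc_right ht.2
  have hI : ‖∫ s in (0 : ℝ)..t, s ^ m * (e s * f s)‖ ≤ ∫ s in (0 : ℝ)..t, t ^ m * e x₁ * |f s| := by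
    refine norm_integral_le_of_norm_le ht0.le
      (Eventually.of_forall fun s hs ↦ ?_) ?_
    · have hs' : s ∈ Icc 0 c := ⟨hs.1.le, hs.2.trans ht.2⟩
      have hes := hw.e_pos s hs'
      rw [norm_mul, norm_mul, norm_pow, Real.norm_eq_abs, Real.norm_eq_abs, Real.norm_eq_abs,
        abs_of_pos hs.1, abs_of_pos hes, ← mul_assoc]
      have := hmax hs'
      have := hs.1.le
      gcongr
      · exact hs.2
      · exact hmax hs'
    · exact ((continuousOn_const.mul (hf.mono hsub).abs)).intervalIntegrable_of_Icc ht0.le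
  rw [← hw.weight_mul_halfDer ht, intervalIntegral.integral_const_mul, norm_mul, Real.norm_eq_abs,
    abs_of_pos (by positivity), Real.norm_eq_abs] at hI
  have hint : 0 ≤ ∫ s in (0 : ℝ)..t, |f s| :=
    integral_nonneg ht0.le fun _ _ ↦ abs_nonneg _
  have h3 : e t * |halfDer m e f t| ≤ e x₁ * ∫ s in (0 : ℝ)..t, |f s| := by
    refine le_of_mul_le_mul_left ?_ htm
    linarith
  have h4 : e x₀ * |halfDer m e f t| ≤ e x₁ * ∫ s in (0 : ℝ)..t, |f s| :=
    (mul_le_mul_of_nonneg_right (hmin ht) (abs_nonneg _)).trans h3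
  rw [div_mul_eq_mul_div, le_div_iff₀ h0, mul_comm]
  exact h4

lemma HalfWeight.exists_abs_halfPsi_le (hw : HalfWeight c m e h₀) :
    ∃ C, 0 < C ∧ ∀ (f : ℝ → ℝ) (R : ℝ), (∀ t ∈ Icc 0 c, |f t| ≤ R) → ∀ t ∈ Icc 0 c,
      |halfPsi m e f t| ≤ C * R := by
  have hc := hw.c_pos
  have hne : (Icc 0 c).Nonempty := nonempty_Icc.2 hc.le
  obtain ⟨x₀, hx₀, hmin⟩ := isCompact_Icc.exists_isMinOn hne hw.continuousOn_e
  obtain ⟨x₁, hx₁, hmax⟩ := isCompact_Icc.exists_isMaxOn hne hw.continuousOn_e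
  have h0 := hw.e_pos x₀ hx₀
  have h1 := hw.e_pos x₁ hx₁
  refine ⟨e x₁ / e x₀, by positivity, fun f R hf t ht ↦ ?_⟩
  have hR : 0 ≤ R := (abs_nonneg _).trans (hf t ht)
  have het := hw.e_pos t ht
  have h2 : |avg m (fun s ↦ e s * f s) t| ≤ e x₁ * R := abs_avg_le m ht fun x hx ↦ by
    rw [abs_mul, abs_of_pos (hw.e_pos x hx)]
    exact mul_le_mul (hmax hx) (hf x hx) (abs_nonneg _) h1.le
  rw [halfPsi, abs_div, abs_of_pos het, div_mul_eq_mul_div]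
  exact div_le_div₀ (by positivity) h2 h0 (hmin ht)

/-- A `C²` function with `u'(0) = 0` has `u' / t` equal to an average of `u''`. -/
lemma eq_mul_avg_of_hasDerivWithinAt {u₁ u₂ : ℝ → ℝ}
    (h1 : ∀ x ∈ Icc 0 c, HasDerivWithinAt u₁ (u₂ x) (Icc 0 c) x) (h2 : ContinuousOn u₂ (Icc 0 c))
    (h0 : u₁ 0 = 0) {t : ℝ} (ht : t ∈ Icc 0 c) : u₁ t = t * avg 0 u₂ t := by
  have h3 := integral_eq_sub_of_hasDerivAt_of_le (a := 0) (b := t) (f := u₁)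
    (f' := u₂) ht.1 (fun s hs ↦ ((h1 s ⟨hs.1, hs.2.trans ht.2⟩).continuousWithinAt).mono
      (Icc_subset_Icc_right ht.2)) (fun s hs ↦ (h1 s ⟨hs.1.le, (hs.2.trans_le ht.2).le⟩).hasDerivAt
      (Icc_mem_nhds hs.1 (hs.2.trans_le ht.2)))
    ((h2.mono (Icc_subset_Icc_right ht.2)).intervalIntegrable_of_Icc ht.1)
  have h4 := integral_pow_mul 0 u₂ t
  simp only [pow_zero, one_mul, zero_add, pow_one] at h4
  rw [← h4, h3, h0, sub_zero]

/-- `L u` extends to the singular endpoint, with two derivatives fewer than `u`. -/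
lemma HalfWeight.exists_CBound_operator (hw : HalfWeight c m e h₀) (hθ0 : 0 < θ) (hθ : θ ≤ 1)
    {u₁ u₂ : ℝ → ℝ} (h1 : ∀ x ∈ Icc 0 c, HasDerivWithinAt u₁ (u₂ x) (Icc 0 c) x)
    (h2 : CBound θ (Icc 0 c) k R u₂) (h0 : u₁ 0 = 0) :
    ∃ (f : ℝ → ℝ) (R' : ℝ), CBound θ (Icc 0 c) k R' f ∧
      ∀ t ∈ Ioc 0 c, f t = u₂ t + (m / t + h₀ t) * u₁ t := by
  have hc := hw.c_pos
  obtain ⟨M, hM0, hM⟩ := CBound.exists_mul (θ := θ) hθ hc.le k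
  obtain ⟨A, hA⟩ := exists_CBound_of_contDiffOn (k := k) hθ hc
    (hw.h_smooth.of_le (by exact_mod_cast le_top))
  have h3 : CBound θ (Icc 0 c) (k + 1) _ u₁ := ⟨fun x hx ↦ (?_ : _ ≤ max (c * R) R), u₂, h1,
    h2.mono (le_max_right _ _)⟩
  · refine ⟨fun t ↦ u₂ t + m * avg 0 u₂ t + h₀ t * u₁ t, _,
      (h2.add ((h2.avg hθ0 hc.le 0).const_mul m)).add
      (hM _ _ _ _ hA (h3.pred hθ)), fun t ht ↦ ?_⟩
    have := eq_mul_avg_of_hasDerivWithinAt h1 (h2.continuousOn hθ0) h0 ⟨ht.1.le, ht.2⟩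
    have ht0 := ht.1.ne'
    simp only []
    rw [this]
    field_simp
    ring
  · rw [eq_mul_avg_of_hasDerivWithinAt h1 (h2.continuousOn hθ0) h0 hx, abs_mul, abs_of_nonneg hx.1]
    refine le_trans ?_ (le_max_left _ _)
    exact mul_le_mul hx.2 (abs_avg_le 0 hx h2.bound) (abs_nonneg _) hc.le

/-- The derivative of `L u` at the singular endpoint is `(1 + m / 2) u'''`. -/
lemma HalfWeight.deriv_operator_zero (hw : HalfWeight c m e h₀)
    {u₁ u₂ u₃ f f₁ : ℝ → ℝ} (h1 : ∀ x ∈ Icc 0 c, HasDerivWithinAt u₁ (u₂ x) (Icc 0 c) x)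
    (h2 : ∀ x ∈ Icc 0 c, HasDerivWithinAt u₂ (u₃ x) (Icc 0 c) x) (h3 : ContinuousOn u₃ (Icc 0 c))
    (h0 : u₁ 0 = 0) (hf : ∀ x ∈ Icc 0 c, HasDerivWithinAt f (f₁ x) (Icc 0 c) x)
    (hfu : ∀ t ∈ Ioo 0 c, f t = u₂ t + (m / t + h₀ t) * u₁ t) :
    f₁ 0 = (1 + m / 2) * u₃ 0 := by
  have hc := hw.c_pos
  have hz : (0 : ℝ) ∈ Icc 0 c := ⟨le_rfl, hc.le⟩
  have hU := uniqueDiffOn_Icc hc 0 hz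
  have hc2 : ContinuousOn u₂ (Icc 0 c) := fun x hx ↦ (h2 x hx).continuousWithinAt
  have hh : HasDerivWithinAt h₀ (derivWithin h₀ (Icc 0 c) 0) (Icc 0 c) 0 :=
    (hw.h_smooth.differentiableOn (by simp) 0 hz).hasDerivWithinAt
  have h4 := ((h2 0 hz).add ((hasDerivWithinAt_avg hc.le 0 h3 h2 hz).const_mul (m : ℝ))).add
    (hh.mul (h1 0 hz))
  have h5 : EqOn (fun t ↦ u₂ t + m * avg 0 u₂ t + h₀ t * u₁ t) f (Ioo 0 c) := fun t ht ↦ by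
    have := eq_mul_avg_of_hasDerivWithinAt h1 hc2 h0 ⟨ht.1.le, ht.2.le⟩
    have ht0 := ht.1.ne'
    simp only []
    rw [hfu t ht, this]
    field_simp
    ring
  have hcont : ContinuousOn (fun t ↦ u₂ t + m * avg 0 u₂ t + h₀ t * u₁ t) (Icc 0 c) :=
    (hc2.add (continuousOn_const.mul (continuousOn_avg hc.le 0 hc2))).add
      (hw.h_smooth.continuousOn.mul fun x hx ↦ (h1 x hx).continuousWithinAt)
  have hfc : ContinuousOn f (Icc 0 c) := fun x hx ↦ (hf x hx).continuousWithinAt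
  have h6 : EqOn (fun t ↦ u₂ t + m * avg 0 u₂ t + h₀ t * u₁ t) f (Icc 0 c) := by
    refine h5.of_subset_closure hcont hfc Ioo_subset_Icc_self ?_
    rw [closure_Ioo hc.ne]
  have h7 := hU.eq_deriv _ (hf 0 hz) (h4.congr (fun x hx ↦ (h6 hx).symm) (h6 hz).symm)
  rw [h7, avg_zero, h0, hw.h_zero]
  push_cast
  ring

end HalfProblem


/-! ### Operators on continuous functions -/

section ContinuousFunctions

variable {D : ℝ} (hD : 0 < D)

/-- The extension of a continuous function on `[0, D]` to the line, constant outside. -/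
noncomputable def ext (hD : 0 < D) (f : C(Icc 0 D, ℝ)) : ℝ → ℝ := IccExtend hD.le f

/-- A function continuous on `[0, D]`, as an element of `C([0, D])`. -/
def toX {D : ℝ} (g : ℝ → ℝ) (hg : ContinuousOn g (Icc 0 D)) : C(Icc 0 D, ℝ) :=
  ⟨(Icc 0 D).domRestrict g, continuousOn_iff_continuous_domRestrict.1 hg⟩

variable {hD}

lemma continuous_ext (f : C(Icc 0 D, ℝ)) : Continuous (ext hD f) := f.continuous.Icc_extend'

lemma continuousOn_ext (f : C(Icc 0 D, ℝ)) : ContinuousOn (ext hD f) (Icc 0 D) :=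
  (continuous_ext f).continuousOn

lemma ext_apply (f : C(Icc 0 D, ℝ)) {t : ℝ} (ht : t ∈ Icc 0 D) : ext hD f t = f ⟨t, ht⟩ :=
  IccExtend_of_mem _ _ ht

@[simp] lemma ext_coe (f : C(Icc 0 D, ℝ)) (t : Icc 0 D) : ext hD f t = f t := ext_apply f t.2

lemma ext_eq (f : C(Icc 0 D, ℝ)) (t : ℝ) : ext hD f t = f (projIcc 0 D hD.le t) := rfl

lemma ext_add (f g : C(Icc 0 D, ℝ)) : ext hD (f + g) = fun t ↦ ext hD f t + ext hD g t := rfl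

lemma ext_sub (f g : C(Icc 0 D, ℝ)) : ext hD (f - g) = fun t ↦ ext hD f t - ext hD g t := rfl

lemma ext_smul (c : ℝ) (f : C(Icc 0 D, ℝ)) : ext hD (c • f) = fun t ↦ c * ext hD f t := rfl

lemma ext_toX {g : ℝ → ℝ} (hg : ContinuousOn g (Icc 0 D)) : EqOn (ext hD (toX g hg)) g (Icc 0 D) :=
  fun _ ht ↦ ext_apply _ ht

lemma abs_ext_le (f : C(Icc 0 D, ℝ)) (t : ℝ) : |ext hD f t| ≤ ‖f‖ := f.norm_coe_le_norm _

lemma ext_injOn {f g : C(Icc 0 D, ℝ)} (h : EqOn (ext hD f) (ext hD g) (Icc 0 D)) : f = g := by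
  ext t
  simpa using h t.2

lemma ext_injOn_Ioo {f g : C(Icc 0 D, ℝ)} (h : EqOn (ext hD f) (ext hD g) (Ioo 0 D)) : f = g := by
  refine ext_injOn (hD := hD) (h.of_subset_closure (continuousOn_ext f) (continuousOn_ext g)
    Ioo_subset_Icc_self ?_)
  rw [closure_Ioo hD.ne]

lemma norm_le_of_ext {f : C(Icc 0 D, ℝ)} {R : ℝ} (hR : 0 ≤ R)
    (h : ∀ t ∈ Icc 0 D, |ext hD f t| ≤ R) : ‖f‖ ≤ R :=
  (ContinuousMap.norm_le _ hR).2 fun t ↦ by simpa using h t t.2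

/-- A linear operation on continuous functions that is bounded for the supremum norm, as a
bounded operator. -/
lemma exists_clm_of_bound (hD : 0 < D) (G : (ℝ → ℝ) → ℝ → ℝ) (C : ℝ)
    (hcont : ∀ f, Continuous f → ContinuousOn (G f) (Icc 0 D))
    (hadd : ∀ f g, Continuous f → Continuous g → ∀ t ∈ Icc 0 D,
      G (fun x ↦ f x + g x) t = G f t + G g t)
    (hsmul : ∀ (c : ℝ) f, Continuous f → ∀ t ∈ Icc 0 D, G (fun x ↦ c * f x) t = c * G f t)
    (hbound : ∀ f R, Continuous f → (∀ t ∈ Icc 0 D, |f t| ≤ R) → ∀ t ∈ Icc 0 D,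
      |G f t| ≤ C * R) :
    ∃ T : C(Icc 0 D, ℝ) →L[ℝ] C(Icc 0 D, ℝ), ∀ f, ∀ t ∈ Icc 0 D,
      ext hD (T f) t = G (ext hD f) t := by
  let T₀ : C(Icc 0 D, ℝ) →ₗ[ℝ] C(Icc 0 D, ℝ) :=
    { toFun := fun f ↦ toX (G (ext hD f)) (hcont _ (continuous_ext f))
      map_add' := fun f g ↦ ContinuousMap.ext fun t ↦
        hadd _ _ (continuous_ext f) (continuous_ext g) t t.2
      map_smul' := fun c f ↦ ContinuousMap.ext fun t ↦ hsmul c _ (continuous_ext f) t t.2 }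
  refine ⟨T₀.mkContinuous (max C 0) fun f ↦ ?_, fun f t ht ↦ ext_apply _ ht⟩
  refine (ContinuousMap.norm_le _ (by positivity)).2 fun t ↦ ?_
  refine (hbound (ext hD f) ‖f‖ (continuous_ext f) (fun t _ ↦ abs_ext_le f t) t t.2).trans ?_
  gcongr
  exact le_max_left _ _

/-- Integration from `0`, as a bounded operator. -/
lemma exists_integral_clm (hD : 0 < D) : ∃ I : C(Icc 0 D, ℝ) →L[ℝ] C(Icc 0 D, ℝ),
    ∀ f, ∀ t ∈ Icc 0 D, ext hD (I f) t = ∫ s in (0 : ℝ)..t, ext hD f s :=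
  exists_clm_of_bound hD (fun f t ↦ ∫ s in (0 : ℝ)..t, f s) D
    (fun f hf ↦
      (intervalIntegral.continuous_primitive (fun a b ↦ hf.intervalIntegrable a b) 0).continuousOn)
    (fun f g hf hg t ht ↦ intervalIntegral.integral_add (hf.intervalIntegrable _ _)
      (hg.intervalIntegrable _ _))
    (fun a f _ t _ ↦ intervalIntegral.integral_const_mul _ _)
    (fun f R hf h t ht ↦ by
      have hR : 0 ≤ R := (abs_nonneg _).trans (h t ht)
      have := intervalIntegral.norm_integral_le_of_norm_le_const (a := 0) (b := t) (C := R)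
        (f := f) fun s hs ↦ by
          rw [uIoc_of_le ht.1] at hs
          exact h s ⟨hs.1.le, hs.2.trans ht.2⟩
      rw [Real.norm_eq_abs, sub_zero, abs_of_nonneg ht.1] at this
      nlinarith [ht.2])

/-- An operator with uniformly Lipschitz values is compact, by the theorem of Arzelà and Ascoli. -/
lemma isCompactOperator_of_lipschitz (T : C(Icc 0 D, ℝ) →L[ℝ] C(Icc 0 D, ℝ)) (C : ℝ)
    (hT : ∀ f x y, |T f x - T f y| ≤ C * ‖f‖ * dist x y) : IsCompactOperator T := by
  set B : ℝ := max ‖T‖ (max C 0)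
  set S : Set C(Icc 0 D, ℝ) := {g | (∀ x, |g x| ≤ B) ∧ ∀ x y, |g x - g y| ≤ B * dist x y} with hS
  have hB : 0 ≤ B := le_max_of_le_right (le_max_right _ _)
  have hcomp : IsCompact S := by
    refine ArzelaAscoli.isCompact_of_equicontinuous S ?_ ?_
    · have himg : ContinuousMap.toFun '' S =
          {g : Icc 0 D → ℝ | (∀ x, |g x| ≤ B) ∧ ∀ x y, |g x - g y| ≤ B * dist x y} := by
        ext g
        constructor
        · rintro ⟨f, hf, rfl⟩
          exact hf
        · intro hg
          have : LipschitzWith B.toNNReal g := LipschitzWith.of_dist_le_mul fun x y ↦ by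
            rw [Real.coe_toNNReal _ hB]; exact hg.2 x y
          exact ⟨⟨g, this.continuous⟩, hg, rfl⟩
      rw [himg]
      have hK : IsCompact (univ.pi fun _ : Icc 0 D ↦ Icc (-B) B) :=
        isCompact_univ_pi fun _ ↦ isCompact_Icc
      refine hK.of_isClosed_subset ?_ fun g hg x _ ↦ abs_le.1 (hg.1 x)
      simp only [ofPred_and, ofPred_forall]
      refine IsClosed.inter (isClosed_iInter fun x ↦ ?_)
        (isClosed_iInter fun x ↦ isClosed_iInter fun y ↦ ?_)
      · exact isClosed_le (by fun_prop) continuous_const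
      · exact isClosed_le (by fun_prop) continuous_const
    · refine Metric.equicontinuous_of_continuity_modulus (fun r ↦ B * r) ?_ _ fun x y g ↦ g.2.2 x y
      have : Continuous fun r : ℝ ↦ B * r := by fun_prop
      simpa using this.tendsto 0
  refine ⟨S, hcomp, ?_⟩
  refine mem_of_superset (Metric.closedBall_mem_nhds 0 one_pos) fun f hf ↦ ?_
  have hf1 : ‖f‖ ≤ 1 := by simpa using hf
  refine ⟨fun x ↦ ?_, fun x y ↦ ?_⟩
  · calc |T f x| ≤ ‖T f‖ := (T f).norm_coe_le_norm x
      _ ≤ ‖T‖ * ‖f‖ := T.le_opNorm f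
      _ ≤ ‖T‖ * 1 := by gcongr
      _ ≤ B := by rw [mul_one]; exact le_max_left _ _
  · refine (hT f x y).trans ?_
    gcongr
    calc C * ‖f‖ ≤ max C 0 * ‖f‖ := by gcongr; exact le_max_left _ _
      _ ≤ max C 0 * 1 := by gcongr
      _ ≤ B := by rw [mul_one]; exact le_max_right _ _

/-- The Fredholm alternative: an injective compact perturbation of the identity is invertible. -/
lemma isUnit_one_sub_of_injective {X : Type*} [NormedAddCommGroup X] [NormedSpace ℝ X]
    [CompleteSpace X] {T : X →L[ℝ] X} (hT : IsCompactOperator T) (h : ∀ x, T x = x → x = 0) :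
    IsUnit (1 - T) := by
  rcases IsCompactOperator.hasEigenvalue_or_mem_resolventSet hT one_ne_zero with h1 | h1
  · obtain ⟨x, hx⟩ := h1.exists_hasEigenvector
    exact absurd (h x (by simpa using hx.apply_eq_smul)) hx.2
  · simpa [spectrum.mem_resolventSet_iff] using h1

/-- An integral form of Grönwall's inequality. -/
lemma eq_zero_of_abs_le_integral {c C : ℝ} {u : ℝ → ℝ} (hu : Continuous u)
    (h : ∀ t ∈ Icc 0 c, |u t| ≤ C * ∫ s in (0 : ℝ)..t, |u s|) : ∀ t ∈ Icc 0 c, u t = 0 := by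
  have hua : Continuous fun s ↦ |u s| := hu.abs
  set m : ℝ → ℝ := fun t ↦ ∫ s in (0 : ℝ)..t, |u s| with hm
  have hmd : ∀ t, HasDerivAt m |u t| t := fun t ↦ (hua.integral_hasStrictDerivAt 0 t).hasDerivAt
  have hd : ∀ t, HasDerivAt (fun t ↦ m t * Real.exp (-C * t))
      ((|u t| - C * m t) * Real.exp (-C * t)) t := fun t ↦ by
    have h1 : HasDerivAt (fun t ↦ Real.exp (-C * t)) (Real.exp (-C * t) * (-C)) t := by
      simpa using ((hasDerivAt_id t).const_mul (-C)).exp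
    exact ((hmd t).mul h1).congr_deriv (by ring)
  have hanti : AntitoneOn (fun t ↦ m t * Real.exp (-C * t)) (Icc 0 c) := by
    refine antitoneOn_of_deriv_nonpos (convex_Icc 0 c)
      (fun t _ ↦ (hd t).continuousAt.continuousWithinAt)
      (fun t _ ↦ (hd t).differentiableAt.differentiableWithinAt) fun t ht ↦ ?_
    rw [(hd t).deriv]
    exact mul_nonpos_of_nonpos_of_nonneg (by linarith [h t (interior_subset ht)]) (Real.exp_pos _).le
  intro t ht
  have h1 := hanti ⟨le_rfl, ht.1.trans ht.2⟩ ht ht.1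
  simp only [hm, intervalIntegral.integral_same, zero_mul] at h1
  have h2 : m t ≤ 0 := by
    by_contra! h3
    exact absurd h1 (not_le.2 (mul_pos h3 (Real.exp_pos _)))
  have h3 : 0 ≤ m t := intervalIntegral.integral_nonneg ht.1 fun _ _ ↦ abs_nonneg _
  have h4 := h t ht
  rw [show (∫ s in (0 : ℝ)..t, |u s|) = 0 from le_antisymm h2 h3, mul_zero] at h4
  exact abs_nonpos_iff.1 h4

end ContinuousFunctions

section HalfOperators

open MeasureTheory intervalIntegral

variable {c : ℝ} {m : ℕ} {e h₀ f g : ℝ → ℝ}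

lemma HalfWeight.halfPsi_add (hw : HalfWeight c m e h₀) (hf : Continuous f) (hg : Continuous g)
    {t : ℝ} (ht : t ∈ Icc 0 c) :
    halfPsi m e (fun x ↦ f x + g x) t = halfPsi m e f t + halfPsi m e g t := by
  have h := intervalIntegral.integral_add
    (avg_intervalIntegrable m (hw.continuousOn_e.mul hf.continuousOn) ht)
    (avg_intervalIntegrable m (hw.continuousOn_e.mul hg.continuousOn) ht)
  simp only [Pi.mul_apply] at h
  rw [halfPsi, halfPsi, halfPsi, ← add_div, avg, avg, avg, ← h]
  simp only [mul_add]

lemma halfPsi_const_mul (a : ℝ) (t : ℝ) :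
    halfPsi m e (fun x ↦ a * f x) t = a * halfPsi m e f t := by
  rw [halfPsi, halfPsi, avg, avg, ← mul_div_assoc, ← intervalIntegral.integral_const_mul]
  congr 2
  ext σ
  ring

/-- The bounded operators `f ↦ u'/t`, `f ↦ u'` and `f ↦ u` for the solution of
`u'' + (m / t + h₀) u' = f`, `u(0) = u'(0) = 0`; the last one is compact and of Volterra type. -/
lemma HalfWeight.exists_operators (hw : HalfWeight c m e h₀) :
    ∃ Ψ E V : C(Icc 0 c, ℝ) →L[ℝ] C(Icc 0 c, ℝ),
      (∀ f, ∀ t ∈ Icc 0 c, ext hw.c_pos (Ψ f) t = halfPsi m e (ext hw.c_pos f) t) ∧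
      (∀ f, ∀ t ∈ Icc 0 c, ext hw.c_pos (E f) t = halfDer m e (ext hw.c_pos f) t) ∧
      (∀ f, ∀ t ∈ Icc 0 c, ext hw.c_pos (V f) t = ∫ s in (0 : ℝ)..t, ext hw.c_pos (E f) s) ∧
      ∀ κ : ℝ, IsUnit (1 + κ • V) := by
  have hc := hw.c_pos
  obtain ⟨C, hC0, hC⟩ := hw.exists_abs_halfPsi_le
  obtain ⟨Ψ, hΨ⟩ := exists_clm_of_bound hc (fun f ↦ halfPsi m e f) C
    (fun f hf ↦ hw.continuousOn_halfPsi hf.continuousOn)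
    (fun f g hf hg t ht ↦ hw.halfPsi_add hf hg ht) (fun a f _ t _ ↦ halfPsi_const_mul a t)
    (fun f R _ h t ht ↦ hC f R h t ht)
  obtain ⟨E, hE⟩ := exists_clm_of_bound hc (fun f ↦ halfDer m e f) (c * C)
    (fun f hf ↦ hw.continuousOn_halfDer hf.continuousOn)
    (fun f g hf hg t ht ↦ by simp only [halfDer, hw.halfPsi_add hf hg ht]; ring)
    (fun a f _ t _ ↦ by simp only [halfDer, halfPsi_const_mul]; ring)
    (fun f R _ h t ht ↦ by
      rw [halfDer, abs_mul, mul_assoc, abs_of_nonneg ht.1]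
      exact mul_le_mul ht.2 (hC f R h t ht) (abs_nonneg _) hc.le)
  obtain ⟨I, hI⟩ := exists_integral_clm hc
  have hV : ∀ f, ∀ t ∈ Icc 0 c, ext hc ((I ∘L E) f) t = ∫ s in (0 : ℝ)..t, ext hc (E f) s :=
    fun f t ht ↦ hI (E f) t ht
  refine ⟨Ψ, E, I ∘L E, hΨ, hE, hV, fun κ ↦ ?_⟩
  have hcomp : IsCompactOperator (I ∘L E) := by
    refine isCompactOperator_of_lipschitz _ ‖E‖ fun f x y ↦ ?_
    have h1 := hV f x x.2
    have h2 := hV f y y.2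
    rw [ext_coe] at h1 h2
    have hi : ∀ a b, IntervalIntegrable (ext hc (E f)) volume a b :=
      fun a b ↦ (continuous_ext _).intervalIntegrable a b
    rw [h1, h2, integral_interval_sub_left (hi _ _) (hi _ _), Subtype.dist_eq,
      Real.dist_eq]
    exact norm_integral_le_of_norm_le_const (f := ext hc (E f)) fun s _ ↦
      (abs_ext_le (E f) s).trans (E.le_opNorm f)
  have hcomp' : IsCompactOperator (-(κ • (I ∘L E)) : C(Icc 0 c, ℝ) →L[ℝ] C(Icc 0 c, ℝ)) := by
    have := (hcomp.smul κ).neg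
    exact this
  have := isUnit_one_sub_of_injective hcomp' fun u hu ↦ ?_
  · simpa using this
  · -- a fixed point `u = -κ V u` satisfies a Grönwall inequality
    obtain ⟨B, hB0, hB⟩ := hw.exists_abs_halfDer_le_integral
    refine ext_injOn (hD := hc) fun t ht ↦ ?_
    have key : ∀ t ∈ Icc 0 c, |ext hc u t| ≤ (|κ| * (c * B)) * ∫ s in (0 : ℝ)..t, |ext hc u s| := by
      intro t ht
      have h1 : ext hc u t = -(κ * ∫ s in (0 : ℝ)..t, ext hc (E u) s) := by
        conv_lhs => rw [← hu]
        rw [← hV u t ht]; rfl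
      have hmono : ∀ s ∈ Icc 0 t, ∫ r in (0 : ℝ)..s, |ext hc u r| ≤
          ∫ r in (0 : ℝ)..t, |ext hc u r| :=
        fun s hs ↦ integral_mono_interval le_rfl hs.1 hs.2
          (Eventually.of_forall fun _ ↦ abs_nonneg _)
          ((continuous_ext u).abs.intervalIntegrable _ _)
      have h2 := norm_integral_le_of_norm_le_const (a := 0) (b := t)
        (C := B * ∫ r in (0 : ℝ)..t, |ext hc u r|) (f := ext hc (E u)) fun s hs ↦ by
          rw [uIoc_of_le ht.1] at hs
          have hs' : s ∈ Icc 0 c := ⟨hs.1.le, hs.2.trans ht.2⟩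
          rw [hE u s hs']
          exact (hB _ (continuousOn_ext u) s hs').trans
            (mul_le_mul_of_nonneg_left (hmono s ⟨hs.1.le, hs.2⟩) hB0.le)
      rw [Real.norm_eq_abs, sub_zero, abs_of_nonneg ht.1] at h2
      have h3 : 0 ≤ ∫ r in (0 : ℝ)..t, |ext hc u r| :=
        integral_nonneg ht.1 fun _ _ ↦ abs_nonneg _
      rw [h1, abs_neg, abs_mul, mul_assoc]
      refine mul_le_mul_of_nonneg_left (h2.trans ?_) (abs_nonneg _)
      calc B * (∫ r in (0 : ℝ)..t, |ext hc u r|) * t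
          ≤ B * (∫ r in (0 : ℝ)..t, |ext hc u r|) * c := by
            gcongr; exact ht.2
        _ = _ := by ring
    rw [eq_zero_of_abs_le_integral (continuous_ext u) key t ht]
    rfl

end HalfOperators


/-! ### The Prüfer angle -/

section Upcrossing

variable {a b d : ℝ} {g : ℝ → ℝ}

lemma eventually_pos_of_hasDerivWithinAt (hab : a < b) (hg : HasDerivWithinAt g d (Icc a b) a)
    (hd : 0 < d) (h0 : g a = 0) : ∀ᶠ t in 𝓝[>] a, 0 < g t := by
  rw [hasDerivWithinAt_iff_tendsto_slope] at hg
  have h1 : 𝓝[>] a ≤ 𝓝[Icc a b \ {a}] a := by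
    rw [← nhdsWithin_Ioc_eq_nhdsGT hab]
    exact nhdsWithin_mono _ fun x hx ↦ ⟨⟨hx.1.le, hx.2⟩, hx.1.ne'⟩
  filter_upwards [(hg.mono_left h1).eventually (lt_mem_nhds hd), self_mem_nhdsWithin] with t ht ht'
  rw [slope_def_field, h0, sub_zero] at ht
  exact (div_pos_iff_of_pos_right (sub_pos.2 ht')).1 ht

/-- A function that starts out positive and whose zeros are all crossed upwards stays positive. -/
lemma pos_of_upcrossing (hg : ContinuousOn g (Icc a b)) (h0 : ∀ᶠ t in 𝓝[>] a, 0 < g t)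
    (hd : ∀ t ∈ Ioc a b, g t = 0 → ∃ d, 0 < d ∧ HasDerivWithinAt g d (Icc a b) t) :
    ∀ t ∈ Ioc a b, 0 < g t := by
  intro t₁ ht₁
  by_contra! hneg
  obtain ⟨a', ha', hpos⟩ : ∃ a' ∈ Ioo a t₁, 0 < g a' :=
    ((h0.and (Ioo_mem_nhdsGT ht₁.1)).exists).imp fun x hx ↦ ⟨hx.2, hx.1⟩
  have hsub : Icc a' t₁ ⊆ Icc a b := Icc_subset_Icc ha'.1.le ht₁.2
  set Z : Set ℝ := Icc a' t₁ ∩ g ⁻¹' Iic 0 with hZ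
  have hZc : IsCompact Z := by
    have : IsClosed Z := (hg.mono hsub).preimage_isClosed_of_isClosed isClosed_Icc isClosed_Iic
    exact isCompact_Icc.of_isClosed_subset this inter_subset_left
  have hZn : Z.Nonempty := ⟨t₁, ⟨ha'.2.le, le_rfl⟩, hneg⟩
  have hs := hZc.sInf_mem hZn
  -- at the first zero `s` all difference quotients from the left are nonpositive
  set s := sInf Z with hs_def
  have hmin : ∀ x ∈ Ico a' s, 0 < g x := fun x hx ↦ by
    by_contra! hx'
    exact absurd (csInf_le hZc.bddBelow ⟨⟨hx.1, hx.2.le.trans hs.1.2⟩, hx'⟩) (not_le.2 hx.2)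
  have has : a' < s := by
    refine lt_of_le_of_ne hs.1.1 fun h ↦ ?_
    have := hs.2
    rw [← h] at this
    exact absurd hpos (not_lt.2 this)
  have hne : (𝓝[Ico a' s] s).NeBot := by
    rw [← mem_closure_iff_nhdsWithin_neBot, closure_Ico has.ne]
    exact ⟨has.le, le_rfl⟩
  have hIs : Ico a' s ⊆ Icc a b \ {s} := fun x hx ↦
    ⟨hsub ⟨hx.1, hx.2.le.trans hs.1.2⟩, hx.2.ne⟩
  have hgs : g s = 0 := by
    refine le_antisymm hs.2 ?_
    have h1 : Tendsto g (𝓝[Ico a' s] s) (𝓝 (g s)) :=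
      (hg s (hsub hs.1)).mono_left (nhdsWithin_mono _ (hIs.trans sdiff_subset))
    exact ge_of_tendsto h1 (eventually_mem_nhdsWithin.mono fun x hx ↦ (hmin x hx).le)
  obtain ⟨d, hd0, hds⟩ := hd s ⟨ha'.1.trans has, hs.1.2.trans ht₁.2⟩ hgs
  rw [hasDerivWithinAt_iff_tendsto_slope] at hds
  have h2 : d ≤ 0 := by
    refine le_of_tendsto (hds.mono_left (nhdsWithin_mono _ hIs))
      (eventually_mem_nhdsWithin.mono fun x hx ↦ ?_)
    rw [slope_def_field, hgs, sub_zero]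
    exact (div_nonpos_of_nonneg_of_nonpos (hmin x hx).le (by linarith [hx.2]))
  linarith

end Upcrossing

section Prufer

open MeasureTheory Real intervalIntegral

/-- Polar coordinates `u = ρ cos ϑ`, `-u' = ξ ρ sin ϑ` for the solution `u ξ` of
`u'' + (m / t + h₀) u' = -ξ² u`, `u(0) = 1`, `u'(0) = 0` on `[0, c]`. -/
structure PruferData (c : ℝ) (m : ℕ) (e h₀ : ℝ → ℝ) (u ρ ϑ : ℝ → ℝ → ℝ) : Prop where
  continuous_u : ∀ ξ, Continuous (u ξ)
  u_zero : ∀ ξ, u ξ 0 = 1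
  u_eq : ∀ ξ, ∀ t ∈ Icc 0 c, u ξ t = 1 - ξ ^ 2 * ∫ s in (0 : ℝ)..t, halfDer m e (u ξ) s
  unique : ∀ ξ (v : ℝ → ℝ), ContinuousOn v (Icc 0 c) →
    (∀ t ∈ Icc 0 c, v t = v 0 - ξ ^ 2 * ∫ s in (0 : ℝ)..t, halfDer m e v s) →
    ∀ t ∈ Icc 0 c, v t = v 0 * u ξ t
  rho_pos : ∀ ξ, ∀ t ∈ Icc 0 c, 0 < ρ ξ t
  cos_eq : ∀ ξ, ∀ t ∈ Icc 0 c, u ξ t = ρ ξ t * cos (ϑ ξ t)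
  sin_eq : ∀ ξ, ∀ t ∈ Icc 0 c, ξ * halfDer m e (u ξ) t = ρ ξ t * sin (ϑ ξ t)
  angle_zero : ∀ ξ, ϑ ξ 0 = 0
  zero_angle : ∀ t, ϑ 0 t = 0
  continuous_end : Continuous fun ξ ↦ ϑ ξ c
  continuous_angle : ∀ ξ, Continuous (ϑ ξ)
  deriv_angle : ∀ ξ, ∀ t ∈ Ioc 0 c,
    HasDerivAt (ϑ ξ) (ξ - (m / t + h₀ t) * (sin (ϑ ξ t) * cos (ϑ ξ t))) t
  deriv_angle_zero : ∀ ξ, HasDerivAt (ϑ ξ) (ξ / (m + 1)) 0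

variable {c : ℝ} {m : ℕ} {e h₀ : ℝ → ℝ}

/-- The pair `(u, y)` with `u' = -ξ y`, `y' = ξ u - (m / t + h₀) y` does not vanish. -/
lemma HalfWeight.sq_add_sq_pos (hw : HalfWeight c m e h₀) {ξ : ℝ} {u y z : ℝ → ℝ}
    (hu : ∀ t ∈ Icc 0 c, HasDerivWithinAt u (-(ξ * y t)) (Icc 0 c) t)
    (hy : ∀ t ∈ Icc 0 c, HasDerivWithinAt y (ξ * u t - z t) (Icc 0 c) t)
    (hz : ∀ t ∈ Ioc 0 c, z t = (m / t + h₀ t) * y t) (hu0 : u 0 = 1) :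
    ∀ t ∈ Icc 0 c, 0 < u t ^ 2 + y t ^ 2 := by
  have hc := hw.c_pos
  set E : ℝ → ℝ := fun t ↦ u t ^ 2 + y t ^ 2 with hE
  have hEd : ∀ t ∈ Icc 0 c, HasDerivWithinAt E (-(2 * z t * y t)) (Icc 0 c) t := fun t ht ↦ by
    refine (((hu t ht).pow 2).add ((hy t ht).pow 2)).congr_deriv ?_
    push_cast
    ring
  have hEc : ContinuousOn E (Icc 0 c) := fun t ht ↦ (hEd t ht).continuousWithinAt
  have hE0 : 0 < E 0 := by simp only [hE, hu0]; positivity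
  obtain ⟨a, ha0, hac, ha⟩ : ∃ a, 0 < a ∧ a ≤ c ∧ ∀ t ∈ Icc 0 a, 0 < E t := by
    have h1 : ∀ᶠ t in 𝓝[≥] (0 : ℝ), 0 < E t := by
      have := (hEc 0 ⟨le_rfl, hc.le⟩).eventually (lt_mem_nhds hE0)
      rwa [nhdsWithin_Icc_eq_nhdsGE hc] at this
    obtain ⟨a, ha, hsub⟩ := mem_nhdsGE_iff_exists_Icc_subset.1 h1
    exact ⟨min a c, lt_min ha hc, min_le_right _ _,
      fun t ht ↦ hsub ⟨ht.1, ht.2.trans (min_le_left _ _)⟩⟩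
  have hsub : Icc a c ⊆ Icc 0 c := Icc_subset_Icc_left ha0.le
  obtain ⟨H, hH⟩ := (isCompact_Icc (a := a) (b := c)).exists_bound_of_continuousOn
    (f := fun t ↦ m / t + h₀ t) ((continuousOn_const.div continuousOn_id fun t ht ↦
      (ha0.trans_le ht.1).ne').add (hw.h_smooth.continuousOn.mono hsub))
  -- away from the singular endpoint `E' ≥ -2 H E`
  have hmono : MonotoneOn (fun t ↦ E t * exp (2 * H * t)) (Icc a c) := by
    have hd : ∀ t ∈ Icc 0 c, HasDerivWithinAt (fun t ↦ E t * exp (2 * H * t))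
        ((2 * H * E t - 2 * z t * y t) * exp (2 * H * t)) (Icc 0 c) t := fun t ht ↦ by
      have h1 : HasDerivAt (fun t ↦ exp (2 * H * t)) (exp (2 * H * t) * (2 * H)) t := by
        simpa using ((hasDerivAt_id t).const_mul (2 * H)).exp
      exact ((hEd t ht).mul h1.hasDerivWithinAt).congr_deriv (by ring)
    refine monotoneOn_of_hasDerivWithinAt_nonneg (convex_Icc a c)
      (fun t ht ↦ ((hd t (hsub ht)).continuousWithinAt).mono hsub)
      (fun t ht ↦ (hd t (hsub (interior_subset ht))).mono (interior_subset.trans hsub))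
      fun t ht ↦ ?_
    have ht' := interior_subset ht
    refine mul_nonneg ?_ (exp_pos _).le
    rw [hz t ⟨ha0.trans_le ht'.1, ht'.2⟩]
    have h2 := hH t ht'
    rw [Real.norm_eq_abs, abs_le] at h2
    simp only [hE]
    nlinarith [sq_nonneg (y t), sq_nonneg (u t), mul_nonneg (sub_nonneg.2 h2.2) (sq_nonneg (y t)),
      mul_nonneg (by linarith : (0 : ℝ) ≤ H) (sq_nonneg (u t))]
  intro t ht
  rcases le_total t a with h | h
  · exact ha t ⟨ht.1, h⟩
  · have h1 := hmono ⟨le_rfl, hac⟩ ⟨h, ht.2⟩ h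
    have h2 : 0 < E a * exp (2 * H * a) := mul_pos (ha a ⟨ha0.le, le_rfl⟩) (exp_pos _)
    exact (pos_iff_pos_of_mul_pos (h2.trans_le h1)).2 (exp_pos _)

/-- The angle defined by integrating the Prüfer equation is a polar angle of `(u, y)`. -/
lemma HalfWeight.polar_of_angle (hw : HalfWeight c m e h₀) {ξ : ℝ} {u y z ϑ : ℝ → ℝ}
    (huc : Continuous u) (hyc : Continuous y) (hzc : Continuous z)
    (hu : ∀ t ∈ Icc 0 c, HasDerivWithinAt u (-(ξ * y t)) (Icc 0 c) t)
    (hy : ∀ t ∈ Icc 0 c, HasDerivWithinAt y (ξ * u t - z t) (Icc 0 c) t)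
    (hz : ∀ t ∈ Ioc 0 c, z t = (m / t + h₀ t) * y t) (hu0 : u 0 = 1)
    (hy0 : y 0 = 0) (hpos : ∀ t, 0 < u t ^ 2 + y t ^ 2)
    (hϑ : ∀ t, HasDerivAt ϑ (ξ - z t * u t / (u t ^ 2 + y t ^ 2)) t) (hϑ0 : ϑ 0 = 0) :
    ∀ t ∈ Icc 0 c, 0 < u t * cos (ϑ t) + y t * sin (ϑ t) ∧
      u t = (u t * cos (ϑ t) + y t * sin (ϑ t)) * cos (ϑ t) ∧
      y t = (u t * cos (ϑ t) + y t * sin (ϑ t)) * sin (ϑ t) := by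
  have hc := hw.c_pos
  have hϑc : Continuous ϑ := continuous_iff_continuousAt.2 fun t ↦ (hϑ t).continuousAt
  -- `A` is the component orthogonal to the direction of angle `ϑ`; it satisfies a linear equation
  set A : ℝ → ℝ := fun t ↦ u t * sin (ϑ t) - y t * cos (ϑ t) with hA
  have hAc : Continuous A := by fun_prop
  set W : ℝ → ℝ := fun t ↦ z t * y t / (u t ^ 2 + y t ^ 2) with hW
  have hWc : Continuous W := (by fun_prop : Continuous fun t ↦ z t * y t).div (by fun_prop)
    fun t ↦ (hpos t).ne'
  have hAd : ∀ t ∈ Ioo 0 c, HasDerivAt A (-(W t * A t)) t := fun t ht ↦ by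
    have ht' : t ∈ Icc 0 c := Ioo_subset_Icc_self ht
    have h1 := (hu t ht').hasDerivAt (Icc_mem_nhds ht.1 ht.2)
    have h2 := (hy t ht').hasDerivAt (Icc_mem_nhds ht.1 ht.2)
    refine ((h1.mul (hϑ t).sin).sub (h2.mul (hϑ t).cos)).congr_deriv ?_
    have h3 := (hpos t).ne'
    have h4 := hz t ⟨ht.1, ht.2.le⟩
    simp only [hW, hA]
    rw [h4]
    field_simp
    ring
  obtain ⟨B, hB⟩ := (isCompact_Icc (a := 0) (b := c)).exists_bound_of_continuousOn hWc.continuousOn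
  -- a linear homogeneous equation with zero initial value
  have hA0 : ∀ t ∈ Icc 0 c, A t = 0 := by
    refine eq_zero_of_abs_le_integral (C := B) hAc fun t ht ↦ ?_
    have h1 := integral_eq_sub_of_hasDerivAt_of_le ht.1 hAc.continuousOn
      (fun s hs ↦ hAd s ⟨hs.1, hs.2.trans_le ht.2⟩)
      ((hWc.mul hAc).neg.intervalIntegrable 0 t)
    have h2 : A 0 = 0 := by simp [hA, hy0, hϑ0]
    rw [h2, sub_zero] at h1
    rw [← h1, ← intervalIntegral.integral_const_mul]
    rw [← Real.norm_eq_abs]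
    refine norm_integral_le_of_norm_le (μ := volume) ht.1
      (Eventually.of_forall fun s hs ↦ ?_) ((continuous_const.mul hAc.abs).intervalIntegrable 0 t)
    rw [norm_neg, norm_mul]
    exact mul_le_mul_of_nonneg_right (hB s ⟨hs.1.le, hs.2.trans ht.2⟩) (abs_nonneg _)
  have hid : ∀ t,
      (u t * cos (ϑ t) + y t * sin (ϑ t)) ^ 2 + A t ^ 2 = u t ^ 2 + y t ^ 2 := fun t ↦ by
    simp only [hA]
    linear_combination (u t ^ 2 + y t ^ 2) * sin_sq_add_cos_sq (ϑ t)
  have hne : ∀ t ∈ Icc 0 c, u t * cos (ϑ t) + y t * sin (ϑ t) ≠ 0 := fun t ht h ↦ by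
    have h1 := hid t
    rw [h, hA0 t ht] at h1
    linarith [hpos t]
  intro t ht
  refine ⟨?_, ?_, ?_⟩
  · by_contra! h
    have hcont : ContinuousOn (fun t ↦ u t * cos (ϑ t) + y t * sin (ϑ t)) (Icc 0 t) := by fun_prop
    have h1 := intermediate_value_Icc' ht.1 hcont
    obtain ⟨s, hs, hs0⟩ := h1 ⟨h, by simp [hu0, hϑ0]⟩
    exact hne s ⟨hs.1, hs.2.trans ht.2⟩ hs0
  · have h1 := hA0 t ht
    simp only [hA] at h1
    linear_combination (-u t) * sin_sq_add_cos_sq (ϑ t) + sin (ϑ t) * h1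
  · have h1 := hA0 t ht
    simp only [hA] at h1
    linear_combination (-y t) * sin_sq_add_cos_sq (ϑ t) - cos (ϑ t) * h1

/-- The initial value problem is the linear equation `u + ξ² V u = 1` in `C([0, c])`, which the
Volterra operator `V` makes uniquely solvable for every `ξ`; the solution depends continuously on
`ξ`. The angle is obtained by integrating its derivative, so that it is continuous in `ξ`. -/
theorem HalfWeight.exists_prufer (hw : HalfWeight c m e h₀) :
    ∃ u ρ ϑ : ℝ → ℝ → ℝ, PruferData c m e h₀ u ρ ϑ := by
  have hc := hw.c_pos
  obtain ⟨Ψ, E, V, hΨ, hE, hV, hunit⟩ := hw.exists_operators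
  set X := C(Icc 0 c, ℝ)
  set U : ℝ → X := fun ξ ↦ Ring.inverse (1 + ξ ^ 2 • V) 1 with hU
  set H₀ : X := toX h₀ hw.h_smooth.continuousOn with hH₀
  set Z : ℝ → X := fun ξ ↦ ξ • ((m : ℝ) • Ψ (U ξ) + H₀ * E (U ξ)) with hZ
  have hUc : Continuous U := by
    have h1 : Continuous fun ξ : ℝ ↦ Ring.inverse (1 + ξ ^ 2 • V) := by
      refine continuous_iff_continuousAt.2 fun ξ ↦ ?_
      obtain ⟨x, hx⟩ := hunit (ξ ^ 2)
      have h2 := NormedRing.inverse_continuousAt (R := X →L[ℝ] X) x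
      rw [hx] at h2
      exact ContinuousAt.comp (f := fun ξ : ℝ ↦ 1 + ξ ^ 2 • V) h2 (by fun_prop)
    exact h1.clm_apply continuous_const
  have hUeq : ∀ ξ, U ξ = 1 - ξ ^ 2 • V (U ξ) := fun ξ ↦ by
    have h1 := congrArg (fun T : X →L[ℝ] X ↦ T 1) (Ring.mul_inverse_cancel _ (hunit (ξ ^ 2)))
    exact eq_sub_of_add_eq h1
  set u : ℝ → ℝ → ℝ := fun ξ ↦ ext hc (U ξ) with hu
  set y : ℝ → ℝ → ℝ := fun ξ t ↦ ξ * ext hc (E (U ξ)) t with hy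
  have hz : (0 : ℝ) ∈ Icc 0 c := ⟨le_rfl, hc.le⟩
  have hueq : ∀ ξ, ∀ t ∈ Icc 0 c, u ξ t = 1 - ξ ^ 2 * ∫ s in (0 : ℝ)..t, ext hc (E (U ξ)) s :=
    fun ξ t ht ↦ by
      have h1 : ext hc (U ξ) t = 1 - ξ ^ 2 * ext hc (V (U ξ)) t := by
        conv_lhs => rw [hUeq ξ]
        rfl
      rw [← hV _ t ht]
      exact h1
  have hu0 : ∀ ξ, u ξ 0 = 1 := fun ξ ↦ by rw [hueq ξ 0 hz]; simp
  have hud : ∀ ξ, ∀ t ∈ Icc 0 c, HasDerivWithinAt (u ξ) (-(ξ * y ξ t)) (Icc 0 c) t := by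
    intro ξ t ht
    have h1 := (hasDerivWithinAt_integral hc.le
      (continuousOn_ext (hD := hc) (E (U ξ))) ht).const_mul
      (ξ ^ 2)
    have h2 := (h1.const_sub 1).congr (hueq ξ) (hueq ξ t ht)
    exact h2.congr_deriv (by simp only [hy]; ring)
  have hEt : ∀ ξ, EqOn (ext hc (E (U ξ))) (halfDer m e (u ξ)) (Icc 0 c) := fun ξ t ht ↦ hE _ t ht
  have hZt : ∀ ξ, ∀ t ∈ Icc 0 c,
      ext hc (Z ξ) t = ξ * (m * halfPsi m e (u ξ) t + h₀ t * halfDer m e (u ξ) t) := by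
    intro ξ t ht
    have h1 : ext hc (Z ξ) t = ξ * (m * ext hc (Ψ (U ξ)) t + ext hc H₀ t * ext hc (E (U ξ)) t) :=
      rfl
    rw [h1, hΨ _ t ht, hE _ t ht, hH₀, ext_toX _ ht]
  have hyd : ∀ ξ, ∀ t ∈ Icc 0 c,
      HasDerivWithinAt (y ξ) (ξ * u ξ t - ext hc (Z ξ) t) (Icc 0 c) t := by
    intro ξ t ht
    have h1 := (hw.hasDerivWithinAt_halfDer (continuousOn_ext (hD := hc) (U ξ)) ht).const_mul ξ
    have h2 := h1.congr (f₁ := y ξ) (fun s hs ↦ by rw [hy]; simp only []; rw [hEt ξ hs])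
      (by rw [hy]; simp only []; rw [hEt ξ ht])
    refine h2.congr_deriv ?_
    rw [hZt ξ t ht]
    ring
  have hzy : ∀ ξ, ∀ t ∈ Ioc 0 c, ext hc (Z ξ) t = (m / t + h₀ t) * y ξ t := by
    intro ξ t ht
    have ht' : t ∈ Icc 0 c := ⟨ht.1.le, ht.2⟩
    have ht0 := ht.1.ne'
    rw [hZt ξ t ht', hy]
    simp only []
    rw [hEt ξ ht', halfDer]
    field_simp
  have huc : ∀ ξ, Continuous (u ξ) := fun ξ ↦ continuous_ext _
  have hyc : ∀ ξ, Continuous (y ξ) := fun ξ ↦ continuous_const.mul (continuous_ext _)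
  have hpos' : ∀ ξ, ∀ t ∈ Icc 0 c, 0 < u ξ t ^ 2 + y ξ t ^ 2 := fun ξ ↦
    hw.sq_add_sq_pos (hud ξ) (hyd ξ) (hzy ξ) (hu0 ξ)
  have hpos : ∀ ξ t, 0 < u ξ t ^ 2 + y ξ t ^ 2 := fun ξ t ↦ by
    have := hpos' ξ _ (projIcc 0 c hc.le t).2
    simpa [hu, hy, ext_eq] using this
  -- the derivative of the angle, in a form that is continuous up to the singular endpoint
  set j : ℝ → ℝ → ℝ := fun ξ t ↦ ξ - ext hc (Z ξ) t * u ξ t / (u ξ t ^ 2 + y ξ t ^ 2) with hj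
  have hjc : Continuous (Function.uncurry j) := by
    have hEc : Continuous fun ξ ↦ E (U ξ) := E.continuous.comp hUc
    have hZc : Continuous Z := continuous_id.smul (((Ψ.continuous.comp hUc).const_smul (m : ℝ)).add
      (continuous_const.mul hEc))
    have hev : ∀ {F : ℝ → X}, Continuous F → Continuous fun p : ℝ × ℝ ↦ ext hc (F p.1) p.2 := by
      intro F hF
      have h1 : Continuous fun p : ℝ × ℝ ↦ (F p.1) (projIcc 0 c hc.le p.2) :=
        (hF.comp continuous_fst).eval (continuous_projIcc.comp continuous_snd)
      exact h1
    have h1 := hev hUc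
    have h2 : Continuous fun p : ℝ × ℝ ↦ y p.1 p.2 := continuous_fst.mul (hev hEc)
    have h3 := hev hZc
    exact continuous_fst.sub ((h3.mul h1).div ((h1.pow 2).add (h2.pow 2)) fun p ↦
      (hpos p.1 p.2).ne')
  set ϑ : ℝ → ℝ → ℝ := fun ξ t ↦ ∫ s in (0 : ℝ)..t, j ξ s with hϑ
  have hϑd : ∀ ξ t, HasDerivAt (ϑ ξ) (j ξ t) t := fun ξ t ↦
    ((hjc.comp (Continuous.prodMk_right ξ)).integral_hasStrictDerivAt 0 t).hasDerivAt
  have hy0 : ∀ ξ, y ξ 0 = 0 := fun ξ ↦ by simp only [hy]; rw [hEt ξ hz, halfDer_zero, mul_zero]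
  have hpol := fun ξ ↦ hw.polar_of_angle (huc ξ) (hyc ξ) (continuous_ext (Z ξ)) (hud ξ) (hyd ξ)
    (hzy ξ) (hu0 ξ) (hy0 ξ) (hpos ξ) (hϑd ξ) (by simp [hϑ])
  refine ⟨u, fun ξ t ↦ u ξ t * cos (ϑ ξ t) + y ξ t * sin (ϑ ξ t), ϑ, ?_⟩
  refine
    { continuous_u := huc
      u_zero := hu0
      u_eq := fun ξ t ht ↦ ?_
      unique := fun ξ v hv hvt ↦ ?_
      rho_pos := fun ξ t ht ↦ (hpol ξ t ht).1
      cos_eq := fun ξ t ht ↦ (hpol ξ t ht).2.1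
      sin_eq := fun ξ t ht ↦ ?_
      angle_zero := fun ξ ↦ by simp [hϑ]
      zero_angle := fun t ↦ ?_
      continuous_end := continuous_parametric_intervalIntegral_of_continuous' hjc 0 c
      continuous_angle := fun ξ ↦ continuous_iff_continuousAt.2 fun t ↦ (hϑd ξ t).continuousAt
      deriv_angle := fun ξ t ht ↦ ?_
      deriv_angle_zero := fun ξ ↦ ?_ }
  · rw [hueq ξ t ht]
    congr 2
    refine integral_congr fun s hs ↦ ?_
    rw [uIcc_of_le ht.1] at hs
    exact hEt ξ ⟨hs.1, hs.2.trans ht.2⟩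
  · have h1 : toX v hv = v 0 • U ξ := by
      have h2 : (1 + ξ ^ 2 • V) (toX v hv) = v 0 • (1 : X) := by
        refine ext_injOn (hD := hc) fun t ht ↦ ?_
        have h3 : ext hc ((1 + ξ ^ 2 • V) (toX v hv)) t =
          ext hc (toX v hv) t + ξ ^ 2 * ext hc (V (toX v hv)) t := rfl
        have h4 : ext hc (v 0 • (1 : X)) t = v 0 * 1 := rfl
        have h5 : ∫ s in (0 : ℝ)..t, ext hc (E (toX v hv)) s =
            ∫ s in (0 : ℝ)..t, halfDer m e v s := by
          refine integral_congr fun s hs ↦ ?_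
          rw [uIcc_of_le ht.1] at hs
          have hs' : s ∈ Icc 0 c := ⟨hs.1, hs.2.trans ht.2⟩
          rw [hE _ s hs', halfDer, halfDer, halfPsi, halfPsi, avg_congr m (g := fun s ↦ e s * v s)
            (fun r hr ↦ by simp only []; rw [ext_toX hv hr]) hs']
        rw [h3, h4, hV _ t ht, ext_toX hv ht, h5, hvt t ht]
        ring
      have h6 := congrArg (fun f ↦ (Ring.inverse (1 + ξ ^ 2 • V) : X →L[ℝ] X) f) h2
      have h7 := congrArg (fun T : X →L[ℝ] X ↦ T (toX v hv))
        (Ring.inverse_mul_cancel _ (hunit (ξ ^ 2)))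
      simp only [map_smul] at h6
      exact h7.symm.trans h6
    intro t ht
    rw [← ext_toX (hD := hc) hv ht, h1]
    rfl
  · rw [← hEt ξ ht]
    exact (hpol ξ t ht).2.2
  · simp [hϑ, hj, hZ, ext_eq]
  · refine (hϑd ξ t).congr_deriv ?_
    have ht' : t ∈ Icc 0 c := ⟨ht.1.le, ht.2⟩
    obtain ⟨h1, h2, h3⟩ := hpol ξ t ht'
    simp only [hj]
    rw [hzy ξ t ht]
    set r := u ξ t * cos (ϑ ξ t) + y ξ t * sin (ϑ ξ t)
    have h4 : u ξ t ^ 2 + y ξ t ^ 2 = r ^ 2 := by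
      rw [h2, h3]
      linear_combination r ^ 2 * sin_sq_add_cos_sq (ϑ ξ t)
    rw [h4, h2, h3]
    field_simp
  · refine (hϑd ξ 0).congr_deriv ?_
    simp only [hj]
    rw [hZt ξ 0 hz, hw.halfPsi_zero, halfDer_zero, hu0, hy0]
    field_simp
    ring

namespace PruferData

variable {u ρ ϑ : ℝ → ℝ → ℝ}

lemma angle_pos (hP : PruferData c m e h₀ u ρ ϑ) (hc : 0 < c) {ξ : ℝ} (hξ : 0 < ξ) :
    ∀ t ∈ Ioc 0 c, 0 < ϑ ξ t := by
  refine pos_of_upcrossing (hP.continuous_angle ξ).continuousOn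
    (eventually_pos_of_hasDerivWithinAt hc (hP.deriv_angle_zero ξ).hasDerivWithinAt
      (by positivity) (hP.angle_zero ξ)) fun t ht h0 ↦ ⟨ξ, hξ, ?_⟩
  refine ((hP.deriv_angle ξ t ht).hasDerivWithinAt).congr_deriv ?_
  simp [h0]

/-- Sturm's comparison theorem: the angle increases with the frequency. -/
lemma strictMono_angle (hP : PruferData c m e h₀ u ρ ϑ) (hc : 0 < c) :
    StrictMono fun ξ ↦ ϑ ξ c := by
  intro ξ₁ ξ₂ h
  have h1 := pos_of_upcrossing (g := fun t ↦ ϑ ξ₂ t - ϑ ξ₁ t) (a := 0) (b := c)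
    ((hP.continuous_angle ξ₂).sub (hP.continuous_angle ξ₁)).continuousOn
    (eventually_pos_of_hasDerivWithinAt hc
      ((hP.deriv_angle_zero ξ₂).sub (hP.deriv_angle_zero ξ₁)).hasDerivWithinAt
      (by rw [← sub_div]; have := sub_pos.2 h; positivity) (by simp [hP.angle_zero]))
    (fun t ht h0 ↦ ⟨ξ₂ - ξ₁, sub_pos.2 h, ?_⟩) c ⟨hc, le_rfl⟩
  · simpa using h1
  · have h2 : ϑ ξ₂ t = ϑ ξ₁ t := sub_eq_zero.1 h0
    refine ((hP.deriv_angle ξ₂ t ht).sub (hP.deriv_angle ξ₁ t ht)).hasDerivWithinAt.congr_deriv ?_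
    rw [h2]
    ring

/-- The angle tends to infinity with the frequency, because its derivative is at least `ξ - H` on
`[c / 2, c]`, where `m / t + h₀` is bounded by some `H`. -/
lemma tendsto_angle (hP : PruferData c m e h₀ u ρ ϑ) (hw : HalfWeight c m e h₀) :
    Tendsto (fun ξ ↦ ϑ ξ c) atTop atTop := by
  have hc := hw.c_pos
  have hsub : Icc (c / 2) c ⊆ Icc 0 c := Icc_subset_Icc_left (by linarith)
  obtain ⟨H, hH⟩ := (isCompact_Icc (a := c / 2) (b := c)).exists_bound_of_continuousOn
    (f := fun t ↦ m / t + h₀ t) ((continuousOn_const.div continuousOn_id fun t ht ↦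
      (by linarith [ht.1] : (0 : ℝ) < t).ne').add (hw.h_smooth.continuousOn.mono hsub))
  have key : ∀ ξ, 0 < ξ → (ξ - H) * (c / 2) ≤ ϑ ξ c := by
    intro ξ hξ
    have h1 := (convex_Icc (c / 2) c).mul_sub_le_image_sub_of_le_deriv (f := ϑ ξ)
      (hP.continuous_angle ξ).continuousOn
      (fun t ht ↦ by
        have ht' := interior_subset ht
        exact (hP.deriv_angle ξ t
          ⟨by linarith [ht'.1], ht'.2⟩).differentiableAt.differentiableWithinAt)
      (C := ξ - H) (fun t ht ↦ by
        have ht' := interior_subset ht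
        rw [(hP.deriv_angle ξ t ⟨by linarith [ht'.1], ht'.2⟩).deriv]
        have h2 : |(m / t + h₀ t) * (sin (ϑ ξ t) * cos (ϑ ξ t))| ≤ H * (1 * 1) := by
          rw [abs_mul, abs_mul]
          have h3 := hH t ht'
          rw [Real.norm_eq_abs] at h3
          have := abs_sin_le_one (ϑ ξ t)
          have := abs_cos_le_one (ϑ ξ t)
          have : 0 ≤ H := (abs_nonneg _).trans h3
          gcongr
        linarith [(abs_le.1 h2).2])
      (c / 2) ⟨le_rfl, by linarith⟩ c ⟨by linarith, le_rfl⟩ (by linarith)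
    have h2 := hP.angle_pos hc hξ (c / 2) ⟨by linarith, by linarith⟩
    nlinarith
  have h3 : Tendsto (fun ξ ↦ (ξ - H) * (c / 2)) atTop atTop :=
    (tendsto_atTop_add_const_right _ (-H) tendsto_id).atTop_mul_const (by linarith)
  refine tendsto_atTop_mono' _ ?_ h3
  filter_upwards [eventually_gt_atTop 0] with ξ hξ using key ξ hξ

end PruferData

end Prufer


/-! ### The operator on the whole interval -/

section Profile

open MeasureTheory

/-- The mean curvature function `h` of an isoparametric foliation of width `D`:
`h(t) = m₀ / t - m₁ / (D - t) + κ(t)` with `κ` smooth on `[0, D]`, the regular part of `h` vanishing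
at either endpoint. `K` is a primitive of `κ`. -/
structure Profile (D : ℝ) (m₀ m₁ : ℕ) (K κ h : ℝ → ℝ) : Prop where
  D_pos : 0 < D
  K_smooth : ContDiffOn ℝ ∞ K (Icc 0 D)
  smooth : ContDiffOn ℝ ∞ κ (Icc 0 D)
  deriv_K : ∀ t ∈ Icc 0 D, HasDerivWithinAt K (κ t) (Icc 0 D) t
  h_eq : ∀ t ∈ Ioo 0 D, h t = m₀ / t - m₁ / (D - t) + κ t
  left : κ 0 = m₁ / D
  right : κ D = -(m₀ / D)

/-- The regular factor `(D - t)^m₁ exp K` of the weight at the endpoint `0`. -/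
noncomputable def regFactor (D : ℝ) (m₁ : ℕ) (K : ℝ → ℝ) (t : ℝ) : ℝ :=
  (D - t) ^ m₁ * Real.exp (K t)

/-- The weight `p = t^m₀ (D - t)^m₁ exp K`, which satisfies `p' = h p`. -/
noncomputable def weight (D : ℝ) (m₀ m₁ : ℕ) (K : ℝ → ℝ) (t : ℝ) : ℝ := t ^ m₀ * regFactor D m₁ K t

/-- The derivative `u'` of the solution of `u'' + h u' = f`, computed from `0` on the left half of
the interval and from `D` on the right half. -/
noncomputable def fullDer (D : ℝ) (m₀ m₁ : ℕ) (K f : ℝ → ℝ) (t : ℝ) : ℝ :=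
  if t ≤ D / 2 then halfDer m₀ (regFactor D m₁ K) f t
  else -halfDer m₁ (regFactor D m₀ fun s ↦ K (D - s)) (fun s ↦ f (D - s)) (D - t)

variable {D : ℝ} {m₀ m₁ : ℕ} {K κ h : ℝ → ℝ} {f g : ℝ → ℝ} {c t : ℝ} {θ : ℝ} {k : ℕ}

lemma mapsTo_reflect : MapsTo (fun t ↦ D - t) (Icc 0 D) (Icc 0 D) :=
  fun _ ht ↦ ⟨sub_nonneg.2 ht.2, sub_le_self _ ht.1⟩

lemma Profile.reflect (hp : Profile D m₀ m₁ K κ h) :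
    Profile D m₁ m₀ (fun t ↦ K (D - t)) (fun t ↦ -κ (D - t)) (fun t ↦ -h (D - t)) where
  D_pos := hp.D_pos
  K_smooth := hp.K_smooth.comp (by fun_prop) mapsTo_reflect
  smooth := (hp.smooth.comp (by fun_prop) mapsTo_reflect).neg
  deriv_K t ht := by
    have h1 : HasDerivWithinAt (fun y ↦ D - y) (-1) (Icc 0 D) t := by
      simpa using (hasDerivWithinAt_id t _).const_sub D
    simpa [Function.comp_def] using
      (hp.deriv_K _ (mapsTo_reflect ht)).scomp t h1 mapsTo_reflect
  h_eq t ht := by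
    rw [hp.h_eq (D - t) ⟨by linarith [ht.2], by linarith [ht.1]⟩]
    ring_nf
  left := by simp [hp.right]
  right := by simp [hp.left]

lemma Profile.halfWeight (hp : Profile D m₀ m₁ K κ h) (hc : 0 < c) (hcD : c < D) :
    HalfWeight c m₀ (regFactor D m₁ K) (fun t ↦ -(m₁ / (D - t)) + κ t) := by
  have hsub : Icc 0 c ⊆ Icc 0 D := Icc_subset_Icc_right hcD.le
  have hne : ∀ t ∈ Icc 0 c, D - t ≠ 0 := fun t ht ↦ by linarith [ht.2]
  refine ⟨hc, fun t ht ↦ ?_, ?_, ?_, fun t ht ↦ ?_, ?_⟩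
  · have : 0 < D - t := by linarith [ht.2]
    unfold regFactor
    positivity
  · exact (ContDiff.contDiffOn (by fun_prop)).mul (hp.K_smooth.mono hsub).exp
  · refine ContDiffOn.add (ContDiffOn.neg ?_) (hp.smooth.mono hsub)
    exact contDiffOn_const.div (by fun_prop) hne
  · have h1 : HasDerivWithinAt (fun y ↦ D - y) (-1) (Icc 0 c) t := by
      simpa using (hasDerivWithinAt_id t _).const_sub D
    have h2 := (h1.pow m₁).mul ((hp.deriv_K t (hsub ht)).mono hsub).exp
    refine h2.congr_deriv ?_
    have := hne t ht
    simp only [regFactor, Pi.pow_apply]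
    cases m₁ with
    | zero => simp; ring
    | succ m =>
      simp only [Nat.add_sub_cancel]
      field_simp
      push_cast
      ring
  · simp [hp.left]

lemma Profile.h_eq_left (hp : Profile D m₀ m₁ K κ h) (ht : t ∈ Ioo 0 D) :
    h t = m₀ / t + (-(m₁ / (D - t)) + κ t) := by rw [hp.h_eq t ht]; ring

lemma Profile.continuousOn_weight (hp : Profile D m₀ m₁ K κ h) :
    ContinuousOn (weight D m₀ m₁ K) (Icc 0 D) := by
  unfold weight regFactor
  exact (continuousOn_id.pow _).mul ((ContinuousOn.pow (by fun_prop) _).mul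
    (Real.continuous_exp.comp_continuousOn hp.K_smooth.continuousOn))

lemma weight_pos (ht : t ∈ Ioo 0 D) : 0 < weight D m₀ m₁ K t := by
  have h1 := ht.1
  have h2 : 0 < D - t := sub_pos.2 ht.2
  unfold weight regFactor
  positivity

lemma weight_nonneg (ht : t ∈ Icc 0 D) : 0 ≤ weight D m₀ m₁ K t := by
  have h1 := ht.1
  have h2 : 0 ≤ D - t := sub_nonneg.2 ht.2
  unfold weight regFactor
  positivity

lemma weight_reflect (t : ℝ) :
    weight D m₁ m₀ (fun s ↦ K (D - s)) t = weight D m₀ m₁ K (D - t) := by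
  simp only [weight, regFactor, sub_sub_cancel]
  ring

lemma Profile.hasDerivAt_weight (hp : Profile D m₀ m₁ K κ h) (ht : t ∈ Ioo 0 D) :
    HasDerivAt (weight D m₀ m₁ K) (h t * weight D m₀ m₁ K t) t := by
  obtain ⟨c, hc1, hc2⟩ := exists_between ht.2
  have hw := hp.halfWeight (ht.1.trans hc1) hc2
  rw [hp.h_eq_left ht]
  exact (hw.hasDerivWithinAt_weight ⟨ht.1, hc1.le⟩).hasDerivAt (Icc_mem_nhds ht.1 hc1)

lemma Profile.weight_mul_halfDer (hp : Profile D m₀ m₁ K κ h) (ht : t ∈ Ico 0 D) :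
    weight D m₀ m₁ K t * halfDer m₀ (regFactor D m₁ K) f t =
      ∫ s in (0 : ℝ)..t, weight D m₀ m₁ K s * f s := by
  obtain ⟨c, hc1, hc2⟩ := exists_between ht.2
  have hw := hp.halfWeight (ht.1.trans_lt hc1) hc2
  simp only [weight, mul_assoc]
  rw [← hw.weight_mul_halfDer ⟨ht.1, hc1.le⟩]
  ring

lemma Profile.continuousOn_weight_mul (hp : Profile D m₀ m₁ K κ h)
    (hf : ContinuousOn f (Icc 0 D)) : ContinuousOn (fun t ↦ weight D m₀ m₁ K t * f t) (Icc 0 D) :=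
  hp.continuousOn_weight.mul hf

lemma Profile.integrable_weight_mul (hp : Profile D m₀ m₁ K κ h)
    (hf : ContinuousOn f (Icc 0 D)) {a b : ℝ} (ha : a ∈ Icc 0 D) (hb : b ∈ Icc 0 D) :
    IntervalIntegrable (fun t ↦ weight D m₀ m₁ K t * f t) volume a b := by
  refine ((hp.continuousOn_weight_mul hf).mono ?_).intervalIntegrable
  exact uIcc_subset_Icc ha hb

/-- The two one-sided solutions agree when the right-hand side has mean zero. -/
lemma Profile.halfDer_eq (hp : Profile D m₀ m₁ K κ h) (hf : ContinuousOn f (Icc 0 D))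
    (hmean : ∫ s in (0 : ℝ)..D, weight D m₀ m₁ K s * f s = 0) (ht : t ∈ Ioo 0 D) :
    halfDer m₀ (regFactor D m₁ K) f t =
      -halfDer m₁ (regFactor D m₀ fun s ↦ K (D - s)) (fun s ↦ f (D - s)) (D - t) := by
  have hD := hp.D_pos
  have h1 := hp.weight_mul_halfDer (f := f) (Ioo_subset_Ico_self ht)
  have h2 := hp.reflect.weight_mul_halfDer (f := fun s ↦ f (D - s)) (t := D - t)
    ⟨by linarith [ht.2], by linarith [ht.1]⟩
  simp only [weight_reflect] at h2
  rw [intervalIntegral.integral_comp_sub_left (fun s ↦ weight D m₀ m₁ K s * f s), sub_sub_cancel,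
    sub_zero] at h2
  have h3 := intervalIntegral.integral_add_adjacent_intervals
    (hp.integrable_weight_mul hf (a := 0) (b := t) ⟨le_rfl, hD.le⟩ (Ioo_subset_Icc_self ht))
    (hp.integrable_weight_mul hf (a := t) (b := D) (Ioo_subset_Icc_self ht) ⟨hD.le, le_rfl⟩)
  have hp0 := (weight_pos (m₀ := m₀) (m₁ := m₁) (K := K) ht).ne'
  refine mul_left_cancel₀ hp0 ?_
  rw [mul_neg, h1, h2]
  linarith

lemma Profile.fullDer_eq_left (hp : Profile D m₀ m₁ K κ h) (hf : ContinuousOn f (Icc 0 D))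
    (hmean : ∫ s in (0 : ℝ)..D, weight D m₀ m₁ K s * f s = 0) (ht : t ∈ Ico 0 D) :
    fullDer D m₀ m₁ K f t = halfDer m₀ (regFactor D m₁ K) f t := by
  unfold fullDer
  split_ifs with h1
  · rfl
  · exact (hp.halfDer_eq hf hmean ⟨by linarith [hp.D_pos], ht.2⟩).symm

lemma Profile.fullDer_eq_right (hp : Profile D m₀ m₁ K κ h) (hf : ContinuousOn f (Icc 0 D))
    (hmean : ∫ s in (0 : ℝ)..D, weight D m₀ m₁ K s * f s = 0) (ht : t ∈ Ioc 0 D) :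
    fullDer D m₀ m₁ K f t =
      -halfDer m₁ (regFactor D m₀ fun s ↦ K (D - s)) (fun s ↦ f (D - s)) (D - t) := by
  unfold fullDer
  split_ifs with h1
  · exact hp.halfDer_eq hf hmean ⟨ht.1, by linarith [hp.D_pos]⟩
  · rfl

lemma fullDer_zero (hD : 0 < D) : fullDer D m₀ m₁ K f 0 = 0 := by
  rw [fullDer, if_pos (by positivity), halfDer_zero]

lemma fullDer_end (hD : 0 < D) : fullDer D m₀ m₁ K f D = 0 := by
  rw [fullDer, if_neg (by linarith), sub_self, halfDer_zero, neg_zero]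

lemma Profile.hasDerivAt_fullDer (hp : Profile D m₀ m₁ K κ h) (hf : ContinuousOn f (Icc 0 D))
    (hmean : ∫ s in (0 : ℝ)..D, weight D m₀ m₁ K s * f s = 0) (ht : t ∈ Ioo 0 D) :
    HasDerivAt (fullDer D m₀ m₁ K f) (f t - h t * fullDer D m₀ m₁ K f t) t := by
  obtain ⟨c, hc1, hc2⟩ := exists_between ht.2
  have hw := hp.halfWeight (ht.1.trans hc1) hc2
  have h1 := (hw.hasDerivWithinAt_halfDer (hf.mono (Icc_subset_Icc_right hc2.le))
    (t := t) ⟨ht.1.le, hc1.le⟩).hasDerivAt (Icc_mem_nhds ht.1 hc1)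
  have h2 := h1.congr_of_eventuallyEq (f₁ := fullDer D m₀ m₁ K f) ?_
  · refine h2.congr_deriv ?_
    have := ht.1.ne'
    rw [hp.fullDer_eq_left hf hmean (Ioo_subset_Ico_self ht), hp.h_eq_left ht, halfDer]
    field_simp
    ring
  · filter_upwards [Ioo_mem_nhds ht.1 ht.2] with s hs
      using hp.fullDer_eq_left hf hmean (Ioo_subset_Ico_self hs)

lemma HalfWeight.contDiffOn_halfDer {m : ℕ} {e h₀ : ℝ → ℝ} (hw : HalfWeight c m e h₀)
    (hf : ContinuousOn f (Icc 0 c)) : ContDiffOn ℝ 1 (halfDer m e f) (Icc 0 c) := by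
  have hU := uniqueDiffOn_Icc hw.c_pos
  rw [show (1 : WithTop ℕ∞) = 0 + 1 by simp, contDiffOn_succ_iff_derivWithin hU]
  refine ⟨fun x hx ↦ (hw.hasDerivWithinAt_halfDer hf hx).differentiableWithinAt, by simp, ?_⟩
  rw [contDiffOn_zero]
  refine ContinuousOn.congr ?_ fun x hx ↦ (hw.hasDerivWithinAt_halfDer hf hx).derivWithin (hU x hx)
  exact (hf.sub (continuousOn_const.mul (hw.continuousOn_halfPsi hf))).sub
    (hw.h_smooth.continuousOn.mul (hw.continuousOn_halfDer hf))

lemma Profile.contDiffOn_fullDer (hp : Profile D m₀ m₁ K κ h) (hf : ContinuousOn f (Icc 0 D))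
    (hmean : ∫ s in (0 : ℝ)..D, weight D m₀ m₁ K s * f s = 0) :
    ContDiffOn ℝ 1 (fullDer D m₀ m₁ K f) (Icc 0 D) := by
  have hD := hp.D_pos
  have hc : D / 2 < D := by linarith
  have h2 : 0 < 2 * D / 3 := by positivity
  have h3 : 2 * D / 3 < D := by linarith
  have hL : ContDiffOn ℝ 1 (fullDer D m₀ m₁ K f) (Icc 0 (2 * D / 3)) :=
    ((hp.halfWeight h2 h3).contDiffOn_halfDer (hf.mono (Icc_subset_Icc_right h3.le))).congr
      fun t ht ↦ hp.fullDer_eq_left hf hmean ⟨ht.1, ht.2.trans_lt h3⟩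
  have hR : ContDiffOn ℝ 1 (fullDer D m₀ m₁ K f) (Icc (D / 3) D) := by
    have h4 := (hp.reflect.halfWeight h2 h3).contDiffOn_halfDer (f := fun s ↦ f (D - s))
      ((hf.comp (by fun_prop) mapsTo_reflect).mono (Icc_subset_Icc_right h3.le))
    refine ((h4.comp (f := fun t ↦ D - t) (s := Icc (D / 3) D) (by fun_prop) fun t ht ↦
      ⟨by linarith [ht.2], by linarith [ht.1]⟩).neg).congr fun t ht ↦ ?_
    exact hp.fullDer_eq_right hf hmean ⟨by linarith [ht.1], ht.2⟩
  intro x hx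
  rcases lt_or_ge x (2 * D / 3) with hx' | hx'
  · refine (hL x ⟨hx.1, hx'.le⟩).mono_of_mem_nhdsWithin ?_
    filter_upwards [self_mem_nhdsWithin, mem_nhdsWithin_of_mem_nhds (Iio_mem_nhds hx')]
      with y hy hy' using ⟨hy.1, le_of_lt hy'⟩
  · refine (hR x ⟨by linarith, hx.2⟩).mono_of_mem_nhdsWithin ?_
    filter_upwards [self_mem_nhdsWithin, mem_nhdsWithin_of_mem_nhds
      (Ioi_mem_nhds (by linarith : D / 3 < x))] with y hy hy' using ⟨le_of_lt hy', hy.2⟩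

lemma Profile.exists_abs_fullDer_le (hp : Profile D m₀ m₁ K κ h) :
    ∃ C, 0 < C ∧ ∀ (f : ℝ → ℝ) (R : ℝ), (∀ t ∈ Icc 0 D, |f t| ≤ R) → ∀ t ∈ Icc 0 D,
      |fullDer D m₀ m₁ K f t| ≤ C * R := by
  have hD := hp.D_pos
  have h2 : 0 < 2 * D / 3 := by positivity
  have h3 : 2 * D / 3 < D := by linarith
  obtain ⟨A, hA0, hA⟩ := (hp.halfWeight h2 h3).exists_abs_halfPsi_le
  obtain ⟨B, hB0, hB⟩ := (hp.reflect.halfWeight h2 h3).exists_abs_halfPsi_le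
  refine ⟨D * (A + B), by positivity, fun f R hf t ht ↦ ?_⟩
  have hR : 0 ≤ R := (abs_nonneg _).trans (hf t ht)
  unfold fullDer
  split_ifs with h1
  · have := hA f R (fun t ht ↦ hf t ⟨ht.1, ht.2.trans h3.le⟩) t ⟨ht.1, by linarith⟩
    rw [halfDer, abs_mul, abs_of_nonneg ht.1, mul_assoc]
    refine mul_le_mul ht.2 (this.trans ?_) (abs_nonneg _) hD.le
    gcongr
    linarith
  · have := hB (fun s ↦ f (D - s)) R
      (fun t ht ↦ hf _ (mapsTo_reflect ⟨ht.1, ht.2.trans h3.le⟩)) (D - t)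
      ⟨by linarith [ht.2], by linarith⟩
    rw [halfDer, abs_neg, abs_mul, abs_of_nonneg (by linarith [ht.2]), mul_assoc]
    refine mul_le_mul (by linarith [ht.1]) (this.trans ?_) (abs_nonneg _) hD.le
    gcongr
    linarith

/-- Regularity of `u'` on the whole interval. -/
lemma Profile.exists_CBound_fullDer (hp : Profile D m₀ m₁ K κ h) (hθ0 : 0 < θ) (hθ : θ ≤ 1)
    (k : ℕ) : ∃ C, 0 ≤ C ∧ ∀ R f, CBound θ (Icc 0 D) k R f →
      ∫ s in (0 : ℝ)..D, weight D m₀ m₁ K s * f s = 0 →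
      CBound θ (Icc 0 D) (k + 1) (C * R) (fullDer D m₀ m₁ K f) := by
  have hD := hp.D_pos
  have h2 : 0 < 2 * D / 3 := by positivity
  have h3 : 2 * D / 3 < D := by linarith
  have hne : (Icc 0 D).Nonempty := nonempty_Icc.2 hD.le
  obtain ⟨A, hA0, hA⟩ := (hp.halfWeight h2 h3).exists_CBound_halfDer hθ0 hθ k
  obtain ⟨B, hB0, hB⟩ := (hp.reflect.halfWeight h2 h3).exists_CBound_halfDer hθ0 hθ k
  obtain ⟨C, hC0, hC⟩ := CBound.exists_glue (θ := θ) (a := 0) (b := D) (c := D / 3) (d := 2 * D / 3)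
    (by positivity) (by linarith) h3 (k + 1) hθ0
  refine ⟨C * (A + B), by positivity, fun R f hf hmean ↦ ?_⟩
  have hR := hf.nonneg hne
  have hfc := hf.continuousOn hθ0
  rw [mul_assoc]
  refine hC _ _ ?_ ?_
  · refine ((hA R f (hf.restrict (Icc_subset_Icc_right h3.le))).congr fun t ht ↦ ?_).mono ?_
    · exact hp.fullDer_eq_left hfc hmean ⟨ht.1, ht.2.trans_lt h3⟩
    · gcongr; linarith
  · have h4 : CBound θ (Icc 0 (2 * D / 3)) k R (fun s ↦ f (D - s)) := by
      have := hf.reflect (D := D)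
      rw [sub_self, sub_zero] at this
      exact this.restrict (Icc_subset_Icc_right h3.le)
    have h5 := (hB R _ h4).reflect (D := D)
    rw [sub_zero, show D - 2 * D / 3 = D / 3 by ring] at h5
    refine (h5.neg.congr fun t ht ↦ ?_).mono ?_
    · exact hp.fullDer_eq_right hfc hmean ⟨by linarith [ht.1], ht.2⟩
    · gcongr; linarith

end Profile


/-! ### The resolvent of `L` -/

section Resolvent

open MeasureTheory intervalIntegral

/-- `u` is twice continuously differentiable on `[0, D]` with derivatives `u₁`, `u₂`, it satisfies
`u'(0) = u'(D) = 0`, and `u'' + h u' = f` with `f` continuous up to the endpoints. -/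
structure LSol (D : ℝ) (h u u₁ u₂ f : ℝ → ℝ) : Prop where
  deriv₁ : ∀ x ∈ Icc 0 D, HasDerivWithinAt u (u₁ x) (Icc 0 D) x
  deriv₂ : ∀ x ∈ Icc 0 D, HasDerivWithinAt u₁ (u₂ x) (Icc 0 D) x
  cont₂ : ContinuousOn u₂ (Icc 0 D)
  left : u₁ 0 = 0
  right : u₁ D = 0
  cont : ContinuousOn f (Icc 0 D)
  eq : ∀ x ∈ Ioo 0 D, f x = u₂ x + h x * u₁ x

/-- The graph of `L`, extended by continuity to the endpoints, in `C([0, D])`. -/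
def LRel {D : ℝ} (hD : 0 < D) (h : ℝ → ℝ) (u f : C(Icc 0 D, ℝ)) : Prop :=
  ∃ u₁ u₂, LSol D h (ext hD u) u₁ u₂ (ext hD f)

variable {D : ℝ} {m₀ m₁ : ℕ} {K κ h : ℝ → ℝ} {f g u u₁ u₂ v v₁ v₂ : ℝ → ℝ} {t : ℝ}

lemma LSol.cont₁ (hu : LSol D h u u₁ u₂ f) : ContinuousOn u₁ (Icc 0 D) :=
  fun x hx ↦ (hu.deriv₂ x hx).continuousWithinAt

lemma LSol.cont₀ (hu : LSol D h u u₁ u₂ f) : ContinuousOn u (Icc 0 D) :=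
  fun x hx ↦ (hu.deriv₁ x hx).continuousWithinAt

lemma LSol.congr (hu : LSol D h u u₁ u₂ f) (hv : EqOn v u (Icc 0 D)) (hg : EqOn g f (Icc 0 D)) :
    LSol D h v u₁ u₂ g where
  deriv₁ x hx := (hu.deriv₁ x hx).congr hv (hv hx)
  deriv₂ := hu.deriv₂
  cont₂ := hu.cont₂
  left := hu.left
  right := hu.right
  cont := hu.cont.congr hg
  eq x hx := by rw [hg (Ioo_subset_Icc_self hx), hu.eq x hx]

lemma LSol.add (hu : LSol D h u u₁ u₂ f) (hv : LSol D h v v₁ v₂ g) (a b : ℝ) :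
    LSol D h (fun x ↦ a * u x + b * v x) (fun x ↦ a * u₁ x + b * v₁ x)
      (fun x ↦ a * u₂ x + b * v₂ x) (fun x ↦ a * f x + b * g x) where
  deriv₁ x hx := ((hu.deriv₁ x hx).const_mul a).add ((hv.deriv₁ x hx).const_mul b)
  deriv₂ x hx := ((hu.deriv₂ x hx).const_mul a).add ((hv.deriv₂ x hx).const_mul b)
  cont₂ := (continuousOn_const.mul hu.cont₂).add (continuousOn_const.mul hv.cont₂)
  left := by simp [hu.left, hv.left]
  right := by simp [hu.right, hv.right]
  cont := (continuousOn_const.mul hu.cont).add (continuousOn_const.mul hv.cont)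
  eq x hx := by rw [hu.eq x hx, hv.eq x hx]; ring

lemma LSol.const (a : ℝ) : LSol D h (fun _ ↦ a) (fun _ ↦ 0) (fun _ ↦ 0) (fun _ ↦ 0) where
  deriv₁ x _ := hasDerivWithinAt_const _ _ _
  deriv₂ x _ := hasDerivWithinAt_const _ _ _
  cont₂ := continuousOn_const
  left := rfl
  right := rfl
  cont := continuousOn_const
  eq x _ := by simp

lemma hasDerivAt_of_Icc {a b x : ℝ} {w w' : ℝ → ℝ}
    (hw : ∀ x ∈ Icc a b, HasDerivWithinAt w (w' x) (Icc a b) x) (hx : x ∈ Ioo a b) :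
    HasDerivAt w (w' x) x :=
  (hw x (Ioo_subset_Icc_self hx)).hasDerivAt (Icc_mem_nhds hx.1 hx.2)

/-- Green's formula. -/
lemma Profile.integral_mul_eq (hp : Profile D m₀ m₁ K κ h) (hu : LSol D h u u₁ u₂ f)
    (hv : ∀ x ∈ Icc 0 D, HasDerivWithinAt v (v₁ x) (Icc 0 D) x) (hv₁ : ContinuousOn v₁ (Icc 0 D)) :
    ∫ s in (0 : ℝ)..D, weight D m₀ m₁ K s * (f s * v s) =
      -∫ s in (0 : ℝ)..D, weight D m₀ m₁ K s * (u₁ s * v₁ s) := by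
  have hD := hp.D_pos
  have hvc : ContinuousOn v (Icc 0 D) := fun x hx ↦ (hv x hx).continuousWithinAt
  have hz : (0 : ℝ) ∈ Icc 0 D := ⟨le_rfl, hD.le⟩
  have hz' : D ∈ Icc 0 D := ⟨hD.le, le_rfl⟩
  have hi1 := hp.integrable_weight_mul (hu.cont.mul hvc) hz hz'
  have hi2 := hp.integrable_weight_mul (hu.cont₁.mul hv₁) hz hz'
  have h1 := integral_eq_sub_of_hasDerivAt_of_le hD.le
    (f := fun s ↦ weight D m₀ m₁ K s * (u₁ s * v s))
    (hp.continuousOn_weight_mul (hu.cont₁.mul hvc)) (fun s hs ↦ ?_) (hi1.add hi2)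
  · rw [integral_add hi1 hi2] at h1
    simp only [hu.left, hu.right, zero_mul, mul_zero, sub_zero] at h1
    exact eq_neg_of_add_eq_zero_left h1
  · have h2 := (hp.hasDerivAt_weight hs).mul
      ((hasDerivAt_of_Icc hu.deriv₂ hs).mul (hasDerivAt_of_Icc hv hs))
    refine h2.congr_deriv ?_
    simp only [Pi.mul_apply]
    rw [hu.eq s hs]
    ring

lemma Profile.integral_eq_zero (hp : Profile D m₀ m₁ K κ h) (hu : LSol D h u u₁ u₂ f) :
    ∫ s in (0 : ℝ)..D, weight D m₀ m₁ K s * f s = 0 := by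
  simpa using hp.integral_mul_eq hu (v := fun _ ↦ 1) (v₁ := fun _ ↦ 0)
    (fun x _ ↦ hasDerivWithinAt_const _ _ _) continuousOn_const

lemma Profile.integral_symm (hp : Profile D m₀ m₁ K κ h) (hu : LSol D h u u₁ u₂ f)
    (hv : LSol D h v v₁ v₂ g) :
    ∫ s in (0 : ℝ)..D, weight D m₀ m₁ K s * (f s * v s) =
      ∫ s in (0 : ℝ)..D, weight D m₀ m₁ K s * (u s * g s) := by
  rw [hp.integral_mul_eq hu hv.deriv₁ hv.cont₁]
  have := hp.integral_mul_eq hv hu.deriv₁ hu.cont₁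
  simp only [mul_comm (u _), mul_comm (u₁ _)]
  exact this.symm

lemma Profile.integral_sq_eq_zero (hp : Profile D m₀ m₁ K κ h) (hu : ContinuousOn u (Icc 0 D))
    (h0 : ∫ s in (0 : ℝ)..D, weight D m₀ m₁ K s * (u s * u s) ≤ 0) : ∀ t ∈ Icc 0 D, u t = 0 := by
  have hD := hp.D_pos
  have hIoo : ∀ t ∈ Ioo 0 D, u t = 0 := by
    intro t ht
    by_contra hne
    have hpos := integral_pos hD
      (f := fun s ↦ weight D m₀ m₁ K s * (u s * u s)) (hp.continuousOn_weight_mul (hu.mul hu))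
      (fun s hs ↦ mul_nonneg (weight_nonneg ⟨hs.1.le, hs.2⟩) (mul_self_nonneg _))
      ⟨t, Ioo_subset_Icc_self ht, mul_pos (weight_pos ht) (mul_self_pos.2 hne)⟩
    exact absurd h0 (not_le.2 hpos)
  have h0' : EqOn u (fun _ ↦ 0) (Ioo 0 D) := fun t ht ↦ hIoo t ht
  exact h0'.of_subset_closure hu continuousOn_const Ioo_subset_Icc_self (by rw [closure_Ioo hD.ne])

lemma Profile.weight_integral_pos (hp : Profile D m₀ m₁ K κ h) :
    0 < ∫ s in (0 : ℝ)..D, weight D m₀ m₁ K s := by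
  have hD := hp.D_pos
  exact integral_pos hD hp.continuousOn_weight
    (fun s hs ↦ weight_nonneg ⟨hs.1.le, hs.2⟩)
    ⟨D / 2, ⟨by positivity, by linarith⟩, weight_pos ⟨by positivity, by linarith⟩⟩

/-- The derivative of a solution is given by the solution formula. -/
lemma Profile.deriv_eq_fullDer (hp : Profile D m₀ m₁ K κ h) (hu : LSol D h u u₁ u₂ f) :
    EqOn u₁ (fullDer D m₀ m₁ K f) (Icc 0 D) := by
  intro t ht
  have hD := hp.D_pos
  rcases ht.2.eq_or_lt with rfl | ht'
  · rw [hu.right, fullDer_end hD]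
  have hmean := hp.integral_eq_zero hu
  obtain ⟨c, hc1, hc2⟩ := exists_between ht'
  have hsub : Icc 0 c ⊆ Icc 0 D := Icc_subset_Icc_right hc2.le
  have hw := hp.halfWeight (ht.1.trans_lt hc1) hc2
  rw [hp.fullDer_eq_left hu.cont hmean ⟨ht.1, ht'⟩]
  refine hw.eqOn_halfDer (hu.cont.mono hsub) (hu.cont₁.mono hsub) hu.left (fun s hs ↦ ?_)
    ⟨ht.1, hc1.le⟩
  have hs' : s ∈ Ioo 0 D := ⟨hs.1, hs.2.trans hc2⟩
  refine (hasDerivAt_of_Icc hu.deriv₂ hs').congr_deriv ?_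
  rw [hu.eq s hs', hp.h_eq_left hs']
  ring

lemma Profile.lsol_fullDer (hp : Profile D m₀ m₁ K κ h) (hf : ContinuousOn f (Icc 0 D))
    (hmean : ∫ s in (0 : ℝ)..D, weight D m₀ m₁ K s * f s = 0) (a : ℝ) :
    LSol D h (fun t ↦ a + ∫ s in (0 : ℝ)..t, fullDer D m₀ m₁ K f s) (fullDer D m₀ m₁ K f)
      (derivWithin (fullDer D m₀ m₁ K f) (Icc 0 D)) f := by
  have hD := hp.D_pos
  have hC := hp.contDiffOn_fullDer hf hmean
  refine ⟨fun x hx ↦ (hasDerivWithinAt_integral hD.le hC.continuousOn hx).const_add a,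
    fun x hx ↦ (hC.differentiableOn one_ne_zero x hx).hasDerivWithinAt,
    hC.continuousOn_derivWithin (uniqueDiffOn_Icc hD) le_rfl, fullDer_zero hD, fullDer_end hD, hf,
    fun x hx ↦ ?_⟩
  have h1 := hp.hasDerivAt_fullDer hf hmean hx
  rw [h1.hasDerivWithinAt.derivWithin (uniqueDiffOn_Icc hD x (Ioo_subset_Icc_self hx))]
  ring

/-- The operators attached to `L` on `C([0, D])`: the weighted mean `P`, the compact inverse `S` of
`L - P`, and `E = d/dx ∘ S`. -/
structure ResolventData (hp : Profile D m₀ m₁ K κ h) (P : C(Icc 0 D, ℝ) →L[ℝ] ℝ)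
    (E S : C(Icc 0 D, ℝ) →L[ℝ] C(Icc 0 D, ℝ)) : Prop where
  mean : ∀ f, P f * ∫ s in (0 : ℝ)..D, weight D m₀ m₁ K s =
    ∫ s in (0 : ℝ)..D, weight D m₀ m₁ K s * ext hp.D_pos f s
  mean_one : P 1 = 1
  compact : IsCompactOperator S
  deriv : ∀ f, ∀ t ∈ Icc 0 D,
    HasDerivWithinAt (ext hp.D_pos (S f)) (ext hp.D_pos (E f) t) (Icc 0 D) t
  rel : ∀ f, LRel hp.D_pos h (S f) (f - P f • 1)
  mean_S : ∀ f, P (S f) = -P f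
  eq_S : ∀ u g, LRel hp.D_pos h u g → u = S (g - P u • 1)
  regularity : ∀ (θ : ℝ), 0 < θ → θ ≤ 1 → ∀ k : ℕ, ∃ C, 0 ≤ C ∧ ∀ R f,
    CBound θ (Icc 0 D) k R (ext hp.D_pos f) →
      CBound θ (Icc 0 D) (k + 2) (C * R) (ext hp.D_pos (S f))

lemma Profile.fullDer_add (hp : Profile D m₀ m₁ K κ h) (hf : Continuous f) (hg : Continuous g)
    (ht : t ∈ Icc 0 D) : fullDer D m₀ m₁ K (fun x ↦ f x + g x) t =
      fullDer D m₀ m₁ K f t + fullDer D m₀ m₁ K g t := by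
  have hD := hp.D_pos
  unfold fullDer
  split_ifs with h1
  · have hw := hp.halfWeight (c := 2 * D / 3) (by positivity) (by linarith)
    rw [halfDer, halfDer, halfDer, hw.halfPsi_add hf hg ⟨ht.1, by linarith⟩]
    ring
  · have hw := hp.reflect.halfWeight (c := 2 * D / 3) (by positivity) (by linarith)
    rw [halfDer, halfDer, halfDer, hw.halfPsi_add (f := fun s ↦ f (D - s))
      (g := fun s ↦ g (D - s)) (by fun_prop) (by fun_prop) ⟨by linarith [ht.2], by linarith⟩]
    ring

lemma fullDer_const_mul (a : ℝ) : fullDer D m₀ m₁ K (fun x ↦ a * f x) t =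
    a * fullDer D m₀ m₁ K f t := by
  unfold fullDer
  split_ifs
  · rw [halfDer, halfDer, halfPsi_const_mul]; ring
  · rw [halfDer, halfDer, halfPsi_const_mul (f := fun s ↦ f (D - s))]; ring

/-- For `f` of mean zero, `u'` is given by the flux formula and `u` by integration; the constant of
integration in `S f` is chosen such that `P (S f) = -P f`. -/
theorem Profile.exists_resolvent (hp : Profile D m₀ m₁ K κ h) :
    ∃ P E S, ResolventData hp P E S := by
  have hD := hp.D_pos
  have hz : (0 : ℝ) ∈ Icc 0 D := ⟨le_rfl, hD.le⟩
  have hz' : D ∈ Icc 0 D := ⟨hD.le, le_rfl⟩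
  set W : ℝ := ∫ s in (0 : ℝ)..D, weight D m₀ m₁ K s with hW
  have hWpos : 0 < W := hp.weight_integral_pos
  have hint : ∀ f : C(Icc 0 D, ℝ), IntervalIntegrable
      (fun s ↦ weight D m₀ m₁ K s * ext hD f s) volume 0 D :=
    fun f ↦ hp.integrable_weight_mul (continuousOn_ext f) hz hz'
  -- the weighted mean
  let P₀ : C(Icc 0 D, ℝ) →ₗ[ℝ] ℝ :=
    { toFun := fun f ↦ (∫ s in (0 : ℝ)..D, weight D m₀ m₁ K s * ext hD f s) / W
      map_add' := fun f g ↦ by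
        rw [← add_div, ← integral_add (hint f) (hint g)]
        simp only [ext_add, mul_add]
      map_smul' := fun a f ↦ by
        simp only [ext_smul, RingHom.id_apply, smul_eq_mul, ← mul_div_assoc]
        rw [← intervalIntegral.integral_const_mul]
        congr 2
        ext s
        ring }
  have hP₀ : ∀ f, ‖P₀ f‖ ≤ 1 * ‖f‖ := fun f ↦ by
    have h1 : ‖∫ s in (0 : ℝ)..D, weight D m₀ m₁ K s * ext hD f s‖ ≤
        ∫ s in (0 : ℝ)..D, weight D m₀ m₁ K s * ‖f‖ := by
      refine norm_integral_le_of_norm_le hD.le (Eventually.of_forall fun s hs ↦ ?_)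
        (hp.integrable_weight_mul continuousOn_const hz hz')
      have h2 := weight_nonneg (m₀ := m₀) (m₁ := m₁) (K := K) (t := s) ⟨hs.1.le, hs.2⟩
      rw [norm_mul, Real.norm_of_nonneg h2]
      exact mul_le_mul_of_nonneg_left (abs_ext_le f s) h2
    rw [intervalIntegral.integral_mul_const, ← hW] at h1
    have h3 : P₀ f = (∫ s in (0 : ℝ)..D, weight D m₀ m₁ K s * ext hD f s) / W := rfl
    rw [h3, norm_div, Real.norm_of_nonneg hWpos.le, div_le_iff₀ hWpos]
    linarith
  set P : C(Icc 0 D, ℝ) →L[ℝ] ℝ := P₀.mkContinuous 1 hP₀ with hP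
  have hPdef : ∀ f, P f * W = ∫ s in (0 : ℝ)..D, weight D m₀ m₁ K s * ext hD f s := fun f ↦
    div_mul_cancel₀ _ hWpos.ne'
  have hP1 : P 1 = 1 := by
    refine mul_right_cancel₀ hWpos.ne' ?_
    rw [hPdef, one_mul, hW]
    exact integral_congr fun s _ ↦ by
      have : ext hD (1 : C(Icc 0 D, ℝ)) s = 1 := rfl
      simp only [this, mul_one]
  -- the projection onto functions of mean zero
  set Q : C(Icc 0 D, ℝ) →L[ℝ] C(Icc 0 D, ℝ) := 1 - P.smulRight 1 with hQ
  have hQf : ∀ f, Q f = f - P f • 1 := fun f ↦ rfl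
  have hQmean : ∀ f, ∫ s in (0 : ℝ)..D, weight D m₀ m₁ K s * ext hD (Q f) s = 0 := fun f ↦ by
    rw [← hPdef, hQf, map_sub, map_smul, hP1, smul_eq_mul, mul_one, sub_self, zero_mul]
  obtain ⟨C, hC0, hC⟩ := hp.exists_abs_fullDer_le
  -- `u'`, as an operator on functions of mean zero
  let E₀ : C(Icc 0 D, ℝ) →ₗ[ℝ] C(Icc 0 D, ℝ) :=
    { toFun := fun f ↦ toX (fullDer D m₀ m₁ K (ext hD (Q f)))
        (hp.contDiffOn_fullDer (continuousOn_ext _) (hQmean f)).continuousOn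
      map_add' := fun f g ↦ ContinuousMap.ext fun t ↦ by
        have h1 := hp.fullDer_add (continuous_ext (hD := hD) (Q f))
          (continuous_ext (hD := hD) (Q g))
          t.2
        rw [← ext_add, ← map_add] at h1
        exact h1
      map_smul' := fun a f ↦ ContinuousMap.ext fun t ↦ by
        have h1 := fullDer_const_mul (D := D) (m₀ := m₀) (m₁ := m₁) (K := K) (f := ext hD (Q f))
          (t := t) a
        rw [← ext_smul, ← map_smul] at h1
        exact h1 }
  set E : C(Icc 0 D, ℝ) →L[ℝ] C(Icc 0 D, ℝ) := E₀.mkContinuous (C * ‖Q‖) fun f ↦ by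
    refine (ContinuousMap.norm_le _ (by positivity)).2 fun t ↦ ?_
    rw [mul_assoc]
    exact (hC _ _ (fun s _ ↦ abs_ext_le (Q f) s) t t.2).trans
      (mul_le_mul_of_nonneg_left (Q.le_opNorm f) hC0.le) with hE
  have hEf : ∀ f, EqOn (ext hD (E f)) (fullDer D m₀ m₁ K (ext hD (Q f))) (Icc 0 D) := fun f t ht ↦
    ext_apply _ ht
  obtain ⟨I, hI⟩ := exists_integral_clm hD
  set S : C(Icc 0 D, ℝ) →L[ℝ] C(Icc 0 D, ℝ) := Q ∘L I ∘L E - P.smulRight 1 with hS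
  have hSf : ∀ f, EqOn (ext hD (S f)) (fun t ↦ (-P (I (E f)) - P f) +
      ∫ s in (0 : ℝ)..t, fullDer D m₀ m₁ K (ext hD (Q f)) s) (Icc 0 D) := fun f t ht ↦ by
    have h1 : ext hD (S f) t = ext hD (I (E f)) t - P (I (E f)) * 1 - P f * 1 := rfl
    have h2 : ∫ s in (0 : ℝ)..t, ext hD (E f) s =
        ∫ s in (0 : ℝ)..t, fullDer D m₀ m₁ K (ext hD (Q f)) s := by
      refine integral_congr fun s hs ↦ ?_
      rw [uIcc_of_le ht.1] at hs
      exact hEf f ⟨hs.1, hs.2.trans ht.2⟩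
    rw [h1, hI _ t ht, h2]
    ring
  have hrel : ∀ f, LSol D h (ext hD (S f)) (fullDer D m₀ m₁ K (ext hD (Q f)))
      (derivWithin (fullDer D m₀ m₁ K (ext hD (Q f))) (Icc 0 D)) (ext hD (Q f)) := fun f ↦
    (hp.lsol_fullDer (continuousOn_ext (Q f)) (hQmean f) _).congr (hSf f) fun _ _ ↦ rfl
  have hderiv : ∀ f, ∀ t ∈ Icc 0 D,
      HasDerivWithinAt (ext hD (S f)) (ext hD (E f) t) (Icc 0 D) t := fun f t ht ↦ by
    rw [hEf f ht]
    exact (hrel f).deriv₁ t ht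
  refine ⟨P, E, S, ⟨hPdef, hP1, ?_, hderiv, fun f ↦ ⟨_, _, hrel f⟩, fun f ↦ ?_, fun u g hu ↦ ?_,
    fun θ hθ0 hθ k ↦ ?_⟩⟩
  · refine isCompactOperator_of_lipschitz _ ‖E‖ fun f x y ↦ ?_
    have h1 := abs_sub_le_of_hasDerivWithinAt (f := ext hD (S f)) (f' := ext hD (E f))
      (R := ‖E‖ * ‖f‖) (fun x _ ↦ (abs_ext_le _ x).trans (E.le_opNorm f)) (hderiv f) x.2 y.2
    simpa [Subtype.dist_eq, Real.dist_eq] using h1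
  · have h1 : S f = I (E f) - P (I (E f)) • 1 - P f • 1 := rfl
    rw [h1, map_sub, map_sub, map_smul, map_smul, hP1]
    simp
  · obtain ⟨u₁, u₂, hu⟩ := hu
    have hg : P g = 0 := by
      have := hPdef g
      rw [hp.integral_eq_zero hu] at this
      exact (mul_eq_zero.1 this).resolve_right hWpos.ne'
    have hQg : Q (g - P u • 1) = g := by
      rw [hQf, map_sub, map_smul, hP1, hg]
      simp
    have hu1 := hp.deriv_eq_fullDer hu
    have hIE : ∀ t ∈ Icc 0 D, ext hD (I (E (g - P u • 1))) t = ext hD u t - ext hD u 0 := by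
      intro t ht
      rw [hI _ t ht]
      refine integral_eq_sub_of_hasDerivAt_of_le ht.1
        (continuous_ext u).continuousOn (fun s hs ↦ ?_) ((continuous_ext _).intervalIntegrable _ _)
      have hs' : s ∈ Ioo 0 D := ⟨hs.1, hs.2.trans_le ht.2⟩
      have hs'' := Ioo_subset_Icc_self hs'
      rw [hEf _ hs'', hQg, ← hu1 hs'']
      exact hasDerivAt_of_Icc hu.deriv₁ hs'
    have hIE' : I (E (g - P u • 1)) = u - ext hD u 0 • 1 := by
      refine ext_injOn (hD := hD) fun t ht ↦ ?_
      rw [hIE t ht]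
      have : ext hD (u - ext hD u 0 • 1) t = ext hD u t - ext hD u 0 * 1 := rfl
      rw [this, mul_one]
    have h1 : S (g - P u • 1) = I (E (g - P u • 1)) - P (I (E (g - P u • 1))) • 1 -
      P (g - P u • 1) • 1 := rfl
    rw [h1, hIE', map_sub, map_sub, map_smul, map_smul, hP1, hg]
    ext t
    simp
  · obtain ⟨A, hA0, hA⟩ := hp.exists_CBound_fullDer hθ0 hθ k
    refine ⟨max ‖S‖ (A * 2), by positivity, fun R f hf ↦ ?_⟩
    have hne : (Icc 0 D).Nonempty := nonempty_Icc.2 hD.le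
    have hR := hf.nonneg hne
    have hnf : ‖f‖ ≤ R := norm_le_of_ext hR hf.bound
    refine ⟨fun x _ ↦ ?_, _, (hrel f).deriv₁, ?_⟩
    · refine (abs_ext_le _ x).trans ((S.le_opNorm f).trans ?_)
      exact mul_le_mul (le_max_left _ _) hnf (norm_nonneg _) (by positivity)
    · have h1 : CBound θ (Icc 0 D) k (R + |P f|) (ext hD (Q f)) := by
        have : CBound θ (Icc 0 D) k (R + |P f|) (fun t ↦ ext hD f t - P f) :=
          hf.sub (CBound.const _)
        refine this.congr fun t _ ↦ ?_
        have h2 : ext hD (Q f) t = ext hD f t - P f * 1 := rfl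
        rw [h2, mul_one]
      have h2 : |P f| ≤ R := (hP₀ f).trans (by linarith)
      refine (hA _ _ h1 (hQmean f)).mono ?_
      calc A * (R + |P f|) ≤ A * (R + R) := by gcongr
        _ = A * 2 * R := by ring
        _ ≤ _ := by gcongr; exact le_max_right _ _

end Resolvent


/-! ### Eigenvalues and critical points of eigenfunctions -/

section Spectrum

open MeasureTheory Real intervalIntegral

variable {D : ℝ} {m₀ m₁ : ℕ} {K κ h : ℝ → ℝ} {f g v v₁ v₂ w w₁ w₂ : ℝ → ℝ} {t μ : ℝ}

/-- If a continuous function passes every multiple of `π` with positive derivative, then on its way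
from `0` to `i π` it meets the multiples of `π` exactly `i + 1` times. -/
lemma encard_sin_eq_zero {ψ : ℝ → ℝ} {i : ℕ} (hD : 0 < D) (hψ : ContinuousOn ψ (Icc 0 D))
    (h0 : ψ 0 = 0) (hi : ψ D = i * π)
    (hd : ∀ t ∈ Icc 0 D, sin (ψ t) = 0 → ∃ d, 0 < d ∧ HasDerivWithinAt ψ d (Icc 0 D) t) :
    {t ∈ Icc 0 D | sin (ψ t) = 0}.encard = i + 1 := by
  -- once `ψ` has reached `n π` it stays above
  have hup : ∀ n : ℤ, ∀ a ∈ Icc 0 D, ψ a = n * π → ∀ t ∈ Icc 0 D, a < t → n * π < ψ t := by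
    intro n a ha hψa t ht hat
    have hsub : Icc a D ⊆ Icc 0 D := Icc_subset_Icc_left ha.1
    have haD : a < D := hat.trans_le ht.2
    obtain ⟨d, hd0, hda⟩ := hd a ha (by rw [hψa, sin_int_mul_pi])
    have h1 := pos_of_upcrossing (g := fun s ↦ ψ s - n * π) (a := a) (b := D)
      ((hψ.mono hsub).sub continuousOn_const)
      (eventually_pos_of_hasDerivWithinAt haD ((hda.mono hsub).sub_const _) hd0 (by simp [hψa]))
      (fun s hs hs0 ↦ by
        obtain ⟨d, hd0, hds⟩ := hd s (hsub ⟨hs.1.le, hs.2⟩)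
          (by rw [sub_eq_zero.1 hs0, sin_int_mul_pi])
        exact ⟨d, hd0, (hds.mono hsub).sub_const _⟩) t ⟨hat, ht.2⟩
    linarith
  have hz : (0 : ℝ) ∈ Icc 0 D := ⟨le_rfl, hD.le⟩
  have hz' : D ∈ Icc 0 D := ⟨hD.le, le_rfl⟩
  have hex : ∀ j : ℕ, j ≤ i → ∃ t ∈ Icc 0 D, ψ t = j * π := fun j hj ↦ by
    have := intermediate_value_Icc hD.le hψ
    rw [h0, hi] at this
    exact this ⟨by positivity, by gcongr⟩
  choose! z hz1 hz2 using hex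
  have hset : {t ∈ Icc 0 D | sin (ψ t) = 0} = z '' ↑(Finset.range (i + 1)) := by
    ext t
    simp only [mem_ofPred_eq, mem_image, Finset.coe_range, mem_Iio]
    constructor
    · rintro ⟨ht, hs⟩
      obtain ⟨n, hn⟩ := sin_eq_zero_iff.1 hs
      have hn0 : 0 ≤ n := by
        rcases ht.1.eq_or_lt with rfl | ht0
        · rw [h0] at hn
          have : (n : ℝ) = 0 := (mul_eq_zero.1 hn).resolve_right pi_ne_zero
          exact_mod_cast this.ge
        · have h1 := hup 0 0 hz (by simpa using h0) t ht ht0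
          rw [← hn] at h1
          have h2 : (0 : ℝ) < n := by
            have := lt_of_mul_lt_mul_right h1 pi_pos.le
            exact_mod_cast this
          exact_mod_cast h2.le
      have hni : n ≤ i := by
        by_contra! hlt
        have hlt' : (i : ℝ) < n := by exact_mod_cast hlt
        have htD : t < D := lt_of_le_of_ne ht.2 fun h ↦ by
          rw [h, hi] at hn
          exact hlt'.ne (mul_right_cancel₀ pi_ne_zero hn).symm
        have h1 := hup n t ht hn.symm D hz' htD
        rw [hi] at h1
        exact absurd (lt_of_mul_lt_mul_right h1 pi_pos.le) (not_lt.2 hlt'.le)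
      lift n to ℕ using hn0
      have hni' : n ≤ i := by exact_mod_cast hni
      refine ⟨n, by omega, ?_⟩
      have h3 := hz2 n hni'
      have h4 : ψ t = n * π := by rw [← hn]; simp
      by_contra hne
      rcases lt_or_gt_of_ne hne with hlt | hlt
      · have := hup n _ (hz1 n hni') (by simpa using h3) t ht hlt
        simp only [Int.cast_natCast] at this
        linarith
      · have := hup n t ht (by simpa using h4) _ (hz1 n hni') hlt
        simp only [Int.cast_natCast] at this
        linarith
    · rintro ⟨j, hj, rfl⟩
      exact ⟨hz1 j (by omega), by rw [hz2 j (by omega), sin_nat_mul_pi]⟩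
  rw [hset, InjOn.encard_image, Set.encard_coe_eq_coe_finsetCard, Finset.card_range]
  · simp
  · intro j hj k hk hjk
    simp only [Finset.coe_range, mem_Iio] at hj hk
    have h1 := hz2 j (by omega)
    have h2 := hz2 k (by omega)
    rw [hjk, h2] at h1
    exact_mod_cast (mul_right_cancel₀ pi_ne_zero h1).symm

lemma LSol.reflect (hu : LSol D h v v₁ v₂ f) :
    LSol D (fun t ↦ -h (D - t)) (fun t ↦ v (D - t)) (fun t ↦ -v₁ (D - t)) (fun t ↦ v₂ (D - t))
      (fun t ↦ f (D - t)) := by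
  have hr : ∀ x, HasDerivWithinAt (fun t ↦ D - t) (-1) (Icc 0 D) x := fun x ↦ by
    simpa using (hasDerivWithinAt_id x (Icc 0 D)).const_sub D
  refine ⟨fun x hx ↦ ?_, fun x hx ↦ ?_, ?_, ?_, ?_, ?_, fun x hx ↦ ?_⟩
  · exact ((hu.deriv₁ _ (mapsTo_reflect hx)).comp x (hr x) mapsTo_reflect).congr_deriv (by ring)
  · exact ((hu.deriv₂ _ (mapsTo_reflect hx)).comp x (hr x) mapsTo_reflect).neg.congr_deriv (by ring)
  · exact hu.cont₂.comp (by fun_prop) mapsTo_reflect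
  · simp [hu.right]
  · simp [hu.left]
  · exact hu.cont.comp (by fun_prop) mapsTo_reflect
  · rw [hu.eq (D - x) ⟨by linarith [hx.2], by linarith [hx.1]⟩]
    ring

lemma halfDer_congr {m : ℕ} {e f g : ℝ → ℝ} {c : ℝ} (hfg : EqOn f g (Icc 0 c)) :
    EqOn (halfDer m e f) (halfDer m e g) (Icc 0 c) := fun t ht ↦ by
  unfold halfDer halfPsi
  have h1 : EqOn (fun s ↦ e s * f s) (fun s ↦ e s * g s) (Icc 0 c) := fun s hs ↦ by
    simp only [hfg hs]
  rw [avg_congr m h1 ht]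

lemma halfDer_const_mul {m : ℕ} {e : ℝ → ℝ} (a t : ℝ) :
    halfDer m e (fun x ↦ a * f x) t = a * halfDer m e f t := by
  rw [halfDer, halfDer, halfPsi_const_mul]; ring

/-- On the left half of the interval an eigenfunction is a multiple of the normalized solution of
the initial value problem at `0`. -/
lemma Profile.eq_left (hp : Profile D m₀ m₁ K κ h) {ξ c : ℝ} (hc : 0 < c) (hcD : c < D)
    {u ρ ϑ : ℝ → ℝ → ℝ}
    (hP : PruferData c m₀ (regFactor D m₁ K) (fun t ↦ -(m₁ / (D - t)) + κ t) u ρ ϑ)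
    (hv : LSol D h v v₁ v₂ fun x ↦ -ξ ^ 2 * v x) (ht : t ∈ Icc 0 c) :
    v t = v 0 * (ρ ξ t * cos (ϑ ξ t)) ∧ v₁ t = -ξ * v 0 * (ρ ξ t * sin (ϑ ξ t)) := by
  have hw := hp.halfWeight hc hcD
  have hsub : Icc 0 c ⊆ Icc 0 D := Icc_subset_Icc_right hcD.le
  have h1 : EqOn v₁ (fun t ↦ -ξ ^ 2 * halfDer m₀ (regFactor D m₁ K) v t) (Icc 0 c) := by
    intro s hs
    beta_reduce
    rw [← halfDer_const_mul]
    refine hw.eqOn_halfDer (hv.cont.mono hsub) (hv.cont₁.mono hsub) hv.left (fun s hs ↦ ?_) hs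
    have hs' : s ∈ Ioo 0 D := ⟨hs.1, hs.2.trans hcD⟩
    refine (hasDerivAt_of_Icc hv.deriv₂ hs').congr_deriv ?_
    rw [hv.eq s hs', hp.h_eq_left hs']
    ring
  have h2 : ∀ t ∈ Icc 0 c, v t = v 0 * u ξ t := by
    refine hP.unique ξ v (hv.cont₀.mono hsub) fun s hs ↦ ?_
    have h3 := integral_eq_sub_of_hasDerivAt_of_le hs.1
      (hv.cont₀.mono (Icc_subset_Icc_right (hs.2.trans hcD.le)))
      (fun r hr ↦ hasDerivAt_of_Icc hv.deriv₁ ⟨hr.1, hr.2.trans_le (hs.2.trans hcD.le)⟩)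
      ((hv.cont₁.mono (by
        rw [uIcc_of_le hs.1]; exact Icc_subset_Icc_right (hs.2.trans hcD.le))).intervalIntegrable)
    rw [← intervalIntegral.integral_const_mul]
    have h4 : ∫ r in (0 : ℝ)..s, ξ ^ 2 * halfDer m₀ (regFactor D m₁ K) v r =
        -∫ r in (0 : ℝ)..s, v₁ r := by
      rw [← intervalIntegral.integral_neg]
      refine integral_congr fun r hr ↦ ?_
      rw [uIcc_of_le hs.1] at hr
      simp only [h1 ⟨hr.1, hr.2.trans hs.2⟩]
      ring
    rw [h4, h3]
    ring
  refine ⟨by rw [h2 t ht, hP.cos_eq ξ t ht], ?_⟩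
  have h5 : halfDer m₀ (regFactor D m₁ K) v t = v 0 * halfDer m₀ (regFactor D m₁ K) (u ξ) t := by
    rw [← halfDer_const_mul]
    exact halfDer_congr h2 ht
  rw [h1 ht, ← hP.sin_eq ξ t ht]
  simp only [h5]
  ring

lemma Profile.eq_right (hp : Profile D m₀ m₁ K κ h) {ξ c : ℝ} (hc : 0 < c) (hcD : c < D)
    {u ρ ϑ : ℝ → ℝ → ℝ}
    (hP : PruferData c m₁ (regFactor D m₀ fun t ↦ K (D - t))
      (fun t ↦ -(m₀ / (D - t)) + -κ (D - t)) u ρ ϑ)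
    (hv : LSol D h v v₁ v₂ fun x ↦ -ξ ^ 2 * v x) (ht : t ∈ Icc 0 c) :
    v (D - t) = v D * (ρ ξ t * cos (ϑ ξ t)) ∧ v₁ (D - t) = ξ * v D * (ρ ξ t * sin (ϑ ξ t)) := by
  have h1 := hp.reflect.eq_left hc hcD hP (ξ := ξ) hv.reflect ht
  simp only [sub_zero] at h1
  exact ⟨h1.1, by linarith [h1.2]⟩

/-- The two Prüfer angles of the initial value problems at `0` and at `D`, followed up to the
midpoint of `[0, D]`. -/
structure AngleData (hp : Profile D m₀ m₁ K κ h) (uL ρL ϑL uR ρR ϑR : ℝ → ℝ → ℝ) : Prop where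
  left : PruferData (D / 2) m₀ (regFactor D m₁ K) (fun t ↦ -(m₁ / (D - t)) + κ t) uL ρL ϑL
  right : PruferData (D / 2) m₁ (regFactor D m₀ fun t ↦ K (D - t))
      (fun t ↦ -(m₀ / (D - t)) + -κ (D - t)) uR ρR ϑR

variable {hp : Profile D m₀ m₁ K κ h} {uL ρL ϑL uR ρR ϑR : ℝ → ℝ → ℝ} {ξ : ℝ}

/-- Equality of the values and of the derivatives at the midpoint forces the amplitudes from both
ends to agree, so that an eigenfunction vanishing at one end vanishes identically. -/
lemma AngleData.vanish (hA : AngleData hp uL ρL ϑL uR ρR ϑR)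
    (hv : LSol D h v v₁ v₂ fun x ↦ -ξ ^ 2 * v x) (hξ : 0 < ξ) (h0 : v 0 = 0 ∨ v D = 0) :
    ∀ t ∈ Icc 0 D, v t = 0 := by
  have hD := hp.D_pos
  have hc : 0 < D / 2 := by positivity
  have hcD : D / 2 < D := by linarith
  have hm : D / 2 ∈ Icc 0 (D / 2) := ⟨hc.le, le_rfl⟩
  obtain ⟨e1, e2⟩ := hp.eq_left hc hcD hA.left hv hm
  obtain ⟨e3, e4⟩ := hp.eq_right hc hcD hA.right hv hm
  rw [sub_half, e1] at e3
  rw [sub_half, e2] at e4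
  have hL := hA.left.rho_pos ξ _ hm
  have hR := hA.right.rho_pos ξ _ hm
  have e4' : -(v 0 * (ρL ξ (D / 2) * sin (ϑL ξ (D / 2)))) =
      v D * (ρR ξ (D / 2) * sin (ϑR ξ (D / 2))) := mul_left_cancel₀ hξ.ne' (by linarith)
  have hsq : (v 0 * ρL ξ (D / 2)) ^ 2 = (v D * ρR ξ (D / 2)) ^ 2 := by
    have h1 := sin_sq_add_cos_sq (ϑL ξ (D / 2))
    have h2 := sin_sq_add_cos_sq (ϑR ξ (D / 2))
    calc _ = (v 0 * (ρL ξ (D / 2) * cos (ϑL ξ (D / 2)))) ^ 2 +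
        (-(v 0 * (ρL ξ (D / 2) * sin (ϑL ξ (D / 2))))) ^ 2 := by
          linear_combination -(v 0 * ρL ξ (D / 2)) ^ 2 * h1
      _ = _ := by rw [e3, e4']; linear_combination (v D * ρR ξ (D / 2)) ^ 2 * h2
  have hboth : v 0 = 0 ∧ v D = 0 := by
    rcases h0 with h0 | h0 <;> rw [h0] at hsq <;> refine ⟨?_, ?_⟩ <;> first | exact h0 | skip
    · have : v D * ρR ξ (D / 2) = 0 := by nlinarith
      exact (mul_eq_zero.1 this).resolve_right hR.ne'
    · have : v 0 * ρL ξ (D / 2) = 0 := by nlinarith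
      exact (mul_eq_zero.1 this).resolve_right hL.ne'
  intro t ht
  rcases le_total t (D / 2) with htc | htc
  · rw [(hp.eq_left hc hcD hA.left hv ⟨ht.1, htc⟩).1, hboth.1, zero_mul]
  · have := (hp.eq_right hc hcD hA.right hv (t := D - t) ⟨by linarith [ht.2], by linarith⟩).1
    rw [sub_sub_cancel] at this
    rw [this, hboth.2, zero_mul]

/-- The matching condition at the midpoint. -/
lemma AngleData.sin_eq_zero (hA : AngleData hp uL ρL ϑL uR ρR ϑR)
    (hv : LSol D h v v₁ v₂ fun x ↦ -ξ ^ 2 * v x) (hξ : 0 < ξ) (h0 : v 0 ≠ 0) :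
    sin (ϑL ξ (D / 2) + ϑR ξ (D / 2)) = 0 := by
  have hD := hp.D_pos
  have hc : 0 < D / 2 := by positivity
  have hcD : D / 2 < D := by linarith
  have hm : D / 2 ∈ Icc 0 (D / 2) := ⟨hc.le, le_rfl⟩
  obtain ⟨e1, e2⟩ := hp.eq_left hc hcD hA.left hv hm
  obtain ⟨e3, e4⟩ := hp.eq_right hc hcD hA.right hv hm
  rw [sub_half, e1] at e3
  rw [sub_half, e2] at e4
  have hL := hA.left.rho_pos ξ _ hm
  have e4' : -(v 0 * (ρL ξ (D / 2) * sin (ϑL ξ (D / 2)))) =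
      v D * (ρR ξ (D / 2) * sin (ϑR ξ (D / 2))) := mul_left_cancel₀ hξ.ne' (by linarith)
  have h1 : v 0 * ρL ξ (D / 2) * sin (ϑL ξ (D / 2) + ϑR ξ (D / 2)) = 0 := by
    rw [sin_add]
    linear_combination sin (ϑR ξ (D / 2)) * e3 - cos (ϑR ξ (D / 2)) * e4'
  exact (mul_eq_zero.1 h1).resolve_left (mul_ne_zero h0 hL.ne')

/-- Two solutions of the initial value problems that match at the midpoint give an
eigenfunction. -/
lemma AngleData.exists_eigenfunction (hA : AngleData hp uL ρL ϑL uR ρR ϑR) (hξ : 0 < ξ) {i : ℕ}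
    (hi : ϑL ξ (D / 2) + ϑR ξ (D / 2) = i * π) :
    ∃ v v₁ v₂, LSol D h v v₁ v₂ (fun x ↦ -ξ ^ 2 * v x) ∧ v 0 ≠ 0 := by
  have hD := hp.D_pos
  set c := D / 2 with hcdef
  have hc : 0 < c := by positivity
  have hcD : c < D := by linarith
  have hDc : D - c = c := by rw [hcdef]; ring
  have hm : c ∈ Icc 0 c := ⟨hc.le, le_rfl⟩
  have hL := hA.left.rho_pos ξ _ hm
  have hR := hA.right.rho_pos ξ _ hm
  have hϑ : ϑL ξ c = i * π - ϑR ξ c := by linarith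
  -- the multiples are chosen such that the two pieces and their derivatives match at `c`
  set A := ρR ξ c with hAdef
  set B := (-1) ^ i * ρL ξ c with hBdef
  have hval : A * uL ξ c = B * uR ξ c := by
    rw [hA.left.cos_eq ξ c hm, hA.right.cos_eq ξ c hm, hϑ, cos_nat_mul_pi_sub]
    ring
  have hder : A * halfDer m₀ (regFactor D m₁ K) (uL ξ) c +
      B * halfDer m₁ (regFactor D m₀ fun t ↦ K (D - t)) (uR ξ) c = 0 := by
    refine (mul_eq_zero.1 ?_).resolve_left hξ.ne'
    have h1 := hA.left.sin_eq ξ c hm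
    have h2 := hA.right.sin_eq ξ c hm
    rw [hϑ, sin_nat_mul_pi_sub] at h1
    linear_combination A * h1 + B * h2
  set v : ℝ → ℝ := fun t ↦ if t ≤ c then A * uL ξ t else B * uR ξ (D - t) with hv
  have hvc : Continuous v := by
    refine Continuous.if_le ?_ ?_ continuous_id continuous_const ?_
    · exact continuous_const.mul (hA.left.continuous_u ξ)
    · exact continuous_const.mul ((hA.right.continuous_u ξ).comp (by fun_prop))
    · rintro t rfl
      rw [hDc]
      exact hval
  have hvL : EqOn v (fun t ↦ A * uL ξ t) (Icc 0 c) := fun t ht ↦ if_pos ht.2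
  have hvR : EqOn (fun t ↦ v (D - t)) (fun t ↦ B * uR ξ t) (Icc 0 c) := fun t ht ↦ by
    simp only [hv]
    split_ifs with h1
    · have : t = c := le_antisymm ht.2 (by linarith)
      rw [this, hDc]
      exact hval
    · rw [sub_sub_cancel]
  set f : ℝ → ℝ := fun x ↦ -ξ ^ 2 * v x with hf
  have hfc : Continuous f := continuous_const.mul hvc
  have hfL : EqOn (halfDer m₀ (regFactor D m₁ K) f)
      (fun t ↦ -ξ ^ 2 * (A * halfDer m₀ (regFactor D m₁ K) (uL ξ) t)) (Icc 0 c) := fun t ht ↦ by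
    rw [hf, halfDer_const_mul, halfDer_congr hvL ht, halfDer_const_mul]
  have hfR : EqOn (halfDer m₁ (regFactor D m₀ fun t ↦ K (D - t)) fun s ↦ f (D - s))
      (fun t ↦ -ξ ^ 2 * (B * halfDer m₁ (regFactor D m₀ fun t ↦ K (D - t)) (uR ξ) t))
      (Icc 0 c) := fun t ht ↦ by
    rw [hf]
    beta_reduce
    rw [halfDer_const_mul (f := fun s ↦ v (D - s)), halfDer_congr hvR ht, halfDer_const_mul]
  have hmean : ∫ s in (0 : ℝ)..D, weight D m₀ m₁ K s * f s = 0 := by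
    have h1 := hp.weight_mul_halfDer (f := f) ⟨hc.le, hcD⟩
    have h2 := hp.reflect.weight_mul_halfDer (f := fun s ↦ f (D - s)) ⟨hc.le, hcD⟩
    simp only [weight_reflect] at h2
    rw [integral_comp_sub_left (fun s ↦ weight D m₀ m₁ K s * f s), hDc,
      sub_zero] at h2
    rw [← integral_add_adjacent_intervals
      (hp.integrable_weight_mul hfc.continuousOn ⟨le_rfl, hD.le⟩ ⟨hc.le, hcD.le⟩)
      (hp.integrable_weight_mul hfc.continuousOn ⟨hc.le, hcD.le⟩ ⟨hD.le, le_rfl⟩), ← h1, ← h2,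
      hfL hm, hfR hm]
    linear_combination (-ξ ^ 2 * weight D m₀ m₁ K c) * hder
  have hsol := hp.lsol_fullDer hfc.continuousOn hmean A
  have huc := hsol.cont₀
  set u : ℝ → ℝ := fun t ↦ A + ∫ s in (0 : ℝ)..t, fullDer D m₀ m₁ K f s with hu
  have hfd := (hp.contDiffOn_fullDer hfc.continuousOn hmean).continuousOn
  have huL : EqOn u v (Icc 0 c) := fun t ht ↦ by
    have h1 : ∫ s in (0 : ℝ)..t, fullDer D m₀ m₁ K f s =
        -ξ ^ 2 * A * ∫ s in (0 : ℝ)..t, halfDer m₀ (regFactor D m₁ K) (uL ξ) s := by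
      rw [← intervalIntegral.integral_const_mul]
      refine integral_congr fun s hs ↦ ?_
      rw [uIcc_of_le ht.1] at hs
      rw [hp.fullDer_eq_left hfc.continuousOn hmean ⟨hs.1, (hs.2.trans ht.2).trans_lt hcD⟩,
        hfL ⟨hs.1, hs.2.trans ht.2⟩]
      ring
    rw [hvL ht]
    simp only [hu]
    rw [h1, hA.left.u_eq ξ t ht]
    ring
  have huR : ∀ s ∈ Icc 0 c, u (D - s) = u D + (B * uR ξ s - B) := fun s hs ↦ by
    have h1 : ∫ r in (D - s)..D, fullDer D m₀ m₁ K f r =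
        ξ ^ 2 * B * ∫ r in (0 : ℝ)..s, halfDer m₁ (regFactor D m₀ fun t ↦ K (D - t)) (uR ξ) r := by
      rw [← intervalIntegral.integral_const_mul]
      have h3 := integral_comp_sub_left (a := 0) (b := s) (fullDer D m₀ m₁ K f) D
      rw [sub_zero] at h3
      rw [← h3]
      refine integral_congr fun r hr ↦ ?_
      rw [uIcc_of_le hs.1] at hr
      have hr2 := hr.2.trans hs.2
      rw [hp.fullDer_eq_right hfc.continuousOn hmean ⟨by linarith, by linarith [hr.1]⟩,
        sub_sub_cancel, hfR ⟨hr.1, hr2⟩]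
      ring
    have h2 : u D = u (D - s) + ∫ r in (D - s)..D, fullDer D m₀ m₁ K f r := by
      simp only [hu]
      rw [add_assoc, integral_add_adjacent_intervals]
      · refine (hfd.mono ?_).intervalIntegrable
        rw [uIcc_of_le (by linarith [hs.2])]
        exact Icc_subset_Icc_right (by linarith [hs.1])
      · refine (hfd.mono ?_).intervalIntegrable
        rw [uIcc_of_le (by linarith [hs.1])]
        exact Icc_subset_Icc_left (by linarith [hs.2])
    rw [h1] at h2
    have h4 := hA.right.u_eq ξ s hs
    linear_combination -h2 - B * h4
  have huD : u D = B := by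
    have h1 := huR c hm
    rw [hDc, huL hm, hvL hm] at h1
    linarith
  have huv : EqOn u v (Icc 0 D) := fun t ht ↦ by
    rcases le_total t c with htc | htc
    · exact huL ⟨ht.1, htc⟩
    · have hs : D - t ∈ Icc 0 c := ⟨by linarith [ht.2], by linarith⟩
      have h1 := huR _ hs
      have h2 := hvR hs
      simp only [sub_sub_cancel] at h1 h2
      rw [h1, h2, huD]
      ring
  refine ⟨u, _, _, hsol.congr (fun _ _ ↦ rfl) fun t ht ↦ by simp only [hf, huv ht], ?_⟩
  rw [huL ⟨le_rfl, hc.le⟩, hvL ⟨le_rfl, hc.le⟩]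
  simp only [hA.left.u_zero]
  exact mul_ne_zero hR.ne' one_ne_zero

/-- At `0` the term `h u'` contributes `m₀ u''(0)`. -/
lemma LSol.second_deriv_zero (hp : Profile D m₀ m₁ K κ h) (hv : LSol D h v v₁ v₂ f) :
    v₂ 0 = f 0 / (m₀ + 1) := by
  have hD := hp.D_pos
  have hc : 0 < D / 2 := by positivity
  have hcD : D / 2 < D := by linarith
  have hw := hp.halfWeight hc hcD
  have hsub : Icc 0 (D / 2) ⊆ Icc 0 D := Icc_subset_Icc_right hcD.le
  have hz : (0 : ℝ) ∈ Icc 0 (D / 2) := ⟨le_rfl, hc.le⟩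
  have h1 : EqOn v₁ (halfDer m₀ (regFactor D m₁ K) f) (Icc 0 (D / 2)) := fun s hs ↦ by
    rw [hp.deriv_eq_fullDer hv (hsub hs), hp.fullDer_eq_left hv.cont (hp.integral_eq_zero hv)
      ⟨hs.1, hs.2.trans_lt hcD⟩]
  have h2 := (hw.hasDerivWithinAt_halfDer (hv.cont.mono hsub) hz).congr h1 (h1 hz)
  have h3 := ((hv.deriv₂ 0 (hsub hz)).mono hsub)
  have h4 := (uniqueDiffOn_Icc hc 0 hz).eq_deriv _ h3 h2
  rw [h4, halfDer_zero, hw.halfPsi_zero, mul_zero, sub_zero]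
  have : (m₀ : ℝ) + 1 ≠ 0 := by positivity
  field_simp
  ring

/-- An eigenfunction with total angle `i π` has exactly `i + 1` critical points, and they are
nondegenerate. -/
lemma AngleData.criticalPoints (hA : AngleData hp uL ρL ϑL uR ρR ϑR) (hξ : 0 < ξ) {i : ℕ}
    (hi : ϑL ξ (D / 2) + ϑR ξ (D / 2) = i * π) (hv : LSol D h v v₁ v₂ fun x ↦ -ξ ^ 2 * v x)
    (h0 : v 0 ≠ 0) (h1 : v D ≠ 0) :
    {t ∈ Icc 0 D | v₁ t = 0}.encard = i + 1 ∧ ∀ t ∈ Icc 0 D, v₁ t = 0 → v₂ t ≠ 0 := by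
  have hD := hp.D_pos
  set c := D / 2 with hcdef
  have hc : 0 < c := by positivity
  have hcD : c < D := by linarith
  have hDc : D - c = c := by rw [hcdef]; ring
  have hm : c ∈ Icc 0 c := ⟨hc.le, le_rfl⟩
  -- the angle along the whole interval, obtained by joining the two angles at `c`
  set ψ : ℝ → ℝ := fun t ↦ if t ≤ c then ϑL ξ t else i * π - ϑR ξ (D - t) with hψ
  have hψc : Continuous ψ := by
    refine Continuous.if_le (hA.left.continuous_angle ξ)
      (continuous_const.sub ((hA.right.continuous_angle ξ).comp (by fun_prop))) continuous_id
      continuous_const ?_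
    rintro t rfl
    rw [hDc]
    linarith
  have hψL : EqOn ψ (ϑL ξ) (Icc 0 c) := fun t ht ↦ if_pos ht.2
  have hψR : EqOn ψ (fun t ↦ i * π - ϑR ξ (D - t)) (Icc c D) := fun t ht ↦ by
    simp only [hψ]
    split_ifs with h1
    · have : t = c := le_antisymm h1 ht.1
      rw [this, hDc]
      linarith
    · rfl
  have hmemR : ∀ {t}, t ∈ Icc c D → D - t ∈ Icc 0 c := fun {t} ht ↦
    ⟨by linarith [ht.2], by linarith [ht.1]⟩
  have hcrit : ∀ t ∈ Icc 0 D, v₁ t = 0 ↔ sin (ψ t) = 0 := fun t ht ↦ by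
    rcases le_total t c with htc | htc
    · have ht' : t ∈ Icc 0 c := ⟨ht.1, htc⟩
      rw [hψL ht', (hp.eq_left hc hcD hA.left hv ht').2]
      have := (hA.left.rho_pos ξ t ht').ne'
      simp [hξ.ne', h0, this]
    · have ht' := hmemR ⟨htc, ht.2⟩
      have h2 := (hp.eq_right hc hcD hA.right hv ht').2
      rw [sub_sub_cancel] at h2
      rw [hψR ⟨htc, ht.2⟩, h2, sin_nat_mul_pi_sub]
      have := (hA.right.rho_pos ξ _ ht').ne'
      simp [hξ.ne', h1, this]
  have hcos : ∀ t ∈ Icc 0 D, v₁ t = 0 → v t ≠ 0 := fun t ht h ↦ by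
    have hs := (hcrit t ht).1 h
    have hcs : cos (ψ t) ≠ 0 := fun h ↦ by
      have := sin_sq_add_cos_sq (ψ t)
      rw [hs, h] at this
      norm_num at this
    rcases le_total t c with htc | htc
    · have ht' : t ∈ Icc 0 c := ⟨ht.1, htc⟩
      rw [(hp.eq_left hc hcD hA.left hv ht').1]
      rw [hψL ht'] at hcs
      exact mul_ne_zero h0 (mul_ne_zero (hA.left.rho_pos ξ t ht').ne' hcs)
    · have ht' := hmemR ⟨htc, ht.2⟩
      have h2 := (hp.eq_right hc hcD hA.right hv ht').1
      rw [sub_sub_cancel] at h2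
      rw [h2]
      rw [hψR ⟨htc, ht.2⟩, cos_nat_mul_pi_sub] at hcs
      exact mul_ne_zero h1 (mul_ne_zero (hA.right.rho_pos ξ _ ht').ne' (right_ne_zero_of_mul hcs))
  have hmul : ∀ {x : ℝ}, sin x = 0 → sin x * cos x = 0 := fun h ↦ by rw [h, zero_mul]
  have hdL : ∀ t ∈ Icc 0 c, sin (ψ t) = 0 → HasDerivWithinAt ψ (if t = 0 then ξ / (m₀ + 1) else ξ)
      (Icc 0 c) t := fun t ht hs ↦ by
    rw [hψL ht] at hs
    refine HasDerivWithinAt.congr ?_ hψL (hψL ht)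
    split_ifs with h
    · rw [h]; exact (hA.left.deriv_angle_zero ξ).hasDerivWithinAt
    · refine ((hA.left.deriv_angle ξ t ⟨lt_of_le_of_ne ht.1 (Ne.symm h), ht.2⟩).congr_deriv
        ?_).hasDerivWithinAt
      rw [hs]; ring
  have hdR : ∀ t ∈ Icc c D, sin (ψ t) = 0 → HasDerivWithinAt ψ (if t = D then ξ / (m₁ + 1) else ξ)
      (Icc c D) t := fun t ht hs ↦ by
    rw [hψR ht, sin_nat_mul_pi_sub] at hs
    have hs' : sin (ϑR ξ (D - t)) = 0 := by simpa using hs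
    refine HasDerivWithinAt.congr ?_ hψR (hψR ht)
    have hr : HasDerivAt (fun t ↦ D - t) (-1) t := by simpa using (hasDerivAt_id t).const_sub D
    split_ifs with h
    · have h2 := hA.right.deriv_angle_zero ξ
      rw [show (0 : ℝ) = D - t by rw [h, sub_self]] at h2
      have h3 := (h2.comp t hr).const_sub (i * π)
      refine (h3.congr_deriv ?_).hasDerivWithinAt
      ring
    · have h2 := hA.right.deriv_angle ξ (D - t) ⟨by
        have := lt_of_le_of_ne ht.2 h
        linarith, (hmemR ht).2⟩
      have h3 := (h2.comp t hr).const_sub (i * π)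
      refine (h3.congr_deriv ?_).hasDerivWithinAt
      rw [hs']; ring
  have hset : {t ∈ Icc 0 D | v₁ t = 0} = {t ∈ Icc 0 D | sin (ψ t) = 0} := by
    ext t
    exact and_congr_right (hcrit t)
  refine ⟨?_, fun t ht h ↦ ?_⟩
  · rw [hset]
    refine encard_sin_eq_zero hD hψc.continuousOn ?_ ?_ fun t ht hs ↦ ?_
    · rw [hψL ⟨le_rfl, hc.le⟩, hA.left.angle_zero]
    · rw [hψR ⟨hcD.le, le_rfl⟩]
      simp only [sub_self, hA.right.angle_zero, sub_zero]
    · rcases lt_trichotomy t c with htc | htc | htc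
      · refine ⟨if t = 0 then ξ / (m₀ + 1) else ξ, by split_ifs <;> positivity, ?_⟩
        refine (hdL t ⟨ht.1, htc.le⟩ hs).mono_of_mem_nhdsWithin ?_
        exact mem_nhdsWithin.2 ⟨Iio c, isOpen_Iio, htc, fun s hs ↦ ⟨hs.2.1, hs.1.le⟩⟩
      · subst htc
        refine ⟨ξ, hξ, ?_⟩
        have e1 := hdL c ⟨ht.1, le_rfl⟩ hs
        have e2 := hdR c ⟨le_rfl, ht.2⟩ hs
        rw [if_neg hc.ne'] at e1
        rw [if_neg hcD.ne] at e2
        rw [← Icc_union_Icc_eq_Icc hc.le hcD.le]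
        exact e1.union e2
      · refine ⟨if t = D then ξ / (m₁ + 1) else ξ, by split_ifs <;> positivity, ?_⟩
        refine (hdR t ⟨htc.le, ht.2⟩ hs).mono_of_mem_nhdsWithin ?_
        exact mem_nhdsWithin.2 ⟨Ioi c, isOpen_Ioi, htc, fun s hs ↦ ⟨hs.1.le, hs.2.2⟩⟩
  · have hvt := hcos t ht h
    rcases ht.1.eq_or_lt with rfl | ht0
    · rw [LSol.second_deriv_zero hp hv]
      have : (m₀ : ℝ) + 1 ≠ 0 := by positivity
      exact div_ne_zero (mul_ne_zero (by simpa using hξ.ne') hvt) this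
    rcases ht.2.eq_or_lt with rfl | htD
    · have h2 := LSol.second_deriv_zero hp.reflect hv.reflect
      simp only [sub_zero] at h2
      rw [h2]
      have : (m₁ : ℝ) + 1 ≠ 0 := by positivity
      exact div_ne_zero (mul_ne_zero (by simpa using hξ.ne') hvt) this
    · have h2 := hv.eq t ⟨ht0, htD⟩
      rw [h, mul_zero, add_zero] at h2
      rw [← h2]
      exact mul_ne_zero (by simpa using hξ.ne') hvt

lemma Profile.exists_angleData (hp : Profile D m₀ m₁ K κ h) :
    ∃ uL ρL ϑL uR ρR ϑR, AngleData hp uL ρL ϑL uR ρR ϑR := by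
  have hD := hp.D_pos
  obtain ⟨uL, ρL, ϑL, h1⟩ := (hp.halfWeight (c := D / 2)
    (by positivity) (by linarith)).exists_prufer
  obtain ⟨uR, ρR, ϑR, h2⟩ :=
    (hp.reflect.halfWeight (c := D / 2) (by positivity) (by linarith)).exists_prufer
  exact ⟨uL, ρL, ϑL, uR, ρR, ϑR, h1, h2⟩

/-- Green's formula shows that `L` has no positive eigenvalues. -/
lemma Profile.eigenvalue_nonpos (hp : Profile D m₀ m₁ K κ h)
    (hv : LSol D h v v₁ v₂ fun x ↦ μ * v x) (hμ : 0 < μ) : ∀ t ∈ Icc 0 D, v t = 0 := by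
  refine hp.integral_sq_eq_zero hv.cont₀ ?_
  have h1 := hp.integral_mul_eq hv hv.deriv₁ hv.cont₁
  have h2 : ∫ s in (0 : ℝ)..D, weight D m₀ m₁ K s * (μ * v s * v s) =
      μ * ∫ s in (0 : ℝ)..D, weight D m₀ m₁ K s * (v s * v s) := by
    rw [← intervalIntegral.integral_const_mul]
    congr 1; ext s; ring
  have h3 : 0 ≤ ∫ s in (0 : ℝ)..D, weight D m₀ m₁ K s * (v₁ s * v₁ s) :=
    integral_nonneg hp.D_pos.le fun s hs ↦
      mul_nonneg (weight_nonneg hs) (mul_self_nonneg _)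
  rw [h2] at h1
  by_contra! h4
  have := mul_pos hμ h4
  linarith

/-- An eigenfunction that vanishes at `0` vanishes identically. -/
lemma Profile.eigenfunction_unique (hp : Profile D m₀ m₁ K κ h)
    (hv : LSol D h v v₁ v₂ fun x ↦ μ * v x) (hμ : μ ≠ 0) (h0 : v 0 = 0) :
    ∀ t ∈ Icc 0 D, v t = 0 := by
  rcases lt_or_gt_of_ne hμ with h | h
  · obtain ⟨uL, ρL, ϑL, uR, ρR, ϑR, hA⟩ := hp.exists_angleData
    have h1 : μ = -√(-μ) ^ 2 := by rw [sq_sqrt (by linarith)]; ring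
    rw [h1] at hv
    exact hA.vanish hv (sqrt_pos.2 (by linarith)) (Or.inl h0)
  · exact hp.eigenvalue_nonpos hv h

/-- The eigenvalues of `L` with Neumann boundary conditions form a decreasing sequence, and the
`i`-th eigenfunction has `i + 1` critical points. -/
theorem Profile.exists_spectrum (hp : Profile D m₀ m₁ K κ h) :
    ∃ lam : ℕ → ℝ, lam 0 = 0 ∧ StrictAnti lam ∧ Tendsto lam atTop atBot ∧
      (∀ μ, (∃ v v₁ v₂, LSol D h v v₁ v₂ (fun x ↦ μ * v x) ∧ ∃ x ∈ Icc 0 D, v x ≠ 0) ↔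
        ∃ i, lam i = μ) ∧
      ∀ i, 1 ≤ i → ∀ v v₁ v₂, LSol D h v v₁ v₂ (fun x ↦ lam i * v x) →
        (∃ x ∈ Icc 0 D, v x ≠ 0) → {t ∈ Icc 0 D | v₁ t = 0}.encard = i + 1 ∧
          ∀ t ∈ Icc 0 D, v₁ t = 0 → v₂ t ≠ 0 := by
  have hD := hp.D_pos
  have hc : 0 < D / 2 := by positivity
  obtain ⟨uL, ρL, ϑL, uR, ρR, ϑR, hA⟩ := hp.exists_angleData
  -- the eigenvalues are `-ξ²`, where the total angle `Θ ξ` is a multiple of `π`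
  set Θ : ℝ → ℝ := fun ξ ↦ ϑL ξ (D / 2) + ϑR ξ (D / 2) with hΘ
  have hΘc : Continuous Θ := hA.left.continuous_end.add hA.right.continuous_end
  have hΘm : StrictMono Θ := (hA.left.strictMono_angle hc).add (hA.right.strictMono_angle hc)
  have hΘ0 : Θ 0 = 0 := by simp only [hΘ, hA.left.zero_angle, hA.right.zero_angle, add_zero]
  have hΘt : Tendsto Θ atTop atTop :=
    (hA.left.tendsto_angle (hp.halfWeight hc (by linarith))).atTop_add_atTop
      (hA.right.tendsto_angle (hp.reflect.halfWeight hc (by linarith)))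
  have hex : ∀ i : ℕ, ∃ ξ, 0 ≤ ξ ∧ Θ ξ = i * π := fun i ↦ by
    obtain ⟨B, hB1, hB2⟩ := ((hΘt.eventually_ge_atTop (i * π)).and (eventually_ge_atTop 0)).exists
    obtain ⟨ξ, hξ, h1⟩ := intermediate_value_Icc hB2 hΘc.continuousOn
      (show (i * π : ℝ) ∈ Icc (Θ 0) (Θ B) from ⟨by rw [hΘ0]; positivity, hB1⟩)
    exact ⟨ξ, hξ.1, h1⟩
  choose ξ hξ0 hξ using hex
  have hξm : StrictMono ξ := fun i j hij ↦ by
    rw [← hΘm.lt_iff_lt, hξ, hξ]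
    have : (i : ℝ) < j := by exact_mod_cast hij
    exact mul_lt_mul_of_pos_right this pi_pos
  have hξt : Tendsto ξ atTop atTop := by
    refine tendsto_atTop.2 fun B ↦ ?_
    obtain ⟨n, hn⟩ := exists_nat_gt (Θ B / π)
    filter_upwards [eventually_ge_atTop n] with i hi
    rw [← hΘm.le_iff_le, hξ]
    rw [div_lt_iff₀ pi_pos] at hn
    refine hn.le.trans ?_
    gcongr
  have hξz : ξ 0 = 0 := hΘm.injective (by rw [hξ, hΘ0]; simp)
  have hpos : ∀ i, 1 ≤ i → 0 < ξ i := fun i hi ↦ by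
    have := hξm (show 0 < i by omega)
    rwa [hξz] at this
  refine ⟨fun i ↦ -ξ i ^ 2, by simp [hξz], fun i j hij ↦ ?_, ?_, fun μ ↦ ⟨?_, ?_⟩, ?_⟩
  · have := hξm hij
    have := hξ0 i
    simp only [neg_lt_neg_iff]
    gcongr
  · exact tendsto_neg_atTop_atBot.comp ((tendsto_pow_atTop two_ne_zero).comp hξt)
  · rintro ⟨v, v₁, v₂, hv, x, hx, hvx⟩
    rcases lt_trichotomy μ 0 with hμ | rfl | hμ
    · have h1 : μ = -√(-μ) ^ 2 := by rw [sq_sqrt (by linarith)]; ring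
      have hs : 0 < √(-μ) := sqrt_pos.2 (by linarith)
      rw [h1] at hv
      have hv0 : v 0 ≠ 0 := fun h0 ↦ hvx (hA.vanish hv hs (Or.inl h0) x hx)
      obtain ⟨n, hn⟩ := sin_eq_zero_iff.1 (hA.sin_eq_zero hv hs hv0)
      have hn0 : 0 ≤ n := by
        have h2 := hΘm hs
        rw [hΘ0] at h2
        simp only [hΘ] at h2
        rw [← hn] at h2
        have : (0 : ℝ) < n := (pos_iff_pos_of_mul_pos h2).2 pi_pos
        exact_mod_cast this.le
      lift n to ℕ using hn0
      refine ⟨n, ?_⟩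
      have h3 : ξ n = √(-μ) := hΘm.injective (by simpa [hξ] using hn)
      simp only [h3]
      exact h1.symm
    · exact ⟨0, by simp [hξz]⟩
    · exact absurd (hp.eigenvalue_nonpos hv hμ x hx) hvx
  · rintro ⟨i, rfl⟩
    rcases Nat.eq_zero_or_pos i with rfl | hi
    · refine ⟨_, _, _, (LSol.const 1).congr (fun _ _ ↦ rfl) fun x _ ↦ ?_, 0, ⟨le_rfl, hD.le⟩,
        one_ne_zero⟩
      simp [hξz]
    · obtain ⟨v, v₁, v₂, hv, hv0⟩ := hA.exists_eigenfunction (hpos i hi) (hξ i)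
      exact ⟨v, v₁, v₂, hv, 0, ⟨le_rfl, hD.le⟩, hv0⟩
  · rintro i hi v v₁ v₂ hv ⟨x, hx, hvx⟩
    exact hA.criticalPoints (hpos i hi) (hξ i) hv
      (fun h0 ↦ hvx (hA.vanish hv (hpos i hi) (Or.inl h0) x hx))
      (fun h0 ↦ hvx (hA.vanish hv (hpos i hi) (Or.inr h0) x hx))

end Spectrum


/-! ### The operator `L` on the Hölder spaces with Neumann boundary conditions -/

section HolderSpaces

variable {D : ℝ} {m₀ m₁ : ℕ} {K κ h : ℝ → ℝ} {f g u u₁ u₂ u₃ v v₁ v₂ w : ℝ → ℝ} {t μ : ℝ}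

lemma LSol.lrel (hD : 0 < D) (hu : LSol D h u u₁ u₂ f) :
    LRel hD h (toX u hu.cont₀) (toX f hu.cont) :=
  ⟨u₁, u₂, hu.congr (ext_toX _) (ext_toX _)⟩

lemma LRel.congr_right {hD : 0 < D} {u f g : C(Icc 0 D, ℝ)} (hu : LRel hD h u f) (hfg : f = g) :
    LRel hD h u g := hfg ▸ hu

lemma LRel.add_const {hD : 0 < D} {u f : C(Icc 0 D, ℝ)} (hu : LRel hD h u f) (a : ℝ) :
    LRel hD h (u + a • 1) f := by
  obtain ⟨u₁, u₂, hu⟩ := hu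
  refine ⟨u₁, u₂, ⟨fun x hx ↦ ?_, hu.deriv₂, hu.cont₂, hu.left, hu.right, hu.cont, hu.eq⟩⟩
  exact (hu.deriv₁ x hx).add_const (a * 1)

lemma LSol.unique_right (hD : 0 < D) (hu : LSol D h u u₁ u₂ f) (hv : LSol D h u v₁ v₂ g) :
    EqOn u₁ v₁ (Icc 0 D) ∧ EqOn u₂ v₂ (Icc 0 D) := by
  have h1 : EqOn u₁ v₁ (Icc 0 D) := fun x hx ↦
    (uniqueDiffOn_Icc hD x hx).eq_deriv _ (hu.deriv₁ x hx) (hv.deriv₁ x hx)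
  exact ⟨h1, fun x hx ↦ (uniqueDiffOn_Icc hD x hx).eq_deriv _ (hu.deriv₂ x hx)
    ((hv.deriv₂ x hx).congr h1 (h1 hx))⟩

lemma CBound.exists_deriv {θ : ℝ} {S : Set ℝ} {k : ℕ} {R : ℝ} (hu : CBound θ S (k + 1) R u) :
    ∃ u₁, (∀ x ∈ S, HasDerivWithinAt u (u₁ x) S x) ∧ CBound θ S k R u₁ := hu.2

/-- `L` maps functions of class `C^{k+2,θ}` with vanishing derivative at both endpoints to functions
of class `C^{k,θ}`. -/
lemma Profile.exists_lsol (hp : Profile D m₀ m₁ K κ h) {θ : ℝ} (hθ0 : 0 < θ) (hθ : θ ≤ 1) {k : ℕ}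
    {R : ℝ} (h1 : ∀ x ∈ Icc 0 D, HasDerivWithinAt u (u₁ x) (Icc 0 D) x)
    (h2 : ∀ x ∈ Icc 0 D, HasDerivWithinAt u₁ (u₂ x) (Icc 0 D) x)
    (h3 : CBound θ (Icc 0 D) k R u₂) (hl : u₁ 0 = 0) (hr : u₁ D = 0) :
    ∃ f R', LSol D h u u₁ u₂ f ∧ CBound θ (Icc 0 D) k R' f := by
  have hD := hp.D_pos
  have hcD : 2 * D / 3 < D := by linarith
  have hc : 0 < 2 * D / 3 := by positivity
  have hsub : Icc 0 (2 * D / 3) ⊆ Icc 0 D := Icc_subset_Icc_right hcD.le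
  obtain ⟨fL, RL, hL1, hL2⟩ := (hp.halfWeight hc hcD).exists_CBound_operator hθ0 hθ
    (u₁ := u₁) (u₂ := u₂) (fun x hx ↦ (h2 x (hsub hx)).mono hsub) (h3.restrict hsub) hl
  have hrd : ∀ x, HasDerivWithinAt (fun t ↦ D - t) (-1) (Icc 0 D) x := fun x ↦ by
    simpa using (hasDerivWithinAt_id x (Icc 0 D)).const_sub D
  obtain ⟨fR, RR, hR1, hR2⟩ := (hp.reflect.halfWeight hc hcD).exists_CBound_operator hθ0 hθ
    (u₁ := fun t ↦ -u₁ (D - t)) (u₂ := fun t ↦ u₂ (D - t)) (fun x hx ↦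
      (((h2 _ (mapsTo_reflect (hsub hx))).comp x (hrd x)
        mapsTo_reflect).neg.congr_deriv (by ring)).mono hsub)
    (by simpa using ((h3.reflect (D := D)).restrict (by simpa using hsub))) (by simp [hr])
  have hLeq : ∀ t ∈ Ioc 0 (2 * D / 3), fL t = u₂ t + h t * u₁ t := fun t ht ↦ by
    rw [hL2 t ht, hp.h_eq_left ⟨ht.1, ht.2.trans_lt hcD⟩]
  have hReq : ∀ t ∈ Ico (D / 3) D, fR (D - t) = u₂ t + h t * u₁ t := fun t ht ↦ by
    have ht' : D - t ∈ Ioc 0 (2 * D / 3) := ⟨by linarith [ht.2], by linarith [ht.1]⟩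
    have h4 := hp.reflect.h_eq_left ⟨ht'.1, ht'.2.trans_lt hcD⟩
    rw [hR2 _ ht', ← h4]
    simp only [sub_sub_cancel]
    ring
  -- the extensions of `L u` to the two endpoints agree on the overlap
  set f : ℝ → ℝ := fun t ↦ if t ≤ D / 2 then fL t else fR (D - t) with hf
  have hfL : EqOn f fL (Icc 0 (2 * D / 3)) := fun t ht ↦ by
    simp only [hf]
    split_ifs with h5
    · rfl
    · rw [hReq t ⟨by linarith, by linarith [ht.2]⟩, hLeq t ⟨by linarith, ht.2⟩]
  have hfR : EqOn f (fun t ↦ fR (D - t)) (Icc (D / 3) D) := fun t ht ↦ by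
    simp only [hf]
    split_ifs with h5
    · rw [hReq t ⟨ht.1, by linarith⟩, hLeq t ⟨by linarith [ht.1], by linarith⟩]
    · rfl
  have hR1' : CBound θ (Icc (D / 3) D) k RR (fun t ↦ fR (D - t)) := by
    have := hR1.reflect (D := D)
    rwa [sub_zero, show D - 2 * D / 3 = D / 3 by ring] at this
  obtain ⟨C, -, hglue⟩ := CBound.exists_glue (θ := θ) (a := 0) (b := D) (c := D / 3)
    (d := 2 * D / 3)
    (by positivity) (by linarith) hcD k hθ0
  have hfC := hglue (max RL RR) f ((hL1.mono (le_max_left _ _)).congr hfL)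
    ((hR1'.mono (le_max_right _ _)).congr hfR)
  refine ⟨f, _, ⟨h1, h2, h3.continuousOn hθ0, hl, hr, hfC.continuousOn hθ0, fun x hx ↦ ?_⟩, hfC⟩
  rcases le_total x (D / 2) with hx2 | hx2
  · rw [hfL ⟨hx.1.le, by linarith⟩, hLeq x ⟨hx.1, by linarith⟩]
  · rw [hfR ⟨by linarith, hx.2.le⟩, ← hReq x ⟨by linarith, hx.2⟩]

/-- With `f = L u` the condition `u'''(0) = 0` amounts to `f'(0) = 0`. -/
lemma LSol.deriv_zero (hp : Profile D m₀ m₁ K κ h) {f₁ : ℝ → ℝ} (hu : LSol D h u u₁ u₂ f)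
    (h3 : ∀ x ∈ Icc 0 D, HasDerivWithinAt u₂ (u₃ x) (Icc 0 D) x) (hc : ContinuousOn u₃ (Icc 0 D))
    (hf : ∀ x ∈ Icc 0 D, HasDerivWithinAt f (f₁ x) (Icc 0 D) x) :
    f₁ 0 = (1 + m₀ / 2) * u₃ 0 := by
  have hD := hp.D_pos
  have hcD : D / 2 < D := by linarith
  have hsub : Icc 0 (D / 2) ⊆ Icc 0 D := Icc_subset_Icc_right hcD.le
  refine (hp.halfWeight (by positivity) hcD).deriv_operator_zero
    (fun x hx ↦ (hu.deriv₂ x (hsub hx)).mono hsub) (fun x hx ↦ (h3 x (hsub hx)).mono hsub)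
    (hc.mono hsub) hu.left (fun x hx ↦ (hf x (hsub hx)).mono hsub) fun t ht ↦ ?_
  have ht' : t ∈ Ioo 0 D := ⟨ht.1, ht.2.trans hcD⟩
  rw [hu.eq t ht', hp.h_eq_left ht']

/-- With `f = L u` the condition `u'''(D) = 0` amounts to `f'(D) = 0`. -/
lemma LSol.deriv_end (hp : Profile D m₀ m₁ K κ h) {f₁ : ℝ → ℝ} (hu : LSol D h u u₁ u₂ f)
    (h3 : ∀ x ∈ Icc 0 D, HasDerivWithinAt u₂ (u₃ x) (Icc 0 D) x) (hc : ContinuousOn u₃ (Icc 0 D))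
    (hf : ∀ x ∈ Icc 0 D, HasDerivWithinAt f (f₁ x) (Icc 0 D) x) :
    f₁ D = (1 + m₁ / 2) * u₃ D := by
  have hr : ∀ x, HasDerivWithinAt (fun t ↦ D - t) (-1) (Icc 0 D) x := fun x ↦ by
    simpa using (hasDerivWithinAt_id x (Icc 0 D)).const_sub D
  have h4 := LSol.deriv_zero hp.reflect (u₃ := fun t ↦ -u₃ (D - t)) (f₁ := fun t ↦ -f₁ (D - t))
    hu.reflect
    (fun x hx ↦ ((h3 _ (mapsTo_reflect hx)).comp x (hr x) mapsTo_reflect).congr_deriv (by ring))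
    (hc.comp (by fun_prop) mapsTo_reflect).neg
    (fun x hx ↦ ((hf _ (mapsTo_reflect hx)).comp x (hr x) mapsTo_reflect).congr_deriv (by ring))
  simp only [sub_zero] at h4
  linarith

variable {hp : Profile D m₀ m₁ K κ h} {P : C(Icc 0 D, ℝ) →L[ℝ] ℝ}
  {E S : C(Icc 0 D, ℝ) →L[ℝ] C(Icc 0 D, ℝ)} {θ : ℝ≥0}

lemma ext_one (hD : 0 < D) (t : ℝ) : ext hD 1 t = 1 := rfl

lemma ResolventData.exists_CBound (hR : ResolventData hp P E S) {θ : ℝ} (hθ0 : 0 < θ) (hθ : θ ≤ 1)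
    {k : ℕ} {R : ℝ} (hu : LSol D h u u₁ u₂ f) (hf : CBound θ (Icc 0 D) k R f) :
    ∃ R', CBound θ (Icc 0 D) (k + 2) R' u := by
  have hD := hp.D_pos
  have h1 := hR.eq_S _ _ (hu.lrel hD)
  obtain ⟨C, -, hC⟩ := hR.regularity θ hθ0 hθ k
  set a := P (toX u hu.cont₀)
  have h2 : CBound θ (Icc 0 D) k (R + |a|) (ext hD (toX f hu.cont - a • 1)) := by
    refine (hf.sub (CBound.const a)).congr fun t ht ↦ ?_
    rw [ext_sub, ext_smul]
    simp only [ext_one, mul_one]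
    rw [ext_toX hu.cont ht]
  have h3 := hC _ _ h2
  rw [← h1] at h3
  exact ⟨_, h3.congr fun t ht ↦ (ext_toX hu.cont₀ ht).symm⟩

lemma LSol.derivOn_one (hD : 0 < D) (hu : LSol D h u u₁ u₂ f) :
    EqOn (derivOn D 1 u) u₁ (Icc 0 D) := fun x hx ↦ by
  rw [derivOn_succ hD hu.deriv₁ 0 x hx, derivOn_zero]

lemma LSol.derivOn_two (hD : 0 < D) (hu : LSol D h u u₁ u₂ f) :
    EqOn (derivOn D 2 u) u₂ (Icc 0 D) := fun x hx ↦ by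
  rw [derivOn_succ hD hu.deriv₁ 1 x hx, derivOn_succ hD hu.deriv₂ 0 x hx, derivOn_zero]

/-- Eigenfunctions in the sense of `IsEigenfunction` are the solutions of `L v = μ v`. -/
lemma ResolventData.isEigenfunction_iff (hR : ResolventData hp P E S) (hθ0 : 0 < θ) (hθ : θ ≤ 1) :
    IsEigenfunction h D θ μ v ↔
      (∃ v₁ v₂, LSol D h v v₁ v₂ fun x ↦ μ * v x) ∧ ∃ x ∈ Icc 0 D, v x ≠ 0 := by
  have hD := hp.D_pos
  constructor
  · rintro ⟨⟨hC, hl, hr⟩, hne, heq⟩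
    obtain ⟨R, hv⟩ := hC.exists_CBound hD
    obtain ⟨v₁, h1, hv₁⟩ := hv.exists_deriv
    obtain ⟨v₂, h2, hv₂⟩ := hv₁.exists_deriv
    have d1 : ∀ x ∈ Icc 0 D, derivOn D 1 v x = v₁ x := fun x hx ↦ by
      rw [derivOn_succ hD h1 0 x hx, derivOn_zero]
    have d2 : ∀ x ∈ Icc 0 D, derivOn D 2 v x = v₂ x := fun x hx ↦ by
      rw [derivOn_succ hD h1 1 x hx, derivOn_succ hD h2 0 x hx, derivOn_zero]
    refine ⟨⟨v₁, v₂, h1, h2, hv₂.continuousOn (by exact_mod_cast hθ0), ?_, ?_, ?_, fun x hx ↦ ?_⟩,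
      hne⟩
    · rw [← d1 0 ⟨le_rfl, hD.le⟩, hl]
    · rw [← d1 D ⟨hD.le, le_rfl⟩, hr]
    · exact continuousOn_const.mul (hv.continuousOn (by exact_mod_cast hθ0))
    · rw [← heq x hx, opL, d1 x (Ioo_subset_Icc_self hx), d2 x (Ioo_subset_Icc_self hx)]
  · rintro ⟨⟨v₁, v₂, hv⟩, hne⟩
    have hθ' : (0 : ℝ) < θ := by exact_mod_cast hθ0
    have hb : ∃ R, CBound θ (Icc 0 D) 0 R fun x ↦ μ * v x := by
      obtain ⟨B, hB⟩ := isCompact_Icc.exists_bound_of_continuousOn hv.cont₀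
      obtain ⟨B₁, hB₁⟩ := isCompact_Icc.exists_bound_of_continuousOn hv.cont₁
      exact ⟨_, (CBound.of_hasDerivWithinAt (R := max B B₁) (by exact_mod_cast hθ)
        (fun x hx ↦ (hB x hx).trans (le_max_left _ _))
        (fun x hx ↦ (hB₁ x hx).trans (le_max_right _ _)) hv.deriv₁).const_mul μ⟩
    obtain ⟨R, hb⟩ := hb
    obtain ⟨R', hC⟩ := hR.exists_CBound hθ' (by exact_mod_cast hθ) hv hb
    refine ⟨⟨hC.memC hD hθ0, ?_, ?_⟩, hne, fun x hx ↦ ?_⟩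
    · rw [hv.derivOn_one hD ⟨le_rfl, hD.le⟩, hv.left]
    · rw [hv.derivOn_one hD ⟨hD.le, le_rfl⟩, hv.right]
    · have hx' := Ioo_subset_Icc_self hx
      rw [opL, hv.derivOn_one hD hx', hv.derivOn_two hD hx', ← hv.eq x hx]

lemma Profile.contDiffOn_h (hp : Profile D m₀ m₁ K κ h) : ContDiffOn ℝ ∞ h (Ioo 0 D) := by
  have h1 : ContDiffOn ℝ ∞ (fun t ↦ m₀ / t - m₁ / (D - t) + κ t) (Ioo 0 D) := by
    refine ((contDiffOn_const.div contDiffOn_id fun t ht ↦ ht.1.ne').sub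
      (contDiffOn_const.div (contDiffOn_const.sub contDiffOn_id) fun t ht ↦ ?_)).add
      (hp.smooth.mono Ioo_subset_Icc_self)
    exact (sub_pos.2 ht.2).ne'
  exact h1.congr hp.h_eq

lemma Profile.hasDerivAt_h (hp : Profile D m₀ m₁ K κ h) (ht : t ∈ Ioo 0 D) :
    HasDerivAt h (deriv h t) t ∧ HasDerivAt (deriv h) (iteratedDeriv 2 h t) t := by
  have hn : Ioo 0 D ∈ 𝓝 t := Ioo_mem_nhds ht.1 ht.2
  have h1 := hp.contDiffOn_h.contDiffAt hn
  refine ⟨(h1.differentiableAt (by simp)).hasDerivAt, ?_⟩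
  have h2 : ContDiffAt ℝ 1 (deriv h) t := by
    have h3 : ContDiffOn ℝ 1 (deriv h) (Ioo 0 D) :=
      hp.contDiffOn_h.deriv_of_isOpen isOpen_Ioo (by norm_cast)
    exact h3.contDiffAt hn
  have h4 := (h2.differentiableAt one_ne_zero).hasDerivAt
  rwa [iteratedDeriv_succ, iteratedDeriv_one]

/-- If `L w = y` and `L y = z` with `z` Hölder continuous, then `w ∈ B₄`, and the linear part of
the equation is `L² w - α L w`. -/
lemma ResolventData.memB₄_of_lsol (hR : ResolventData hp P E S) (hθ0 : 0 < θ) (hθ : θ ≤ 1)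
    {y y₁ y₂ z w₁ w₂ : ℝ → ℝ} {R : ℝ} (hw : LSol D h w w₁ w₂ y) (hy : LSol D h y y₁ y₂ z)
    (hz : CBound θ (Icc 0 D) 0 R z) :
    MemB₄ D θ w ∧ ∀ α, ∀ x ∈ Ioo 0 D, linearPart h D α w x = z x - α * y x := by
  have hD := hp.D_pos
  have hθ0' : (0 : ℝ) < θ := by exact_mod_cast hθ0
  have hθ' : (θ : ℝ) ≤ 1 := by exact_mod_cast hθ
  obtain ⟨R₂, hyC⟩ := hR.exists_CBound hθ0' hθ' hy hz
  obtain ⟨R₄, hwC⟩ := hR.exists_CBound hθ0' hθ' hw hyC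
  obtain ⟨w₁', h1', hw₁'⟩ := hwC.exists_deriv
  have e1 : EqOn w₁ w₁' (Icc 0 D) := fun x hx ↦
    (uniqueDiffOn_Icc hD x hx).eq_deriv _ (hw.deriv₁ x hx) (h1' x hx)
  obtain ⟨w₂', h2', hw₂'⟩ := (hw₁'.congr e1).exists_deriv
  have e2 : EqOn w₂ w₂' (Icc 0 D) := fun x hx ↦
    (uniqueDiffOn_Icc hD x hx).eq_deriv _ (hw.deriv₂ x hx) (h2' x hx)
  obtain ⟨w₃, h3, hw₃⟩ := (hw₂'.congr e2).exists_deriv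
  obtain ⟨w₄, h4, hw₄⟩ := hw₃.exists_deriv
  have d1 := hw.derivOn_one hD
  have d2 := hw.derivOn_two hD
  have d3 : ∀ x ∈ Icc 0 D, derivOn D 3 w x = w₃ x := fun x hx ↦ by
    rw [derivOn_succ hD hw.deriv₁ 2 x hx, derivOn_succ hD hw.deriv₂ 1 x hx,
      derivOn_succ hD h3 0 x hx, derivOn_zero]
  have d4 : ∀ x ∈ Icc 0 D, derivOn D 4 w x = w₄ x := fun x hx ↦ by
    rw [derivOn_succ hD hw.deriv₁ 3 x hx, derivOn_succ hD hw.deriv₂ 2 x hx,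
      derivOn_succ hD h3 1 x hx, derivOn_succ hD h4 0 x hx, derivOn_zero]
  have hl : (0 : ℝ) ∈ Icc 0 D := ⟨le_rfl, hD.le⟩
  have hr : D ∈ Icc 0 D := ⟨hD.le, le_rfl⟩
  refine ⟨⟨hwC.memC hD hθ0, ?_, ?_, ?_, ?_⟩, fun α x hx ↦ ?_⟩
  · rw [d1 hl, hw.left]
  · rw [d3 0 hl]
    have h5 := LSol.deriv_zero hp hw h3 (hw₃.continuousOn hθ0') hy.deriv₁
    rw [hy.left] at h5
    have : (1 : ℝ) + m₀ / 2 ≠ 0 := by positivity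
    exact (mul_eq_zero.1 h5.symm).resolve_left this
  · rw [d1 hr, hw.right]
  · rw [d3 D hr]
    have h5 := LSol.deriv_end hp hw h3 (hw₃.continuousOn hθ0') hy.deriv₁
    rw [hy.right] at h5
    have : (1 : ℝ) + m₁ / 2 ≠ 0 := by positivity
    exact (mul_eq_zero.1 h5.symm).resolve_left this
  · have hx' := Ioo_subset_Icc_self hx
    -- differentiate `y = w'' + h w'` twice
    have k1 : ∀ x ∈ Ioo 0 D, y₁ x = w₃ x + (_root_.deriv h x * w₁ x + h x * w₂ x) := fun x hx ↦ by
      have hev : y =ᶠ[𝓝 x] fun s ↦ w₂ s + h s * w₁ s := by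
        filter_upwards [Ioo_mem_nhds hx.1 hx.2] with s hs using hw.eq s hs
      exact (hasDerivAt_of_Icc hy.deriv₁ hx).unique (((hasDerivAt_of_Icc h3 hx).add
        ((hp.hasDerivAt_h hx).1.mul (hasDerivAt_of_Icc hw.deriv₂ hx))).congr_of_eventuallyEq hev)
    have k2 : y₂ x = w₄ x + ((iteratedDeriv 2 h x * w₁ x + _root_.deriv h x * w₂ x) +
        (_root_.deriv h x * w₂ x + h x * w₃ x)) := by
      have hev : y₁ =ᶠ[𝓝 x] fun s ↦ w₃ s + (_root_.deriv h s * w₁ s + h s * w₂ s) := by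
        filter_upwards [Ioo_mem_nhds hx.1 hx.2] with s hs using k1 s hs
      exact (hasDerivAt_of_Icc hy.deriv₂ hx).unique (((hasDerivAt_of_Icc h4 hx).add
        (((hp.hasDerivAt_h hx).2.mul (hasDerivAt_of_Icc hw.deriv₂ hx)).add
        ((hp.hasDerivAt_h hx).1.mul (hasDerivAt_of_Icc h3 hx)))).congr_of_eventuallyEq hev)
    rw [linearPart, d1 hx', d2 hx', d3 x hx', d4 x hx', hy.eq x hx, k2, k1 x hx, hw.eq x hx]
    ring

lemma ResolventData.S_one (hR : ResolventData hp P E S) : S 1 = -1 := by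
  have h1 : LRel hp.D_pos h 1 0 :=
    ⟨_, _, (LSol.const (D := D) (h := h) 1).congr (fun _ _ ↦ rfl) fun _ _ ↦ rfl⟩
  have h2 := hR.eq_S _ _ h1
  rw [hR.mean_one, one_smul, zero_sub, map_neg] at h2
  exact (neg_eq_iff_eq_neg.1 h2.symm)

lemma ResolventData.P_eq_zero (hR : ResolventData hp P E S) {u f : C(Icc 0 D, ℝ)}
    (hu : LRel hp.D_pos h u f) : P f = 0 := by
  obtain ⟨u₁, u₂, hu⟩ := hu
  have h1 := hR.mean f
  rw [hp.integral_eq_zero hu] at h1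
  exact (mul_eq_zero.1 h1).resolve_right hp.weight_integral_pos.ne'

lemma ResolventData.lrel_S_add (hR : ResolventData hp P E S) (g : C(Icc 0 D, ℝ)) :
    LRel hp.D_pos h (S (S g)) (S g + P g • 1) := by
  have := hR.rel (S g)
  rwa [hR.mean_S, neg_smul, sub_neg_eq_add] at this

lemma ResolventData.lrel_S_add' (hR : ResolventData hp P E S) (g : C(Icc 0 D, ℝ)) :
    LRel hp.D_pos h (S g + P g • 1) (g - P g • 1) := (hR.rel g).add_const _

/-- `B₄` is the image of the Hölder continuous functions under `S²`. -/
lemma ResolventData.memB₄_iff (hR : ResolventData hp P E S) (hθ0 : 0 < θ) (hθ : θ ≤ 1) :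
    MemB₄ D θ w ↔ ∃ g : C(Icc 0 D, ℝ), EqOn w (ext hp.D_pos (S (S g))) (Icc 0 D) ∧
      ∃ R, CBound θ (Icc 0 D) 0 R (ext hp.D_pos g) := by
  have hD := hp.D_pos
  have hθ0' : (0 : ℝ) < θ := by exact_mod_cast hθ0
  have hθ' : (θ : ℝ) ≤ 1 := by exact_mod_cast hθ
  have hl : (0 : ℝ) ∈ Icc 0 D := ⟨le_rfl, hD.le⟩
  have hr : D ∈ Icc 0 D := ⟨hD.le, le_rfl⟩
  constructor
  · rintro ⟨hC, hl1, hl3, hr1, hr3⟩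
    obtain ⟨R, hw⟩ := hC.exists_CBound hD
    obtain ⟨w₁, h1, hw₁⟩ := hw.exists_deriv
    obtain ⟨w₂, h2, hw₂⟩ := hw₁.exists_deriv
    obtain ⟨w₃, h3, hw₃⟩ := hw₂.exists_deriv
    have d1 : ∀ x ∈ Icc 0 D, derivOn D 1 w x = w₁ x := fun x hx ↦ by
      rw [derivOn_succ hD h1 0 x hx, derivOn_zero]
    have d3 : ∀ x ∈ Icc 0 D, derivOn D 3 w x = w₃ x := fun x hx ↦ by
      rw [derivOn_succ hD h1 2 x hx, derivOn_succ hD h2 1 x hx,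
        derivOn_succ hD h3 0 x hx, derivOn_zero]
    rw [d1 0 hl] at hl1
    rw [d3 0 hl] at hl3
    rw [d1 D hr] at hr1
    rw [d3 D hr] at hr3
    obtain ⟨y, Ry, hwy, hy⟩ := hp.exists_lsol hθ0' hθ' h1 h2 hw₂ hl1 hr1
    obtain ⟨y₁, k1, hy₁⟩ := hy.exists_deriv
    obtain ⟨y₂, k2, hy₂⟩ := hy₁.exists_deriv
    have hw₃c := hw₃.continuousOn hθ0'
    obtain ⟨z, Rz, hyz, hz⟩ := hp.exists_lsol hθ0' hθ' k1 k2 hy₂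
      (by rw [LSol.deriv_zero hp hwy h3 hw₃c k1, hl3, mul_zero])
      (by rw [LSol.deriv_end hp hwy h3 hw₃c k1, hr3, mul_zero])
    have r1 := hwy.lrel hD
    have r2 := hyz.lrel hD
    set W := toX w hwy.cont₀
    set Z := toX z hyz.cont
    have e1 := hR.eq_S _ _ r1
    have e2 := hR.eq_S _ _ r2
    rw [hR.P_eq_zero r1, zero_smul, sub_zero] at e2
    refine ⟨Z + P W • 1, fun t ht ↦ ?_, Rz + |P W|, ?_⟩
    · rw [map_add, map_add, map_smul, map_smul, hR.S_one, map_neg, hR.S_one, neg_neg]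
      have e3 : W = S (S Z) + P W • 1 := by
        conv_lhs => rw [e1, map_sub, map_smul, hR.S_one, smul_neg, sub_neg_eq_add]
        rw [← e2]
      rw [← e3]
      exact (ext_toX hwy.cont₀ ht).symm
    · refine (hz.add (CBound.const (P W))).congr fun t ht ↦ ?_
      rw [ext_add, ext_smul]
      simp only [ext_one, mul_one]
      rw [ext_toX hyz.cont ht]
  · rintro ⟨g, hg, R, hC⟩
    obtain ⟨w₁, w₂, hw⟩ := hR.lrel_S_add g
    obtain ⟨y₁, y₂, hy⟩ := hR.lrel_S_add' g
    refine (hR.memB₄_of_lsol hθ0 hθ (hw.congr hg fun _ _ ↦ rfl) hy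
      (R := R + |P g|) ((hC.sub (CBound.const (P g))).congr fun t ht ↦ ?_)).1
    rw [ext_sub, ext_smul]
    simp only [ext_one, mul_one]

/-- The linear part of the equation at `w = S² g` is a bounded operator applied to `g`. -/
lemma ResolventData.linearPart_eq (hR : ResolventData hp P E S) (hθ0 : 0 < θ) (hθ : θ ≤ 1)
    {g : C(Icc 0 D, ℝ)} {R : ℝ} (hg : CBound θ (Icc 0 D) 0 R (ext hp.D_pos g))
    (hw : EqOn w (ext hp.D_pos (S (S g))) (Icc 0 D)) (α : ℝ) {x : ℝ} (hx : x ∈ Ioo 0 D) :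
    linearPart h D α w x = ext hp.D_pos (g - P g • 1 - α • (S g + P g • 1)) x := by
  obtain ⟨w₁, w₂, hsol⟩ := hR.lrel_S_add g
  obtain ⟨y₁, y₂, hy⟩ := hR.lrel_S_add' g
  rw [(hR.memB₄_of_lsol hθ0 hθ (hsol.congr hw fun _ _ ↦ rfl) hy
    (R := R + |P g|) ((hg.sub (CBound.const (P g))).congr fun t ht ↦ by
      rw [ext_sub, ext_smul]
      simp only [ext_one, mul_one])).2 α x hx]
  rfl

/-- `|L w|` is controlled by the second derivative of `w`, in spite of the singularity of `h`. -/
lemma Profile.exists_abs_le (hp : Profile D m₀ m₁ K κ h) :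
    ∃ C, 0 < C ∧ ∀ w w₁ w₂ y R, LSol D h w w₁ w₂ y → (∀ x ∈ Icc 0 D, |w₂ x| ≤ R) →
      ∀ x ∈ Icc 0 D, |y x| ≤ C * R := by
  have hD := hp.D_pos
  obtain ⟨B, hB⟩ := isCompact_Icc.exists_bound_of_continuousOn hp.smooth.continuousOn
  have hB0 : 0 ≤ B := (norm_nonneg _).trans (hB 0 ⟨le_rfl, hD.le⟩)
  refine ⟨1 + m₀ + m₁ + B * D, by positivity, fun w w₁ w₂ y R hw hR ↦ ?_⟩
  have hR0 : 0 ≤ R := (abs_nonneg _).trans (hR 0 ⟨le_rfl, hD.le⟩)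
  have hl : (0 : ℝ) ∈ Icc 0 D := ⟨le_rfl, hD.le⟩
  have hr : D ∈ Icc 0 D := ⟨hD.le, le_rfl⟩
  -- `|w'|` is at most `R` times the distance to either endpoint, which absorbs the poles of `h`
  have hIoo : ∀ x ∈ Ioo 0 D, |y x| ≤ (1 + m₀ + m₁ + B * D) * R := by
    intro x hx
    have hx' := Ioo_subset_Icc_self hx
    have h1 : |w₁ x| ≤ R * x := by
      have := abs_sub_le_of_hasDerivWithinAt hR hw.deriv₂ hx' hl
      rwa [hw.left, sub_zero, sub_zero, abs_of_pos hx.1] at this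
    have h2 : |w₁ x| ≤ R * (D - x) := by
      have := abs_sub_le_of_hasDerivWithinAt hR hw.deriv₂ hx' hr
      rwa [hw.right, sub_zero, abs_sub_comm x D, abs_of_pos (sub_pos.2 hx.2)] at this
    have h3 : |m₀ / x * w₁ x| ≤ m₀ * R := by
      rw [abs_mul, abs_of_nonneg (div_nonneg (Nat.cast_nonneg _) hx.1.le), div_mul_eq_mul_div,
        div_le_iff₀ hx.1, mul_assoc]
      gcongr
    have h4 : |m₁ / (D - x) * w₁ x| ≤ m₁ * R := by
      have hpos := sub_pos.2 hx.2
      rw [abs_mul, abs_of_nonneg (div_nonneg (Nat.cast_nonneg _) hpos.le), div_mul_eq_mul_div,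
        div_le_iff₀ hpos, mul_assoc]
      gcongr
    have h5 : |κ x * w₁ x| ≤ B * (R * D) := by
      rw [abs_mul]
      refine mul_le_mul (hB x hx') (h1.trans ?_) (abs_nonneg _) hB0
      gcongr
      exact hx.2.le
    have h6 : y x = w₂ x + (m₀ / x * w₁ x - m₁ / (D - x) * w₁ x + κ x * w₁ x) := by
      rw [hw.eq x hx, hp.h_eq x hx]; ring
    have h7 := hR x hx'
    rw [h6]
    rw [abs_le] at *
    constructor <;> linarith [h3.1, h3.2, h4.1, h4.2, h5.1, h5.2, h7.1, h7.2]
  have hcl : closure (Ioo 0 D) = Icc 0 D := closure_Ioo hD.ne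
  intro x hx
  rw [← hcl] at hx
  have hc : ContinuousOn (fun x ↦ |y x|) (closure (Ioo 0 D)) := by rw [hcl]; exact hw.cont.abs
  exact le_on_closure hIoo hc continuousOn_const hx

end HolderSpaces


/-! ### Bifurcation from a simple eigenvalue -/

section Bifurcation

open Real

/-- The fixed points of a family of contractions that depends continuously on a parameter. -/
lemma exists_fixedPoint_family {X : Type*} [NormedAddCommGroup X] [NormedSpace ℝ X]
    [CompleteSpace X] {Ψ : ℝ → X → X} {ρ ε M : ℝ} (hε : 0 < ε) (hM : 0 ≤ M) (hMρ : M * ε ≤ ρ / 2)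
    (hlip : ∀ s ∈ Ioo (-ε) ε, ∀ x, ‖x‖ ≤ ρ → ∀ y, ‖y‖ ≤ ρ →
      ‖Ψ s x - Ψ s y‖ ≤ 1 / 2 * ‖x - y‖)
    (hzero : ∀ s ∈ Ioo (-ε) ε, ‖Ψ s 0‖ ≤ M * |s|)
    (hcont : ∀ x, ‖x‖ ≤ ρ → ContinuousOn (fun s ↦ Ψ s x) (Ioo (-ε) ε)) :
    ∃ ξ : ℝ → X, (∀ s ∈ Ioo (-ε) ε, ‖ξ s‖ ≤ 2 * M * |s| ∧ ‖ξ s‖ ≤ ρ ∧ Ψ s (ξ s) = ξ s ∧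
      ∀ x, ‖x‖ ≤ ρ → Ψ s x = x → x = ξ s) ∧ ContinuousOn ξ (Ioo (-ε) ε) := by
  have hρ : 0 ≤ ρ := by
    have := mul_nonneg hM hε.le
    linarith
  have hex : ∀ s ∈ Ioo (-ε) ε, ∃ x, ‖x‖ ≤ ρ ∧ Ψ s x = x := fun s hs ↦ by
    have hs' : |s| ≤ ε := (abs_lt.2 hs).le
    have hmaps : MapsTo (Ψ s) (Metric.closedBall 0 ρ) (Metric.closedBall 0 ρ) := fun x hx ↦ by
      rw [mem_closedBall_zero_iff] at hx ⊢
      have h1 := hlip s hs x hx 0 (by simpa using hρ)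
      have h2 := hzero s hs
      rw [sub_zero] at h1
      have h3 : M * |s| ≤ M * ε := by gcongr
      calc ‖Ψ s x‖ ≤ ‖Ψ s x - Ψ s 0‖ + ‖Ψ s 0‖ := norm_le_norm_sub_add _ _
        _ ≤ _ := by linarith
    have hcontr : ContractingWith (1 / 2) (hmaps.restrict (Ψ s) _ _) := by
      refine ⟨by rw [← NNReal.coe_lt_coe]; norm_num, LipschitzWith.of_dist_le_mul ?_⟩
      rintro ⟨x, hx⟩ ⟨y, hy⟩
      have := hlip s hs x (mem_closedBall_zero_iff.1 hx) y (mem_closedBall_zero_iff.1 hy)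
      simpa [Subtype.dist_eq, dist_eq_norm] using this
    obtain ⟨x, hx, hfix, -⟩ := hcontr.exists_fixedPoint' Metric.isClosed_closedBall.isComplete hmaps
      (x := 0) (by simpa using hρ) (edist_ne_top _ _)
    exact ⟨x, mem_closedBall_zero_iff.1 hx, hfix⟩
  choose! ξ hξ1 hξ2 using hex
  refine ⟨ξ, fun s hs ↦ ⟨?_, hξ1 s hs, hξ2 s hs, fun x hx hfix ↦ ?_⟩, fun s hs ↦ ?_⟩
  · have h1 := hlip s hs _ (hξ1 s hs) 0 (by simpa using hρ)
    have h2 := hzero s hs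
    rw [hξ2 s hs, sub_zero] at h1
    have h3 := norm_le_norm_sub_add (ξ s) (Ψ s 0)
    linarith
  · have h1 := hlip s hs x hx _ (hξ1 s hs)
    rw [hfix, hξ2 s hs] at h1
    have h2 : ‖x - ξ s‖ ≤ 0 := by linarith [norm_nonneg (x - ξ s)]
    exact sub_eq_zero.1 (norm_le_zero_iff.1 h2)
  · have hkey : ∀ r ∈ Ioo (-ε) ε, ‖ξ r - ξ s‖ ≤ 2 * ‖Ψ r (ξ s) - Ψ s (ξ s)‖ := fun r hr ↦ by
      have h1 := hlip r hr _ (hξ1 r hr) _ (hξ1 s hs)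
      have h2 : ‖ξ r - ξ s‖ ≤ ‖Ψ r (ξ r) - Ψ r (ξ s)‖ + ‖Ψ r (ξ s) - Ψ s (ξ s)‖ := by
        rw [hξ2 r hr]
        have h3 := norm_sub_le_norm_sub_add_norm_sub (ξ r) (Ψ r (ξ s)) (ξ s)
        have h4 := hξ2 s hs
        rwa [h4]
      linarith
    have hlim : Tendsto (fun r ↦ 2 * ‖Ψ r (ξ s) - Ψ s (ξ s)‖) (𝓝[Ioo (-ε) ε] s) (𝓝 0) := by
      have h1 := hcont _ (hξ1 s hs) s hs
      have h2 := ((h1.sub_const (Ψ s (ξ s))).norm).const_mul 2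
      have h3 : 2 * ‖Ψ s (ξ s) - Ψ s (ξ s)‖ = 0 := by simp
      rw [← h3]
      exact h2
    rw [ContinuousWithinAt, tendsto_iff_norm_sub_tendsto_zero]
    refine squeeze_zero' (Eventually.of_forall fun _ ↦ norm_nonneg _) ?_ hlim
    filter_upwards [self_mem_nhdsWithin] with r hr using hkey r hr

/-- The map `𝒩` vanishes at `0` and is small of second order there. -/
structure QuadraticAt {X : Type*} [NormedAddCommGroup X] (𝒩 : X → X) (C : ℝ) : Prop where
  nonneg : 0 ≤ C
  continuous : Continuous 𝒩
  zero : 𝒩 0 = 0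
  lip : ∀ (r : ℝ) (f g : X), r ≤ 1 / 2 → ‖f‖ ≤ r → ‖g‖ ≤ r → ‖𝒩 f - 𝒩 g‖ ≤ C * r * ‖f - g‖

/-- Composition with a function `ν` that vanishes to second order at `0`. -/
lemma quadraticAt_comp {Y : Type*} [TopologicalSpace Y] [CompactSpace Y] {ν : C(ℝ, ℝ)} {C : ℝ}
    (hC : 0 ≤ C) (h0 : ν 0 = 0)
    (h : ∀ r x y : ℝ, r ≤ 1 / 2 → |x| ≤ r → |y| ≤ r → |ν x - ν y| ≤ C * r * |x - y|) :
    QuadraticAt (fun f : C(Y, ℝ) ↦ ν.comp f) C where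
  nonneg := hC
  continuous := ν.continuous_postcomp
  zero := by ext y; exact h0
  lip r f g hr hf hg := by
    have hr0 : 0 ≤ r := (norm_nonneg f).trans hf
    refine (ContinuousMap.norm_le _ (by positivity)).2 fun y ↦ ?_
    refine (h r (f y) (g y) hr ((f.norm_coe_le_norm y).trans hf)
      ((g.norm_coe_le_norm y).trans hg)).trans ?_
    gcongr
    exact (f - g).norm_coe_le_norm y

variable {X : Type*} [NormedAddCommGroup X] [NormedSpace ℝ X]

lemma QuadraticAt.norm_le {X : Type*} [NormedAddCommGroup X] {𝒩 : X → X} {C r : ℝ}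
    (hν : QuadraticAt 𝒩 C) (hr : r ≤ 1 / 2)
    {f : X} (hf : ‖f‖ ≤ r) : ‖𝒩 f‖ ≤ C * r * ‖f‖ := by
  have h1 := hν.lip r f 0 hr hf (by simpa using (norm_nonneg f).trans hf)
  rwa [hν.zero, sub_zero, sub_zero] at h1

/-- The operator pencil `A₀ - a(t) A₁ - b(t) A₂`. -/
def pencil (A₀ A₁ A₂ : X →L[ℝ] X) (a b : ℝ → ℝ) (t : ℝ) : X →L[ℝ] X :=
  A₀ - a t • A₁ - b t • A₂

variable {A₀ A₁ A₂ J : X →L[ℝ] X} {a b : ℝ → ℝ} {τ a' b' C : ℝ} {𝒩 : X → X}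

/-- Along small solutions, the linearization at the base point is small relative to the solution. -/
lemma exists_norm_pencil_le (ha : ContinuousAt a τ) (hb : ContinuousAt b τ)
    (hν : QuadraticAt 𝒩 C) {η : ℝ} (hη : 0 < η) :
    ∃ δ, 0 < δ ∧ ∀ (g : X) (r β : ℝ), ‖g‖ < δ → |r - τ| < δ → |β| ≤ |b r| →
      pencil A₀ A₁ A₂ a b r g + β • 𝒩 (J g) = 0 → ‖pencil A₀ A₁ A₂ a b τ g‖ ≤ η * ‖g‖ := by
  have hC := hν.nonneg
  set N := ‖A₁‖ + ‖A₂‖ + 1 with hN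
  have hN0 : 0 < N := by positivity
  obtain ⟨δ₁, hδ₁, h1⟩ := Metric.continuousAt_iff.1 ha (η / (4 * N)) (by positivity)
  obtain ⟨δ₂, hδ₂, h2⟩ := Metric.continuousAt_iff.1 hb (η / (4 * N)) (by positivity)
  obtain ⟨δ₃, hδ₃, h3⟩ := Metric.continuousAt_iff.1 hb 1 one_pos
  set B := |b τ| + 1 with hB
  have hB0 : 0 < B := by positivity
  set q := ‖J‖ + 1 with hq
  have hq0 : 0 < q := by positivity
  refine ⟨min (min δ₁ δ₂) (min δ₃ (min (1 / (2 * q)) (η / (2 * (B * (C + 1) * q * q))))),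
    by positivity, fun g r β hg hr hβ heq ↦ ?_⟩
  simp only [lt_min_iff] at hg hr
  have e1 := (h1 hr.1.1).le
  have e2 := (h2 hr.1.2).le
  have e3 := h3 hr.2.1
  rw [dist_eq] at e1 e2 e3
  have e4 : |β| ≤ B := by
    have := abs_sub_abs_le_abs_sub (b r) (b τ)
    linarith
  have hJ : ‖J g‖ ≤ q * ‖g‖ := (J.le_opNorm g).trans (by gcongr; linarith)
  have hJ' : q * ‖g‖ ≤ 1 / 2 := by
    have := hg.2.2.1.le
    rw [le_div_iff₀ (by positivity)] at this
    linarith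
  have e5 := hν.norm_le hJ' hJ
  have e6 : pencil A₀ A₁ A₂ a b τ g =
      (a r - a τ) • A₁ g + (b r - b τ) • A₂ g - β • 𝒩 (J g) := by
    have : pencil A₀ A₁ A₂ a b τ g = pencil A₀ A₁ A₂ a b r g + (a r - a τ) • A₁ g +
      (b r - b τ) • A₂ g := by
      simp only [pencil, _root_.sub_apply, _root_.smul_apply, sub_smul]
      abel
    rw [this, eq_neg_of_add_eq_zero_left heq]
    abel
  have e7 : ‖(a r - a τ) • A₁ g‖ ≤ η / 4 * ‖g‖ := by
    rw [norm_smul, norm_eq_abs]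
    calc _ ≤ η / (4 * N) * (N * ‖g‖) := by
          gcongr
          refine (A₁.le_opNorm g).trans ?_
          gcongr
          rw [hN]; linarith [norm_nonneg A₂]
      _ = _ := by field_simp
  have e8 : ‖(b r - b τ) • A₂ g‖ ≤ η / 4 * ‖g‖ := by
    rw [norm_smul, norm_eq_abs]
    calc _ ≤ η / (4 * N) * (N * ‖g‖) := by
          gcongr
          refine (A₂.le_opNorm g).trans ?_
          gcongr
          rw [hN]; linarith [norm_nonneg A₁]
      _ = _ := by field_simp
  have e9 : ‖β • 𝒩 (J g)‖ ≤ η / 2 * ‖g‖ := by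
    rw [norm_smul, norm_eq_abs]
    have hgs := hg.2.2.2.le
    rw [le_div_iff₀ (by positivity)] at hgs
    calc _ ≤ B * ((C + 1) * (q * ‖g‖) * (q * ‖g‖)) := by
          gcongr
          refine e5.trans ?_
          gcongr
          linarith
      _ = (‖g‖ * (2 * (B * (C + 1) * q * q))) / 2 * ‖g‖ := by ring
      _ ≤ _ := by gcongr
  rw [e6]
  calc _ ≤ ‖(a r - a τ) • A₁ g‖ + ‖(b r - b τ) • A₂ g‖ + ‖β • 𝒩 (J g)‖ :=
        (norm_sub_le _ _).trans (by gcongr; exact norm_add_le _ _)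
    _ ≤ _ := by linarith

/-- No bifurcation where the linearization is invertible. -/
lemma exists_eq_zero_of_isUnit (ha : ContinuousAt a τ) (hb : ContinuousAt b τ)
    (hν : QuadraticAt 𝒩 C) (hu : IsUnit (pencil A₀ A₁ A₂ a b τ)) :
    ∃ δ, 0 < δ ∧ ∀ (g : X) (r : ℝ), ‖g‖ < δ → |r - τ| < δ →
      pencil A₀ A₁ A₂ a b r g + b r • 𝒩 (J g) = 0 → g = 0 := by
  obtain ⟨V, hV⟩ := hu.exists_left_inv
  obtain ⟨δ, hδ, h⟩ := exists_norm_pencil_le (A₀ := A₀) (A₁ := A₁) (A₂ := A₂) (J := J) ha hb hν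
    (η := 1 / (2 * (‖V‖ + 1))) (by positivity)
  refine ⟨δ, hδ, fun g r hg hr heq ↦ ?_⟩
  have h1 := h g r (b r) hg hr le_rfl heq
  have h2 : V (pencil A₀ A₁ A₂ a b τ g) = g := DFunLike.congr_fun hV g
  have h3 := V.le_opNorm (pencil A₀ A₁ A₂ a b τ g)
  rw [h2] at h3
  have h4 : ‖g‖ ≤ 1 / 2 * ‖g‖ := by
    calc ‖g‖ ≤ (‖V‖ + 1) * (1 / (2 * (‖V‖ + 1)) * ‖g‖) := h3.trans (by gcongr; linarith)
      _ = _ := by field_simp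
  exact norm_le_zero_iff.1 (by linarith [norm_nonneg g])

set_option maxHeartbeats 1000000 in
/-- Bifurcation from a simple eigenvalue: the nontrivial zeros of
`A(t) g + b(t) 𝒩(J g)` near `(0, τ)` form a curve tangent to the kernel `ℝ e` of `A(τ)`, provided
that the linear functional `ℓ` normalizes `e` and the operator `A(τ) + ℓ(·) A'(τ) e` is invertible. -/
theorem exists_branch [CompleteSpace X] (ha : HasStrictDerivAt a a' τ)
    (hb : HasStrictDerivAt b b' τ)
    (hν : QuadraticAt 𝒩 C) {e : X} {ℓ : X →L[ℝ] ℝ} (hℓ : ℓ e = 1)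
    (he : pencil A₀ A₁ A₂ a b τ e = 0)
    (hB : IsUnit (pencil A₀ A₁ A₂ a b τ + ℓ.smulRight (-(a' • A₁ e) - b' • A₂ e))) :
    ∃ (ε M : ℝ) (g : ℝ → X) (T : ℝ → ℝ), 0 < ε ∧ 0 ≤ M ∧ g 0 = 0 ∧ T 0 = τ ∧
      (∀ s ∈ Ioo (-ε) ε, pencil A₀ A₁ A₂ a b (T s) (g s) + b (T s) • 𝒩 (J (g s)) = 0 ∧
        ℓ (g s) = s ∧ ‖g s - s • e‖ ≤ M * s ^ 2 ∧ |T s - τ| ≤ M * |s|) ∧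
      ContinuousOn g (Ioo (-ε) ε) ∧ ContinuousOn T (Ioo (-ε) ε) ∧
      ∀ ε' : ℝ, 0 < ε' → ε' ≤ ε → ∃ δ, 0 < δ ∧ ∀ (f : X) (r : ℝ), f ≠ 0 → ‖f‖ < δ →
        |r - τ| < δ → pencil A₀ A₁ A₂ a b r f + b r • 𝒩 (J f) = 0 →
        ℓ f ∈ Ioo (-ε') ε' ∧ ℓ f ≠ 0 ∧ g (ℓ f) = f ∧ T (ℓ f) = r := by
  have hC := hν.nonneg
  set A := pencil A₀ A₁ A₂ a b with hA
  set B := A τ + ℓ.smulRight (-(a' • A₁ e) - b' • A₂ e) with hBdef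
  obtain ⟨V, hVB⟩ := hB.exists_left_inv
  obtain ⟨V', hBV'⟩ := hB.exists_right_inv
  have hV1 : ∀ x, V (B x) = x := fun x ↦ DFunLike.congr_fun hVB x
  have hVinj : ∀ x, V x = 0 → x = 0 := fun x hx ↦ by
    have h1 : B (V' x) = x := DFunLike.congr_fun hBV' x
    have h2 := hV1 (V' x)
    rw [h1, hx] at h2
    rw [← h1, ← h2, map_zero]
  -- the ansatz `g = s (e + ξ - ℓ(ξ) e)`, `t = τ + ℓ(ξ)`
  set G : X → X := fun ξ ↦ e + ξ - ℓ ξ • e with hG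
  have hGsub : ∀ x y, G x - G y = (x - y) - ℓ (x - y) • e := fun x y ↦ by
    simp only [hG, map_sub, sub_smul]; abel
  have hℓG : ∀ x, ℓ (G x) = 1 := fun x ↦ by simp [hG, hℓ]
  set F : X → X := fun ξ ↦ A (τ + ℓ ξ) (G ξ) with hF
  have hGd : HasStrictFDerivAt G (ContinuousLinearMap.id ℝ _ - ℓ.smulRight e) 0 := by
    have h1 : HasStrictFDerivAt (fun ξ : X ↦ ℓ.smulRight e ξ) (ℓ.smulRight e) 0 :=
      (ℓ.smulRight e).hasStrictFDerivAt
    exact ((hasStrictFDerivAt_id (0 : X)).const_add e).sub h1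
  have hG0 : G 0 = e := by simp [hG]
  have hcoef : ∀ (c : ℝ → ℝ) (c' : ℝ), HasStrictDerivAt c c' τ →
      HasStrictFDerivAt (fun ξ : X ↦ c (τ + ℓ ξ)) (c' • ℓ) 0 := fun c c' hc ↦ by
    have h1 : HasStrictFDerivAt (fun ξ : X ↦ τ + ℓ ξ) ℓ 0 :=
      (ℓ.hasStrictFDerivAt).const_add τ
    have h2 : HasStrictDerivAt c c' (τ + ℓ 0) := by simpa using hc
    exact h2.comp_hasStrictFDerivAt 0 h1
  -- the bordered operator `B` is the derivative of the linear part of the ansatz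
  have hFd : HasStrictFDerivAt F B 0 := by
    have h0 := A₀.hasStrictFDerivAt.comp (0 : X) hGd
    have h1 := (hcoef a a' ha).smul (A₁.hasStrictFDerivAt.comp (0 : X) hGd)
    have h2 := (hcoef b b' hb).smul (A₂.hasStrictFDerivAt.comp (0 : X) hGd)
    refine ((h0.sub h1).sub h2).congr_fderiv ?_
    ext1 ξ
    have h3 : A₀ e = a τ • A₁ e + b τ • A₂ e := by
      have h4 : A₀ e - a τ • A₁ e - b τ • A₂ e = 0 := he
      rw [sub_sub, sub_eq_zero] at h4
      exact h4
    simp only [hBdef, hA, pencil, _root_.sub_apply, _root_.add_apply,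
      _root_.smul_apply, ContinuousLinearMap.comp_apply, hG0,
      ContinuousLinearMap.smulRight_apply, ContinuousLinearMap.id_apply, map_zero, add_zero,
      map_sub, map_smul, h3]
    simp only [smul_sub, smul_add, smul_neg, smul_smul, smul_eq_mul, mul_comm]
    abel
  set ℓn := ‖ℓ‖ + 1 with hℓn
  have hℓ0 : 0 < ℓn := by positivity
  have hℓle : ∀ x, |ℓ x| ≤ ℓn * ‖x‖ := fun x ↦ (ℓ.le_opNorm x).trans (by gcongr; linarith)
  set k := 1 + ℓn * ‖e‖ with hk
  have hk0 : 0 < k := by positivity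
  have hGlip : ∀ x y, ‖G x - G y‖ ≤ k * ‖x - y‖ := fun x y ↦ by
    rw [hGsub]
    refine (norm_sub_le _ _).trans ?_
    rw [norm_smul, norm_eq_abs, hk]
    have := mul_le_mul_of_nonneg_right (hℓle (x - y)) (norm_nonneg e)
    linarith
  set Vn := ‖V‖ + 1 with hVn
  have hVn0 : 0 < Vn := by positivity
  have hVle : ∀ x, ‖V x‖ ≤ Vn * ‖x‖ := fun x ↦ (V.le_opNorm x).trans (by gcongr; linarith)
  -- the radius on which the linear part is close to its derivative
  obtain ⟨ρ₁, hρ₁, hFρ⟩ : ∃ ρ, 0 < ρ ∧ ∀ x, ‖x‖ ≤ ρ → ∀ y, ‖y‖ ≤ ρ →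
      ‖F x - F y - B (x - y)‖ ≤ 1 / (4 * Vn) * ‖x - y‖ := by
    obtain ⟨s, hs, h1⟩ := hFd.approximates_deriv_on_nhds (c := (1 / (4 * Vn)).toNNReal)
      (Or.inr (by rw [Real.toNNReal_pos]; positivity))
    obtain ⟨ρ, hρ, hsub⟩ := Metric.nhds_basis_closedBall.mem_iff.1 hs
    refine ⟨ρ, hρ, fun x hx y hy ↦ ?_⟩
    have h2 := h1 (x := x) (hsub (by simpa using hx)) (y := y) (hsub (by simpa using hy))
    rwa [coe_toNNReal _ (by positivity)] at h2
  obtain ⟨ρ₂, hρ₂, L, hL0, hbρ⟩ : ∃ ρ, 0 < ρ ∧ ∃ L, 0 < L ∧ ∀ x, ‖x‖ ≤ ρ →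
      |b (τ + ℓ x)| ≤ L ∧ ∀ y, ‖y‖ ≤ ρ → |b (τ + ℓ x) - b (τ + ℓ y)| ≤ L * ‖x - y‖ := by
    obtain ⟨L, s, hs, h1⟩ := (hcoef b b' hb).exists_lipschitzOnWith
    obtain ⟨ρ, hρ, hsub⟩ := Metric.nhds_basis_closedBall.mem_iff.1 hs
    have h2 : ∀ x, ‖x‖ ≤ ρ → ∀ y, ‖y‖ ≤ ρ → |b (τ + ℓ x) - b (τ + ℓ y)| ≤ L * ‖x - y‖ :=
      fun x hx y hy ↦ by
        have := h1.dist_le_mul x (hsub (by simpa using hx)) y (hsub (by simpa using hy))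
        rwa [dist_eq_norm, dist_eq_norm, norm_eq_abs] at this
    refine ⟨ρ, hρ, |b τ| + L * ρ + L + 1, by positivity, fun x hx ↦ ⟨?_, fun y hy ↦ ?_⟩⟩
    · have h3 := h2 x hx 0 (by simpa using hρ.le)
      simp only [map_zero, add_zero, sub_zero] at h3
      have h4 := abs_sub_abs_le_abs_sub (b (τ + ℓ x)) (b τ)
      have h5 : (L : ℝ) * ‖x‖ ≤ L * ρ := by gcongr
      have := L.2
      linarith [L.coe_nonneg]
    · refine (h2 x hx y hy).trans ?_
      gcongr
      have : 0 ≤ |b τ| + L * ρ := by positivity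
      linarith
  set ρ := min ρ₁ (min ρ₂ 1) with hρdef
  have hρ : 0 < ρ := by positivity
  -- size of `J G` on the ball
  set m := (‖J‖ + 1) * (‖e‖ + k) with hm
  have hm0 : 0 < m := by positivity
  have hGn : ∀ x, ‖x‖ ≤ ρ → ‖G x‖ ≤ ‖e‖ + k := fun x hx ↦ by
    have h1 := hGlip x 0
    rw [hG0, sub_zero] at h1
    have h2 := norm_le_norm_add_norm_sub' (G x) e
    have h3 : ‖x‖ ≤ 1 := hx.trans ((min_le_right _ _).trans (min_le_right _ _))
    have h4 : k * ‖x‖ ≤ k * 1 := by gcongr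
    linarith
  have hJle : ∀ x, ‖J x‖ ≤ (‖J‖ + 1) * ‖x‖ := fun x ↦ (J.le_opNorm x).trans (by gcongr; linarith)
  have hJG : ∀ x, ‖x‖ ≤ ρ → ‖J (G x)‖ ≤ m := fun x hx ↦
    (hJle _).trans (by rw [hm]; gcongr; exact hGn x hx)
  -- the rescaled nonlinearity
  set N : ℝ → X → X := fun s f ↦ s⁻¹ • 𝒩 (s • f) with hN
  have hNlip : ∀ s : ℝ, |s| * m ≤ 1 / 2 → ∀ f g : X, ‖f‖ ≤ m → ‖g‖ ≤ m →
      ‖N s f - N s g‖ ≤ C * m * |s| * ‖f - g‖ := fun s hs f g hf hg ↦ by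
    rcases eq_or_ne s 0 with rfl | hs0
    · simp [hN]
    · have h1 : ∀ f : X, ‖f‖ ≤ m → ‖s • f‖ ≤ |s| * m := fun f hf ↦ by
        rw [norm_smul, norm_eq_abs]; gcongr
      have h2 := hν.lip _ _ _ hs (h1 f hf) (h1 g hg)
      simp only [hN]
      rw [← smul_sub, norm_smul, norm_inv, norm_eq_abs]
      rw [← smul_sub, norm_smul, norm_eq_abs] at h2
      have hs1 : 0 < |s| := abs_pos.2 hs0
      calc _ ≤ |s|⁻¹ * (C * (|s| * m) * (|s| * ‖f - g‖)) := by gcongr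
        _ = _ := by field_simp
  have hN0 : ∀ s, N s 0 = 0 := fun s ↦ by
    simp only [hN, smul_zero]
    rw [hν.zero, smul_zero]
  have hNle : ∀ s : ℝ, |s| * m ≤ 1 / 2 → ∀ f : X, ‖f‖ ≤ m → ‖N s f‖ ≤ C * m * |s| * m :=
    fun s hs f hf ↦ by
      have h1 := hNlip s hs f 0 hf (by simpa using hm0.le)
      rw [hN0, sub_zero, sub_zero] at h1
      exact h1.trans (by gcongr)
  set Φ : ℝ → X → X := fun s x ↦ F x + b (τ + ℓ x) • N s (J (G x)) with hΦ
  set Q := L * (C * m * ((‖J‖ + 1) * k)) + L * (C * m * m) with hQ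
  have hQ0 : 0 ≤ Q := by positivity
  have hpert : ∀ s : ℝ, |s| * m ≤ 1 / 2 → ∀ x, ‖x‖ ≤ ρ → ∀ y, ‖y‖ ≤ ρ →
      ‖b (τ + ℓ x) • N s (J (G x)) - b (τ + ℓ y) • N s (J (G y))‖ ≤ Q * |s| * ‖x - y‖ :=
    fun s hs x hx y hy ↦ by
      have hρ2 : ρ ≤ ρ₂ := (min_le_right _ _).trans (min_le_left _ _)
      obtain ⟨b1, b2⟩ := hbρ x (hx.trans hρ2)
      have h1 : b (τ + ℓ x) • N s (J (G x)) - b (τ + ℓ y) • N s (J (G y)) =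
          b (τ + ℓ x) • (N s (J (G x)) - N s (J (G y))) +
            (b (τ + ℓ x) - b (τ + ℓ y)) • N s (J (G y)) := by
        rw [smul_sub, sub_smul]; abel
      have h2 : ‖J (G x) - J (G y)‖ ≤ (‖J‖ + 1) * (k * ‖x - y‖) := by
        rw [← map_sub]
        exact (hJle _).trans (by gcongr; exact hGlip x y)
      have h3 := hNlip s hs _ _ (hJG x hx) (hJG y hy)
      have h4 := hNle s hs _ (hJG y hy)
      rw [h1]
      refine (norm_add_le _ _).trans ?_
      rw [norm_smul, norm_smul, norm_eq_abs, norm_eq_abs]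
      calc _ ≤ L * (C * m * |s| * ((‖J‖ + 1) * (k * ‖x - y‖))) +
            (L * ‖x - y‖) * (C * m * |s| * m) := by
            gcongr
            · exact h3.trans (by gcongr)
            · exact b2 y (hy.trans hρ2)
        _ = _ := by rw [hQ]; ring
  -- after division by `s` the equation reads `Φ s ξ = 0`; `Ψ s` is its Newton iteration at `0`
  set Ψ : ℝ → X → X := fun s x ↦ x - V (Φ s x) with hΨ
  set M := Vn * (L * (C * m * m)) with hM
  have hM0 : 0 ≤ M := by positivity
  set ε := min (1 / (2 * m)) (min (1 / (4 * Vn * (Q + 1))) (ρ / (2 * (M + 1)))) with hεdef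
  have hε : 0 < ε := by positivity
  have hs2 : ∀ s ∈ Ioo (-ε) ε, |s| * m ≤ 1 / 2 := fun s hs ↦ by
    have : |s| ≤ 1 / (2 * m) := (abs_lt.2 hs).le.trans (min_le_left _ _)
    rw [le_div_iff₀ (by positivity)] at this
    linarith
  obtain ⟨ξ, hξ, hξc⟩ := exists_fixedPoint_family (Ψ := Ψ) (ρ := ρ) (M := M) hε hM0 (by
      have h1 : ε ≤ ρ / (2 * (M + 1)) := (min_le_right _ _).trans (min_le_right _ _)
      rw [le_div_iff₀ (by positivity)] at h1
      have h2 : ε * (2 * (M + 1)) = 2 * (M * ε) + 2 * ε := by ring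
      linarith) (fun s hs x hx y hy ↦ by
      have h1 := hFρ x (hx.trans (min_le_left _ _)) y (hy.trans (min_le_left _ _))
      have h2 := hpert s (hs2 s hs) x hx y hy
      have h3 : Ψ s x - Ψ s y = -V ((F x - F y - B (x - y)) +
          (b (τ + ℓ x) • N s (J (G x)) - b (τ + ℓ y) • N s (J (G y)))) := by
        simp only [hΨ, hΦ, map_add, map_sub, hV1]
        abel
      rw [h3, norm_neg]
      have h4 : |s| ≤ 1 / (4 * Vn * (Q + 1)) :=
        (abs_lt.2 hs).le.trans ((min_le_right _ _).trans (min_le_left _ _))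
      have h5 : Q * |s| ≤ 1 / (4 * Vn) := by
        calc Q * |s| ≤ (Q + 1) * (1 / (4 * Vn * (Q + 1))) := by gcongr; linarith
          _ = _ := by field_simp
      refine (hVle _).trans ?_
      calc _ ≤ Vn * (1 / (4 * Vn) * ‖x - y‖ + 1 / (4 * Vn) * ‖x - y‖) := by
            gcongr
            refine (norm_add_le _ _).trans (add_le_add h1 (h2.trans ?_))
            gcongr
        _ = _ := by field_simp; ring)
    (fun s hs ↦ by
      have h1 : F 0 = 0 := by simp only [hF, map_zero, add_zero, hG0, he]
      simp only [hΨ, hΦ, h1, zero_add, zero_sub, norm_neg]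
      refine (hVle _).trans ?_
      rw [norm_smul, norm_eq_abs, hM, mul_assoc]
      have h2 := hNle s (hs2 s hs) _ (hJG 0 (by simpa using hρ.le))
      have h3 := (hbρ 0 (by simpa using hρ₂.le)).1
      calc _ ≤ Vn * (L * (C * m * |s| * m)) := by gcongr
        _ = _ := by ring)
    (fun x hx s hs ↦ by
      have hNc : ContinuousWithinAt (fun s ↦ N s (J (G x))) (Ioo (-ε) ε) s := by
        rcases eq_or_ne s 0 with rfl | hs0
        · have h0 : N 0 (J (G x)) = 0 := by simp [hN]
          rw [ContinuousWithinAt, h0]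
          refine squeeze_zero_norm' (a := fun s ↦ C * m * |s| * m) ?_ ?_
          · filter_upwards [self_mem_nhdsWithin] with s hs using hNle s (hs2 s hs) _ (hJG x hx)
          · have : Continuous fun s : ℝ ↦ C * m * |s| * m := by fun_prop
            have h1 := this.tendsto 0
            simp only [abs_zero, mul_zero, zero_mul] at h1
            exact h1.mono_left nhdsWithin_le_nhds
        · refine ((continuousAt_inv₀ hs0).smul ?_).continuousWithinAt
          exact (hν.continuous.comp (continuous_id.smul continuous_const)).continuousAt
      exact continuousWithinAt_const.sub (V.continuous.continuousAt.comp_continuousWithinAt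
        (continuousWithinAt_const.add (hNc.const_smul (b (τ + ℓ x))))))
  have hscale : ∀ (s : ℝ) (x : X), s ≠ 0 → A (τ + ℓ x) (s • G x) +
      b (τ + ℓ x) • 𝒩 (J (s • G x)) = s • Φ s x := fun s x hs ↦ by
    simp only [hΦ, hF, hN, map_smul, smul_add]
    rw [smul_comm s (b _), smul_smul s s⁻¹, mul_inv_cancel₀ hs, one_smul]
  have hz : (0 : ℝ) ∈ Ioo (-ε) ε := ⟨by linarith, hε⟩
  have hξ0 : ξ 0 = 0 := by simpa using (hξ 0 hz).1
  refine ⟨ε, k * (2 * M) + ℓn * (2 * M), fun s ↦ s • G (ξ s), fun s ↦ τ + ℓ (ξ s), hε,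
    by positivity, by simp, by simp [hξ0], fun s hs ↦ ?_, ?_, ?_, fun ε' hε' hεε ↦ ?_⟩
  · obtain ⟨h1, h2, h3, -⟩ := hξ s hs
    refine ⟨?_, by rw [map_smul, hℓG, smul_eq_mul, mul_one], ?_, ?_⟩
    · rcases eq_or_ne s 0 with rfl | hs0
      · simp only [zero_smul, map_zero, zero_add]
        rw [hν.zero, smul_zero]
      · have h4 : Φ s (ξ s) = 0 := hVinj _ (by
          simp only [hΨ] at h3
          exact sub_eq_self.1 h3)
        rw [hscale s _ hs0, h4, smul_zero]
    · rw [← smul_sub, norm_smul, norm_eq_abs]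
      have h4 := hGlip (ξ s) 0
      rw [hG0, sub_zero] at h4
      calc _ ≤ |s| * (k * (2 * M * |s|)) := by gcongr; exact h4.trans (by gcongr)
        _ = k * (2 * M) * s ^ 2 := by rw [← sq_abs]; ring
        _ ≤ _ := by gcongr; have : 0 ≤ ℓn * (2 * M) := by positivity
                    linarith
    · rw [add_sub_cancel_left]
      calc _ ≤ ℓn * (2 * M * |s|) := (hℓle _).trans (by gcongr)
        _ = ℓn * (2 * M) * |s| := by ring
        _ ≤ _ := by gcongr; have : 0 ≤ k * (2 * M) := by positivity
                    linarith
  · refine continuousOn_id.smul ?_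
    simp only [hG]
    exact (continuousOn_const.add hξc).sub
      ((ℓ.continuous.comp_continuousOn hξc).smul continuousOn_const)
  · exact continuousOn_const.add (ℓ.continuous.comp_continuousOn hξc)
  · set en := ‖e‖ + 1 with hen
    have hen0 : 0 < en := by positivity
    -- conversely, the parameter of a small solution `f` is `s = ℓ f`, and `f - s e` is small
    -- relative to `s`
    set η := min (1 / (2 * (Vn * k))) (ρ / (4 * en * (Vn * k))) with hη
    obtain ⟨δ, hδ, h1⟩ := exists_norm_pencil_le (A₀ := A₀) (A₁ := A₁) (A₂ := A₂) (J := J)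
      ha.hasDerivAt.continuousAt hb.hasDerivAt.continuousAt hν (η := η) (by positivity)
    refine ⟨min δ (min (ε' / ℓn) (ρ / (2 * en))), by positivity, fun f r hf0 hf hr heq ↦ ?_⟩
    simp only [lt_min_iff] at hf hr
    have h2 := h1 f r (b r) hf.1 hr.1 le_rfl heq
    set s := ℓ f with hs
    set f₂ := f - s • e with hf₂
    have hℓf₂ : ℓ f₂ = 0 := by simp [hf₂, hℓ, hs]
    have hBf : B f₂ = A τ f := by
      have h3 : B f₂ = A τ f₂ + ℓ f₂ • (-(a' • A₁ e) - b' • A₂ e) := rfl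
      rw [h3, hℓf₂, zero_smul, add_zero, hf₂, map_sub, map_smul, he, smul_zero, sub_zero]
    have hf₂n : ‖f₂‖ ≤ Vn * (η * ‖f‖) := by
      rw [← hV1 f₂, hBf]
      exact (hVle _).trans (by gcongr)
    have hk1 : 1 ≤ k := by rw [hk]; have : 0 ≤ ℓn * ‖e‖ := by positivity
                           linarith
    have hη0 : 0 ≤ η := by positivity
    have hη1 : Vn * η ≤ 1 / 2 := by
      have : η ≤ 1 / (2 * (Vn * k)) := min_le_left _ _
      rw [le_div_iff₀ (by positivity)] at this
      have h3 : Vn * η * 1 ≤ Vn * η * k := mul_le_mul_of_nonneg_left hk1 (mul_nonneg hVn0.le hη0)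
      have h4 : η * (2 * (Vn * k)) = 2 * (Vn * η * k) := by ring
      linarith
    have hη2 : Vn * η * (2 * en) ≤ ρ / 2 := by
      have : η ≤ ρ / (4 * en * (Vn * k)) := min_le_right _ _
      rw [le_div_iff₀ (by positivity)] at this
      have h3 : Vn * η * en * 1 ≤ Vn * η * en * k :=
        mul_le_mul_of_nonneg_left hk1 (mul_nonneg (mul_nonneg hVn0.le hη0) hen0.le)
      have h4 : η * (4 * en * (Vn * k)) = 4 * (Vn * η * en * k) := by ring
      linarith
    have hfn : ‖f‖ ≤ 2 * |s| * en := by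
      have h3 : ‖f‖ ≤ ‖f₂‖ + |s| * ‖e‖ := by
        have h4 : f = f₂ + s • e := by rw [hf₂]; abel
        conv_lhs => rw [h4]
        refine (norm_add_le _ _).trans ?_
        rw [norm_smul, norm_eq_abs]
      have h5 : Vn * (η * ‖f‖) ≤ 1 / 2 * ‖f‖ := by
        rw [← mul_assoc]; gcongr
      have h6 : |s| * ‖e‖ ≤ |s| * en := by gcongr; rw [hen]; linarith
      linarith
    have hs0 : s ≠ 0 := fun h ↦ by
      rw [h] at hfn
      simp only [abs_zero, mul_zero, zero_mul] at hfn
      exact hf0 (norm_le_zero_iff.1 hfn)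
    have hsε : s ∈ Ioo (-ε') ε' := by
      refine abs_lt.1 ((hℓle f).trans_lt ?_)
      have := hf.2.1
      rw [lt_div_iff₀ hℓ0] at this
      linarith
    have hsε' : s ∈ Ioo (-ε) ε := ⟨by linarith [hsε.1], by linarith [hsε.2]⟩
    -- recover `ξ` from the solution
    set x := s⁻¹ • f₂ + (r - τ) • e with hx
    have hℓx : ℓ x = r - τ := by simp [hx, hℓf₂, hℓ]
    have hGx : s • G x = f := by
      have h3 : G x = e + (s⁻¹ • f₂ + (r - τ) • e) - (r - τ) • e := by
        simp only [hG]
        rw [hℓx]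
      rw [h3, show e + (s⁻¹ • f₂ + (r - τ) • e) - (r - τ) • e = e + s⁻¹ • f₂ by abel,
        smul_add, smul_smul,
        mul_inv_cancel₀ hs0, one_smul, hf₂]
      abel
    have hxn : ‖x‖ ≤ ρ := by
      refine (norm_add_le _ _).trans ?_
      rw [norm_smul, norm_smul, norm_inv, norm_eq_abs, norm_eq_abs]
      have hsp : 0 < |s| := abs_pos.2 hs0
      have h3 : |s|⁻¹ * ‖f₂‖ ≤ ρ / 2 := by
        calc _ ≤ |s|⁻¹ * (Vn * (η * (2 * |s| * en))) := by gcongr; exact hf₂n.trans (by gcongr)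
          _ = Vn * η * (2 * en) := by field_simp
          _ ≤ _ := hη2
      have h4 : |r - τ| * ‖e‖ ≤ ρ / 2 := by
        have h5 := hr.2.2.le
        rw [le_div_iff₀ (by positivity)] at h5
        have h6 : |r - τ| * ‖e‖ ≤ |r - τ| * en := by gcongr; rw [hen]; linarith
        linarith
      linarith
    have hτ : τ + ℓ x = r := by rw [hℓx]; ring
    have hΦx : Φ s x = 0 := by
      have h3 := hscale s x hs0
      rw [hτ, hGx, heq] at h3
      exact (smul_eq_zero.1 h3.symm).resolve_left hs0
    have hxξ : x = ξ s := (hξ s hsε').2.2.2 x hxn (by simp only [hΨ, hΦx, map_zero, sub_zero])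
    refine ⟨hsε, hs0, ?_, ?_⟩
    · simp only []
      rw [← hxξ, hGx]
    · simp only []
      rw [← hxξ, hτ]

end Bifurcation


/-! ### The linearization at the trivial solutions -/

section Linearization

variable {D : ℝ} {m₀ m₁ : ℕ} {K κ h : ℝ → ℝ} {hp : Profile D m₀ m₁ K κ h}
  {P : C(Icc 0 D, ℝ) →L[ℝ] ℝ} {E S : C(Icc 0 D, ℝ) →L[ℝ] C(Icc 0 D, ℝ)} {μ α β : ℝ}
  {f g u v w y z : C(Icc 0 D, ℝ)}

lemma LRel.comb {hD : 0 < D} (hu : LRel hD h u f) (hv : LRel hD h v g) (a b : ℝ) :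
    LRel hD h (a • u + b • v) (a • f + b • g) := by
  obtain ⟨u₁, u₂, hu⟩ := hu
  obtain ⟨v₁, v₂, hv⟩ := hv
  exact ⟨_, _, hu.add hv a b⟩

lemma LRel.unique_right {hD : 0 < D} (hu : LRel hD h u f) (hv : LRel hD h u g) : f = g := by
  obtain ⟨u₁, u₂, hu⟩ := hu
  obtain ⟨v₁, v₂, hv⟩ := hv
  obtain ⟨e1, e2⟩ := hu.unique_right hD hv
  refine ext_injOn_Ioo (hD := hD) fun t ht ↦ ?_
  rw [hu.eq t ht, hv.eq t ht, e1 (Ioo_subset_Icc_self ht), e2 (Ioo_subset_Icc_self ht)]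

lemma lrel_zero (hD : 0 < D) : LRel hD h 0 0 :=
  ⟨_, _, (LSol.const (D := D) (h := h) 0).congr (fun _ _ ↦ rfl) fun _ _ ↦ rfl⟩

lemma Profile.eq_zero_of_pos (hp : Profile D m₀ m₁ K κ h) (hu : LRel hp.D_pos h u (μ • u))
    (hμ : 0 < μ) : u = 0 := by
  obtain ⟨u₁, u₂, hu⟩ := hu
  exact ext_injOn (hD := hp.D_pos) fun t ht ↦ hp.eigenvalue_nonpos hu hμ t ht

/-- The eigenspaces of `L` are one-dimensional. -/
lemma Profile.eq_smul_of_eigen (hp : Profile D m₀ m₁ K κ h) (hv : LRel hp.D_pos h v (μ • v))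
    (hμ : μ ≠ 0) (hv0 : v ≠ 0) (hu : LRel hp.D_pos h u (μ • u)) : ∃ c : ℝ, u = c • v := by
  have hD := hp.D_pos
  have hz : (0 : ℝ) ∈ Icc 0 D := ⟨le_rfl, hD.le⟩
  have hne : ext hD v 0 ≠ 0 := fun h0 ↦ hv0 (by
    obtain ⟨v₁, v₂, hv⟩ := hv
    exact ext_injOn (hD := hD) fun t ht ↦ hp.eigenfunction_unique hv hμ h0 t ht)
  set c := ext hD u 0 / ext hD v 0 with hc
  refine ⟨c, ?_⟩
  have h1 : LRel hD h (u - c • v) (μ • (u - c • v)) := by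
    have h2 := hu.comb hv 1 (-c)
    rw [one_smul, one_smul, neg_smul, ← sub_eq_add_neg] at h2
    refine h2.congr_right ?_
    rw [smul_sub, smul_comm μ c, neg_smul, sub_eq_add_neg]
  have h3 : ext hD (u - c • v) 0 = 0 := by
    rw [ext_sub, ext_smul]
    simp only [hc]
    rw [div_mul_cancel₀ _ hne, sub_self]
  obtain ⟨w₁, w₂, hw⟩ := h1
  refine sub_eq_zero.1 (ext_injOn (hD := hD) fun t ht ↦ ?_)
  exact hp.eigenfunction_unique hw hμ h3 t ht

namespace ResolventData

lemma P_eigen (hR : ResolventData hp P E S) (hv : LRel hp.D_pos h v (μ • v)) (hμ : μ ≠ 0) :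
    P v = 0 := by
  have h1 := hR.P_eq_zero hv
  rw [map_smul, smul_eq_mul] at h1
  exact (mul_eq_zero.1 h1).resolve_left hμ

lemma S_eigen (hR : ResolventData hp P E S) (hv : LRel hp.D_pos h v (μ • v)) (hμ : μ ≠ 0) :
    μ • S v = v := by
  have h1 := hR.eq_S _ _ hv
  rw [hR.P_eigen hv hμ, zero_smul, sub_zero, map_smul] at h1
  exact h1.symm

lemma eq_zero_of_S (hR : ResolventData hp P E S) (hf : S f = 0) : f = 0 := by
  have h1 := hR.mean_S f
  rw [hf, map_zero] at h1
  have h2 := hR.rel f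
  rw [hf, neg_eq_zero.1 h1.symm, zero_smul, sub_zero] at h2
  exact h2.unique_right (lrel_zero _)

/-- `L` is symmetric with respect to the weighted mean of products. -/
lemma P_symm (hR : ResolventData hp P E S) (hu : LRel hp.D_pos h u f) (hv : LRel hp.D_pos h v g) :
    P (f * v) = P (u * g) := by
  obtain ⟨u₁, u₂, hu⟩ := hu
  obtain ⟨v₁, v₂, hv⟩ := hv
  refine mul_right_cancel₀ hp.weight_integral_pos.ne' ?_
  rw [hR.mean, hR.mean]
  exact hp.integral_symm hu hv

lemma P_sq_pos (hR : ResolventData hp P E S) (hv : v ≠ 0) : 0 < P (v * v) := by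
  by_contra! hle
  refine hv (ext_injOn (hD := hp.D_pos) fun t ht ↦ ?_)
  refine hp.integral_sq_eq_zero (continuousOn_ext v) ?_ t ht
  have h1 := hR.mean (v * v)
  have h2 := mul_nonpos_of_nonpos_of_nonneg hle hp.weight_integral_pos.le
  rw [h1] at h2
  exact h2

/-- The operator `g ↦ L² w - α L w - β w`, where `w = S² g`. -/
noncomputable def _root_.PaneitzBifurcation.linOp (P : C(Icc 0 D, ℝ) →L[ℝ] ℝ)
    (S : C(Icc 0 D, ℝ) →L[ℝ] C(Icc 0 D, ℝ)) (α β : ℝ) : C(Icc 0 D, ℝ) →L[ℝ] C(Icc 0 D, ℝ) :=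
  1 - P.smulRight 1 - α • (S + P.smulRight 1) - β • (S ∘L S)

lemma _root_.PaneitzBifurcation.linOp_apply : linOp P S α β g =
    g - P g • 1 - α • (S g + P g • 1) - β • S (S g) := rfl

lemma isUnit_linOp_add (hR : ResolventData hp P E S) (ℓ : C(Icc 0 D, ℝ) →L[ℝ] ℝ)
    (hinj : ∀ f, linOp P S α β f + ℓ f • z = 0 → f = 0) :
    IsUnit (linOp P S α β + ℓ.smulRight z) := by
  have hrank : ∀ (k : C(Icc 0 D, ℝ) →L[ℝ] ℝ) (x : C(Icc 0 D, ℝ)),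
      IsCompactOperator (k.smulRight x) := fun k x ↦ by
    have h1 : IsCompactOperator k :=
      isCompactOperator_of_locallyCompactSpace_dom k
    exact h1.clm_comp (ContinuousLinearMap.toSpanSingleton ℝ x)
  have hc : IsCompactOperator (P.smulRight 1 + α • (S + P.smulRight 1) + β • (S ∘L S) -
      ℓ.smulRight z : C(Icc 0 D, ℝ) →L[ℝ] C(Icc 0 D, ℝ)) :=
    (((hrank P 1).add ((hR.compact.add (hrank P 1)).smul α)).add
      ((hR.compact.comp_clm S).smul β)).sub (hrank ℓ z)
  have h1 : linOp P S α β + ℓ.smulRight z = 1 - (P.smulRight 1 + α • (S + P.smulRight 1) +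
      β • (S ∘L S) - ℓ.smulRight z) := by
    rw [linOp]; abel
  rw [h1]
  refine isUnit_one_sub_of_injective hc fun x hx ↦ hinj x ?_
  have h2 := DFunLike.congr_fun h1 x
  rw [sub_apply, hx] at h2
  exact h2.trans (sub_self x)

/-- The factorization `L² - α L - β = (L - μ) (L - μ')`. -/
lemma lrel_factor (hR : ResolventData hp P E S) {μ' : ℝ} (hα : α = μ + μ') (hβ : β = -(μ * μ'))
    (hg : linOp P S α β g = 0) : LRel hp.D_pos h (S g + P g • 1 - μ' • S (S g))
      (μ • (S g + P g • 1 - μ' • S (S g))) := by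
  have h1 := (hR.lrel_S_add' g).comb (hR.lrel_S_add g) 1 (-μ')
  rw [one_smul, one_smul, neg_smul, neg_smul, ← sub_eq_add_neg] at h1
  refine h1.congr_right ?_
  rw [linOp_apply, hα, hβ] at hg
  have h2 : g - P g • 1 = (μ + μ') • (S g + P g • 1) - (μ * μ') • S (S g) := by
    rw [sub_sub, sub_eq_zero] at hg
    rw [hg, neg_smul]
    abel
  rw [h2, smul_sub, smul_smul, add_smul]
  abel

lemma eq_zero_of_factor (hR : ResolventData hp P E S) {μ' : ℝ} (hμ' : 0 < μ')
    (hg : S g + P g • 1 - μ' • S (S g) = 0) : g = 0 := by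
  have h1 := hR.lrel_S_add g
  rw [sub_eq_zero.1 hg] at h1
  exact hR.eq_zero_of_S (hR.eq_zero_of_S (hp.eq_zero_of_pos h1 hμ'))

lemma isUnit_linOp (hR : ResolventData hp P E S) {μ' : ℝ} (hμ' : 0 < μ') (hα : α = μ + μ')
    (hβ : β = -(μ * μ')) (hμ : ∀ v, LRel hp.D_pos h v (μ • v) → v = 0) :
    IsUnit (linOp P S α β) := by
  have h1 := hR.isUnit_linOp_add (α := α) (β := β) (z := 0) 0 fun f hf ↦ by
    rw [smul_zero, add_zero] at hf
    exact hR.eq_zero_of_factor hμ' (hμ _ (hR.lrel_factor hα hβ hf))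
  have h2 : (0 : C(Icc 0 D, ℝ) →L[ℝ] ℝ).smulRight (0 : C(Icc 0 D, ℝ)) = 0 := by
    ext; simp
  rwa [h2, add_zero] at h1

section Kernel

variable {μ' : ℝ}

lemma S_S_eigen (hR : ResolventData hp P E S) (hv : LRel hp.D_pos h v (μ • v)) (hμ : μ ≠ 0) :
    S (S (μ ^ 2 • v)) = v := by
  rw [map_smul, map_smul, pow_two, mul_smul, ← map_smul S μ (S v), hR.S_eigen hv hμ,
    hR.S_eigen hv hμ]

lemma linOp_eigen (hR : ResolventData hp P E S) (hv : LRel hp.D_pos h v (μ • v)) (hμ : μ ≠ 0)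
    (hα : α = μ + μ') (hβ : β = -(μ * μ')) : linOp P S α β (μ ^ 2 • v) = 0 := by
  have h1 : S (μ ^ 2 • v) = μ • v := by
    rw [map_smul, pow_two, mul_smul, hR.S_eigen hv hμ]
  rw [linOp_apply, hR.S_S_eigen hv hμ, h1, map_smul, hR.P_eigen hv hμ, hα, hβ, smul_zero, zero_smul,
    sub_zero, add_zero, smul_smul, ← sub_smul, ← sub_smul]
  have : μ ^ 2 - (μ + μ') * μ - -(μ * μ') = 0 := by ring
  rw [this, zero_smul]

/-- The kernel of the linearization is spanned by the eigenfunction. -/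
lemma eq_smul_of_linOp (hR : ResolventData hp P E S) (hv : LRel hp.D_pos h v (μ • v)) (hμ : μ < 0)
    (hμ' : 0 < μ') (hv0 : v ≠ 0) (hα : α = μ + μ') (hβ : β = -(μ * μ'))
    (hg : linOp P S α β g = 0) : ∃ c : ℝ, g = c • μ ^ 2 • v := by
  obtain ⟨c, hc⟩ := hp.eq_smul_of_eigen hv hμ.ne hv0 (hR.lrel_factor hα hβ hg)
  have hne : μ - μ' ≠ 0 := by linarith
  refine ⟨c / (μ - μ'), sub_eq_zero.1 (hR.eq_zero_of_factor hμ' ?_)⟩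
  have h1 : S (μ ^ 2 • v) = μ • v := by
    rw [map_smul, pow_two, mul_smul, hR.S_eigen hv hμ.ne]
  have h2 : P (μ ^ 2 • v) = 0 := by rw [map_smul, hR.P_eigen hv hμ.ne, smul_zero]
  have h3 : S (g - (c / (μ - μ')) • μ ^ 2 • v) = S g - (c / (μ - μ')) • μ • v := by
    rw [map_sub, map_smul, h1]
  have h4 : S (μ • v) = v := by rw [map_smul, hR.S_eigen hv hμ.ne]
  rw [h3, map_sub, map_sub, map_smul S, h4, map_smul P, h2, smul_zero, sub_zero]
  have h5 : S g - (c / (μ - μ')) • μ • v + P g • 1 - μ' • (S (S g) - (c / (μ - μ')) • v) =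
      (S g + P g • 1 - μ' • S (S g)) - (c / (μ - μ') * (μ - μ')) • v := by
    rw [smul_sub, mul_sub, sub_smul, smul_smul, smul_smul, mul_comm μ' (c / _)]
    abel
  rw [h5, hc, div_mul_cancel₀ _ hne, sub_self]

/-- The range of the linearization is orthogonal to the eigenfunction. -/
lemma P_linOp_mul (hR : ResolventData hp P E S) (hv : LRel hp.D_pos h v (μ • v))
    (hα : α = μ + μ') (hβ : β = -(μ * μ')) : P (linOp P S α β g * v) = 0 := by
  have h1 := hR.P_symm (hR.lrel_S_add g) hv
  have h2 := hR.P_symm (hR.lrel_S_add' g) hv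
  rw [mul_smul_comm, map_smul, smul_eq_mul] at h1 h2
  rw [linOp_apply, sub_mul, sub_mul, smul_mul_assoc, smul_mul_assoc, map_sub, map_sub, map_smul,
    map_smul, h2, h1, hα, hβ, smul_eq_mul, smul_eq_mul]
  ring

/-- The component of `S² g` along `v`. -/
noncomputable def _root_.PaneitzBifurcation.coord (P : C(Icc 0 D, ℝ) →L[ℝ] ℝ)
    (S : C(Icc 0 D, ℝ) →L[ℝ] C(Icc 0 D, ℝ)) (v : C(Icc 0 D, ℝ)) : C(Icc 0 D, ℝ) →L[ℝ] ℝ :=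
  (P (v * v))⁻¹ • (P ∘L (ContinuousLinearMap.mul ℝ C(Icc 0 D, ℝ)).flip v ∘L S ∘L S)

lemma coord_eigen (hR : ResolventData hp P E S) (hv : LRel hp.D_pos h v (μ • v)) (hμ : μ ≠ 0)
    (hv0 : v ≠ 0) : coord P S v (μ ^ 2 • v) = 1 := by
  have h1 : coord P S v (μ ^ 2 • v) = (P (v * v))⁻¹ * P (S (S (μ ^ 2 • v)) * v) := rfl
  rw [h1, hR.S_S_eigen hv hμ, inv_mul_cancel₀ (hR.P_sq_pos hv0).ne']

/-- Bordering removes the kernel: testing against `v` kills the range of the linearization, so the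
transversality constant `c ≠ 0` forces the coordinate along `v` to vanish. -/
lemma isUnit_bordered (hR : ResolventData hp P E S) (hv : LRel hp.D_pos h v (μ • v)) (hμ : μ < 0)
    (hμ' : 0 < μ') (hv0 : v ≠ 0) (hα : α = μ + μ') (hβ : β = -(μ * μ')) {c : ℝ} (hc : c ≠ 0) :
    IsUnit (linOp P S α β + (coord P S v).smulRight (c • v)) := by
  refine hR.isUnit_linOp_add _ fun f hf ↦ ?_
  have h1 := congrArg (fun x ↦ P (x * v)) hf
  simp only [add_mul, map_add, hR.P_linOp_mul hv hα hβ, zero_mul, map_zero, zero_add,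
    smul_mul_assoc, map_smul, smul_eq_mul] at h1
  have h2 : coord P S v f = 0 :=
    (mul_eq_zero.1 h1).resolve_right (mul_ne_zero hc (hR.P_sq_pos hv0).ne')
  rw [h2, zero_smul, add_zero] at hf
  obtain ⟨s, hs⟩ := hR.eq_smul_of_linOp hv hμ hμ' hv0 hα hβ hf
  rw [hs, map_smul, hR.coord_eigen hv hμ.ne hv0, smul_eq_mul, mul_one] at h2
  rw [hs, h2, zero_smul]

end Kernel

end ResolventData

end Linearization


/-! ### Stability of nondegenerate critical points -/

section Stability

variable {D : ℝ} {v₁ v₂ : ℝ → ℝ}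

/-- The zeros of `v₁` on `[0, D]` are simple and include the endpoints; then every function with the
same boundary values that is `C¹`-close to `v₁` has as many zeros, all of them simple. -/
lemma exists_encard_zeros_eq (hD : 0 < D)
    (hv : ∀ x ∈ Icc 0 D, HasDerivWithinAt v₁ (v₂ x) (Icc 0 D) x) (hv₂ : ContinuousOn v₂ (Icc 0 D))
    (hl : v₁ 0 = 0) (hr : v₁ D = 0) (hfin : {t ∈ Icc 0 D | v₁ t = 0}.Finite)
    (hnd : ∀ t ∈ Icc 0 D, v₁ t = 0 → v₂ t ≠ 0) :
    ∃ η, 0 < η ∧ ∀ u₁ u₂ : ℝ → ℝ, (∀ x ∈ Icc 0 D, HasDerivWithinAt u₁ (u₂ x) (Icc 0 D) x) →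
      u₁ 0 = 0 → u₁ D = 0 → (∀ x ∈ Icc 0 D, |u₁ x - v₁ x| ≤ η ∧ |u₂ x - v₂ x| ≤ η) →
      {t ∈ Icc 0 D | u₁ t = 0}.encard = {t ∈ Icc 0 D | v₁ t = 0}.encard ∧
        ∀ t ∈ Icc 0 D, u₁ t = 0 → u₂ t ≠ 0 := by
  set Z := {t ∈ Icc 0 D | v₁ t = 0} with hZ
  have hz0 : (0 : ℝ) ∈ Z := ⟨⟨le_rfl, hD.le⟩, hl⟩
  have hzD : D ∈ Z := ⟨⟨hD.le, le_rfl⟩, hr⟩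
  have hvc : ContinuousOn v₁ (Icc 0 D) := fun x hx ↦ (hv x hx).continuousWithinAt
  -- a radius on which `v₂` keeps its sign near each zero
  obtain ⟨r, hr0, hrZ⟩ : ∃ r, 0 < r ∧ ∀ z ∈ Z, ∀ t ∈ Icc 0 D, |t - z| ≤ r →
      v₂ z ^ 2 / 2 ≤ v₂ z * v₂ t := by
    have h1 : ∀ᶠ r in 𝓝[>] (0 : ℝ), ∀ z ∈ Z, ∀ t ∈ Icc 0 D, |t - z| ≤ r →
        v₂ z ^ 2 / 2 ≤ v₂ z * v₂ t := by
      refine (eventually_all_finite hfin).2 fun z hz ↦ ?_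
      have h2 : ∀ᶠ t in 𝓝[Icc 0 D] z, v₂ z ^ 2 / 2 < v₂ z * v₂ t := by
        have h3 : ContinuousWithinAt (fun t ↦ v₂ z * v₂ t) (Icc 0 D) z :=
          continuousWithinAt_const.mul (hv₂ z hz.1)
        refine h3.eventually (lt_mem_nhds ?_)
        have := pow_pos (abs_pos.2 (hnd z hz.1 hz.2)) 2
        rw [sq_abs] at this
        nlinarith
      obtain ⟨δ, hδ, h4⟩ := Metric.mem_nhdsWithin_iff.1 h2
      filter_upwards [Ioo_mem_nhdsGT hδ] with r hr t ht htr
      exact (h4 ⟨by rw [Metric.mem_ball, Real.dist_eq]; exact htr.trans_lt hr.2, ht⟩).le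
    obtain ⟨r, h2, h3⟩ := (h1.and self_mem_nhdsWithin).exists
    exact ⟨r, h3, h2⟩
  have hpos2 : ∀ z ∈ Z, 0 < v₂ z ^ 2 := fun z hz ↦ by
    have := pow_pos (abs_pos.2 (hnd z hz.1 hz.2)) 2
    rwa [sq_abs] at this
  have hmono : ∀ {p q c : ℝ} {w w' : ℝ → ℝ}, Icc p q ⊆ Icc 0 D →
      (∀ x ∈ Icc 0 D, HasDerivWithinAt w (w' x) (Icc 0 D) x) → (∀ x ∈ Icc p q, 0 < c * w' x) →
      StrictMonoOn (fun x ↦ c * w x) (Icc p q) := by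
    intro p q c w w' hsub hw hw'
    refine strictMonoOn_of_hasDerivWithinAt_pos (f' := fun x ↦ c * w' x) (convex_Icc p q)
      (continuousOn_const.mul fun x hx ↦ ((hw x (hsub hx)).continuousWithinAt).mono hsub)
      (fun x hx ↦ ((hw x (hsub (interior_subset hx))).mono
        (interior_subset.trans hsub)).const_mul c) fun x hx ↦ hw' x (interior_subset hx)
  -- `v₁` is strictly monotone within distance `r` of a zero, which separates the zeros
  have hsep : ∀ z ∈ Z, ∀ z' ∈ Z, z < z' → r < z' - z := by
    intro z hz z' hz' hlt
    by_contra! hle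
    have h1 := hmono (p := z) (q := z') (c := v₂ z) (Icc_subset_Icc hz.1.1 hz'.1.2) hv
      (fun x hx ↦ by
        have := hrZ z hz x ⟨hz.1.1.trans hx.1, hx.2.trans hz'.1.2⟩
          (by rw [abs_of_nonneg (by linarith [hx.1])]; linarith [hx.2])
        linarith [hpos2 z hz]) ⟨le_rfl, hlt.le⟩ ⟨hlt.le, le_rfl⟩ hlt
    simp [hz.2, hz'.2] at h1
  set ρ := r / 3 with hρ
  have hρ0 : 0 < ρ := by positivity
  -- away from the zeros `v₁` is bounded below
  obtain ⟨m, hm0, hm⟩ : ∃ m, 0 < m ∧ ∀ t ∈ Icc 0 D, (∀ z ∈ Z, ρ ≤ |t - z|) → m ≤ |v₁ t| := by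
    set A := {t ∈ Icc 0 D | ∀ z ∈ Z, ρ ≤ |t - z|} with hA
    have hAc : IsCompact A := by
      have h1 : A = Icc 0 D ∩ ⋂ z ∈ Z, {t | ρ ≤ |t - z|} := by
        ext; simp [hA]
      rw [h1]
      exact isCompact_Icc.inter_right
        (isClosed_biInter fun z _ ↦ isClosed_le continuous_const (by fun_prop))
    rcases A.eq_empty_or_nonempty with hemp | hne
    · exact ⟨1, one_pos, fun t ht h ↦ absurd (show t ∈ A from ⟨ht, h⟩) (by rw [hemp]; simp)⟩
    · obtain ⟨t₀, ht₀, hmin⟩ := hAc.exists_isMinOn hne (hvc.abs.mono fun t ht ↦ ht.1)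
      refine ⟨|v₁ t₀|, abs_pos.2 fun h ↦ ?_, fun t ht h ↦ hmin ⟨ht, h⟩⟩
      have := ht₀.2 t₀ ⟨ht₀.1, h⟩
      simp at this
      linarith
  obtain ⟨η₀, hη₀, hηZ⟩ : ∃ η, 0 < η ∧ ∀ z ∈ Z, η < |v₂ z| / 2 := by
    have h1 : ∀ᶠ η in 𝓝[>] (0 : ℝ), ∀ z ∈ Z, η < |v₂ z| / 2 :=
      (eventually_all_finite hfin).2 fun z hz ↦ by
        have : 0 < |v₂ z| / 2 := by have := abs_pos.2 (hnd z hz.1 hz.2); positivity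
        filter_upwards [Ioo_mem_nhdsGT this] with η hη using hη.2
    obtain ⟨η, h2, h3⟩ := (h1.and self_mem_nhdsWithin).exists
    exact ⟨η, h3, h2⟩
  refine ⟨min (m / 2) η₀, by positivity, fun u₁ u₂ hu hul hur hclose ↦ ?_⟩
  have hc1 : ∀ x ∈ Icc 0 D, |u₁ x - v₁ x| ≤ m / 2 := fun x hx ↦
    (hclose x hx).1.trans (min_le_left _ _)
  have hsign : ∀ z ∈ Z, ∀ t ∈ Icc 0 D, |t - z| ≤ r → 0 < v₂ z * u₂ t := by
    intro z hz t ht htr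
    have h1 := hrZ z hz t ht htr
    have h2 := (hclose t ht).2.trans (min_le_right _ _)
    have h3 := hηZ z hz
    have h4 : |v₂ z * (u₂ t - v₂ t)| < v₂ z ^ 2 / 2 := by
      rw [abs_mul, ← sq_abs]
      have h5 : 0 < |v₂ z| := abs_pos.2 (hnd z hz.1 hz.2)
      calc _ ≤ |v₂ z| * η₀ := by gcongr
        _ < |v₂ z| * (|v₂ z| / 2) := by gcongr
        _ = _ := by ring
    have h5 := (abs_lt.1 h4).1
    nlinarith
  -- every zero of `u₁` is close to a zero of `v₁`
  have hnear : ∀ t ∈ Icc 0 D, u₁ t = 0 → ∃ z ∈ Z, |t - z| < ρ := by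
    intro t ht h0
    by_contra! hne
    have h1 := hm t ht hne
    have h2 := hc1 t ht
    rw [h0, zero_sub, abs_neg] at h2
    linarith
  have huniq : ∀ z ∈ Z, ∀ s ∈ Icc 0 D, ∀ t ∈ Icc 0 D, |s - z| ≤ ρ → |t - z| ≤ ρ → u₁ s = 0 →
      u₁ t = 0 → s = t := by
    have key : ∀ z ∈ Z, ∀ s ∈ Icc 0 D, ∀ t ∈ Icc 0 D, |s - z| ≤ ρ → |t - z| ≤ ρ → u₁ s = 0 →
        u₁ t = 0 → ¬ s < t := by
      intro z hz s hs t ht hsz htz hs0 ht0 hlt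
      rw [abs_le] at hsz htz
      have h1 := hmono (p := s) (q := t) (c := v₂ z) (Icc_subset_Icc hs.1 ht.2) hu
        (fun x hx ↦ hsign z hz x ⟨hs.1.trans hx.1, hx.2.trans ht.2⟩
          (abs_le.2 ⟨by linarith [hx.1, hsz.1], by linarith [hx.2, htz.2]⟩))
        ⟨le_rfl, hlt.le⟩ ⟨hlt.le, le_rfl⟩ hlt
      simp [hs0, ht0] at h1
    intro z hz s hs t ht hsz htz hs0 ht0
    exact le_antisymm (not_lt.1 (key z hz t ht s hs htz hsz ht0 hs0))
      (not_lt.1 (key z hz s hs t ht hsz htz hs0 ht0))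
  have hex : ∀ z ∈ Z, ∃ y ∈ Icc 0 D, |y - z| ≤ ρ ∧ u₁ y = 0 := by
    intro z hz
    rcases hz.1.1.eq_or_lt with rfl | h0
    · exact ⟨0, hz.1, by simpa using hρ0.le, hul⟩
    rcases hz.1.2.eq_or_lt with rfl | h1
    · exact ⟨z, hz.1, by simpa using hρ0.le, hur⟩
    have e1 := hsep 0 hz0 z hz h0
    have e2 := hsep z hz D hzD h1
    have hsub : Icc (z - ρ) (z + ρ) ⊆ Icc 0 D := Icc_subset_Icc (by linarith) (by linarith)
    have hm' := hmono (p := z - ρ) (q := z + ρ) (c := v₂ z) hsub hv (fun x hx ↦ by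
      have := hrZ z hz x (hsub hx) (abs_le.2 ⟨by linarith [hx.1], by linarith [hx.2]⟩)
      linarith [hpos2 z hz])
    have e3 := hm' ⟨le_rfl, by linarith⟩ ⟨by linarith, by linarith⟩ (show z - ρ < z by linarith)
    have e4 := hm' ⟨by linarith, by linarith⟩ ⟨by linarith, le_rfl⟩ (show z < z + ρ by linarith)
    simp only [hz.2, mul_zero] at e3 e4
    have hfar : ∀ t, |t - z| = ρ → ∀ z' ∈ Z, ρ ≤ |t - z'| := by
      intro t ht z' hz'
      rcases lt_trichotomy z z' with hlt | rfl | hlt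
      · have := hsep z hz z' hz' hlt
        have h5 := (abs_le.1 ht.le).2
        rw [abs_sub_comm]
        exact le_trans (by linarith) (le_abs_self _)
      · exact ht.ge
      · have := hsep z' hz' z hz hlt
        have h5 := (abs_le.1 ht.le).1
        exact le_trans (by linarith) (le_abs_self _)
    have a1 : z - ρ ∈ Icc 0 D := hsub ⟨le_rfl, by linarith⟩
    have a2 : z + ρ ∈ Icc 0 D := hsub ⟨by linarith, le_rfl⟩
    have f1 := hm (z - ρ) a1 (hfar _ (by simp [abs_of_pos hρ0]))
    have f2 := hm (z + ρ) a2 (hfar _ (by simp [abs_of_pos hρ0]))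
    have g1 := hc1 _ a1
    have g2 := hc1 _ a2
    -- closeness preserves the signs of `v₁` at the ends of the interval
    have hkeep : ∀ c x y : ℝ, m ≤ |x| → |y - x| ≤ m / 2 → 0 < c * x → 0 < c * y := by
      intro c x y hx hy hcx
      have h5 : 0 < |c| := abs_pos.2 (left_ne_zero_of_mul hcx.ne')
      have h6 : |c * (y - x)| ≤ |c| * (m / 2) := by rw [abs_mul]; gcongr
      have h7 : |c| * m ≤ c * x := by
        rw [← abs_of_pos hcx, abs_mul]; gcongr
      have h8 := (abs_le.1 h6).1
      nlinarith [mul_pos h5 hm0]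
    have k1 := hkeep (-v₂ z) _ _ f1 g1 (by linarith)
    have k2 := hkeep (v₂ z) _ _ f2 g2 e4
    have hcont : ContinuousOn (fun x ↦ v₂ z * u₁ x) (Icc (z - ρ) (z + ρ)) :=
      continuousOn_const.mul fun x hx ↦ ((hu x (hsub hx)).continuousWithinAt).mono hsub
    obtain ⟨y, hy, hy0⟩ := intermediate_value_Icc (show z - ρ ≤ z + ρ by linarith) hcont
      (show (0 : ℝ) ∈ Icc _ _ from ⟨by linarith, k2.le⟩)
    exact ⟨y, hsub hy, abs_le.2 ⟨by linarith [hy.1], by linarith [hy.2]⟩,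
      (mul_eq_zero.1 hy0).resolve_left (hnd z hz.1 hz.2)⟩
  choose! ζ hζ1 hζ2 hζ3 using hex
  have hset : {t ∈ Icc 0 D | u₁ t = 0} = ζ '' Z := by
    ext t
    constructor
    · rintro ⟨ht, h0⟩
      obtain ⟨z, hz, htz⟩ := hnear t ht h0
      exact ⟨z, hz, huniq z hz _ (hζ1 z hz) _ ht (hζ2 z hz) htz.le (hζ3 z hz) h0⟩
    · rintro ⟨z, hz, rfl⟩
      exact ⟨hζ1 z hz, hζ3 z hz⟩
  refine ⟨?_, fun t ht h0 ↦ ?_⟩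
  · rw [hset, InjOn.encard_image]
    have key : ∀ z ∈ Z, ∀ z' ∈ Z, ζ z = ζ z' → ¬ z < z' := by
      intro z hz z' hz' heq hlt
      have h1 := (abs_le.1 (hζ2 z hz)).2
      have h2 := (abs_le.1 (hζ2 z' hz')).1
      rw [heq] at h1
      have := hsep z hz z' hz' hlt
      linarith
    intro z hz z' hz' heq
    exact le_antisymm (not_lt.1 (key z' hz' z hz heq.symm)) (not_lt.1 (key z hz z' hz' heq))
  · obtain ⟨z, hz, htz⟩ := hnear t ht h0
    exact right_ne_zero_of_mul (hsign z hz t ht (by linarith)).ne'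

end Stability

/-! ### The nonlinearity -/

section Nonlinearity

/-- The part of second order of `u - u ^ q` at `u = 1`. -/
lemma exists_nonlinearity {q : ℝ} (hq : 1 < q) : ∃ (ν ν' : C(ℝ, ℝ)) (C : ℝ), 0 ≤ C ∧
    (∀ x, ν x = 1 + q * x - (1 + x) ^ q) ∧ (∀ x, HasDerivAt ν (ν' x) x) ∧
    (∀ x, |x| ≤ 1 / 2 → |ν' x| ≤ C * |x|) ∧ ν 0 = 0 ∧
    ∀ r x y : ℝ, r ≤ 1 / 2 → |x| ≤ r → |y| ≤ r → |ν x - ν y| ≤ C * r * |x - y| := by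
  have hc : ∀ p : ℝ, 0 ≤ p → Continuous fun x : ℝ ↦ (1 + x) ^ p := fun p hp ↦
    (continuous_const.add continuous_id).rpow_const fun _ ↦ Or.inr hp
  have hd : ∀ x, HasDerivAt (fun x : ℝ ↦ 1 + q * x - (1 + x) ^ q)
      (q - q * (1 + x) ^ (q - 1)) x := by
    intro x
    have h1 : HasDerivAt (fun x : ℝ ↦ 1 + x) 1 x := (hasDerivAt_id x).const_add 1
    have h2 := (Real.hasDerivAt_rpow_const (x := 1 + x) (p := q) (Or.inr hq.le)).comp x h1
    have h3 : HasDerivAt (fun x : ℝ ↦ 1 + q * x) q x := by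
      simpa using ((hasDerivAt_id x).const_mul q).const_add 1
    exact (h3.sub h2).congr_deriv (by ring)
  have hb : ∃ C, 0 ≤ C ∧ ∀ x, |x| ≤ 1 / 2 → |q - q * (1 + x) ^ (q - 1)| ≤ C * |x| := by
    have h1 : ∀ x ∈ Icc (-(1 / 2) : ℝ) (1 / 2), HasDerivWithinAt
        (fun x ↦ q - q * (1 + x) ^ (q - 1)) (-(q * ((q - 1) * (1 + x) ^ (q - 1 - 1))))
        (Icc (-(1 / 2)) (1 / 2)) x := by
      intro x hx
      have h1 : HasDerivAt (fun x : ℝ ↦ 1 + x) 1 x := (hasDerivAt_id x).const_add 1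
      have hx0 : (1 : ℝ) + x ≠ 0 := by linarith [hx.1]
      have h2 := (Real.hasDerivAt_rpow_const (x := 1 + x) (p := q - 1) (Or.inl hx0)).comp x h1
      exact ((h2.const_mul q).const_sub q).hasDerivWithinAt.congr_deriv (by ring)
    have h2 : ContinuousOn (fun x : ℝ ↦ -(q * ((q - 1) * (1 + x) ^ (q - 1 - 1))))
        (Icc (-(1 / 2)) (1 / 2)) := by
      refine (continuousOn_const.mul (continuousOn_const.mul
        ((continuousOn_const.add continuousOn_id).rpow_const fun x hx ↦ Or.inl ?_))).neg
      have : (1 : ℝ) + x ≠ 0 := by linarith [hx.1]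
      exact this
    obtain ⟨C, hC⟩ := isCompact_Icc.exists_bound_of_continuousOn h2
    refine ⟨C, (norm_nonneg _).trans (hC 0 (by constructor <;> norm_num)), fun x hx ↦ ?_⟩
    have h3 := abs_sub_le_of_hasDerivWithinAt hC h1 (abs_le.1 hx)
      (show (0 : ℝ) ∈ Icc _ _ by constructor <;> norm_num)
    simpa using h3
  obtain ⟨C, hC0, hC⟩ := hb
  refine ⟨⟨_, (continuous_const.add (continuous_const.mul continuous_id)).sub (hc q (by linarith))⟩,
    ⟨_, continuous_const.sub (continuous_const.mul (hc (q - 1) (by linarith)))⟩, C, hC0,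
    fun x ↦ rfl, hd, hC, by simp, fun r x y hr hx hy ↦ ?_⟩
  refine abs_sub_le_of_hasDerivWithinAt (a := -r) (b := r) (fun z hz ↦ ?_)
    (fun z _ ↦ (hd z).hasDerivWithinAt) (abs_le.1 hx) (abs_le.1 hy)
  have hz' : |z| ≤ r := abs_le.2 hz
  exact (hC z (hz'.trans hr)).trans (by gcongr)

lemma normC_congr {D : ℝ} {θ : ℝ≥0} {k : ℕ} {u v : ℝ → ℝ} (huv : EqOn u v (Icc 0 D)) :
    normC D θ k u = normC D θ k v := by
  unfold normC
  congr 1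
  · refine Finset.sum_congr rfl fun j _ ↦ ?_
    refine iSup_congr fun x ↦ ?_
    rw [derivOn_congr huv j x.2]
  · congr 1
    ext x
    rw [derivOn_congr huv k x.2]

variable {D : ℝ} {m₀ m₁ : ℕ} {K κ h : ℝ → ℝ} {hp : Profile D m₀ m₁ K κ h}
  {P : C(Icc 0 D, ℝ) →L[ℝ] ℝ} {E S : C(Icc 0 D, ℝ) →L[ℝ] C(Icc 0 D, ℝ)} {θ : ℝ≥0}

lemma CBound.of_deriv_ext {hD : 0 < D} {θ : ℝ} (hθ : θ ≤ 1) {g g' : C(Icc 0 D, ℝ)}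
    (hg : ∀ t ∈ Icc 0 D, HasDerivWithinAt (ext hD g) (ext hD g' t) (Icc 0 D) t) :
    CBound θ (Icc 0 D) 0 (max 1 ((D - 0) ^ (1 - θ)) * (‖g‖ + ‖g'‖)) (ext hD g) :=
  CBound.of_hasDerivWithinAt hθ
    (fun x _ ↦ (abs_ext_le g x).trans (by linarith [norm_nonneg g']))
    (fun x _ ↦ (abs_ext_le g' x).trans (by linarith [norm_nonneg g])) hg

/-- The `C^{4,θ}` norm of `S² g` is controlled by the `C¹` norm of `g`. -/
lemma ResolventData.exists_normC_le (hR : ResolventData hp P E S) (hθ0 : 0 < θ) (hθ : θ ≤ 1) :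
    ∃ C, 0 ≤ C ∧ ∀ g g' : C(Icc 0 D, ℝ),
      (∀ t ∈ Icc 0 D, HasDerivWithinAt (ext hp.D_pos g) (ext hp.D_pos g' t) (Icc 0 D) t) →
      normC D θ 4 (ext hp.D_pos (S (S g))) ≤ ENNReal.ofReal (C * (‖g‖ + ‖g'‖)) := by
  have hθ0' : (0 : ℝ) < θ := by exact_mod_cast hθ0
  have hθ' : (θ : ℝ) ≤ 1 := by exact_mod_cast hθ
  obtain ⟨C₁, hC₁, h1⟩ := hR.regularity θ hθ0' hθ' 0
  obtain ⟨C₂, hC₂, h2⟩ := hR.regularity θ hθ0' hθ' 2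
  refine ⟨6 * (C₂ * (C₁ * max 1 ((D - 0) ^ (1 - (θ : ℝ))))), by positivity, fun g g' hg ↦ ?_⟩
  refine (((h2 _ _ (h1 _ _ (CBound.of_deriv_ext hθ' hg))).normC_le hp.D_pos).trans_eq ?_)
  congr 1
  push_cast
  ring

end Nonlinearity


/-! ### The solution set near the trivial solutions -/

section Solutions

open Asymptotics

variable {D : ℝ} {m₀ m₁ : ℕ} {K κ h : ℝ → ℝ} {hp : Profile D m₀ m₁ K κ h}
  {P : C(Icc 0 D, ℝ) →L[ℝ] ℝ} {E S : C(Icc 0 D, ℝ) →L[ℝ] C(Icc 0 D, ℝ)} {μ μ' α β : ℝ}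
  {θ : ℝ≥0} {q : ℝ} {a b : ℝ → ℝ} {ν ν' : C(ℝ, ℝ)} {u v : ℝ → ℝ} {r τ t : ℝ}

/-- The derivative of a solution `g` of `linOp P S α β g + γ ν(S² g) = 0`. -/
noncomputable def derG (E S : C(Icc 0 D, ℝ) →L[ℝ] C(Icc 0 D, ℝ)) (ν' : C(ℝ, ℝ)) (α β γ : ℝ)
    (g : C(Icc 0 D, ℝ)) : C(Icc 0 D, ℝ) :=
  α • E g + β • E (S g) - γ • (ν'.comp (S (S g)) * E (S g))

namespace ResolventData

lemma hasDerivWithinAt_derG (hR : ResolventData hp P E S) (hν : ∀ x, HasDerivAt ν (ν' x) x)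
    {γ : ℝ} {g : C(Icc 0 D, ℝ)} (hg : linOp P S α β g + γ • ν.comp (S (S g)) = 0) :
    ∀ t ∈ Icc 0 D, HasDerivWithinAt (ext hp.D_pos g) (ext hp.D_pos (derG E S ν' α β γ g) t)
      (Icc 0 D) t := by
  intro t ht
  set eD := ext hp.D_pos
  have h1 : g = P g • 1 + α • (S g + P g • 1) + β • S (S g) - γ • ν.comp (S (S g)) := by
    rw [linOp_apply] at hg
    have h2 : g = (g - P g • 1 - α • (S g + P g • 1) - β • S (S g) + γ • ν.comp (S (S g))) +
        (P g • 1 + α • (S g + P g • 1) + β • S (S g) - γ • ν.comp (S (S g))) := by abel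
    rw [hg, zero_add] at h2
    exact h2
  have h2 : eD g = fun x ↦ P g * 1 + α * (eD (S g) x + P g * 1) + β * eD (S (S g)) x -
      γ * ν (eD (S (S g)) x) := by
    conv_lhs => rw [h1]
    rfl
  rw [h2]
  have d1 := hR.deriv g t ht
  have d2 := hR.deriv (S g) t ht
  have d3 := (hν (eD (S (S g)) t)).comp_hasDerivWithinAt t d2
  refine ((((d1.add_const (P g * 1)).const_mul α).const_add (P g * 1)).add (d2.const_mul β)).sub
    (d3.const_mul γ)

/-- Regularity: a continuous solution of the fixed point equation is continuously differentiable,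
and therefore Hölder continuous. -/
lemma exists_CBound_of_eq (hR : ResolventData hp P E S) (hθ : θ ≤ 1)
    (hν : ∀ x, HasDerivAt ν (ν' x) x) {γ : ℝ} {g : C(Icc 0 D, ℝ)}
    (hg : linOp P S α β g + γ • ν.comp (S (S g)) = 0) :
    ∃ R, CBound θ (Icc 0 D) 0 R (ext hp.D_pos g) :=
  ⟨_, CBound.of_deriv_ext (by exact_mod_cast hθ) (hR.hasDerivWithinAt_derG hν hg)⟩

/-- The linearization of the equation at `u = 1` is `linOp` in terms of `g`. -/
lemma opDH_eq (hR : ResolventData hp P E S) (hθ0 : 0 < θ) (hθ : θ ≤ 1) {w : ℝ → ℝ}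
    {g : C(Icc 0 D, ℝ)} {R : ℝ} (hg : CBound θ (Icc 0 D) 0 R (ext hp.D_pos g))
    (hw : EqOn w (ext hp.D_pos (S (S g))) (Icc 0 D)) {x : ℝ} (hx : x ∈ Ioo 0 D) :
    opDH h D q a b t w x = ext hp.D_pos (linOp P S (a t) (b t * (q - 1)) g) x := by
  have h1 : ext hp.D_pos (linOp P S (a t) (b t * (q - 1)) g) x =
      ext hp.D_pos (g - P g • 1 - a t • (S g + P g • 1)) x -
        b t * (q - 1) * ext hp.D_pos (S (S g)) x := rfl
  rw [opDH, hR.linearPart_eq hθ0 hθ hg hw _ hx, hw (Ioo_subset_Icc_self hx), h1]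
  ring

lemma S_S_add_one (hR : ResolventData hp P E S) (g : C(Icc 0 D, ℝ)) :
    S (S (g + 1)) = S (S g) + 1 := by
  rw [map_add, map_add, hR.S_one, map_neg, hR.S_one, neg_neg]

/-- The equation in terms of `g`, where `u = 1 + S² g`. -/
lemma opH_eq (hR : ResolventData hp P E S) (hθ0 : 0 < θ) (hθ : θ ≤ 1)
    (hν : ∀ x, ν x = 1 + q * x - (1 + x) ^ q)
    {g : C(Icc 0 D, ℝ)} {R : ℝ} (hg : CBound θ (Icc 0 D) 0 R (ext hp.D_pos g))
    (hu : EqOn u (fun x ↦ 1 + ext hp.D_pos (S (S g)) x) (Icc 0 D)) {x : ℝ} (hx : x ∈ Ioo 0 D) :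
    opH h D q a b u t x =
      ext hp.D_pos (linOp P S (a t) (b t * (q - 1)) g + b t • ν.comp (S (S g))) x := by
  have hx' := Ioo_subset_Icc_self hx
  have hg1 : CBound θ (Icc 0 D) 0 (R + |1|) (ext hp.D_pos (g + 1)) := hg.add (CBound.const 1)
  have hu1 : EqOn u (ext hp.D_pos (S (S (g + 1)))) (Icc 0 D) := fun x hx ↦ by
    rw [hu hx, hR.S_S_add_one]
    exact add_comm _ _
  rw [opH, hR.linearPart_eq hθ0 hθ hg1 hu1 _ hx, hu hx']
  have e1 : g + 1 - P (g + 1) • 1 - a t • (S (g + 1) + P (g + 1) • 1) =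
      g - P g • 1 - a t • (S g + P g • 1) := by
    rw [map_add, map_add, hR.S_one, hR.mean_one, add_smul, one_smul]
    abel_nf
  have e2 : ext hp.D_pos (linOp P S (a t) (b t * (q - 1)) g + b t • ν.comp (S (S g))) x =
      ext hp.D_pos (g - P g • 1 - a t • (S g + P g • 1)) x -
        b t * (q - 1) * ext hp.D_pos (S (S g)) x + b t * ν (ext hp.D_pos (S (S g)) x) := rfl
  rw [e1, e2, hν]
  ring

/-- In terms of `g = (L - P)² (u - 1)` the equation becomes a fixed point equation in
`C([0, D])`. -/
lemma isNontrivialSolution_iff (hR : ResolventData hp P E S) (hθ0 : 0 < θ) (hθ : θ ≤ 1)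
    (hν : ∀ x, ν x = 1 + q * x - (1 + x) ^ q) (hν' : ∀ x, HasDerivAt ν (ν' x) x) :
    IsNontrivialSolution h D θ q a b u r ↔ 0 < r ∧ (∀ x ∈ Icc 0 D, 0 < u x) ∧
      ∃ g : C(Icc 0 D, ℝ), g ≠ 0 ∧ EqOn u (fun x ↦ 1 + ext hp.D_pos (S (S g)) x) (Icc 0 D) ∧
        linOp P S (a r) (b r * (q - 1)) g + b r • ν.comp (S (S g)) = 0 := by
  constructor
  · rintro ⟨⟨hr, hB, hpos, heq⟩, x, hx, hne⟩
    obtain ⟨g, hg, R, hC⟩ := (hR.memB₄_iff hθ0 hθ).1 hB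
    have hu : EqOn u (fun x ↦ 1 + ext hp.D_pos (S (S (g - 1))) x) (Icc 0 D) := fun x hx ↦ by
      have h1 : S (S g) = S (S (g - 1)) + 1 := by rw [← hR.S_S_add_one, sub_add_cancel]
      rw [hg hx, h1]
      exact add_comm _ _
    have hC1 : CBound θ (Icc 0 D) 0 (R + |1|) (ext hp.D_pos (g - 1)) := hC.sub (CBound.const 1)
    refine ⟨hr, hpos, g - 1, fun h0 ↦ hne ?_, hu, ext_injOn_Ioo (hD := hp.D_pos) fun x hx ↦ ?_⟩
    · rw [hu hx, h0, map_zero, map_zero]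
      exact add_zero 1
    · rw [← hR.opH_eq hθ0 hθ hν hC1 hu hx, heq x hx]
      rfl
  · rintro ⟨hr, hpos, g, hg0, hu, heq⟩
    obtain ⟨R, hC⟩ := hR.exists_CBound_of_eq hθ hν' heq
    have hu1 : EqOn u (ext hp.D_pos (S (S (g + 1)))) (Icc 0 D) := fun x hx ↦ by
      rw [hu hx, hR.S_S_add_one]
      exact add_comm _ _
    refine ⟨⟨hr, (hR.memB₄_iff hθ0 hθ).2 ⟨g + 1, hu1, _, hC.add (CBound.const 1)⟩, hpos,
      fun x hx ↦ ?_⟩, ?_⟩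
    · rw [hR.opH_eq hθ0 hθ hν hC hu hx, heq]
      rfl
    · by_contra! hall
      refine hg0 (hR.eq_zero_of_S (hR.eq_zero_of_S (ext_injOn (hD := hp.D_pos) fun x hx ↦ ?_)))
      have h1 := hall x hx
      rw [hu hx] at h1
      have h2 : ext hp.D_pos 0 x = 0 := rfl
      rw [h2]
      linarith

/-- Solutions close to the trivial one in `C^{4,θ}` correspond to small `g`. -/
lemma exists_norm_lt (hR : ResolventData hp P E S) {Cν : ℝ}
    (hQ : QuadraticAt (fun f : C(Icc 0 D, ℝ) ↦ ν.comp f) Cν)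
    (ha : ContinuousAt a τ) (hb : ContinuousAt b τ) {δ : ℝ} (hδ : 0 < δ) :
    ∃ ε, 0 < ε ∧ ∀ (u : ℝ → ℝ) (r : ℝ) (g : C(Icc 0 D, ℝ)),
      EqOn u (fun x ↦ 1 + ext hp.D_pos (S (S g)) x) (Icc 0 D) →
      linOp P S (a r) (b r * (q - 1)) g + b r • ν.comp (S (S g)) = 0 →
      normC D θ 4 (fun x ↦ u x - 1) < ENNReal.ofReal ε → |r - τ| < ε → ‖g‖ < δ := by
  obtain ⟨C₁, hC₁, hC⟩ := hp.exists_abs_le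
  have hν0 := hQ.nonneg
  obtain ⟨δ₁, hδ₁, h1⟩ := Metric.continuousAt_iff.1 ha 1 one_pos
  obtain ⟨δ₂, hδ₂, h2⟩ := Metric.continuousAt_iff.1 hb 1 one_pos
  set A := |a τ| + 1
  set B := |b τ| + 1
  set N := ‖P‖ + A * C₁ + B * |q - 1| + B * Cν + 1 with hN
  have hN0 : 0 < N := by positivity
  refine ⟨min (min δ₁ δ₂) (min (1 / 2) (δ / (2 * N))), by positivity,
    fun u r g hu heq hn hr ↦ ?_⟩
  set ε := min (min δ₁ δ₂) (min (1 / 2) (δ / (2 * N)))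
  have hε0 : 0 < ε := by positivity
  have hε1 : ε ≤ 1 / 2 := (min_le_right _ _).trans (min_le_left _ _)
  have hε2 : ε ≤ δ / (2 * N) := (min_le_right _ _).trans (min_le_right _ _)
  have ha1 : |a r| ≤ A := by
    have := h1 (hr.trans_le ((min_le_left _ _).trans (min_le_left _ _)))
    rw [Real.dist_eq] at this
    linarith [abs_sub_abs_le_abs_sub (a r) (a τ)]
  have hb1 : |b r| ≤ B := by
    have := h2 (hr.trans_le ((min_le_left _ _).trans (min_le_right _ _)))
    rw [Real.dist_eq] at this
    linarith [abs_sub_abs_le_abs_sub (b r) (b τ)]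
  have hw : EqOn (fun x ↦ u x - 1) (ext hp.D_pos (S (S g))) (Icc 0 D) := fun x hx ↦ by
    simp only [hu hx]; ring
  rw [normC_congr hw] at hn
  obtain ⟨w₁, w₂, hsol⟩ := hR.lrel_S_add g
  have hw0 : ‖S (S g)‖ ≤ ε := norm_le_of_ext (hD := hp.D_pos) hε0.le fun x hx ↦ by
    have := abs_derivOn_le_of_normC_le hε0.le hn.le (show 0 ≤ 4 by norm_num) x hx
    rwa [derivOn_zero] at this
  have hw2 : ∀ x ∈ Icc 0 D, |w₂ x| ≤ ε := fun x hx ↦ by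
    have := abs_derivOn_le_of_normC_le hε0.le hn.le (show 2 ≤ 4 by norm_num) x hx
    rwa [hsol.derivOn_two hp.D_pos hx] at this
  have hy : ‖S g + P g • 1‖ ≤ C₁ * ε := norm_le_of_ext (hD := hp.D_pos) (by positivity)
    (hC _ _ _ _ ε hsol hw2)
  have hPg : ‖P g • (1 : C(Icc 0 D, ℝ))‖ ≤ ‖P‖ * ε := by
    have h3 : P g = P (S (S g)) := by rw [hR.mean_S, hR.mean_S, neg_neg]
    have h4 : ‖(1 : C(Icc 0 D, ℝ))‖ ≤ 1 :=
      (ContinuousMap.norm_le _ zero_le_one).2 fun x ↦ by simp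
    rw [h3, norm_smul]
    calc _ ≤ ‖P (S (S g))‖ * 1 := by gcongr
      _ ≤ _ := by rw [mul_one]; exact (P.le_opNorm _).trans (by gcongr)
  -- the equation expresses `g` by quantities controlled by two derivatives of `u - 1`
  have h5 : g = P g • 1 + a r • (S g + P g • 1) + (b r * (q - 1)) • S (S g) -
      b r • ν.comp (S (S g)) := by
    rw [linOp_apply] at heq
    have h6 : g = (g - P g • 1 - a r • (S g + P g • 1) - (b r * (q - 1)) • S (S g) +
        b r • ν.comp (S (S g))) + (P g • 1 + a r • (S g + P g • 1) +
        (b r * (q - 1)) • S (S g) - b r • ν.comp (S (S g))) := by abel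
    rw [heq, zero_add] at h6
    exact h6
  have hνn : ‖ν.comp (S (S g))‖ ≤ Cν * 1 * ε :=
    (hQ.norm_le hε1 hw0).trans (by gcongr; linarith)
  have h7 : ‖g‖ ≤ N * ε := by
    rw [h5]
    refine (norm_sub_le _ _).trans ((add_le_add ((norm_add_le _ _).trans
      (add_le_add (norm_add_le _ _) le_rfl)) le_rfl).trans ?_)
    rw [norm_smul (a r), norm_smul (b r * (q - 1)), norm_smul (b r), norm_mul, Real.norm_eq_abs,
      Real.norm_eq_abs, Real.norm_eq_abs]
    calc _ ≤ ‖P‖ * ε + A * (C₁ * ε) + B * |q - 1| * ε + B * (Cν * 1 * ε) := by gcongr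
      _ ≤ _ := by rw [hN]; linarith
  calc ‖g‖ ≤ N * (δ / (2 * N)) := h7.trans (by gcongr)
    _ = δ / 2 := by field_simp
    _ < δ := by linarith

/-- The pencil of linearizations. -/
lemma pencil_eq : pencil (1 - P.smulRight 1) (S + P.smulRight 1) ((q - 1) • (S ∘L S)) a b t =
    linOp P S (a t) (b t * (q - 1)) := by
  rw [pencil, linOp, smul_smul]

/-- There is no bifurcation where the linearization is invertible. -/
lemma not_isBifurcationPoint (hR : ResolventData hp P E S) (hθ0 : 0 < θ) (hθ : θ ≤ 1) (hq : 1 < q)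
    (ha : ContinuousAt a τ) (hb : ContinuousAt b τ)
    (hu : IsUnit (linOp P S (a τ) (b τ * (q - 1)))) : ¬ IsBifurcationPoint h D θ q a b τ := by
  rintro ⟨-, hbif⟩
  obtain ⟨ν, ν', Cν, hCν, hν, hν', -, hν0, hlip⟩ := exists_nonlinearity hq
  have hQ : QuadraticAt (fun f : C(Icc 0 D, ℝ) ↦ ν.comp f) Cν := quadraticAt_comp hCν hν0 hlip
  rw [← pencil_eq] at hu
  obtain ⟨δ, hδ, h1⟩ := exists_eq_zero_of_isUnit (J := S ∘L S) ha hb hQ hu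
  obtain ⟨ε, hε, h2⟩ := hR.exists_norm_lt (θ := θ) (q := q) hQ ha hb hδ
  obtain ⟨u, r, hsol, hn, hr⟩ := hbif (min ε δ) (by positivity)
  obtain ⟨-, -, g, hg0, hug, heq⟩ := (hR.isNontrivialSolution_iff hθ0 hθ hν hν').1 hsol
  have h3 := h2 u r g hug heq (hn.trans_le (ENNReal.ofReal_le_ofReal (min_le_left _ _)))
    (hr.trans_le (min_le_left _ _))
  refine hg0 (h1 g r h3 (hr.trans_le (min_le_right _ _)) ?_)
  rw [pencil_eq]
  exact heq

/-- Simplicity of the bifurcation point: the range of the linearization is orthogonal to `v`, while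
the mixed derivative is `c v` with `c ≠ 0` by transversality; the bordered operator shows that `c v`
spans a complement of the range. -/
lemma isSimpleWithKernel (hR : ResolventData hp P E S) (hθ0 : 0 < θ) (hθ : θ ≤ 1)
    (hv : IsEigenfunction h D θ μ v) (hμ : μ < 0) (hμ' : 0 < μ') (hα : a τ = μ + μ')
    (hβ : b τ * (q - 1) = -(μ * μ')) (hc : -_root_.deriv a τ * μ + _root_.deriv b τ * (1 - q) ≠ 0) :
    IsSimpleWithKernel h D θ q a b τ v := by
  have hθ' : (θ : ℝ) ≤ 1 := by exact_mod_cast hθ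
  obtain ⟨⟨v₁, v₂, hsol⟩, x₀, hx₀, hvx₀⟩ := (hR.isEigenfunction_iff hθ0 hθ).1 hv
  set c := -_root_.deriv a τ * μ + _root_.deriv b τ * (1 - q)
  set V := toX v hsol.cont₀ with hVdef
  have hVv : EqOn (ext hp.D_pos V) v (Icc 0 D) := ext_toX _
  have hV : LRel hp.D_pos h V (μ • V) :=
    ⟨v₁, v₂, hsol.congr hVv fun x hx ↦ by rw [ext_smul]; simp only [hVv hx]⟩
  have hV0 : V ≠ 0 := fun h0 ↦ hvx₀ (by rw [← hVv hx₀, h0]; rfl)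
  have hVC : ∃ R, CBound θ (Icc 0 D) 0 R (ext hp.D_pos V) := by
    have hd := hR.deriv (μ • V)
    rw [map_smul, hR.S_eigen hV hμ.ne] at hd
    exact ⟨_, CBound.of_deriv_ext hθ' hd⟩
  obtain ⟨RV, hVC⟩ := hVC
  have heC : CBound θ (Icc 0 D) 0 (|μ ^ 2| * RV) (ext hp.D_pos (μ ^ 2 • V)) := hVC.const_mul _
  have hve : EqOn v (ext hp.D_pos (S (S (μ ^ 2 • V)))) (Icc 0 D) := fun x hx ↦ by
    rw [hR.S_S_eigen hV hμ.ne, hVv hx]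
  have hmix : ∀ x ∈ Ioo 0 D, opMixed h D q a b τ v x = c * v x := fun x hx ↦ by
    rw [opMixed, hv.2.2 x hx]; ring
  refine ⟨⟨(hR.memB₄_iff hθ0 hθ).2 ⟨_, hve, _, heC⟩, x₀, hx₀, hvx₀⟩, fun w hw ↦ ?_, ?_,
    fun f hf ↦ ?_⟩
  · obtain ⟨g, hg, R, hC⟩ := (hR.memB₄_iff hθ0 hθ).1 hw
    constructor
    · intro h0
      have h1 : linOp P S (a τ) (b τ * (q - 1)) g = 0 :=
        ext_injOn_Ioo (hD := hp.D_pos) fun x hx ↦ by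
          rw [← hR.opDH_eq hθ0 hθ hC hg hx, h0 x hx]; rfl
      obtain ⟨s, hs⟩ := hR.eq_smul_of_linOp hV hμ hμ' hV0 hα hβ h1
      refine ⟨s, fun x hx ↦ ?_⟩
      rw [hg hx, hs, map_smul, map_smul, hR.S_S_eigen hV hμ.ne, ext_smul]
      simp only [hVv hx]
    · rintro ⟨s, hs⟩ x hx
      have hws : EqOn w (ext hp.D_pos (S (S (s • μ ^ 2 • V)))) (Icc 0 D) := fun x hx ↦ by
        rw [hs x hx, map_smul, map_smul, hR.S_S_eigen hV hμ.ne, ext_smul]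
        simp only [hVv hx]
      rw [hR.opDH_eq hθ0 hθ (heC.const_mul s) hws hx, map_smul, hR.linOp_eigen hV hμ.ne hα hβ,
        smul_zero]
      rfl
  · rintro ⟨w, hw, heq⟩
    obtain ⟨g, hg, R, hC⟩ := (hR.memB₄_iff hθ0 hθ).1 hw
    have h1 : linOp P S (a τ) (b τ * (q - 1)) g = c • V :=
      ext_injOn_Ioo (hD := hp.D_pos) fun x hx ↦ by
        rw [← hR.opDH_eq hθ0 hθ hC hg hx, heq x hx, hmix x hx, ext_smul]
        simp only [hVv (Ioo_subset_Icc_self hx)]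
    have h2 := hR.P_linOp_mul (g := g) hV hα hβ
    rw [h1, smul_mul_assoc, map_smul, smul_eq_mul] at h2
    exact mul_ne_zero hc (hR.P_sq_pos hV0).ne' h2
  · obtain ⟨R, hfC⟩ := hf.exists_CBound hp.D_pos
    obtain ⟨B, hB⟩ := (hR.isUnit_bordered hV hμ hμ' hV0 hα hβ hc).exists_right_inv
    set F := toX f (hfC.continuousOn (by exact_mod_cast hθ0)) with hF
    have hFf : EqOn (ext hp.D_pos F) f (Icc 0 D) := ext_toX _
    set g := B F
    have h1 : linOp P S (a τ) (b τ * (q - 1)) g + coord P S V g • (c • V) = F :=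
      DFunLike.congr_fun hB F
    have hgC : ∃ R, CBound θ (Icc 0 D) 0 R (ext hp.D_pos g) := by
      have h2 : g = F + P g • 1 + a τ • S g + a τ • P g • 1 + (b τ * (q - 1)) • S (S g) -
          coord P S V g • (c • V) := by
        rw [← h1, linOp_apply, smul_add]; abel
      have k1 := CBound.of_deriv_ext (hD := hp.D_pos) hθ' (hR.deriv g)
      have k2 := CBound.of_deriv_ext (hD := hp.D_pos) hθ' (hR.deriv (S g))
      have k3 := ((((hfC.congr hFf).add (CBound.const (P g * 1))).add (k1.const_mul (a τ))).add
        (CBound.const (a τ * (P g * 1)))).add (k2.const_mul (b τ * (q - 1)))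
      refine ⟨_, (k3.sub ((hVC.const_mul c).const_mul (coord P S V g))).congr fun x hx ↦ ?_⟩
      conv_lhs => rw [h2]
      rfl
    obtain ⟨Rg, hgC⟩ := hgC
    refine ⟨ext hp.D_pos (S (S g)), (hR.memB₄_iff hθ0 hθ).2 ⟨g, fun _ _ ↦ rfl, _, hgC⟩,
      coord P S V g, fun x hx ↦ ?_⟩
    rw [hR.opDH_eq hθ0 hθ hgC (fun _ _ ↦ rfl) hx, hmix x hx, ← hFf (Ioo_subset_Icc_self hx),
      ← hVv (Ioo_subset_Icc_self hx), ← h1]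
    rfl

end ResolventData

end Solutions


/-! ### The bifurcating curve -/

section Curve

open Asymptotics

variable {D : ℝ} {m₀ m₁ : ℕ} {K κ h : ℝ → ℝ} {hp : Profile D m₀ m₁ K κ h}
  {P : C(Icc 0 D, ℝ) →L[ℝ] ℝ} {E S : C(Icc 0 D, ℝ) →L[ℝ] C(Icc 0 D, ℝ)} {μ μ' : ℝ}
  {θ : ℝ≥0} {q : ℝ} {a b : ℝ → ℝ} {ν' : C(ℝ, ℝ)} {v : ℝ → ℝ} {τ : ℝ}

/-- Along a curve `g(s) = s e + O(s²)` the derivative of `g(s)` is `s e' + O(s²)`. -/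
lemma isBigO_derG_sub {g : ℝ → C(Icc 0 D, ℝ)} {e : C(Icc 0 D, ℝ)} {α β γ : ℝ → ℝ} {α₀ β₀ C : ℝ}
    (hν : ∀ x, |x| ≤ 1 / 2 → |ν' x| ≤ C * |x|) (hC : 0 ≤ C)
    (hg : (fun s ↦ g s - s • e) =O[𝓝 0] fun s ↦ s ^ 2)
    (hα : (fun s ↦ α s - α₀) =O[𝓝 0] fun s ↦ s) (hβ : (fun s ↦ β s - β₀) =O[𝓝 0] fun s ↦ s)
    (hγ : γ =O[𝓝 0] fun _ ↦ (1 : ℝ)) :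
    (fun s ↦ derG E S ν' (α s) (β s) (γ s) (g s) - s • derG E S ν' α₀ β₀ 0 e) =O[𝓝 0]
      fun s ↦ s ^ 2 := by
  have hs1 : (fun s : ℝ ↦ s) =O[𝓝 0] fun _ ↦ (1 : ℝ) :=
    (continuous_id.tendsto (0 : ℝ)).isBigO_one ℝ
  have hone : ∀ {α : ℝ → ℝ} {α₀ : ℝ}, (fun s ↦ α s - α₀) =O[𝓝 0] (fun s : ℝ ↦ s) →
      α =O[𝓝 0] fun _ ↦ (1 : ℝ) := fun {α α₀} hα ↦ by
    have h1 := (hα.trans hs1).add (isBigO_const_const α₀ (one_ne_zero (α := ℝ)) (𝓝 (0 : ℝ)))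
    simpa using h1
  have hg1 : g =O[𝓝 0] fun s ↦ s := by
    have h1 : (fun s : ℝ ↦ s ^ 2) =O[𝓝 0] fun s ↦ s := by
      simpa [pow_two] using (isBigO_refl (fun s : ℝ ↦ s) (𝓝 0)).mul hs1
    have h2 : (fun s : ℝ ↦ s • e) =O[𝓝 0] fun s ↦ s := by
      simpa using (isBigO_refl (fun s : ℝ ↦ s) (𝓝 0)).smul
        (isBigO_const_const e (one_ne_zero (α := ℝ)) (𝓝 (0 : ℝ)))
    simpa using (hg.trans h1).add h2
  have hw1 : (fun s ↦ S (S (g s))) =O[𝓝 0] fun s ↦ s :=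
    ((S ∘L S).isBigO_comp g _).trans hg1
  have hw0 : Tendsto (fun s ↦ S (S (g s))) (𝓝 0) (𝓝 0) :=
    hw1.trans_tendsto (continuous_id.tendsto (0 : ℝ))
  have hν1 : (fun s ↦ ν'.comp (S (S (g s)))) =O[𝓝 0] fun s ↦ s := by
    refine IsBigO.trans (IsBigO.of_bound C ?_) hw1
    filter_upwards [hw0.eventually (Metric.ball_mem_nhds 0 (show (0 : ℝ) < 1 / 2 by norm_num))]
      with s hs
    rw [dist_zero_right] at hs
    refine (ContinuousMap.norm_le _ (by positivity)).2 fun x ↦ ?_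
    have h1 := (S (S (g s))).norm_coe_le_norm x
    exact (hν _ (h1.trans hs.le)).trans (by gcongr; exact h1)
  have t1 : (fun s ↦ α s • E (g s - s • e)) =O[𝓝 0] fun s ↦ s ^ 2 := by
    simpa using (hone hα).smul ((E.isBigO_comp _ _).trans hg)
  have t2 : (fun s ↦ (α s - α₀) • s • E e) =O[𝓝 0] fun s ↦ s ^ 2 := by
    have := hα.smul ((isBigO_refl (fun s : ℝ ↦ s) (𝓝 0)).smul
      (isBigO_const_const (E e) (one_ne_zero (α := ℝ)) (𝓝 (0 : ℝ))))
    simpa [pow_two] using this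
  have t3 : (fun s ↦ β s • E (S (g s - s • e))) =O[𝓝 0] fun s ↦ s ^ 2 := by
    simpa using (hone hβ).smul (((E ∘L S).isBigO_comp _ _).trans hg)
  have t4 : (fun s ↦ (β s - β₀) • s • E (S e)) =O[𝓝 0] fun s ↦ s ^ 2 := by
    have := hβ.smul ((isBigO_refl (fun s : ℝ ↦ s) (𝓝 0)).smul
      (isBigO_const_const (E (S e)) (one_ne_zero (α := ℝ)) (𝓝 (0 : ℝ))))
    simpa [pow_two] using this
  have t5 : (fun s ↦ γ s • (ν'.comp (S (S (g s))) * E (S (g s)))) =O[𝓝 0] fun s ↦ s ^ 2 := by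
    have := hγ.smul (hν1.mul (((E ∘L S).isBigO_comp g _).trans hg1))
    simpa [pow_two] using this
  refine (((t1.add t2).add (t3.add t4)).sub t5).congr_left fun s ↦ ?_
  simp only [derG, map_sub, map_smul, smul_sub, sub_smul, sub_mul, smul_add, zero_smul, smul_zero,
    smul_smul, mul_comm s]
  abel

namespace ResolventData

/-- A simple eigenvalue crossing transversally produces a curve of nontrivial solutions. -/
theorem exists_isBifurcationCurve (hR : ResolventData hp P E S) (hθ0 : 0 < θ) (hθ : θ ≤ 1)
    (hq : 1 < q) (hτ : 0 < τ) (hac : ContinuousOn a (Ioi 0)) (hbc : ContinuousOn b (Ioi 0))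
    (ha : HasStrictDerivAt a (_root_.deriv a τ) τ) (hb : HasStrictDerivAt b (_root_.deriv b τ) τ)
    (hv : IsEigenfunction h D θ μ v) (hμ : μ < 0) (hμ' : 0 < μ') (hα : a τ = μ + μ')
    (hβ : b τ * (q - 1) = -(μ * μ')) (hc : -_root_.deriv a τ * μ + _root_.deriv b τ * (1 - q) ≠ 0)
    {N : ℕ} (hN : HasNondegenerateCriticalPoints D N v) :
    ∃ (ε : ℝ) (U : ℝ → ℝ → ℝ) (T : ℝ → ℝ), 0 < ε ∧
      IsBifurcationCurve h D θ q a b τ v ε U T ∧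
      ∀ s ∈ Ioo (-ε) ε, s ≠ 0 → HasNondegenerateCriticalPoints D N (U s) := by
  have hD := hp.D_pos
  obtain ⟨⟨v₁, v₂, hsol⟩, x₀, hx₀, hvx₀⟩ := (hR.isEigenfunction_iff hθ0 hθ).1 hv
  set V := toX v hsol.cont₀ with hVdef
  have hVv : EqOn (ext hp.D_pos V) v (Icc 0 D) := ext_toX _
  have hV : LRel hp.D_pos h V (μ • V) :=
    ⟨v₁, v₂, hsol.congr hVv fun x hx ↦ by rw [ext_smul]; simp only [hVv hx]⟩
  have hV0 : V ≠ 0 := fun h0 ↦ hvx₀ (by rw [← hVv hx₀, h0]; rfl)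
  set e := μ ^ 2 • V with he
  set c := -_root_.deriv a τ * μ + _root_.deriv b τ * (1 - q)
  obtain ⟨ν, ν', Cν, hCν, hν, hν', hνb, hν0, hlip⟩ := exists_nonlinearity hq
  have hQ : QuadraticAt (fun f : C(Icc 0 D, ℝ) ↦ ν.comp f) Cν := quadraticAt_comp hCν hν0 hlip
  have hBeq : -(_root_.deriv a τ •
      (S + P.smulRight (1 : C(Icc 0 D, ℝ)) : C(Icc 0 D, ℝ) →L[ℝ] C(Icc 0 D, ℝ)) e) -
      _root_.deriv b τ • ((q - 1) • (S ∘L S)) e = c • V := by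
    have h1 : (S + P.smulRight (1 : C(Icc 0 D, ℝ))) e = μ • V := by
      have h2 : (S + P.smulRight (1 : C(Icc 0 D, ℝ))) e = S e + P e • 1 := rfl
      rw [h2, he, map_smul, map_smul, hR.P_eigen hV hμ.ne, smul_zero, zero_smul, add_zero, pow_two,
        mul_smul, hR.S_eigen hV hμ.ne]
    have h2 : ((q - 1) • (S ∘L S)) e = (q - 1) • S (S e) := rfl
    rw [h1, h2, hR.S_S_eigen hV hμ.ne, smul_smul, smul_smul, ← neg_smul, ← sub_smul]
    congr 1
    ring
  have hlin : linOp P S (a τ) (b τ * (q - 1)) e = 0 := hR.linOp_eigen hV hμ.ne hα hβ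
  obtain ⟨ε₀, M, g, T, hε₀, hM, hg0, hT0, hcurve, hgc, hTc, huniq⟩ :=
    exists_branch (J := S ∘L S) (A₀ := 1 - P.smulRight 1) (A₁ := S + P.smulRight 1)
      (A₂ := (q - 1) • (S ∘L S)) ha hb hQ (hR.coord_eigen hV hμ.ne hV0)
      (by rw [pencil_eq]; exact hlin)
      (by rw [pencil_eq, hBeq]; exact hR.isUnit_bordered hV hμ hμ' hV0 hα hβ hc)
  have hIoo : ∀ᶠ s in 𝓝 (0 : ℝ), s ∈ Ioo (-ε₀) ε₀ := Ioo_mem_nhds (by linarith) hε₀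
  have heq : ∀ s ∈ Ioo (-ε₀) ε₀, linOp P S (a (T s)) (b (T s) * (q - 1)) (g s) +
      b (T s) • ν.comp (S (S (g s))) = 0 := fun s hs ↦ by
    have := (hcurve s hs).1
    rwa [pencil_eq] at this
  have hder := fun s hs ↦ hR.hasDerivWithinAt_derG hν' (heq s hs)
  have hdere := hR.hasDerivWithinAt_derG (α := a τ) (β := b τ * (q - 1)) (γ := 0) (g := e) hν'
    (by rw [zero_smul, add_zero]; exact hlin)
  -- asymptotics of the branch at `s = 0`
  have hgO : (fun s ↦ g s - s • e) =O[𝓝 0] fun s ↦ s ^ 2 := by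
    refine IsBigO.of_bound M (hIoo.mono fun s hs ↦ ?_)
    rw [Real.norm_of_nonneg (sq_nonneg s)]
    exact (hcurve s hs).2.2.1
  have hTO : (fun s ↦ T s - τ) =O[𝓝 0] fun s ↦ s :=
    IsBigO.of_bound M (hIoo.mono fun s hs ↦ (hcurve s hs).2.2.2)
  have hTt : Tendsto T (𝓝 0) (𝓝 τ) := by
    have := hTO.trans_tendsto (continuous_id.tendsto (0 : ℝ))
    simpa using this.add_const τ
  have haO : (fun s ↦ a (T s) - a τ) =O[𝓝 0] fun s ↦ s :=
    (ha.hasDerivAt.hasFDerivAt.isBigO_sub.comp_tendsto hTt).trans hTO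
  have hbO : (fun s ↦ b (T s) - b τ) =O[𝓝 0] fun s ↦ s :=
    (hb.hasDerivAt.hasFDerivAt.isBigO_sub.comp_tendsto hTt).trans hTO
  have hbO' : (fun s ↦ b (T s) * (q - 1) - b τ * (q - 1)) =O[𝓝 0] fun s ↦ s := by
    simpa [sub_mul, mul_comm] using hbO.const_mul_left (q - 1)
  have hbO1 : (fun s ↦ b (T s)) =O[𝓝 0] fun _ ↦ (1 : ℝ) :=
    (hb.hasDerivAt.continuousAt.tendsto.comp hTt).isBigO_one ℝ
  obtain ⟨C₁, hC₁, hnorm⟩ := hR.exists_normC_le hθ0 hθ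
  obtain ⟨C₂, hC₂⟩ := (isBigO_iff.1 (hgO.norm_left.add
    (isBigO_derG_sub (E := E) (S := S) hνb hCν hgO
    haO hbO' hbO1).norm_left))
  have hquad : ∀ᶠ s in 𝓝 (0 : ℝ),
      normC D θ 4 (ext hp.D_pos (S (S (g s - s • e)))) ≤ ENNReal.ofReal (C₁ * C₂ * s ^ 2) := by
    filter_upwards [hC₂, hIoo] with s hs hsI
    refine (hnorm _ (derG E S ν' (a (T s)) (b (T s) * (q - 1)) (b (T s)) (g s) -
      s • derG E S ν' (a τ) (b τ * (q - 1)) 0 e) fun t ht ↦ ?_).trans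
      (ENNReal.ofReal_le_ofReal ?_)
    · exact (hder s hsI t ht).sub ((hdere t ht).const_mul s)
    · rw [mul_assoc]
      gcongr
      rwa [Real.norm_of_nonneg (by positivity), Real.norm_of_nonneg (sq_nonneg s)] at hs
  have hw0 : Tendsto (fun s ↦ S (S (g s))) (𝓝 0) (𝓝 0) := by
    have h1 : ContinuousAt g 0 := hgc.continuousAt hIoo
    have h2 : ContinuousAt (fun s ↦ S (S (g s))) 0 :=
      (S.continuous.comp S.continuous).continuousAt.comp h1
    have h3 := h2.tendsto
    rwa [hg0, map_zero, map_zero] at h3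
  -- stability of the critical points
  have hvset : {x ∈ Icc 0 D | derivOn D 1 v x = 0} = {x ∈ Icc 0 D | v₁ x = 0} := by
    ext x
    exact and_congr_right fun hx ↦ by rw [hsol.derivOn_one hD hx]
  obtain ⟨hN1, hN2⟩ := hN
  rw [hvset] at hN1
  obtain ⟨η, hη, hstab⟩ := exists_encard_zeros_eq hD hsol.deriv₂ hsol.cont₂ hsol.left hsol.right
    (finite_of_encard_eq_coe hN1) fun t ht h0 ↦ by
      rw [← hsol.derivOn_two hD ht]
      exact hN2 t ht (by rw [hsol.derivOn_one hD ht, h0])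
  have hsmall : ∀ᶠ s : ℝ in 𝓝 0, |C₁ * C₂ * s| < η := by
    have h1 : Tendsto (fun s : ℝ ↦ |C₁ * C₂ * s|) (𝓝 0) (𝓝 |C₁ * C₂ * 0|) :=
      (continuous_const.mul continuous_id).abs.tendsto 0
    rw [mul_zero, abs_zero] at h1
    exact h1.eventually_lt_const hη
  have hev := hIoo.and (hquad.and ((hw0.eventually (Metric.ball_mem_nhds 0 one_pos)).and
    ((hTt.eventually_const_lt hτ).and hsmall)))
  obtain ⟨ε, hε, hball⟩ := Metric.eventually_nhds_iff.1 hev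
  have hball : ∀ s ∈ Ioo (-ε) ε, _ := fun s hs ↦ hball (y := s) (by
    rw [Real.dist_eq, sub_zero]; exact abs_lt.2 hs)
  set U : ℝ → ℝ → ℝ := fun s x ↦ 1 + ext hp.D_pos (S (S (g s))) x with hU
  have hpos : ∀ s ∈ Ioo (-ε) ε, ∀ x ∈ Icc 0 D, 0 < U s x := fun s hs x hx ↦ by
    obtain ⟨-, -, h1, -⟩ := hball s hs
    rw [dist_zero_right] at h1
    have h2 := (abs_ext_le (hD := hp.D_pos) (S (S (g s))) x).trans_lt h1
    have := (abs_lt.1 h2).1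
    simp only [hU]; linarith
  have hℓ : ∀ s ∈ Ioo (-ε) ε, coord P S V (g s) = s := fun s hs ↦ (hcurve s (hball s hs).1).2.1
  have hεε₀ : ε ≤ ε₀ := by
    by_contra! hlt
    exact lt_irrefl _ (hball ε₀ ⟨by linarith, hlt⟩).1.2
  -- `U s` is `1 + s v + z` with `z = S² (g s - s e)`
  have hsplit : ∀ s, S (S (g s - s • e)) = S (S (g s)) - s • V := fun s ↦ by
    rw [map_sub, map_sub, map_smul, map_smul, hR.S_S_eigen hV hμ.ne]
  refine ⟨ε, U, T, hε, ⟨fun x hx ↦ ?_, hT0, fun s hs hs0 ↦ ?_, ?_, fun s hs ↦ ?_, ⟨C₁ * C₂,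
    fun s hs ↦ ?_⟩, ?_⟩, fun s hs hs0 ↦ ?_⟩
  · simp only [hU, hg0, map_zero]
    exact add_zero 1
  · refine (hR.isNontrivialSolution_iff hθ0 hθ hν hν').2 ⟨(hball s hs).2.2.2.1, hpos s hs, g s,
      fun h0 ↦ hs0 ?_, fun _ _ ↦ rfl, heq s (hball s hs).1⟩
    rw [← hℓ s hs, h0, map_zero]
  · exact hTc.mono fun s hs ↦ (hball s hs).1
  · have hsI := (hball s hs).1
    have hnear : ∀ᶠ r in 𝓝 s, r ∈ Ioo (-ε₀) ε₀ := Ioo_mem_nhds hsI.1 hsI.2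
    have c1 : ContinuousAt g s := hgc.continuousAt hnear
    have c2 : ContinuousAt T s := hTc.continuousAt hnear
    have hTs := (hball s hs).2.2.2.1
    have c3 : ContinuousAt (fun r ↦ a (T r)) s :=
      ContinuousAt.comp (hac.continuousAt (Ioi_mem_nhds hTs)) c2
    have c4 : ContinuousAt (fun r ↦ b (T r)) s :=
      ContinuousAt.comp (hbc.continuousAt (Ioi_mem_nhds hTs)) c2
    have c5 : ContinuousAt (fun r ↦ S (g r)) s := S.continuous.continuousAt.comp c1
    have c6 : ContinuousAt (fun r ↦ S (S (g r))) s := S.continuous.continuousAt.comp c5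
    have c7 : ContinuousAt (fun r ↦ E (g r)) s := E.continuous.continuousAt.comp c1
    have c8 : ContinuousAt (fun r ↦ E (S (g r))) s := E.continuous.continuousAt.comp c5
    have c9 : ContinuousAt (fun r ↦ ν'.comp (S (S (g r)))) s :=
      (ν'.continuous_postcomp).continuousAt.comp c6
    have c10 : ContinuousAt
        (fun r ↦ derG E S ν' (a (T r)) (b (T r) * (q - 1)) (b (T r)) (g r)) s :=
      ((c3.smul c7).add ((c4.mul continuousAt_const).smul c8)).sub (c4.smul (c9.mul c8))
    have c11 : Tendsto (fun r ↦ ENNReal.ofReal (C₁ * (‖g r - g s‖ +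
        ‖derG E S ν' (a (T r)) (b (T r) * (q - 1)) (b (T r)) (g r) -
          derG E S ν' (a (T s)) (b (T s) * (q - 1)) (b (T s)) (g s)‖))) (𝓝 s) (𝓝 0) := by
      have h0 : ContinuousAt (fun r ↦ C₁ * (‖g r - g s‖ +
          ‖derG E S ν' (a (T r)) (b (T r) * (q - 1)) (b (T r)) (g r) -
            derG E S ν' (a (T s)) (b (T s) * (q - 1)) (b (T s)) (g s)‖)) s :=
        continuousAt_const.mul
          ((c1.sub continuousAt_const).norm.add (c10.sub continuousAt_const).norm)
      have h1 := h0.tendsto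
      have h2 := ENNReal.tendsto_ofReal h1
      simpa using h2
    refine tendsto_of_tendsto_of_tendsto_of_le_of_le' tendsto_const_nhds c11
      (Eventually.of_forall fun _ ↦ zero_le) (hnear.mono fun r hr ↦ ?_)
    have h1 : EqOn (fun x ↦ U r x - U s x) (ext hp.D_pos (S (S (g r - g s)))) (Icc 0 D) :=
      fun x _ ↦ by
        rw [map_sub, map_sub]
        exact add_sub_add_left_eq_sub _ _ _
    rw [normC_congr h1]
    exact hnorm _ _ fun t ht ↦ (hder r hr t ht).sub (hder s hsI t ht)
  · have h1 : EqOn (fun x ↦ U s x - 1 - s * v x) (ext hp.D_pos (S (S (g s - s • e)))) (Icc 0 D) :=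
      fun x hx ↦ by
        rw [hsplit, ext_sub, ext_smul]
        simp only [hU, hVv hx]
        ring
    rw [normC_congr h1]
    exact (hball s hs).2.1
  · obtain ⟨δ₀, hδ₀, hun⟩ := huniq ε hε hεε₀
    obtain ⟨δ₁, hδ₁, hgs⟩ := hR.exists_norm_lt (θ := θ) (q := q) hQ ha.hasDerivAt.continuousAt
      hb.hasDerivAt.continuousAt hδ₀
    refine ⟨min δ₀ δ₁, by positivity, fun u r hu hur hr ↦ ?_⟩
    obtain ⟨-, -, f, hf0, huf, hfeq⟩ := (hR.isNontrivialSolution_iff hθ0 hθ hν hν').1 hu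
    have hfn := hgs u r f huf hfeq (hur.trans_le (ENNReal.ofReal_le_ofReal (min_le_right _ _)))
      (hr.trans_le (min_le_right _ _))
    obtain ⟨k1, k2, k3, k4⟩ := hun f r hf0 hfn (hr.trans_le (min_le_left _ _))
      (by rw [pencil_eq]; exact hfeq)
    refine ⟨coord P S V f, ⟨k1, k2, k4, fun x hx ↦ ?_⟩, fun s ⟨hs, hs0, hsT, hsu⟩ ↦ ?_⟩
    · rw [huf hx]
      simp only [hU, k3]
    · have h1 : S (S (g s - f)) = 0 := ext_injOn (hD := hp.D_pos) fun x hx ↦ by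
        rw [map_sub, map_sub]
        have h2 : ext hp.D_pos (S (S (g s)) - S (S f)) x =
          ext hp.D_pos (S (S (g s))) x - ext hp.D_pos (S (S f)) x := rfl
        have h3 := hsu hx
        rw [huf hx] at h3
        simp only [hU] at h3
        have h4 : ext hp.D_pos 0 x = 0 := rfl
        rw [h2, h4]
        linarith
      rw [← hℓ s hs, sub_eq_zero.1 (hR.eq_zero_of_S (hR.eq_zero_of_S h1))]
  · obtain ⟨hsI, hq2, -, -, hsη⟩ := hball s hs
    obtain ⟨z₁, z₂, hz⟩ := hR.lrel_S_add (g s - s • e)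
    have hUs := (hz.add hsol 1 s).add (LSol.const (D := D) (h := h) 1) 1 1
    have hUs := hUs.congr (v := U s) (fun x hx ↦ by
      rw [hsplit, ext_sub, ext_smul]
      simp only [hU, hVv hx]
      ring) (fun _ _ ↦ rfl)
    have hq3 : normC D θ 4 (ext hp.D_pos (S (S (g s - s • e)))) ≤
        ENNReal.ofReal (|C₁ * C₂ * s| * |s|) := hq2.trans (ENNReal.ofReal_le_ofReal (by
          rw [← abs_mul]
          calc _ = C₁ * C₂ * s * s := by ring
            _ ≤ _ := le_abs_self _))
    have hs0' : 0 < |s| := abs_pos.2 hs0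
    have hz1 : ∀ x ∈ Icc 0 D, |z₁ x| ≤ η * |s| := fun x hx ↦ by
      have := abs_derivOn_le_of_normC_le (by positivity) hq3 (show 1 ≤ 4 by norm_num) x hx
      rw [hz.derivOn_one hD hx] at this
      exact this.trans (by gcongr)
    have hz2 : ∀ x ∈ Icc 0 D, |z₂ x| ≤ η * |s| := fun x hx ↦ by
      have := abs_derivOn_le_of_normC_le (by positivity) hq3 (show 2 ≤ 4 by norm_num) x hx
      rw [hz.derivOn_two hD hx] at this
      exact this.trans (by gcongr)
    -- the derivatives of `(U s - 1) / s` are close to those of `v`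
    have hquot : ∀ {y : ℝ}, |y| ≤ η * |s| → |y / s| ≤ η := fun {y} hy ↦ by
      rw [abs_div, div_le_iff₀ hs0']; exact hy
    obtain ⟨k1, k2⟩ := hstab (fun x ↦ z₁ x / s + v₁ x) (fun x ↦ z₂ x / s + v₂ x)
      (fun x hx ↦ ((hz.deriv₂ x hx).div_const s).add (hsol.deriv₂ x hx))
      (by simp [hz.left, hsol.left]) (by simp [hz.right, hsol.right])
      (fun x hx ↦ ⟨by simpa using hquot (hz1 x hx), by simpa using hquot (hz2 x hx)⟩)
    have e1 : ∀ x ∈ Icc 0 D, derivOn D 1 (U s) x = s * (z₁ x / s + v₁ x) := fun x hx ↦ by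
      rw [hUs.derivOn_one hD hx]; field_simp; ring
    have e2 : ∀ x ∈ Icc 0 D, derivOn D 2 (U s) x = s * (z₂ x / s + v₂ x) := fun x hx ↦ by
      rw [hUs.derivOn_two hD hx]; field_simp; ring
    refine ⟨?_, fun x hx hx0 ↦ ?_⟩
    · rw [← hN1, ← k1]
      congr 1
      ext x
      exact and_congr_right fun hx ↦ by rw [e1 x hx, mul_eq_zero, or_iff_right hs0]
    · rw [e1 x hx, mul_eq_zero, or_iff_right hs0] at hx0
      rw [e2 x hx]
      exact mul_ne_zero hs0 (k2 x hx hx0)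

end ResolventData

end Curve


/-! ### Bifurcation for a profile -/

section Bifurcation

variable {D : ℝ} {m₀ m₁ : ℕ} {K κ h : ℝ → ℝ} {θ : ℝ≥0} {q : ℝ} {a b : ℝ → ℝ}

/-- `φ(t)` is the negative root of the characteristic polynomial of the linearization. -/
lemma exists_roots {t : ℝ} (hq : 1 < q) (ha : 0 < a t) (hb : 0 < b t) :
    phi q a b t < 0 ∧ ∃ μ', 0 < μ' ∧ a t = phi q a b t + μ' ∧
      b t * (q - 1) = -(phi q a b t * μ') := by
  have h1 : 0 < b t * (q - 1) := mul_pos hb (sub_pos.2 hq)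
  have h2 : √(a t ^ 2 + 4 * b t * (q - 1)) ^ 2 = a t ^ 2 + 4 * b t * (q - 1) :=
    Real.sq_sqrt (by nlinarith)
  have h3 : a t < √(a t ^ 2 + 4 * b t * (q - 1)) := Real.lt_sqrt_of_sq_lt (by linarith)
  refine ⟨by rw [phi]; linarith, 1 / 2 * (a t + √(a t ^ 2 + 4 * b t * (q - 1))), by linarith,
    by rw [phi]; ring, ?_⟩
  rw [phi]
  linear_combination (-1 / 4 : ℝ) * h2

lemma continuousOn_phi (ha : ContinuousOn a (Ioi 0)) (hb : ContinuousOn b (Ioi 0)) :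
    ContinuousOn (phi q a b) (Ioi 0) :=
  continuousOn_const.mul (ha.sub ((ha.pow 2).add
    ((continuousOn_const.mul hb).mul continuousOn_const)).sqrt)

/-- A bifurcating curve shows that its base point is a bifurcation point. -/
lemma IsBifurcationCurve.isBifurcationPoint {τ ε : ℝ} {v : ℝ → ℝ} {U : ℝ → ℝ → ℝ} {T : ℝ → ℝ}
    (hU : IsBifurcationCurve h D θ q a b τ v ε U T) (hε : 0 < ε) (hτ : 0 < τ) :
    IsBifurcationPoint h D θ q a b τ := by
  obtain ⟨hU0, hT0, hsol, hT, hUc, -, -⟩ := hU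
  refine ⟨hτ, fun r hr ↦ ?_⟩
  have h0 : (0 : ℝ) ∈ Ioo (-ε) ε := ⟨by linarith, hε⟩
  have hnear : ∀ᶠ s in 𝓝 (0 : ℝ), s ∈ Ioo (-ε) ε := Ioo_mem_nhds h0.1 h0.2
  have h1 := (hUc 0 h0).eventually_lt_const (ENNReal.ofReal_pos.2 hr)
  have h2 : ∀ᶠ s in 𝓝 (0 : ℝ), |T s - τ| < r := by
    have := (hT.continuousAt hnear).tendsto.eventually (Metric.ball_mem_nhds _ hr)
    rwa [hT0] at this
  have h3 : ∀ᶠ s in 𝓝[≠] (0 : ℝ), s ≠ 0 := eventually_mem_nhdsWithin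
  obtain ⟨s, hs0, hs, hs1, hs2⟩ := (h3.and
    ((hnear.and (h1.and h2)).filter_mono nhdsWithin_le_nhds)).exists
  refine ⟨U s, T s, hsol s hs hs0, ?_, hs2⟩
  rwa [normC_congr (v := fun x ↦ U s x - U 0 x) fun x hx ↦ by simp only [hU0 x hx]]

/-- Since `φ(t) < 0` is one root of the characteristic polynomial of the linearization and the other
root is positive, the linearization is singular exactly when `φ(t)` is an eigenvalue of `L`. -/
theorem Profile.bifurcation (hp : Profile D m₀ m₁ K κ h) (hθ₀ : 0 < θ) (hθ₁ : θ < 1) (hq : 1 < q)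
    (ha : ContDiffOn ℝ ∞ a (Ioi 0)) (hb : ContDiffOn ℝ ∞ b (Ioi 0))
    (ha_pos : ∀ t, 0 < t → 0 < a t) (hb_pos : ∀ t, 0 < t → 0 < b t)
    (hφ_anti : StrictAntiOn (phi q a b) (Ioi 0))
    (hφ_zero : Tendsto (phi q a b) (𝓝[>] 0) (𝓝 0))
    (hφ_bot : Tendsto (phi q a b) atTop atBot)
    (htrans : ∀ t, 0 < t → IsEigenvalue h D θ (phi q a b t) →
      -deriv a t * phi q a b t + deriv b t * (1 - q) ≠ 0) :
    ∃ lam : ℕ → ℝ, lam 0 = 0 ∧ StrictAnti lam ∧ Tendsto lam atTop atBot ∧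
      (∀ μ, IsEigenvalue h D θ μ ↔ ∃ i, lam i = μ) ∧
    ∃ τ : ℕ → ℝ, (∀ i, 1 ≤ i → 0 < τ i) ∧ StrictMonoOn τ (Ici 1) ∧ Tendsto τ atTop atTop ∧
      (∀ i, 1 ≤ i → ∀ t, 0 < t → (phi q a b t = lam i ↔ t = τ i)) ∧
      (∀ t, IsBifurcationPoint h D θ q a b t ↔ ∃ i, 1 ≤ i ∧ τ i = t) ∧
      ∀ i, 1 ≤ i → ∀ v, IsEigenfunction h D θ (lam i) v →
        IsSimpleWithKernel h D θ q a b (τ i) v ∧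
        HasNondegenerateCriticalPoints D (i + 1) v ∧
        ∃ (ε : ℝ) (U : ℝ → ℝ → ℝ) (T : ℝ → ℝ), 0 < ε ∧
          IsBifurcationCurve h D θ q a b (τ i) v ε U T ∧
          ∀ s ∈ Ioo (-ε) ε, s ≠ 0 → HasNondegenerateCriticalPoints D (i + 1) (U s) := by
  have hD := hp.D_pos
  obtain ⟨P, E, S, hR⟩ := hp.exists_resolvent
  obtain ⟨lam, hl0, hlanti, hlbot, hlspec, hlcrit⟩ := hp.exists_spectrum
  have heig : ∀ μ, IsEigenvalue h D θ μ ↔ ∃ i, lam i = μ := fun μ ↦ by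
    rw [← hlspec μ]
    constructor
    · rintro ⟨v, hv⟩
      obtain ⟨⟨v₁, v₂, h1⟩, h2⟩ := (hR.isEigenfunction_iff hθ₀ hθ₁.le).1 hv
      exact ⟨v, v₁, v₂, h1, h2⟩
    · rintro ⟨v, v₁, v₂, h1, h2⟩
      exact ⟨v, (hR.isEigenfunction_iff hθ₀ hθ₁.le).2 ⟨⟨v₁, v₂, h1⟩, h2⟩⟩
  have hlneg : ∀ i, 1 ≤ i → lam i < 0 := fun i hi ↦ by
    have := hlanti (show 0 < i by omega)
    rwa [hl0] at this
  have hφc : ContinuousOn (phi q a b) (Ioi 0) := continuousOn_phi ha.continuousOn hb.continuousOn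
  have hex : ∀ i, ∃ t, 1 ≤ i → 0 < t ∧ phi q a b t = lam i := fun i ↦ by
    by_cases hi : 1 ≤ i
    · obtain ⟨t₁, h1, h1'⟩ := ((hφ_zero.eventually_const_lt (hlneg i hi)).and
        self_mem_nhdsWithin).exists
      obtain ⟨t₂, h2, h2'⟩ := ((hφ_bot.eventually_lt_atBot (lam i)).and (eventually_gt_atTop 0)).exists
      obtain ⟨t, ht, hte⟩ := isPreconnected_Ioi.intermediate_value h2' h1' hφc ⟨h2.le, h1.le⟩
      exact ⟨t, fun _ ↦ ⟨ht, hte⟩⟩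
    · exact ⟨0, fun h ↦ absurd h hi⟩
  choose τ hτ using hex
  have huniq : ∀ i, 1 ≤ i → ∀ t, 0 < t → (phi q a b t = lam i ↔ t = τ i) := fun i hi t ht ↦ by
    constructor
    · intro h1
      exact hφ_anti.injOn ht (hτ i hi).1 (h1.trans (hτ i hi).2.symm)
    · rintro rfl
      exact (hτ i hi).2
  have hmain : ∀ i, 1 ≤ i → ∀ v, IsEigenfunction h D θ (lam i) v →
        IsSimpleWithKernel h D θ q a b (τ i) v ∧
        HasNondegenerateCriticalPoints D (i + 1) v ∧
        ∃ (ε : ℝ) (U : ℝ → ℝ → ℝ) (T : ℝ → ℝ), 0 < ε ∧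
          IsBifurcationCurve h D θ q a b (τ i) v ε U T ∧
          ∀ s ∈ Ioo (-ε) ε, s ≠ 0 → HasNondegenerateCriticalPoints D (i + 1) (U s) := by
    intro i hi v hv
    obtain ⟨hτ0, hφ⟩ := hτ i hi
    obtain ⟨-, μ', hμ', hα, hβ⟩ := exists_roots hq (ha_pos _ hτ0) (hb_pos _ hτ0)
    rw [hφ] at hα hβ
    have hc := htrans (τ i) hτ0 (hφ ▸ ⟨v, hv⟩)
    rw [hφ] at hc
    obtain ⟨⟨v₁, v₂, hsol⟩, hne⟩ := (hR.isEigenfunction_iff hθ₀ hθ₁.le).1 hv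
    obtain ⟨hc1, hc2⟩ := hlcrit i hi v v₁ v₂ hsol hne
    have hN : HasNondegenerateCriticalPoints D (i + 1) v := by
      refine ⟨?_, fun x hx h0 ↦ ?_⟩
      · rw [show {x ∈ Icc 0 D | derivOn D 1 v x = 0} = {x ∈ Icc 0 D | v₁ x = 0} from
          Set.ext fun x ↦ and_congr_right fun hx ↦ by rw [hsol.derivOn_one hD hx], hc1]
        norm_cast
      · rw [hsol.derivOn_two hD hx]
        exact hc2 x hx (by rw [← hsol.derivOn_one hD hx, h0])
    have hstrict : ∀ {f : ℝ → ℝ}, ContDiffOn ℝ ∞ f (Ioi 0) →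
        HasStrictDerivAt f (deriv f (τ i)) (τ i) := fun hf ↦
      (hf.contDiffAt (Ioi_mem_nhds hτ0)).hasStrictDerivAt (by simp)
    exact ⟨hR.isSimpleWithKernel hθ₀ hθ₁.le hv (hlneg i hi) hμ' hα hβ hc, hN,
      hR.exists_isBifurcationCurve hθ₀ hθ₁.le hq hτ0 ha.continuousOn hb.continuousOn (hstrict ha)
        (hstrict hb) hv (hlneg i hi) hμ' hα hβ hc hN⟩
  refine ⟨lam, hl0, hlanti, hlbot, heig, τ, fun i hi ↦ (hτ i hi).1, fun i hi j hj hij ↦ ?_,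
    ?_, huniq,
    fun t ↦ ⟨fun hbif ↦ ?_, ?_⟩, hmain⟩
  · refine (hφ_anti.lt_iff_gt (hτ j hj).1 (hτ i hi).1).1 ?_
    rw [(hτ i hi).2, (hτ j hj).2]
    exact hlanti hij
  · refine tendsto_atTop.2 fun B ↦ ?_
    filter_upwards [hlbot.eventually_lt_atBot (phi q a b (max B 1)),
      eventually_ge_atTop 1] with i h1 h2
    have h3 : (0 : ℝ) < max B 1 := lt_max_of_lt_right one_pos
    rw [← (hτ i h2).2] at h1
    exact (le_max_left _ _).trans ((hφ_anti.lt_iff_gt (hτ i h2).1 h3).1 h1).le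
  · by_contra! hno
    have ht := hbif.1
    obtain ⟨hμ, μ', hμ', hα, hβ⟩ := exists_roots hq (ha_pos _ ht) (hb_pos _ ht)
    refine hR.not_isBifurcationPoint hθ₀ hθ₁.le hq
      (ha.continuousOn.continuousAt (Ioi_mem_nhds ht))
      (hb.continuousOn.continuousAt (Ioi_mem_nhds ht))
      (hR.isUnit_linOp hμ' hα hβ fun v hv ↦ ?_) hbif
    by_contra hv0
    obtain ⟨v₁, v₂, hsol⟩ := hv
    have hne : ∃ x ∈ Icc 0 D, ext hp.D_pos v x ≠ 0 := by
      by_contra! hall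
      exact hv0 (ext_injOn (hD := hp.D_pos) fun x hx ↦ (hall x hx).trans rfl)
    obtain ⟨i, hi⟩ := (hlspec (phi q a b t)).1 ⟨_, v₁, v₂, hsol, hne⟩
    have hi1 : 1 ≤ i := by
      by_contra! h0
      obtain rfl : i = 0 := by omega
      rw [hl0] at hi
      exact hμ.ne hi.symm
    exact hno i hi1 ((huniq i hi1 t ht).1 hi.symm).symm
  · rintro ⟨i, hi, rfl⟩
    obtain ⟨v, hv⟩ := (heig (lam i)).2 ⟨i, rfl⟩
    obtain ⟨-, -, ε, U, T, hε, hU, -⟩ := hmain i hi v hv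
    exact hU.isBifurcationPoint hε (hτ i hi).1

end Bifurcation


/-! ### The metric in charts -/

set_option linter.unusedSectionVars false

section Chart

open Matrix Manifold MeasureTheory

/-- The quadratic form of the inverse Gram matrix computes the square norm of the vector that
represents a linear form. -/
lemma exists_riesz_gram {V : Type*} [NormedAddCommGroup V] [InnerProductSpace ℝ V] {n : ℕ}
    (b : Fin n → V) (hb : LinearIndependent ℝ b) (hspan : ∀ u, ∃ c : Fin n → ℝ, u = ∑ i, c i • b i)
    (ℓ : V → ℝ) (hℓ : ∀ c : Fin n → ℝ, ℓ (∑ i, c i • b i) = ∑ i, c i * ℓ (b i)) :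
    ∃ v : V, (∀ u, ℓ u = inner ℝ v u) ∧ (v = ∑ i, ((gram ℝ b)⁻¹ *ᵥ fun i ↦ ℓ (b i)) i • b i) ∧
      (fun i ↦ ℓ (b i)) ⬝ᵥ (gram ℝ b)⁻¹ *ᵥ (fun i ↦ ℓ (b i)) = ‖v‖ ^ 2 := by
  set G := gram ℝ b with hG
  set ξ := fun i ↦ ℓ (b i) with hξ
  have hdet : IsUnit G.det := (Matrix.isUnit_iff_isUnit_det _).1
    (posDef_gram_of_linearIndependent hb).isUnit
  set w := G⁻¹ *ᵥ ξ with hw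
  have hGw : G *ᵥ w = ξ := by rw [hw, mulVec_mulVec, mul_nonsing_inv _ hdet, one_mulVec]
  set v := ∑ i, w i • b i with hv
  have hinner : ∀ j, inner ℝ v (b j) = ξ j := fun j ↦ by
    rw [← hGw, hv, sum_inner]
    simp only [mulVec, dotProduct, hG, gram_apply]
    refine Finset.sum_congr rfl fun i _ ↦ ?_
    rw [real_inner_smul_left, real_inner_comm, mul_comm]
  have hℓv : ∀ u, ℓ u = inner ℝ v u := fun u ↦ by
    obtain ⟨c, rfl⟩ := hspan u
    rw [hℓ, inner_sum]
    refine Finset.sum_congr rfl fun i _ ↦ ?_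
    rw [real_inner_smul_right, hinner]
  refine ⟨v, hℓv, rfl, ?_⟩
  rw [← real_inner_self_eq_norm_sq, ← hℓv, hv, hℓ, dotProduct]
  exact Finset.sum_congr rfl fun i _ ↦ mul_comm _ _

variable {n : ℕ} {M : Type*} [MetricSpace M] [ChartedSpace (EuclideanSpace ℝ (Fin n)) M]
  [IsManifold (𝓡 n) ∞ M]
  {f : M → ℝ} {x p : M} {y : EuclideanSpace ℝ (Fin n)} {C : ℝ}

/-- The differential of a real function, as a linear form. -/
noncomputable def diffAt (f : M → ℝ) (p : M) : TangentSpace (𝓡 n) p →L[ℝ] ℝ :=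
  mfderiv (𝓡 n) 𝓘(ℝ, ℝ) f p

lemma isOpen_target (x : M) : IsOpen (extChartAt (𝓡 n) x).target := isOpen_extChartAt_target x

lemma mdifferentiableAt_symm (hy : y ∈ (extChartAt (𝓡 n) x).target) :
    MDifferentiableAt (𝓡 n) (𝓡 n) (extChartAt (𝓡 n) x).symm y :=
  ((contMDiffOn_extChartAt_symm (n := ∞) x).contMDiffAt
    ((isOpen_target x).mem_nhds hy)).mdifferentiableAt (by simp)

lemma contDiffOn_inChart (hf : ContMDiff (𝓡 n) 𝓘(ℝ, ℝ) ∞ f) (x : M) :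
    ContDiffOn ℝ ∞ (inChart x f) (extChartAt (𝓡 n) x).target :=
  (hf.comp_contMDiffOn (contMDiffOn_extChartAt_symm x)).contDiffOn

lemma partialDeriv_inChart (hf : MDifferentiableAt (𝓡 n) 𝓘(ℝ, ℝ) f ((extChartAt (𝓡 n) x).symm y))
    (hy : y ∈ (extChartAt (𝓡 n) x).target) (i : Fin n) :
    partialDeriv i (inChart x f) y =
      diffAt f ((extChartAt (𝓡 n) x).symm y) (coordVector x i y) := by
  have h1 := mfderiv_comp y hf (mdifferentiableAt_symm hy)
  rw [partialDeriv, ← mfderiv_eq_fderiv]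
  exact DFunLike.congr_fun h1 _

lemma mfderiv_symm_apply (y w : EuclideanSpace ℝ (Fin n)) :
    (mfderiv (𝓡 n) (𝓡 n) (extChartAt (𝓡 n) x).symm y w :
      TangentSpace (𝓡 n) ((extChartAt (𝓡 n) x).symm y)) = ∑ i, w i • coordVector x i y := by
  have h1 : w = ∑ i, w i • EuclideanSpace.single i (1 : ℝ) := by
    ext j
    simp [Finset.sum_apply, Pi.single_apply]
  conv_lhs => rw [h1]
  exact (map_sum (mfderiv (𝓡 n) (𝓡 n) (extChartAt (𝓡 n) x).symm y) _ _).trans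
    (Finset.sum_congr rfl fun i _ ↦ map_smul _ _ _)

lemma isInvertible_mfderiv_symm (hy : y ∈ (extChartAt (𝓡 n) x).target) :
    (mfderiv (𝓡 n) (𝓡 n) (extChartAt (𝓡 n) x).symm y).IsInvertible := by
  have h1 := isInvertible_mfderivWithin_extChartAt_symm (I := 𝓡 n) hy
  rwa [ModelWithCorners.range_eq_univ, mfderivWithin_univ] at h1

variable [Bundle.RiemannianBundle (fun x : M ↦ TangentSpace (𝓡 n) x)]

lemma linearIndependent_coordVector (hy : y ∈ (extChartAt (𝓡 n) x).target) :
    LinearIndependent ℝ (fun i ↦ coordVector x i y) := by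
  rw [Fintype.linearIndependent_iff]
  intro c hc i
  have h1 := mfderiv_symm_apply (x := x) y (WithLp.toLp 2 c)
  have h2 : (mfderiv (𝓡 n) (𝓡 n) (extChartAt (𝓡 n) x).symm y) (WithLp.toLp 2 c) = 0 := h1.trans hc
  have h3 := (isInvertible_mfderiv_symm hy).injective (h2.trans (map_zero _).symm)
  have h4 : (WithLp.toLp 2 c : EuclideanSpace ℝ (Fin n)) = 0 := h3
  simpa using congrArg (fun z : EuclideanSpace ℝ (Fin n) ↦ z i) h4

lemma exists_coord (hy : y ∈ (extChartAt (𝓡 n) x).target)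
    (u : TangentSpace (𝓡 n) ((extChartAt (𝓡 n) x).symm y)) :
    ∃ c : Fin n → ℝ, u = ∑ i, c i • coordVector x i y := by
  obtain ⟨w, hw⟩ := (isInvertible_mfderiv_symm hy).surjective u
  exact ⟨fun i ↦ (show EuclideanSpace ℝ (Fin n) from w) i, hw.symm.trans (mfderiv_symm_apply _ _)⟩

lemma posDef_metricMatrix (hy : y ∈ (extChartAt (𝓡 n) x).target) : (metricMatrix x y).PosDef :=
  posDef_gram_of_linearIndependent (linearIndependent_coordVector hy)

/-- `c` is the square norm of the gradient of `f` at `p`. -/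
def IsGradNormSq (f : M → ℝ) (p : M) (c : ℝ) : Prop :=
  ∃ v : TangentSpace (𝓡 n) p, (∀ u, diffAt f p u = inner ℝ v u) ∧ c = ‖v‖ ^ 2

lemma IsGradNormSq.unique {c c' : ℝ} (h : IsGradNormSq (n := n) f p c)
    (h' : IsGradNormSq (n := n) f p c') : c = c' := by
  obtain ⟨v, hv, rfl⟩ := h
  obtain ⟨v', hv', rfl⟩ := h'
  rw [ext_inner_right ℝ fun u ↦ (hv u).symm.trans (hv' u)]

lemma IsGradNormSq.abs_le {c : ℝ} (h : IsGradNormSq (n := n) f p c) (u : TangentSpace (𝓡 n) p) :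
    |diffAt f p u| ≤ √c * ‖u‖ := by
  obtain ⟨v, hv, rfl⟩ := h
  rw [hv, Real.sqrt_sq (norm_nonneg _)]
  exact abs_real_inner_le_norm v u

/-- The gradient form `∑ gⁱʲ ∂ᵢ f ∂ⱼ f` read in the chart at `x`. -/
lemma isGradNormSq_chart (hf : MDifferentiableAt (𝓡 n) 𝓘(ℝ, ℝ) f ((extChartAt (𝓡 n) x).symm y))
    (hy : y ∈ (extChartAt (𝓡 n) x).target) :
    IsGradNormSq (n := n) f ((extChartAt (𝓡 n) x).symm y)
      ((fun i ↦ partialDeriv i (inChart x f) y) ⬝ᵥ (metricMatrix x y)⁻¹ *ᵥ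
        fun i ↦ partialDeriv i (inChart x f) y) := by
  have hsum : ∀ c : Fin n → ℝ, diffAt f ((extChartAt (𝓡 n) x).symm y)
      (∑ i, c i • coordVector x i y) =
      ∑ i, c i * diffAt f ((extChartAt (𝓡 n) x).symm y) (coordVector x i y) := fun c ↦ by
    rw [map_sum]
    exact Finset.sum_congr rfl fun i _ ↦ map_smul _ _ _
  obtain ⟨v, h1, -, h2⟩ := exists_riesz_gram
    (V := TangentSpace (𝓡 n) ((extChartAt (𝓡 n) x).symm y)) (fun i ↦ coordVector x i y)
    (linearIndependent_coordVector hy) (exists_coord hy)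
    (fun u ↦ diffAt f ((extChartAt (𝓡 n) x).symm y) u) hsum
  refine ⟨v, h1, ?_⟩
  rw [← h2]
  simp only [partialDeriv_inChart hf hy]
  rfl

lemma gradNormSq_eq (f : M → ℝ) (x : M) : gradNormSq (n := n) f x =
    (fun i ↦ partialDeriv i (inChart x f) (extChartAt (𝓡 n) x x)) ⬝ᵥ
      (metricMatrix x (extChartAt (𝓡 n) x x))⁻¹ *ᵥ
        fun i ↦ partialDeriv i (inChart x f) (extChartAt (𝓡 n) x x) := by
  simp only [gradNormSq, dotProduct, mulVec, Finset.mul_sum]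
  refine Finset.sum_congr rfl fun i _ ↦ Finset.sum_congr rfl fun j _ ↦ by ring

lemma isGradNormSq (hf : MDifferentiableAt (𝓡 n) 𝓘(ℝ, ℝ) f p) :
    IsGradNormSq (n := n) f p (gradNormSq (n := n) f p) := by
  have h0 : (extChartAt (𝓡 n) p).symm (extChartAt (𝓡 n) p p) = p := extChartAt_to_inv p
  have h1 := isGradNormSq_chart (f := f) (x := p) (y := extChartAt (𝓡 n) p p)
    (by rwa [h0]) (mem_extChartAt_target p)
  rw [h0] at h1
  rwa [gradNormSq_eq]

/-- `|∇ f|²` does not depend on the chart. -/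
lemma gradNormSq_eq_chart (hf : MDifferentiableAt (𝓡 n) 𝓘(ℝ, ℝ) f ((extChartAt (𝓡 n) x).symm y))
    (hy : y ∈ (extChartAt (𝓡 n) x).target) :
    (fun i ↦ partialDeriv i (inChart x f) y) ⬝ᵥ (metricMatrix x y)⁻¹ *ᵥ
        (fun i ↦ partialDeriv i (inChart x f) y) =
      gradNormSq (n := n) f ((extChartAt (𝓡 n) x).symm y) :=
  (isGradNormSq_chart hf hy).unique (isGradNormSq hf)

lemma norm_mfderiv_symm_sq (y w : EuclideanSpace ℝ (Fin n)) :
    ‖(mfderiv (𝓡 n) (𝓡 n) (extChartAt (𝓡 n) x).symm y w :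
      TangentSpace (𝓡 n) ((extChartAt (𝓡 n) x).symm y))‖ ^ 2 =
      w.ofLp ⬝ᵥ metricMatrix x y *ᵥ w.ofLp := by
  rw [mfderiv_symm_apply, ← real_inner_self_eq_norm_sq, sum_inner]
  simp only [inner_sum, real_inner_smul_left, real_inner_smul_right, dotProduct, mulVec,
    Finset.mul_sum, metricMatrix, of_apply]
  exact Finset.sum_congr rfl fun i _ ↦ Finset.sum_congr rfl fun j _ ↦ by ring

variable [IsContMDiffRiemannianBundle (𝓡 n) ∞ (EuclideanSpace ℝ (Fin n))
      (fun x : M ↦ TangentSpace (𝓡 n) x)]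

lemma contMDiffOn_coordVector (x : M) (i : Fin n) :
    ContMDiffOn (𝓡 n) (𝓡 n).tangent ∞
      (fun y ↦ (⟨(extChartAt (𝓡 n) x).symm y, coordVector x i y⟩ : TangentBundle (𝓡 n) M))
      (extChartAt (𝓡 n) x).target := by
  have h1 := (contMDiffOn_extChartAt_symm (I := 𝓡 n) (n := ∞) x).contMDiffOn_tangentMapWithin
    (m := ∞) le_rfl (isOpen_target x).uniqueMDiffOn
  have h2 : ContMDiff (𝓡 n) (𝓡 n).tangent ∞ (fun y : EuclideanSpace ℝ (Fin n) ↦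
      (⟨y, EuclideanSpace.single i (1 : ℝ)⟩ : TangentBundle (𝓡 n) (EuclideanSpace ℝ (Fin n)))) := by
    rw [← contMDiffOn_univ]
    exact contMDiffOn_vectorSpace_iff_contDiffOn.2 contDiffOn_const
  refine (h1.comp h2.contMDiffOn fun y hy ↦ hy).congr fun y hy ↦ ?_
  simp only [Function.comp_apply, tangentMapWithin, coordVector,
    mfderivWithin_of_mem_nhds ((isOpen_target x).mem_nhds hy)]

lemma contDiffOn_metricMatrix (x : M) (i j : Fin n) :
    ContDiffOn ℝ ∞ (fun y ↦ metricMatrix x y i j) (extChartAt (𝓡 n) x).target :=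
  ((contMDiffOn_coordVector x i).inner_bundle (contMDiffOn_coordVector x j)).contDiffOn

/-! ### Gradient bounds and distances -/

variable [IsRiemannianManifold (𝓡 n) M] {g : M → ℝ}

/-- A function whose differential is bounded by `C` is `C`-Lipschitz. -/
lemma abs_sub_le_of_diffAt_le (hg : ContMDiff (𝓡 n) 𝓘(ℝ, ℝ) 1 g) (hC : 0 ≤ C)
    (h : ∀ p u, |diffAt (n := n) g p u| ≤ C * ‖u‖) (x y : M) : |g x - g y| ≤ C * dist x y := by
  have key : ∀ r : ℝ≥0∞, edist x y < r → edist (g x) (g y) ≤ ENNReal.ofReal C * r := fun r hr ↦ by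
    rw [IsRiemannianManifold.out (I := 𝓡 n) x y] at hr
    obtain ⟨γ, h0, h1, hγ, hlen⟩ := exists_lt_of_riemannianEDist_lt hr
    have hgγ : ContMDiffOn 𝓘(ℝ) 𝓘(ℝ, ℝ) 1 (g ∘ γ) (Icc 0 1) := hg.comp_contMDiffOn hγ
    rw [IsRiemannianManifold.out (I := 𝓘(ℝ, ℝ)) (g x) (g y)]
    refine (riemannianEDist_le_pathELength hgγ (by simp [h0]) (by simp [h1]) zero_le_one).trans ?_
    refine le_trans ?_ (mul_le_mul_right hlen.le _)
    rw [pathELength_eq_lintegral_mfderiv_Ioo, pathELength_eq_lintegral_mfderiv_Ioo,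
      ← lintegral_const_mul' _ _ ENNReal.ofReal_ne_top]
    refine setLIntegral_mono' measurableSet_Ioo fun t ht ↦ ?_
    have hγt : MDifferentiableAt 𝓘(ℝ) (𝓡 n) γ t :=
      (hγ.contMDiffAt (Icc_mem_nhds ht.1 ht.2)).mdifferentiableAt one_ne_zero
    have e1 := mfderiv_comp t ((hg (γ t)).mdifferentiableAt one_ne_zero) hγt
    have e2 : mfderiv 𝓘(ℝ) 𝓘(ℝ, ℝ) (g ∘ γ) t 1 =
      diffAt (n := n) g (γ t) (mfderiv 𝓘(ℝ) (𝓡 n) γ t 1) := by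
      rw [e1]; rfl
    rw [enorm_tangentSpace_vectorSpace, e2]
    have e3 := h (γ t) (mfderiv 𝓘(ℝ) (𝓡 n) γ t 1)
    rw [← ofReal_norm, ← ofReal_norm, ← ENNReal.ofReal_mul hC]
    exact ENNReal.ofReal_le_ofReal e3
  have key' : ∀ r, dist x y < r → |g x - g y| ≤ C * r := fun r hr ↦ by
    have hr0 : 0 < r := dist_nonneg.trans_lt hr
    have h2 := key (ENNReal.ofReal r) (by rwa [edist_dist, ENNReal.ofReal_lt_ofReal_iff hr0])
    rw [edist_dist, ← ENNReal.ofReal_mul hC] at h2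
    exact (ENNReal.ofReal_le_ofReal_iff (by positivity)).1 h2
  refine le_of_forall_pos_le_add fun ε hε ↦ (key' (dist x y + ε / (C + 1))
    (lt_add_of_pos_right _ (by positivity))).trans ?_
  have h3 : C * (ε / (C + 1)) ≤ ε := by
    rw [mul_div_assoc', div_le_iff₀ (by positivity)]
    nlinarith
  linarith

lemma fderiv_eq_sum (f : EuclideanSpace ℝ (Fin n) → ℝ) (y w : EuclideanSpace ℝ (Fin n)) :
    fderiv ℝ f y w = w.ofLp ⬝ᵥ fun i ↦ partialDeriv i f y := by
  have h1 : w = ∑ i, w i • EuclideanSpace.single i (1 : ℝ) := by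
    ext j
    simp [Finset.sum_apply, Pi.single_apply]
  conv_lhs => rw [h1]
  rw [map_sum]
  exact Finset.sum_congr rfl fun i _ ↦ map_smul _ _ _

/-- If `w` has length less than `c` at `x`, then by continuity of the metric the point with
coordinates `y₀ + s w` has distance at most `c s` from `x` for small `s`. -/
lemma eventually_dist_le (x : M) (w : EuclideanSpace ℝ (Fin n)) {c : ℝ} (hc : 0 < c)
    (hw : w.ofLp ⬝ᵥ metricMatrix x (extChartAt (𝓡 n) x x) *ᵥ w.ofLp < c ^ 2) :
    ∀ᶠ s in 𝓝[>] (0 : ℝ),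
      dist x ((extChartAt (𝓡 n) x).symm (extChartAt (𝓡 n) x x + s • w)) ≤ c * s := by
  set y₀ := extChartAt (𝓡 n) x x with hy₀
  have hy₀t : y₀ ∈ (extChartAt (𝓡 n) x).target := mem_extChartAt_target x
  have hline : Continuous fun s : ℝ ↦ y₀ + s • w := by fun_prop
  have hline0 : y₀ + (0 : ℝ) • w = y₀ := by simp
  have ht : ∀ᶠ s in 𝓝 (0 : ℝ), y₀ + s • w ∈ (extChartAt (𝓡 n) x).target :=
    hline.continuousAt.eventually_mem (by rw [hline0]; exact (isOpen_target x).mem_nhds hy₀t)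
  have hG : ContinuousAt (fun s : ℝ ↦ w.ofLp ⬝ᵥ metricMatrix x (y₀ + s • w) *ᵥ w.ofLp) 0 := by
    simp only [dotProduct, mulVec]
    refine tendsto_finsetSum _ fun i _ ↦ Tendsto.const_mul _ (tendsto_finsetSum _ fun j _ ↦
      Tendsto.mul_const _ ?_)
    have h1 : ContinuousAt (fun y ↦ metricMatrix x y i j) (y₀ + (0 : ℝ) • w) := by
      rw [hline0]
      exact (contDiffOn_metricMatrix x i j).continuousOn.continuousAt
        ((isOpen_target x).mem_nhds hy₀t)
    exact ContinuousAt.comp (f := fun s : ℝ ↦ y₀ + s • w) h1 hline.continuousAt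
  have hG' := hG.tendsto.eventually_lt_const (u := c ^ 2) (by rwa [hline0])
  obtain ⟨δ, hδ, hδ'⟩ := Metric.eventually_nhds_iff.1 (ht.and hG')
  filter_upwards [Ioo_mem_nhdsGT hδ] with s hs
  have hin : ∀ t ∈ Icc 0 s, y₀ + t • w ∈ (extChartAt (𝓡 n) x).target ∧
      w.ofLp ⬝ᵥ metricMatrix x (y₀ + t • w) *ᵥ w.ofLp < c ^ 2 := fun t ht ↦ hδ' (by
    rw [Real.dist_eq, sub_zero, abs_of_nonneg ht.1]; exact ht.2.trans_lt hs.2)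
  set γ : ℝ → M := fun t ↦ (extChartAt (𝓡 n) x).symm (y₀ + t • w) with hγ
  have hlineM : ContMDiff 𝓘(ℝ) (𝓡 n) 1 (fun s : ℝ ↦ y₀ + s • w) :=
    (contDiff_const.add (contDiff_id.smul contDiff_const)).contMDiff
  have hγM : ContMDiffOn 𝓘(ℝ) (𝓡 n) 1 γ (Icc 0 s) :=
    (contMDiffOn_extChartAt_symm (n := 1) x).comp hlineM.contMDiffOn fun t ht ↦ (hin t ht).1
  have h1 := riemannianEDist_le_pathELength hγM (x := x) (y := γ s)
    (by simp [hγ, hy₀]) rfl hs.1.le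
  have h2 : pathELength (𝓡 n) γ 0 s ≤ ENNReal.ofReal (c * s) := by
    rw [pathELength_eq_lintegral_mfderiv_Icc]
    calc _ ≤ ∫⁻ _ in Icc 0 s, ENNReal.ofReal c := by
          refine setLIntegral_mono' measurableSet_Icc fun t ht ↦ ?_
          have e0 : HasDerivAt (fun s : ℝ ↦ y₀ + s • w) w t := by
            simpa using ((hasDerivAt_id t).smul_const w).const_add y₀
          have e1 := mfderiv_comp t (mdifferentiableAt_symm (hin t ht).1)
            ((hlineM t).mdifferentiableAt one_ne_zero)
          have e2 : mfderiv 𝓘(ℝ) (𝓡 n) γ t 1 =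
              mfderiv (𝓡 n) (𝓡 n) (extChartAt (𝓡 n) x).symm (y₀ + t • w) w := by
            have e3 : mfderiv 𝓘(ℝ) (𝓡 n) (fun s : ℝ ↦ y₀ + s • w) t (1 : ℝ) = w := by
              rw [mfderiv_eq_fderiv, e0.hasFDerivAt.fderiv]
              exact one_smul ℝ w
            rw [hγ]
            exact (DFunLike.congr_fun e1 (1 : ℝ)).trans (congrArg _ e3)
          rw [e2, ← ofReal_norm]
          refine ENNReal.ofReal_le_ofReal (abs_le_of_sq_le_sq' ?_ hc.le).2
          rw [norm_mfderiv_symm_sq]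
          exact (hin t ht).2.le
      _ = _ := by
          rw [setLIntegral_const, Real.volume_Icc, sub_zero, ENNReal.ofReal_mul hc.le]
  rw [← IsRiemannianManifold.out (I := 𝓡 n), edist_dist] at h1
  exact (ENNReal.ofReal_le_ofReal_iff (mul_nonneg hc.le hs.1.le)).1 (h1.trans h2)

/-- A function with gradient of length `1` decreases with almost unit speed. -/
lemma exists_add_dist_lt (hg : MDifferentiableAt (𝓡 n) 𝓘(ℝ, ℝ) g x)
    (h1 : gradNormSq (n := n) g x = 1) {η : ℝ} (hη0 : 0 < η) (hη : η < 1) :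
    ∃ z, g z + η * dist x z < g x := by
  set y₀ := extChartAt (𝓡 n) x x with hy₀
  have hy₀t : y₀ ∈ (extChartAt (𝓡 n) x).target := mem_extChartAt_target x
  set ξ : Fin n → ℝ := fun i ↦ partialDeriv i (inChart x g) y₀ with hξ
  set G := metricMatrix x y₀
  have hdet : IsUnit G.det := (Matrix.isUnit_iff_isUnit_det _).1 (posDef_metricMatrix hy₀t).isUnit
  rw [gradNormSq_eq] at h1
  -- the coordinates of `-∇ g`
  set w : EuclideanSpace ℝ (Fin n) := WithLp.toLp 2 (-(G⁻¹ *ᵥ ξ)) with hw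
  have hwG : w.ofLp ⬝ᵥ G *ᵥ w.ofLp = 1 := by
    rw [hw, mulVec_neg, dotProduct_neg, neg_dotProduct, neg_neg, mulVec_mulVec,
      mul_nonsing_inv _ hdet, one_mulVec, dotProduct_comm]
    exact h1
  have hdiff : DifferentiableAt ℝ (inChart x g) y₀ := by
    rw [← mdifferentiableAt_iff_differentiableAt]
    exact MDifferentiableAt.comp y₀ (by rwa [hy₀, extChartAt_to_inv x])
      (mdifferentiableAt_symm hy₀t)
  have hder : HasDerivAt (fun s : ℝ ↦ inChart x g (y₀ + s • w)) (-1) 0 := by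
    have e0 : HasDerivAt (fun s : ℝ ↦ y₀ + s • w) w 0 := by
      simpa using ((hasDerivAt_id (0 : ℝ)).smul_const w).const_add y₀
    have e1 : HasFDerivAt (inChart x g) (fderiv ℝ (inChart x g) y₀) (y₀ + (0 : ℝ) • w) := by
      simpa using hdiff.hasFDerivAt
    have e2 := e1.comp_hasDerivAt 0 e0
    have e3 : fderiv ℝ (inChart x g) y₀ w = -1 := by
      rw [fderiv_eq_sum, hw, neg_dotProduct, dotProduct_comm, h1]
    rw [e3] at e2
    exact e2
  -- a constant `c > 1` such that `η c` is still below the speed of descent `(1 + η) / 2`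
  have hc : 0 < (3 * η + 1) / (4 * η) := by positivity
  have hc1 : 1 < (3 * η + 1) / (4 * η) := by rw [one_lt_div (by positivity)]; linarith
  have hdist := eventually_dist_le x w hc (by rw [← hy₀, hwG]; nlinarith)
  have hslope := hder.tendsto_slope_zero_right.eventually_lt_const
    (show (-1 : ℝ) < -((1 + η) / 2) by linarith)
  obtain ⟨s, ⟨h2, h3⟩, hs⟩ := ((hdist.and hslope).and eventually_mem_nhdsWithin).exists
  have hs0 : 0 < s := hs
  refine ⟨(extChartAt (𝓡 n) x).symm (y₀ + s • w), ?_⟩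
  have e5 : inChart x g (y₀ + (0 : ℝ) • w) = g x := by
    rw [zero_smul, add_zero, inChart, hy₀, extChartAt_to_inv x]
  rw [zero_add, e5, smul_eq_mul, inv_mul_lt_iff₀ hs0] at h3
  have e6 : η * ((3 * η + 1) / (4 * η) * s) = (3 * η + 1) / 4 * s := by field_simp
  have e7 := mul_le_mul_of_nonneg_left h2 hη0.le
  rw [e6] at e7
  have e8 : inChart x g (y₀ + s • w) = g ((extChartAt (𝓡 n) x).symm (y₀ + s • w)) := rfl
  rw [e8] at h3
  nlinarith

/-- The chain rule for `|∇ f|²`. -/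
lemma gradNormSq_comp {ψ : ℝ → ℝ} {ψ' : ℝ} (hf : MDifferentiableAt (𝓡 n) 𝓘(ℝ, ℝ) f x)
    (hψ : HasDerivAt ψ ψ' (f x)) :
    gradNormSq (n := n) (ψ ∘ f) x = ψ' ^ 2 * gradNormSq (n := n) f x := by
  set y₀ := extChartAt (𝓡 n) x x with hy₀
  have hdiff : DifferentiableAt ℝ (inChart x f) y₀ := by
    rw [← mdifferentiableAt_iff_differentiableAt]
    exact MDifferentiableAt.comp y₀ (by rwa [hy₀, extChartAt_to_inv x])
      (mdifferentiableAt_symm (mem_extChartAt_target x))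
  have h1 : ∀ i, partialDeriv i (inChart x (ψ ∘ f)) y₀ = ψ' * partialDeriv i (inChart x f) y₀ :=
    fun i ↦ by
      have e1 : HasDerivAt ψ ψ' (inChart x f y₀) := by
        rwa [inChart, hy₀, extChartAt_to_inv x]
      have e2 := e1.comp_hasFDerivAt y₀ hdiff.hasFDerivAt
      have e3 : inChart (n := n) x (ψ ∘ f) = ψ ∘ inChart x f := rfl
      rw [partialDeriv, e3, e2.fderiv]
      rfl
  simp only [gradNormSq, ← hy₀, h1, Finset.mul_sum]
  exact Finset.sum_congr rfl fun i _ ↦ Finset.sum_congr rfl fun j _ ↦ by ring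

end Chart



/-! ### The gradient of an isoparametric function -/

section Isoparametric

open Matrix Manifold Real

variable {n : ℕ} {M : Type*} [MetricSpace M] [ChartedSpace (EuclideanSpace ℝ (Fin n)) M]
  [IsManifold (𝓡 n) ∞ M] [Bundle.RiemannianBundle (fun x : M ↦ TangentSpace (𝓡 n) x)]
  {F : M → ℝ} {t₀ t₁ : ℝ} {β α : ℝ → ℝ} {x p : M}

/-- An isoparametric function together with its structure functions: `|∇ F|² = β(F)` and
`Δ F = α(F)`. -/
structure IsoData (n : ℕ) {M : Type*} [MetricSpace M] [ChartedSpace (EuclideanSpace ℝ (Fin n)) M]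
    [Bundle.RiemannianBundle (fun x : M ↦ TangentSpace (𝓡 n) x)]
    (F : M → ℝ) (t₀ t₁ : ℝ) (β α : ℝ → ℝ) : Prop where
  lt : t₀ < t₁
  range_eq : range F = Icc t₀ t₁
  smooth : ContMDiff (𝓡 n) 𝓘(ℝ, ℝ) ∞ F
  smooth_β : ContDiffOn ℝ ∞ β (Icc t₀ t₁)
  gradient : ∀ x, gradNormSq (n := n) F x = β (F x)
  smooth_α : ContDiffOn ℝ ∞ α (Icc t₀ t₁)
  laplace : ∀ x, laplacian (n := n) F x = α (F x)

lemma partialDeriv_neg {n : ℕ} (i : Fin n) (f : EuclideanSpace ℝ (Fin n) → ℝ)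
    (y : EuclideanSpace ℝ (Fin n)) : partialDeriv i (fun y ↦ -f y) y = -partialDeriv i f y := by
  rw [partialDeriv, fderiv_fun_neg]
  rfl

namespace IsoData

lemma neg (hF : IsoData n F t₀ t₁ β α) :
    IsoData n (fun x ↦ -F x) (-t₁) (-t₀) (fun s ↦ β (-s)) (fun s ↦ -α (-s)) := by
  have hneg : ∀ x y, partialDeriv x (inChart (n := n) y fun z ↦ -F z) =
      fun w ↦ -partialDeriv x (inChart (n := n) y F) w := fun i y ↦
    funext fun w ↦ partialDeriv_neg i (inChart (n := n) y F) w
  have hmaps : MapsTo (fun s : ℝ ↦ -s) (Icc (-t₁) (-t₀)) (Icc t₀ t₁) := fun s hs ↦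
    ⟨by linarith [hs.2], by linarith [hs.1]⟩
  refine ⟨neg_lt_neg hF.lt, ?_, hF.smooth.neg, hF.smooth_β.comp contDiff_neg.contDiffOn hmaps,
    fun x ↦ ?_, (hF.smooth_α.comp contDiff_neg.contDiffOn hmaps).neg, fun x ↦ ?_⟩
  · rw [← image_neg_Icc, ← hF.range_eq, ← range_comp]
    rfl
  · rw [neg_neg, ← hF.gradient, gradNormSq, gradNormSq]
    simp only [hneg]
    exact Finset.sum_congr rfl fun i _ ↦ Finset.sum_congr rfl fun j _ ↦ by ring
  · rw [neg_neg, ← hF.laplace, laplacian, laplacian, ← mul_neg, ← Finset.sum_neg_distrib]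
    congr 1
    refine Finset.sum_congr rfl fun i _ ↦ ?_
    rw [← partialDeriv_neg]
    congr 1
    ext w
    simp only [hneg, mul_neg, Finset.sum_neg_distrib]

lemma mem_Icc (hF : IsoData n F t₀ t₁ β α) (x : M) : F x ∈ Icc t₀ t₁ :=
  hF.range_eq ▸ mem_range_self x

lemma exists_eq (hF : IsoData n F t₀ t₁ β α) {s : ℝ} (hs : s ∈ Icc t₀ t₁) : ∃ x, F x = s := by
  rwa [← hF.range_eq] at hs

lemma mdifferentiableAt (hF : IsoData n F t₀ t₁ β α) (x : M) :
    MDifferentiableAt (𝓡 n) 𝓘(ℝ, ℝ) F x := (hF.smooth x).mdifferentiableAt (by simp)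

lemma isGradNormSq (hF : IsoData n F t₀ t₁ β α) (x : M) :
    IsGradNormSq (n := n) F x (β (F x)) := by
  rw [← hF.gradient]
  exact PaneitzBifurcation.isGradNormSq (hF.mdifferentiableAt x)

lemma nonneg (hF : IsoData n F t₀ t₁ β α) {s : ℝ} (hs : s ∈ Icc t₀ t₁) : 0 ≤ β s := by
  obtain ⟨x, rfl⟩ := hF.exists_eq hs
  obtain ⟨v, -, h⟩ := hF.isGradNormSq x
  rw [h]
  positivity

lemma partialDeriv_eq_zero (hF : IsoData n F t₀ t₁ β α) (hx : F x = t₀) (i : Fin n) :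
    partialDeriv i (inChart (n := n) x F) (extChartAt (𝓡 n) x x) = 0 := by
  have h1 : IsLocalMin (inChart (n := n) x F) (extChartAt (𝓡 n) x x) :=
    Eventually.of_forall fun y ↦ by
      rw [inChart, inChart, extChartAt_to_inv x, hx]
      exact (hF.mem_Icc _).1
  rw [partialDeriv, h1.fderiv_eq_zero]
  rfl

lemma left_eq_zero (hF : IsoData n F t₀ t₁ β α) : β t₀ = 0 := by
  obtain ⟨x, hx⟩ := hF.exists_eq (left_mem_Icc.2 hF.lt.le)
  rw [← hx, ← hF.gradient, gradNormSq]
  simp only [hF.partialDeriv_eq_zero hx, mul_zero, Finset.sum_const_zero]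

lemma hasDerivWithinAt (hF : IsoData n F t₀ t₁ β α) {s : ℝ} (hs : s ∈ Icc t₀ t₁) :
    HasDerivWithinAt β (derivWithin β (Icc t₀ t₁) s) (Icc t₀ t₁) s :=
  (hF.smooth_β.differentiableOn (by simp) s hs).hasDerivWithinAt

lemma continuousOn_deriv (hF : IsoData n F t₀ t₁ β α) :
    ContinuousOn (derivWithin β (Icc t₀ t₁)) (Icc t₀ t₁) :=
  hF.smooth_β.continuousOn_derivWithin (uniqueDiffOn_Icc hF.lt) (by simp)

variable [CompactSpace M] [IsContMDiffRiemannianBundle (𝓡 n) ∞ (EuclideanSpace ℝ (Fin n))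
    (fun x : M ↦ TangentSpace (𝓡 n) x)] [IsRiemannianManifold (𝓡 n) M]

/-- A function of `F` whose gradient is bounded by `C` is `C`-Lipschitz. -/
lemma abs_sub_le (hF : IsoData n F t₀ t₁ β α) {ψ ψ' : ℝ → ℝ} {C : ℝ} (hC : 0 ≤ C)
    (hψ : ∀ s, HasDerivAt ψ (ψ' s) s) (hψ' : Continuous ψ')
    (h : ∀ s ∈ Icc t₀ t₁, |ψ' s| * √(β s) ≤ C) (x y : M) :
    |ψ (F x) - ψ (F y)| ≤ C * dist x y := by
  have hψ1 : ContDiff ℝ 1 ψ := by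
    rw [contDiff_one_iff_deriv]
    refine ⟨fun s ↦ (hψ s).differentiableAt, ?_⟩
    rwa [show deriv ψ = ψ' from funext fun s ↦ (hψ s).deriv]
  have hcomp : ContMDiff (𝓡 n) 𝓘(ℝ, ℝ) 1 (ψ ∘ F) :=
    hψ1.contMDiff.comp (hF.smooth.of_le (by simp))
  refine abs_sub_le_of_diffAt_le hcomp hC (fun p u ↦ ?_) x y
  have h1 := PaneitzBifurcation.isGradNormSq ((hcomp p).mdifferentiableAt one_ne_zero)
  refine (h1.abs_le u).trans ?_
  gcongr
  rw [gradNormSq_comp (hF.mdifferentiableAt p) (hψ _), hF.gradient, sqrt_mul (sq_nonneg _),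
    sqrt_sq_eq_abs]
  exact h _ (hF.mem_Icc p)

/-- The zeros of `β` are simple: otherwise `log (F - s)` would be Lipschitz. -/
lemma not_double_zero (hF : IsoData n F t₀ t₁ β α) {s : ℝ} (hs : s ∈ Icc t₀ t₁) (h0 : β s = 0)
    (h1 : derivWithin β (Icc t₀ t₁) s = 0) : False := by
  set I := Icc t₀ t₁ with hI
  have hd2 : ContDiffOn ℝ 1 (derivWithin β I) I :=
    hF.smooth_β.derivWithin (uniqueDiffOn_Icc hF.lt) (by norm_cast)
  obtain ⟨K, hK⟩ := isCompact_Icc.exists_bound_of_continuousOn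
    (hd2.continuousOn_derivWithin (uniqueDiffOn_Icc hF.lt) le_rfl)
  have hK0 : 0 ≤ K := (norm_nonneg _).trans (hK s hs)
  have hb1 : ∀ r ∈ I, |derivWithin β I r| ≤ K * |r - s| := fun r hr ↦ by
    have := (convex_Icc t₀ t₁).norm_image_sub_le_of_norm_hasDerivWithin_le
      (fun x hx ↦ (hd2.differentiableOn one_ne_zero x hx).hasDerivWithinAt) hK hs hr
    rwa [h1, sub_zero] at this
  have hb : ∀ r ∈ I, β r ≤ K * (r - s) ^ 2 := fun r hr ↦ by
    have hsub : uIcc s r ⊆ I := (ordConnected_Icc).uIcc_subset hs hr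
    have := (convex_uIcc s r).norm_image_sub_le_of_norm_hasDerivWithin_le
      (fun x hx ↦ (hF.hasDerivWithinAt (hsub hx)).mono hsub)
      (fun x hx ↦ (hb1 x (hsub hx)).trans (mul_le_mul_of_nonneg_left
        (abs_sub_left_of_mem_uIcc hx) hK0)) left_mem_uIcc right_mem_uIcc
    rw [h0, sub_zero, norm_eq_abs, norm_eq_abs, mul_assoc, ← abs_mul, ← pow_two,
      abs_of_nonneg (sq_nonneg (r - s))] at this
    exact (le_abs_self _).trans this
  obtain ⟨r, hr, hrs⟩ : ∃ r ∈ I, r ≠ s := by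
    by_cases h : s = t₀
    · exact ⟨t₁, right_mem_Icc.2 hF.lt.le, by rw [h]; exact hF.lt.ne'⟩
    · exact ⟨t₀, left_mem_Icc.2 hF.lt.le, Ne.symm h⟩
  obtain ⟨x, hx⟩ := hF.exists_eq hr
  obtain ⟨y, hy⟩ := hF.exists_eq hs
  have hkey : ∀ ε : ℝ, 0 < ε → 1 / 2 * log ((r - s) ^ 2 + ε) ≤
      √K * dist x y + 1 / 2 * log ε := fun ε hε ↦ by
    have hpos : ∀ z : ℝ, 0 < (z - s) ^ 2 + ε := fun z ↦ by positivity
    have := hF.abs_sub_le (ψ := fun z ↦ 1 / 2 * log ((z - s) ^ 2 + ε))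
      (ψ' := fun z ↦ (z - s) / ((z - s) ^ 2 + ε)) (C := √K) (sqrt_nonneg _) (fun z ↦ ?_)
      ((continuous_id.sub continuous_const).div (by fun_prop) fun z ↦ (hpos z).ne')
      (fun z hz ↦ ?_) x y
    · rw [hx, hy, sub_self, zero_pow two_ne_zero, zero_add] at this
      linarith [le_abs_self (1 / 2 * log ((r - s) ^ 2 + ε) - 1 / 2 * log ε)]
    · have e1 : HasDerivAt (fun z ↦ (z - s) ^ 2 + ε) (2 * (z - s)) z := by
        simpa using (((hasDerivAt_id z).sub_const s).pow 2).add_const ε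
      exact ((e1.log (hpos z).ne').const_mul (1 / 2)).congr_deriv (by ring)
    · have e1 : √(β z) ≤ √K * |z - s| := by
        rw [← sqrt_sq_eq_abs, ← sqrt_mul hK0]
        exact sqrt_le_sqrt (hb z hz)
      rw [abs_div, abs_of_pos (hpos z), div_mul_eq_mul_div, div_le_iff₀ (hpos z)]
      have e2 : |z - s| ^ 2 = (z - s) ^ 2 := sq_abs _
      nlinarith [mul_le_mul_of_nonneg_left e1 (abs_nonneg (z - s)), sqrt_nonneg K,
        mul_nonneg (sqrt_nonneg K) hε.le]
  have hlim : Tendsto (fun ε : ℝ ↦ √K * dist x y + 1 / 2 * log ε) (𝓝[>] 0) atBot :=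
    tendsto_atBot_add_const_left _ _ (tendsto_log_nhdsGT_zero.const_mul_atBot (by norm_num))
  obtain ⟨ε, h2, hε⟩ := ((hlim.eventually_lt_atBot (1 / 2 * log ((r - s) ^ 2))).and
    self_mem_nhdsWithin).exists
  have hε' : (0 : ℝ) < ε := hε
  have h3 : log ((r - s) ^ 2) ≤ log ((r - s) ^ 2 + ε) :=
    log_le_log (by have := sub_ne_zero.2 hrs; positivity) (by linarith)
  linarith [hkey ε hε]

lemma pos (hF : IsoData n F t₀ t₁ β α) {s : ℝ} (hs : s ∈ Ioo t₀ t₁) : 0 < β s := by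
  have hs' := Ioo_subset_Icc_self hs
  refine (hF.nonneg hs').lt_of_ne fun h0 ↦ hF.not_double_zero hs' h0.symm ?_
  have h1 : IsLocalMin β s := by
    filter_upwards [Icc_mem_nhds hs.1 hs.2] with r hr
    rw [← h0]
    exact hF.nonneg hr
  rw [derivWithin_of_mem_nhds (Icc_mem_nhds hs.1 hs.2), h1.deriv_eq_zero]

lemma deriv_left_pos (hF : IsoData n F t₀ t₁ β α) : 0 < derivWithin β (Icc t₀ t₁) t₀ := by
  have h0 := left_mem_Icc.2 hF.lt.le
  refine lt_of_le_of_ne ?_ fun h ↦ hF.not_double_zero h0 hF.left_eq_zero h.symm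
  have h1 := ((hF.hasDerivWithinAt h0).mono Ioo_subset_Icc_self)
  rw [hasDerivWithinAt_iff_tendsto_slope' (by simp)] at h1
  have : (𝓝[Ioo t₀ t₁] t₀).NeBot := by
    rw [nhdsWithin_Ioo_eq_nhdsGT hF.lt]; infer_instance
  refine ge_of_tendsto h1 (eventually_mem_nhdsWithin.mono fun r hr ↦ ?_)
  rw [slope_def_field, hF.left_eq_zero, sub_zero]
  exact div_nonneg (hF.pos hr).le (by linarith [hr.1])

end IsoData

end Isoparametric


/-! ### The distance to the focal set -/

section Focal

open Matrix Manifold MeasureTheory Real intervalIntegral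

/-- The primitive of `β^(-1/2)` that vanishes at `t₀`: the distance to the focal set, as a function
of the value of the isoparametric function. -/
noncomputable def arc (β : ℝ → ℝ) (t₀ s : ℝ) : ℝ := ∫ r in t₀..s, (√(β r))⁻¹

variable {n : ℕ} {M : Type*} [MetricSpace M] [ChartedSpace (EuclideanSpace ℝ (Fin n)) M]
  [IsManifold (𝓡 n) ∞ M] [Bundle.RiemannianBundle (fun x : M ↦ TangentSpace (𝓡 n) x)]
  [CompactSpace M] [IsContMDiffRiemannianBundle (𝓡 n) ∞ (EuclideanSpace ℝ (Fin n))
    (fun x : M ↦ TangentSpace (𝓡 n) x)] [IsRiemannianManifold (𝓡 n) M]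
  {F : M → ℝ} {t₀ t₁ : ℝ} {β α : ℝ → ℝ} {x y p : M} {s t : ℝ}

lemma arc_left : arc β t₀ t₀ = 0 := integral_same

namespace IsoData

lemma continuousOn_inv_sqrt (hF : IsoData n F t₀ t₁ β α) :
    ContinuousOn (fun r ↦ (√(β r))⁻¹) (Ioo t₀ t₁) :=
  (hF.smooth_β.continuousOn.mono Ioo_subset_Icc_self).sqrt.inv₀
    fun _ hr ↦ (sqrt_pos.2 (hF.pos hr)).ne'

/-- The primitives of `(β + ε)^(-1/2)` composed with `F` are `1`-Lipschitz; `ε` tends to `0`. -/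
lemma integral_le_dist (hF : IsoData n F t₀ t₁ β α) (hxy : F x ≤ F y)
    (hint : IntervalIntegrable (fun r ↦ (√(β r))⁻¹) volume (F x) (F y)) :
    ∫ r in F x..F y, (√(β r))⁻¹ ≤ dist x y := by
  set B : ℝ → ℝ := IccExtend hF.lt.le ((Icc t₀ t₁).domRestrict β) with hB
  have hBc : Continuous B := hF.smooth_β.continuousOn.domRestrict.Icc_extend'
  have hBeq : ∀ r ∈ Icc t₀ t₁, B r = β r := fun r hr ↦ IccExtend_of_mem _ _ hr
  have hB0 : ∀ r, 0 ≤ B r := fun r ↦ hF.nonneg (projIcc t₀ t₁ hF.lt.le r).2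
  have hρc : ∀ ε : ℝ, 0 < ε → Continuous fun r ↦ (√(B r + ε))⁻¹ := fun ε hε ↦
    (hBc.add continuous_const).sqrt.inv₀ fun r ↦
      (sqrt_pos.2 (add_pos_of_nonneg_of_pos (hB0 r) hε)).ne'
  have h1 : ∀ ε : ℝ, 0 < ε → ∫ r in F x..F y, (√(B r + ε))⁻¹ ≤ dist x y := fun ε hε ↦ by
    have h2 := hF.abs_sub_le (ψ := fun s ↦ ∫ r in t₀..s, (√(B r + ε))⁻¹) (C := 1) zero_le_one
      (fun s ↦ (hρc ε hε).integral_hasStrictDerivAt t₀ s |>.hasDerivAt) (hρc ε hε)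
      (fun s hs ↦ by
        have h3 : 0 < √(B s + ε) := sqrt_pos.2 (by linarith [hB0 s])
        rw [abs_of_pos (inv_pos.2 h3), inv_mul_le_iff₀ h3, mul_one]
        exact sqrt_le_sqrt (by rw [hBeq s hs]; linarith)) y x
    rw [one_mul, dist_comm, integral_interval_sub_left
      ((hρc ε hε).intervalIntegrable _ _) ((hρc ε hε).intervalIntegrable _ _)] at h2
    exact (le_abs_self _).trans h2
  have hmem : ∀ r ∈ uIoc (F x) (F y), r ≠ t₁ → r ∈ Ioo t₀ t₁ := fun r hr hne ↦ by
    rw [uIoc_of_le hxy] at hr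
    exact ⟨(hF.mem_Icc x).1.trans_lt hr.1, lt_of_le_of_ne (hr.2.trans (hF.mem_Icc y).2) hne⟩
  have hae : ∀ᵐ r : ℝ, r ≠ t₁ := (countable_singleton t₁).ae_notMem volume
  refine le_of_tendsto (tendsto_integral_filter_of_dominated_convergence
    (l := 𝓝[>] (0 : ℝ)) (F := fun ε r ↦ (√(B r + ε))⁻¹) (fun r ↦ (√(β r))⁻¹) ?_ ?_ hint ?_)
    (eventually_mem_nhdsWithin.mono h1)
  · exact eventually_mem_nhdsWithin.mono fun ε hε ↦ (hρc ε hε).aestronglyMeasurable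
  · refine eventually_mem_nhdsWithin.mono fun ε (hε : 0 < ε) ↦ hae.mono fun r hr hrI ↦ ?_
    have hr' := hmem r hrI hr
    have h3 := sqrt_pos.2 (hF.pos hr')
    rw [hBeq r (Ioo_subset_Icc_self hr'), norm_of_nonneg (by positivity)]
    exact inv_anti₀ h3 (sqrt_le_sqrt (by linarith))
  · refine hae.mono fun r hr hrI ↦ ?_
    have hr' := hmem r hrI hr
    have h3 := sqrt_pos.2 (hF.pos hr')
    rw [hBeq r (Ioo_subset_Icc_self hr')]
    have h4 : ContinuousAt (fun ε : ℝ ↦ (√(β r + ε))⁻¹) 0 :=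
      ContinuousAt.inv₀ (by fun_prop) (by rw [add_zero]; exact h3.ne')
    have h5 := h4.tendsto
    rw [add_zero] at h5
    exact h5.mono_left nhdsWithin_le_nhds

/-- The integral of `β^(-1/2)` over compact subintervals is bounded by the diameter of `M`. -/
lemma intervalIntegrable (hF : IsoData n F t₀ t₁ β α) :
    IntervalIntegrable (fun r ↦ (√(β r))⁻¹) volume t₀ t₁ := by
  rw [intervalIntegrable_iff_integrableOn_Ioc_of_le hF.lt.le]
  set w := t₁ - t₀ with hw
  have hw0 : 0 < w := sub_pos.2 hF.lt
  have hpos : ∀ i : ℕ, 0 < w / (i + 3) := fun i ↦ by positivity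
  have hle : ∀ i : ℕ, w / (i + 3) ≤ w / 3 := fun i ↦
    div_le_div_of_nonneg_left hw0.le (by norm_num) (by linarith [i.cast_nonneg (α := ℝ)])
  have hlim : Tendsto (fun i : ℕ ↦ w / ((i : ℝ) + 3)) atTop (𝓝 0) :=
    tendsto_const_nhds.div_atTop
      (tendsto_atTop_add_const_right _ _ tendsto_natCast_atTop_atTop)
  have hsub : ∀ i : ℕ, Icc (t₀ + w / (i + 3)) (t₁ - w / (i + 3)) ⊆ Ioo t₀ t₁ := fun i r hr ↦
    ⟨by linarith [hr.1, hpos i], by linarith [hr.2, hpos i]⟩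
  have hint : ∀ i : ℕ, IntervalIntegrable (fun r ↦ (√(β r))⁻¹) volume
      (t₀ + w / (i + 3)) (t₁ - w / (i + 3)) := fun i ↦
    (hF.continuousOn_inv_sqrt.mono (hsub i)).intervalIntegrable_of_Icc (by linarith [hle i])
  refine integrableOn_Ioc_of_intervalIntegral_norm_bounded (l := atTop)
    (a := fun i : ℕ ↦ t₀ + w / (i + 3)) (b := fun i : ℕ ↦ t₁ - w / (i + 3))
    (I := Metric.diam (univ : Set M)) (fun i ↦ (hint i).1) (by simpa using hlim.const_add t₀)
    (by simpa using hlim.const_sub t₁) (Eventually.of_forall fun i ↦ ?_)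
  have hui : t₀ + w / (i + 3) ≤ t₁ - w / (i + 3) := by linarith [hle i]
  obtain ⟨x, hx⟩ := hF.exists_eq (Ioo_subset_Icc_self (hsub i (left_mem_Icc.2 hui)))
  obtain ⟨y, hy⟩ := hF.exists_eq (Ioo_subset_Icc_self (hsub i (right_mem_Icc.2 hui)))
  have h1 := hF.integral_le_dist (x := x) (y := y) (by rwa [hx, hy]) (by rw [hx, hy]; exact hint i)
  have h2 : ∀ r, ‖(√(β r))⁻¹‖ = (√(β r))⁻¹ := fun r ↦ norm_of_nonneg (by positivity)
  simp only [h2]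
  rw [hx, hy, integral_of_le hui] at h1
  exact h1.trans (Metric.dist_le_diam_of_mem isCompact_univ.isBounded (mem_univ _) (mem_univ _))

lemma intervalIntegrable_of_mem (hF : IsoData n F t₀ t₁ β α) (hs : s ∈ Icc t₀ t₁)
    (ht : t ∈ Icc t₀ t₁) : IntervalIntegrable (fun r ↦ (√(β r))⁻¹) volume s t :=
  hF.intervalIntegrable.mono_set (by
    rw [uIcc_of_le hF.lt.le]; exact ordConnected_Icc.uIcc_subset hs ht)

lemma arc_sub (hF : IsoData n F t₀ t₁ β α) (hs : s ∈ Icc t₀ t₁) (ht : t ∈ Icc t₀ t₁) :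
    arc β t₀ t - arc β t₀ s = ∫ r in s..t, (√(β r))⁻¹ :=
  have h0 := left_mem_Icc.2 hF.lt.le
  integral_interval_sub_left (hF.intervalIntegrable_of_mem h0 ht)
    (hF.intervalIntegrable_of_mem h0 hs)

lemma hasDerivAt_arc (hF : IsoData n F t₀ t₁ β α) (hs : s ∈ Ioo t₀ t₁) :
    HasDerivAt (arc β t₀) (√(β s))⁻¹ s :=
  integral_hasDerivAt_right
    (hF.intervalIntegrable_of_mem (left_mem_Icc.2 hF.lt.le) (Ioo_subset_Icc_self hs))
    (hF.continuousOn_inv_sqrt.stronglyMeasurableAtFilter isOpen_Ioo s hs)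
    (hF.continuousOn_inv_sqrt.continuousAt (isOpen_Ioo.mem_nhds hs))

lemma continuousOn_arc (hF : IsoData n F t₀ t₁ β α) : ContinuousOn (arc β t₀) (Icc t₀ t₁) := by
  have h1 := continuousOn_primitive_interval' hF.intervalIntegrable left_mem_uIcc
  rwa [uIcc_of_le hF.lt.le] at h1

lemma strictMonoOn_arc (hF : IsoData n F t₀ t₁ β α) : StrictMonoOn (arc β t₀) (Icc t₀ t₁) :=
  strictMonoOn_of_deriv_pos (convex_Icc _ _) hF.continuousOn_arc fun s hs ↦ by
    rw [interior_Icc] at hs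
    rw [(hF.hasDerivAt_arc hs).deriv]
    exact inv_pos.2 (sqrt_pos.2 (hF.pos hs))

lemma abs_arc_sub_le (hF : IsoData n F t₀ t₁ β α) (x y : M) :
    |arc β t₀ (F x) - arc β t₀ (F y)| ≤ dist x y := by
  wlog h : F x ≤ F y generalizing x y
  · rw [abs_sub_comm, dist_comm]
    exact this y x (not_le.1 h).le
  · rw [abs_sub_comm, abs_of_nonneg
      (sub_nonneg.2 (hF.strictMonoOn_arc.monotoneOn (hF.mem_Icc x) (hF.mem_Icc y) h)),
      hF.arc_sub (hF.mem_Icc x) (hF.mem_Icc y)]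
    exact hF.integral_le_dist h (hF.intervalIntegrable_of_mem (hF.mem_Icc x) (hF.mem_Icc y))

/-- The function `arc ∘ F` has gradient of length `1` off the focal sets. -/
lemma exists_arc_add_dist_lt (hF : IsoData n F t₀ t₁ β α) (hx : F x ∈ Ioo t₀ t₁) {η : ℝ}
    (hη0 : 0 < η) (hη : η < 1) :
    ∃ z, arc β t₀ (F z) + η * dist x z < arc β t₀ (F x) := by
  have h1 := hF.hasDerivAt_arc hx
  refine exists_add_dist_lt (n := n) (g := arc β t₀ ∘ F) ?_ ?_ hη0 hη
  · exact h1.differentiableAt.mdifferentiableAt.comp x (hF.mdifferentiableAt x)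
  · have h2 := hF.pos hx
    rw [gradNormSq_comp (hF.mdifferentiableAt x) h1, hF.gradient, inv_pow, sq_sqrt h2.le,
      inv_mul_cancel₀ h2.ne']

lemma nonempty_left (hF : IsoData n F t₀ t₁ β α) : (F ⁻¹' {t₀}).Nonempty :=
  hF.exists_eq (left_mem_Icc.2 hF.lt.le)

lemma arc_le_focalDist (hF : IsoData n F t₀ t₁ β α) (x : M) :
    arc β t₀ (F x) ≤ focalDist F t₀ x := by
  refine (Metric.le_infDist hF.nonempty_left).2 fun y hy ↦ ?_
  have h1 := hF.abs_arc_sub_le x y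
  rw [show F y = t₀ from hy, arc_left, sub_zero] at h1
  exact (le_abs_self _).trans h1

/-- Minimizing `arc (F y) + η d(x, y)` in `y` for `η < 1` leads to a point of the focal set. -/
lemma focalDist_eq (hF : IsoData n F t₀ t₁ β α) (hx : F x < t₁) :
    focalDist F t₀ x = arc β t₀ (F x) := by
  refine le_antisymm ?_ (hF.arc_le_focalDist x)
  have key : ∀ η : ℝ, 0 < η → η < 1 → η * focalDist F t₀ x ≤ arc β t₀ (F x) := fun η hη0 hη ↦ by
    have hc : Continuous fun y ↦ arc β t₀ (F y) + η * dist x y :=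
      (hF.continuousOn_arc.comp_continuous hF.smooth.continuous hF.mem_Icc).add
        (continuous_const.mul (continuous_const.dist continuous_id))
    obtain ⟨y, -, hy⟩ := isCompact_univ.exists_isMinOn ⟨x, mem_univ x⟩ hc.continuousOn
    have hmin : ∀ z, arc β t₀ (F y) + η * dist x y ≤ arc β t₀ (F z) + η * dist x z :=
      fun z ↦ hy (mem_univ z)
    have h1 := hmin x
    rw [dist_self, mul_zero, add_zero] at h1
    have h2 : F y < t₁ := by
      refine lt_of_le_of_lt ?_ hx
      refine (hF.strictMonoOn_arc.le_iff_le (hF.mem_Icc y) (hF.mem_Icc x)).1 ?_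
      have : 0 ≤ η * dist x y := by positivity
      linarith
    have h3 : F y = t₀ := by
      by_contra hne
      obtain ⟨z, hz⟩ := hF.exists_arc_add_dist_lt
        (x := y) ⟨lt_of_le_of_ne (hF.mem_Icc y).1 (Ne.symm hne), h2⟩ hη0 hη
      have h4 := hmin z
      have h5 := mul_le_mul_of_nonneg_left (dist_triangle x y z) hη0.le
      linarith
    rw [h3, arc_left, zero_add] at h1
    refine le_trans ?_ h1
    gcongr
    exact Metric.infDist_le_dist_of_mem h3
  have hlim : Tendsto (fun η : ℝ ↦ η * focalDist F t₀ x) (𝓝[<] 1) (𝓝 (1 * focalDist F t₀ x)) :=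
    (tendsto_id.mul_const _).mono_left nhdsWithin_le_nhds
  rw [one_mul] at hlim
  refine le_of_tendsto hlim ?_
  filter_upwards [Ioo_mem_nhdsLT (zero_lt_one (α := ℝ))] with η hη
  exact key η hη.1 hη.2

/-- The maximum of `F` is a limit of smaller values of `F`, which suffices for the distance of the
focal sets. -/
lemma focalWidth_eq (hF : IsoData n F t₀ t₁ β α) : focalWidth F t₀ t₁ = arc β t₀ t₁ := by
  have hmem0 := left_mem_Icc.2 hF.lt.le
  have hmem1 := right_mem_Icc.2 hF.lt.le
  set R := {r | ∃ x y, F x = t₀ ∧ F y = t₁ ∧ r = dist x y} with hR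
  have hlow : ∀ r ∈ R, arc β t₀ t₁ ≤ r := by
    rintro r ⟨x, y, hx, hy, rfl⟩
    have h1 := hF.abs_arc_sub_le y x
    rw [hx, hy, arc_left, sub_zero, dist_comm] at h1
    exact (le_abs_self _).trans h1
  have hne : R.Nonempty := by
    obtain ⟨x, hx⟩ := hF.exists_eq hmem0
    obtain ⟨y, hy⟩ := hF.exists_eq hmem1
    exact ⟨_, x, y, hx, hy, rfl⟩
  refine le_antisymm ?_ (le_csInf hne hlow)
  -- points `x k` with values tending to the maximum, and nearest points `z k` of the focal set
  have hs : ∀ k : ℕ, t₁ - (t₁ - t₀) / (k + 1) ∈ Icc t₀ t₁ := fun k ↦ by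
    have h1 := sub_pos.2 hF.lt
    have h2 : (t₁ - t₀) / ((k : ℝ) + 1) ≤ t₁ - t₀ :=
      div_le_self h1.le (by linarith [k.cast_nonneg (α := ℝ)])
    have h3 : 0 < (t₁ - t₀) / ((k : ℝ) + 1) := by positivity
    exact ⟨by linarith, by linarith⟩
  choose xs hxs using fun k ↦ hF.exists_eq (hs k)
  obtain ⟨x, -, φ, hφ, hlim⟩ := isCompact_univ.tendsto_subseq fun k ↦ mem_univ (xs k)
  have hslim : Tendsto (fun k ↦ F (xs (φ k))) atTop (𝓝 t₁) := by
    have h1 : Tendsto (fun k : ℕ ↦ t₁ - (t₁ - t₀) / ((k : ℝ) + 1)) atTop (𝓝 (t₁ - 0)) :=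
      tendsto_const_nhds.sub (tendsto_const_nhds.div_atTop
        (tendsto_atTop_add_const_right _ _ tendsto_natCast_atTop_atTop))
    rw [sub_zero] at h1
    simp only [hxs]
    exact h1.comp hφ.tendsto_atTop
  have hFx : F x = t₁ :=
    tendsto_nhds_unique ((hF.smooth.continuous.tendsto x).comp hlim) hslim
  have hup : ∀ k, sInf R ≤ dist (xs (φ k)) x + arc β t₀ (F (xs (φ k))) := fun k ↦ by
    have hlt : F (xs (φ k)) < t₁ := by
      rw [hxs]
      have := sub_pos.2 hF.lt
      have h3 : 0 < (t₁ - t₀) / ((φ k : ℝ) + 1) := by positivity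
      linarith
    have hclosed : IsClosed (F ⁻¹' {t₀}) := isClosed_singleton.preimage hF.smooth.continuous
    obtain ⟨z, hz, hzd⟩ := hclosed.isCompact.exists_infDist_eq_dist hF.nonempty_left (xs (φ k))
    have h1 : sInf R ≤ dist z x := csInf_le ⟨_, hlow⟩ ⟨z, x, hz, hFx, rfl⟩
    have h2 := hF.focalDist_eq hlt
    rw [focalDist, hzd] at h2
    rw [← h2]
    have := dist_triangle z (xs (φ k)) x
    rw [dist_comm z (xs (φ k))] at this
    linarith
  have h4 : Tendsto (fun k ↦ arc β t₀ (F (xs (φ k)))) atTop (𝓝 (arc β t₀ t₁)) :=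
    (hF.continuousOn_arc t₁ hmem1).tendsto.comp
      (tendsto_nhdsWithin_iff.2 ⟨hslim, Eventually.of_forall fun k ↦ hF.mem_Icc _⟩)
  have h5 := (hlim.dist (tendsto_const_nhds (x := x))).add h4
  rw [dist_self, zero_add] at h5
  exact ge_of_tendsto' h5 hup

end IsoData

end Focal


/-! ### The Laplacian of the distance function -/

section Laplacian

open Matrix Manifold

variable {n : ℕ} {X : Type*} [NormedAddCommGroup X] [NormedSpace ℝ X] {U : Set X}

lemma contDiffOn_det {A : X → Matrix (Fin n) (Fin n) ℝ}
    (hA : ∀ i j, ContDiffOn ℝ ∞ (fun y ↦ A y i j) U) : ContDiffOn ℝ ∞ (fun y ↦ (A y).det) U := by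
  simp only [det_apply']
  exact ContDiffOn.sum fun σ _ ↦ contDiffOn_const.mul (contDiffOn_prod fun i _ ↦ hA _ _)

lemma contDiffOn_inv {A : X → Matrix (Fin n) (Fin n) ℝ}
    (hA : ∀ i j, ContDiffOn ℝ ∞ (fun y ↦ A y i j) U) (h0 : ∀ y ∈ U, (A y).det ≠ 0) (i j : Fin n) :
    ContDiffOn ℝ ∞ (fun y ↦ (A y)⁻¹ i j) U := by
  have h1 : ∀ y, (A y)⁻¹ i j = (A y).det⁻¹ * ((A y).updateRow j (Pi.single i 1)).det := fun y ↦ by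
    rw [inv_def, Ring.inverse_eq_inv', Matrix.smul_apply, smul_eq_mul, adjugate_apply]
  simp only [h1]
  refine ((contDiffOn_det hA).inv h0).mul (contDiffOn_det fun k l ↦ ?_)
  by_cases hk : k = j
  · simp only [hk, updateRow_self]
    exact contDiffOn_const
  · simp only [updateRow_ne hk]
    exact hA k l

variable {M : Type*} [MetricSpace M] [ChartedSpace (EuclideanSpace ℝ (Fin n)) M]
  [IsManifold (𝓡 n) ∞ M] [Bundle.RiemannianBundle (fun x : M ↦ TangentSpace (𝓡 n) x)]
  [IsContMDiffRiemannianBundle (𝓡 n) ∞ (EuclideanSpace ℝ (Fin n))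
    (fun x : M ↦ TangentSpace (𝓡 n) x)]
  {f g F : M → ℝ} {t₀ t₁ : ℝ} {β α ψ ψ' : ℝ → ℝ} {ψ'' : ℝ} {x y p : M} {s t : ℝ}

lemma contDiffOn_inv_metricMatrix (x : M) (i j : Fin n) :
    ContDiffOn ℝ ∞ (fun y ↦ (metricMatrix x y)⁻¹ i j) (extChartAt (𝓡 n) x).target :=
  contDiffOn_inv (contDiffOn_metricMatrix x) (fun _ hy ↦ (posDef_metricMatrix hy).det_pos.ne') i j

lemma contDiffOn_partialDeriv {f : EuclideanSpace ℝ (Fin n) → ℝ}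
    {U : Set (EuclideanSpace ℝ (Fin n))} (hU : IsOpen U) (hf : ContDiffOn ℝ ∞ f U) (i : Fin n) :
    ContDiffOn ℝ ∞ (partialDeriv i f) U :=
  (hf.fderiv_of_isOpen hU (by norm_cast)).clm_apply contDiffOn_const

/-- The chain rule for the Laplacian. -/
lemma laplacian_comp (hf : ContMDiff (𝓡 n) 𝓘(ℝ, ℝ) ∞ f) (hg : g =ᶠ[𝓝 x] ψ ∘ f)
    (hψ : ∀ᶠ s in 𝓝 (f x), HasDerivAt ψ (ψ' s) s) (hψ' : HasDerivAt ψ' ψ'' (f x)) :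
    laplacian (n := n) g x =
      ψ' (f x) * laplacian (n := n) f x + ψ'' * gradNormSq (n := n) f x := by
  set y₀ := extChartAt (𝓡 n) x x with hy₀
  set Ω := (extChartAt (𝓡 n) x).target
  have hy₀t : y₀ ∈ Ω := mem_extChartAt_target x
  have hΩ : Ω ∈ 𝓝 y₀ := (isOpen_target x).mem_nhds hy₀t
  set fc := inChart (n := n) x f with hfc
  have hfc0 : fc y₀ = f x := by rw [hfc, inChart, hy₀, extChartAt_to_inv x]
  have hfcs : ContDiffOn ℝ ∞ fc Ω := contDiffOn_inChart hf x
  have hfcd : DifferentiableAt ℝ fc y₀ := (hfcs.contDiffAt hΩ).differentiableAt (by simp)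
  set W : Fin n → EuclideanSpace ℝ (Fin n) → ℝ := fun i y ↦ √(metricMatrix x y).det *
        ∑ j, (metricMatrix x y)⁻¹ i j * partialDeriv j fc y with hW
  have hWd : ∀ i, DifferentiableAt ℝ (W i) y₀ := fun i ↦ by
    have h1 : ContDiffOn ℝ ∞ (W i) Ω :=
      ((contDiffOn_det (contDiffOn_metricMatrix x)).sqrt
        fun y hy ↦ (posDef_metricMatrix hy).det_pos.ne').mul
      (ContDiffOn.sum fun j _ ↦ (contDiffOn_inv_metricMatrix x i j).mul
        (contDiffOn_partialDeriv (isOpen_target x) hfcs j))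
    exact (h1.contDiffAt hΩ).differentiableAt (by simp)
  have hgc : inChart (n := n) x g =ᶠ[𝓝 y₀] ψ ∘ fc := by
    have h1 : ContinuousAt (extChartAt (𝓡 n) x).symm y₀ := continuousAt_extChartAt_symm x
    have h2 : Tendsto (extChartAt (𝓡 n) x).symm (𝓝 y₀) (𝓝 x) := by
      have := h1.tendsto
      rwa [hy₀, extChartAt_to_inv x] at this
    exact h2.eventually hg
  have hpart : ∀ᶠ y in 𝓝 y₀, ∀ j, partialDeriv j (inChart (n := n) x g) y =
      ψ' (fc y) * partialDeriv j fc y := by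
    have h1 : ∀ᶠ y in 𝓝 y₀, HasDerivAt ψ (ψ' (fc y)) (fc y) := by
      have h2 : Tendsto fc (𝓝 y₀) (𝓝 (f x)) := hfc0 ▸ hfcd.continuousAt.tendsto
      exact h2.eventually hψ
    filter_upwards [hgc.fderiv (𝕜 := ℝ), h1, hΩ] with y h2 h3 hy j
    have h4 : DifferentiableAt ℝ fc y :=
      (hfcs.contDiffAt ((isOpen_target x).mem_nhds hy)).differentiableAt (by simp)
    rw [partialDeriv, h2, (h3.comp_hasFDerivAt y h4.hasFDerivAt).fderiv]
    rfl
  have hWg : ∀ i, partialDeriv i (fun y ↦ √(metricMatrix x y).det *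
        ∑ j, (metricMatrix x y)⁻¹ i j * partialDeriv j (inChart (n := n) x g) y) y₀ =
      ψ' (f x) * partialDeriv i (W i) y₀ + W i y₀ * (ψ'' * partialDeriv i fc y₀) := fun i ↦ by
    have h1 : (fun y ↦ √(metricMatrix x y).det *
        ∑ j, (metricMatrix x y)⁻¹ i j * partialDeriv j (inChart (n := n) x g) y) =ᶠ[𝓝 y₀]
        fun y ↦ ψ' (fc y) * W i y := by
      filter_upwards [hpart] with y hy
      simp only [hW, hy, Finset.mul_sum]
      exact Finset.sum_congr rfl fun j _ ↦ by ring
    have h2 : HasDerivAt ψ' ψ'' (fc y₀) := by rwa [hfc0]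
    have h3 := (h2.comp_hasFDerivAt y₀ hfcd.hasFDerivAt).mul (hWd i).hasFDerivAt
    rw [partialDeriv, h1.fderiv_eq]
    erw [h3.fderiv]
    rw [← hfc0]
    rfl
  have hdet : √(metricMatrix x y₀).det ≠ 0 :=
    (Real.sqrt_pos.2 (posDef_metricMatrix hy₀t).det_pos).ne'
  rw [laplacian, laplacian, gradNormSq, ← hy₀, ← hfc]
  simp only [hWg, Finset.sum_add_distrib, mul_add]
  congr 1
  · rw [← Finset.mul_sum]
    ring
  · simp only [hW, Finset.mul_sum, Finset.sum_mul]
    refine Finset.sum_congr rfl fun i _ ↦ Finset.sum_congr rfl fun j _ ↦ ?_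
    field_simp

variable [CompactSpace M] [IsRiemannianManifold (𝓡 n) M]

namespace IsoData

/-- The formula follows from the chain rule, as `d = arc ∘ F` with `arc' = β^(-1/2)`. -/
lemma laplacian_focalDist (hF : IsoData n F t₀ t₁ β α) (hx : F x ∈ Ioo t₀ t₁) :
    laplacian (n := n) (focalDist F t₀) x =
      (α (F x) - derivWithin β (Icc t₀ t₁) (F x) / 2) / √(β (F x)) := by
  have hnear : Ioo t₀ t₁ ∈ 𝓝 (F x) := isOpen_Ioo.mem_nhds hx
  have h1 : focalDist F t₀ =ᶠ[𝓝 x] arc β t₀ ∘ F := by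
    filter_upwards [hF.smooth.continuous.continuousAt.eventually_mem hnear] with y hy
    exact hF.focalDist_eq hy.2
  have hpos := hF.pos hx
  have hs := Real.sqrt_pos.2 hpos
  have h2 : HasDerivAt β (derivWithin β (Icc t₀ t₁) (F x)) (F x) :=
    (hF.hasDerivWithinAt (Ioo_subset_Icc_self hx)).hasDerivAt (Icc_mem_nhds hx.1 hx.2)
  have h3 := (h2.sqrt hpos.ne').fun_inv hs.ne'
  rw [laplacian_comp hF.smooth h1 (by filter_upwards [hnear] with s hs using hF.hasDerivAt_arc hs) h3,
    hF.gradient, hF.laplace, Real.sq_sqrt hpos.le]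
  field_simp
  ring

lemma meanCurvature_arc (hF : IsoData n F t₀ t₁ β α) (hs : s ∈ Ioo t₀ t₁) :
    meanCurvature (n := n) F t₀ (arc β t₀ s) =
      (α s - derivWithin β (Icc t₀ t₁) s / 2) / √(β s) := by
  have hs' := Ioo_subset_Icc_self hs
  obtain ⟨x, hx⟩ := hF.exists_eq hs'
  have hex : ∃ x : M, focalDist F t₀ x = arc β t₀ s :=
    ⟨x, by rw [hF.focalDist_eq (by rw [hx]; exact hs.2), hx]⟩
  rw [meanCurvature, dif_pos hex]
  have h1 := hex.choose_spec
  set z := hex.choose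
  have hmono := hF.strictMonoOn_arc
  have h2 : F z < t₁ := lt_of_le_of_lt ((hmono.le_iff_le (hF.mem_Icc z) hs').1
    ((hF.arc_le_focalDist z).trans_eq h1)) hs.2
  rw [hF.focalDist_eq h2] at h1
  have h3 : F z = s := hmono.injOn (hF.mem_Icc z) hs' h1
  rw [hF.laplacian_focalDist (by rwa [h3]), h3]

end IsoData

/-! ### The Hessian at the focal set -/

/-- An idempotent matrix has a natural number as its trace. -/
lemma exists_trace_eq {n : ℕ} {A B : Matrix (Fin n) (Fin n) ℝ} {k : ℝ} (hk : 0 < k)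
    (hB : IsUnit B.det) (hA : A ≠ 0) (h : A * B * A = k • A) :
    ∃ r : ℕ, 1 ≤ r ∧ (B * A).trace = k * r := by
  set Q := k⁻¹ • (B * A) with hQ
  have hQA : B * A = k • Q := by rw [hQ, smul_smul, mul_inv_cancel₀ hk.ne', one_smul]
  have hidem : IsIdempotentElem (toLin' Q) := by
    rw [IsIdempotentElem, Module.End.mul_eq_comp, ← toLin'_mul]
    congr 1
    rw [hQ, smul_mul_smul_comm, ← Matrix.mul_assoc, Matrix.mul_assoc B A B,
      Matrix.mul_assoc B (A * B),
      h, Matrix.mul_smul, smul_smul, mul_assoc, inv_mul_cancel₀ hk.ne', mul_one]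
  have h1 := ((LinearMap.isProj_range_iff_isIdempotentElem _).2 hidem).trace
  rw [Matrix.trace_toLin'_eq] at h1
  refine ⟨Module.finrank ℝ (LinearMap.range (toLin' Q)),
    Nat.one_le_iff_ne_zero.2 fun h0 ↦ hA ?_, ?_⟩
  · have h2 : Q = 0 := by
      rw [Submodule.finrank_eq_zero, LinearMap.range_eq_bot] at h0
      simpa using h0
    rw [h2, smul_zero] at hQA
    have h3 := congrArg (B⁻¹ * ·) hQA
    simpa only [← Matrix.mul_assoc, nonsing_inv_mul _ hB, Matrix.one_mul, Matrix.mul_zero] using h3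
  · rw [hQA, trace_smul, h1, smul_eq_mul]

lemma hasDerivAt_line {f : EuclideanSpace ℝ (Fin n) → ℝ} {y : EuclideanSpace ℝ (Fin n)}
    (hf : DifferentiableAt ℝ f y) (l : Fin n) :
    HasDerivAt (fun s : ℝ ↦ f (y + s • EuclideanSpace.single l 1)) (partialDeriv l f y) 0 := by
  have e0 : HasDerivAt (fun s : ℝ ↦ y + s • EuclideanSpace.single l (1 : ℝ))
      (EuclideanSpace.single l 1) 0 := by
    simpa using ((hasDerivAt_id (0 : ℝ)).smul_const (EuclideanSpace.single l (1 : ℝ))).const_add y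
  have e1 : HasFDerivAt f (fderiv ℝ f y) (y + (0 : ℝ) • EuclideanSpace.single l (1 : ℝ)) := by
    simpa using hf.hasFDerivAt
  exact e1.comp_hasDerivAt 0 e0

lemma partialDeriv_eq_of_line {f : EuclideanSpace ℝ (Fin n) → ℝ} {y : EuclideanSpace ℝ (Fin n)}
    (hf : DifferentiableAt ℝ f y) {l : Fin n} {c : ℝ}
    (h : HasDerivAt (fun s : ℝ ↦ f (y + s • EuclideanSpace.single l 1)) c 0) :
    partialDeriv l f y = c := (hasDerivAt_line hf l).unique h

namespace IsoData

/-- At a boundary point of the focal set, the Hessian `A` satisfies `A G⁻¹ A = (β' / 2) A`. Both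
this and `A ≠ 0` follow from the derivative of `|∇ F|² = β(F)`, which is a linear equation for the
differential of `F`. -/
lemma exists_rank_of_frontier (hF : IsoData n F t₀ t₁ β α) (hp : F p = t₀)
    (hfr : ∃ᶠ z in 𝓝 p, t₀ < F z) :
    ∃ r : ℕ, 1 ≤ r ∧ α t₀ = derivWithin β (Icc t₀ t₁) t₀ / 2 * r := by
  set y₀ := extChartAt (𝓡 n) p p with hy₀
  set Ω := (extChartAt (𝓡 n) p).target
  have hΩo : IsOpen Ω := isOpen_target p
  have hy₀t : y₀ ∈ Ω := mem_extChartAt_target p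
  have hΩ : Ω ∈ 𝓝 y₀ := hΩo.mem_nhds hy₀t
  set fc := inChart (n := n) p F with hfc
  have hfc0 : fc y₀ = t₀ := by rw [hfc, inChart, hy₀, extChartAt_to_inv p, hp]
  have hfcs : ContDiffOn ℝ ∞ fc Ω := contDiffOn_inChart hF.smooth p
  set ξ : Fin n → EuclideanSpace ℝ (Fin n) → ℝ := fun i ↦ partialDeriv i fc with hξ
  have hξs : ∀ i, ContDiffOn ℝ ∞ (ξ i) Ω := fun i ↦ contDiffOn_partialDeriv hΩo hfcs i
  set B : Fin n → Fin n → EuclideanSpace ℝ (Fin n) → ℝ := fun i j y ↦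
    (metricMatrix p y)⁻¹ i j with hB
  have hBs : ∀ i j, ContDiffOn ℝ ∞ (B i j) Ω := contDiffOn_inv_metricMatrix p
  have hBsymm : ∀ i j, ∀ y, B i j y = B j i y := fun i j y ↦ by
    have h1 : (metricMatrix p y).IsSymm := by
      ext i j
      exact real_inner_comm (coordVector p i y) (coordVector p j y)
    exact (h1.inv.apply i j).symm
  have hdiff : ∀ {f : EuclideanSpace ℝ (Fin n) → ℝ}, ContDiffOn ℝ ∞ f Ω → ∀ {y}, y ∈ Ω →
      DifferentiableAt ℝ f y := fun hf y hy ↦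
    (hf.contDiffAt (hΩo.mem_nhds hy)).differentiableAt (by simp)
  have hcont : ∀ {f : EuclideanSpace ℝ (Fin n) → ℝ}, ContDiffOn ℝ ∞ f Ω → ContinuousAt f y₀ :=
    fun hf ↦ (hdiff hf hy₀t).continuousAt
  have hξ0 : ∀ i, ξ i y₀ = 0 := hF.partialDeriv_eq_zero hp
  set β' := derivWithin β (Icc t₀ t₁)
  have hgrad : ∀ y ∈ Ω, ∑ i, ξ i y * ∑ j, B i j y * ξ j y = β (fc y) := fun y hy ↦ by
    have h1 := gradNormSq_eq_chart (f := F) (x := p) (hF.mdifferentiableAt _) hy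
    rwa [hF.gradient] at h1
  -- the linear equation for the differential `ξ`
  set N : EuclideanSpace ℝ (Fin n) → Matrix (Fin n) (Fin n) ℝ := fun y ↦ Matrix.of fun l j ↦
    2 * (∑ i, partialDeriv l (ξ i) y * B i j y) + (∑ i, ξ i y * partialDeriv l (B i j) y) -
      β' (fc y) * (1 : Matrix (Fin n) (Fin n) ℝ) l j with hN
  have hlt : ∀ᶠ y in 𝓝 y₀, fc y < t₁ :=
    (hcont hfcs).tendsto.eventually_lt_const (by rw [hfc0]; exact hF.lt)
  have hNξ : ∀ᶠ y in 𝓝 y₀, ∀ l, ∑ j, N y l j * ξ j y = 0 := by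
    filter_upwards [hlt, hΩ] with y hy1 hy l
    -- where `F = t₀` the differential vanishes; elsewhere `β ∘ F` can be differentiated
    rcases (hF.mem_Icc ((extChartAt (𝓡 n) p).symm y)).1.eq_or_lt with h0 | h0
    · have h1 : IsLocalMin fc y := Eventually.of_forall fun z ↦ by
        have h2 : fc y = t₀ := h0.symm
        rw [h2]
        exact (hF.mem_Icc _).1
      have h2 : ∀ j, ξ j y = 0 := fun j ↦ by
        simp only [hξ, partialDeriv]
        rw [h1.fderiv_eq_zero]
        rfl
      simp only [h2, mul_zero, Finset.sum_const_zero]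
    · have hs : fc y ∈ Ioo t₀ t₁ := ⟨h0, hy1⟩
      have hβ : HasDerivAt β (β' (fc y)) (fc (y + (0 : ℝ) • EuclideanSpace.single l (1 : ℝ))) := by
        rw [zero_smul, add_zero]
        exact (hF.hasDerivWithinAt (Ioo_subset_Icc_self hs)).hasDerivAt (Icc_mem_nhds hs.1 hs.2)
      have d1 := HasDerivAt.comp (0 : ℝ) hβ (hasDerivAt_line (hdiff hfcs hy) l)
      have d2 := HasDerivAt.fun_sum (u := Finset.univ) fun i _ ↦
        (hasDerivAt_line (hdiff (hξs i) hy) l).fun_mul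
          (HasDerivAt.fun_sum (u := Finset.univ) fun j _ ↦
            (hasDerivAt_line (hdiff (hBs i j) hy) l).fun_mul (hasDerivAt_line (hdiff (hξs j) hy) l))
      have hev : (β ∘ fun s : ℝ ↦ fc (y + s • EuclideanSpace.single l 1)) =ᶠ[𝓝 0]
          fun s ↦ ∑ i, ξ i (y + s • EuclideanSpace.single l 1) *
            ∑ j, B i j (y + s • EuclideanSpace.single l 1) *
              ξ j (y + s • EuclideanSpace.single l 1) := by
        have hc : ContinuousAt (fun s : ℝ ↦ y + s • EuclideanSpace.single l (1 : ℝ)) 0 :=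
          by fun_prop
        have hm : ∀ᶠ s in 𝓝 (0 : ℝ), y + s • EuclideanSpace.single l (1 : ℝ) ∈ Ω :=
          hc.eventually_mem (by rw [zero_smul, add_zero]; exact hΩo.mem_nhds hy)
        filter_upwards [hm] with s hs
        exact (hgrad _ hs).symm
      have h3 := (d1.congr_of_eventuallyEq hev.symm).unique d2
      simp only [zero_smul, add_zero] at h3
      have h4 : ∑ i, ξ i y * ∑ j, B i j y * partialDeriv l (ξ j) y =
          ∑ i, partialDeriv l (ξ i) y * ∑ j, B i j y * ξ j y := by
        simp only [Finset.mul_sum]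
        rw [Finset.sum_comm]
        refine Finset.sum_congr rfl fun i _ ↦ Finset.sum_congr rfl fun j _ ↦ ?_
        rw [hBsymm j i]
        ring
      have h5 : ∑ j, N y l j * ξ j y = 2 * ∑ i, partialDeriv l (ξ i) y * ∑ j, B i j y * ξ j y +
          ∑ i, ξ i y * ∑ j, partialDeriv l (B i j) y * ξ j y - β' (fc y) * ξ l y := by
        simp only [hN, of_apply, sub_mul, add_mul, Finset.sum_sub_distrib, Finset.sum_add_distrib]
        congr 1
        · congr 1
          · simp only [Finset.mul_sum, Finset.sum_mul]
            rw [Finset.sum_comm]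
            exact Finset.sum_congr rfl fun i _ ↦ Finset.sum_congr rfl fun j _ ↦ by ring
          · simp only [Finset.mul_sum, Finset.sum_mul]
            rw [Finset.sum_comm]
            exact Finset.sum_congr rfl fun i _ ↦ Finset.sum_congr rfl fun j _ ↦ by ring
        · simp [one_apply]
      simp only [mul_add, Finset.sum_add_distrib] at h3
      rw [h4] at h3
      rw [h5, h3]
      ring
  -- continuity of the coefficients
  have hNc : ∀ l j, ContinuousAt (fun y ↦ N y l j) y₀ := fun l j ↦ by
    simp only [hN, of_apply]
    have hβc : ContinuousAt (fun y ↦ β' (fc y)) y₀ := by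
      have h1 : ContinuousWithinAt β' (Icc t₀ t₁) (fc y₀) :=
        hF.continuousOn_deriv _ (by rw [hfc0]; exact left_mem_Icc.2 hF.lt.le)
      exact h1.tendsto.comp (tendsto_nhdsWithin_iff.2 ⟨(hcont hfcs).tendsto,
        Eventually.of_forall fun y ↦ hF.mem_Icc _⟩)
    exact ((tendsto_const_nhds.mul (tendsto_finsetSum _ fun i _ ↦
      (hcont (contDiffOn_partialDeriv hΩo (hξs i) l)).tendsto.mul (hcont (hBs i j)).tendsto)).add
      (tendsto_finsetSum _ fun i _ ↦ (hcont (hξs i)).tendsto.mul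
        (hcont (contDiffOn_partialDeriv hΩo (hBs i j) l)).tendsto)).sub
      (hβc.tendsto.mul tendsto_const_nhds)
  set k := β' t₀ / 2 with hk
  have hk0 : 0 < k := half_pos hF.deriv_left_pos
  set A : Matrix (Fin n) (Fin n) ℝ := Matrix.of fun l i ↦ partialDeriv l (ξ i) y₀ with hA
  set B₀ := (metricMatrix p y₀)⁻¹ with hB₀
  have hN0 : N y₀ = (2 : ℝ) • (A * B₀ - k • 1) := by
    ext l j
    simp only [hN, of_apply, hξ0, zero_mul, Finset.sum_const_zero, add_zero, hfc0,
      Matrix.smul_apply,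
      Matrix.sub_apply, mul_apply, smul_eq_mul, hA, hB₀, hk]
    ring
  -- first consequence: divide the equation by the distance to `y₀` along coordinate lines
  have hABA : A * B₀ * Aᵀ = k • Aᵀ := by
    have h1 : ∀ l m, ∑ j, N y₀ l j * A m j = 0 := fun l m ↦ by
      have hc : Tendsto (fun s : ℝ ↦ y₀ + s • EuclideanSpace.single m (1 : ℝ)) (𝓝[>] 0) (𝓝 y₀) := by
        have : ContinuousAt (fun s : ℝ ↦ y₀ + s • EuclideanSpace.single m (1 : ℝ)) 0 := by fun_prop
        simpa using this.tendsto.mono_left nhdsWithin_le_nhds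
      have h2 : Tendsto (fun s : ℝ ↦ ∑ j, N (y₀ + s • EuclideanSpace.single m (1 : ℝ)) l j *
          (s⁻¹ * ξ j (y₀ + s • EuclideanSpace.single m (1 : ℝ)))) (𝓝[>] 0)
          (𝓝 (∑ j, N y₀ l j * A m j)) := by
        refine tendsto_finsetSum _ fun j _ ↦ ((hNc l j).tendsto.comp hc).mul ?_
        have h3 := (hasDerivAt_line (hdiff (hξs j) hy₀t) m).tendsto_slope_zero_right
        simpa [hξ0, hA] using h3
      refine tendsto_nhds_unique h2 (tendsto_const_nhds.congr' ?_)
      filter_upwards [hc.eventually hNξ] with s hs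
      have h4 := hs l
      rw [← mul_zero s⁻¹, ← h4, Finset.mul_sum]
      exact Finset.sum_congr rfl fun j _ ↦ by ring
    have h2 : N y₀ * Aᵀ = 0 := by
      ext l m
      rw [mul_apply]
      exact h1 l m
    rw [hN0, smul_mul, smul_eq_zero_iff_right two_ne_zero, Matrix.sub_mul, sub_eq_zero, smul_mul,
      Matrix.one_mul] at h2
    exact h2
  have hsymmB : B₀ᵀ = B₀ := by
    ext i j
    exact hBsymm j i y₀
  have hsymm : Aᵀ = A := by
    have h1 : (A * B₀ * Aᵀ)ᵀ = A * B₀ * Aᵀ := by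
      rw [transpose_mul, transpose_mul, transpose_transpose, hsymmB, Matrix.mul_assoc]
    rw [hABA, transpose_smul, transpose_transpose] at h1
    exact (smul_right_injective _ hk0.ne' h1).symm
  rw [hsymm] at hABA
  -- second consequence: the coefficient matrix is singular near `y₀`, hence at `y₀`
  have hA0 : A ≠ 0 := fun h0 ↦ by
    have hdet : (N y₀).det ≠ 0 := by
      have h1 : N y₀ = (-(2 * k)) • 1 := by
        rw [hN0, h0, Matrix.zero_mul, zero_sub, smul_neg, smul_smul, neg_smul]
      rw [h1, det_smul, det_one, mul_one]
      exact pow_ne_zero _ (by simpa using hk0.ne')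
    have hdc : ContinuousAt (fun y ↦ (N y).det) y₀ := by
      simp only [det_apply']
      exact tendsto_finsetSum _ fun σ _ ↦ tendsto_const_nhds.mul
        (tendsto_finsetProd _ fun i _ ↦ (hNc _ _).tendsto)
    have hfr' : ∃ᶠ y in 𝓝 y₀, t₀ < fc y := by
      have h1 : Tendsto (extChartAt (𝓡 n) p) (𝓝 p) (𝓝 y₀) := continuousAt_extChartAt p
      refine h1.frequently ((hfr.and_eventually (extChartAt_source_mem_nhds (I := 𝓡 n) p)).mono ?_)
      rintro z ⟨hz, hzs⟩
      rwa [hfc, inChart, (extChartAt (𝓡 n) p).left_inv hzs]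
    obtain ⟨y, hy, hdy, hNy, hy1, hyΩ⟩ := (hfr'.and_eventually
      ((hdc.eventually_ne hdet).and (hNξ.and (hlt.and hΩ)))).exists
    refine hdy (exists_mulVec_eq_zero_iff.1 ⟨fun j ↦ ξ j y, fun h1 ↦ ?_, funext hNy⟩)
    have h2 := hgrad y hyΩ
    have h3 : ∀ j, ξ j y = 0 := congrFun h1
    simp only [h3, zero_mul, Finset.sum_const_zero] at h2
    exact (hF.pos ⟨hy, hy1⟩).ne h2
  have hdet : IsUnit (metricMatrix p y₀).det := (posDef_metricMatrix hy₀t).det_pos.ne'.isUnit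
  obtain ⟨r, hr, htr⟩ := exists_trace_eq hk0 (B := B₀)
    (isUnit_nonsing_inv_det _ hdet) hA0 hABA
  refine ⟨r, hr, ?_⟩
  rw [← htr, ← hp, ← hF.laplace]
  set G : EuclideanSpace ℝ (Fin n) → ℝ := fun y ↦ √(metricMatrix p y).det with hG
  have hGs : ContDiffOn ℝ ∞ G Ω := (contDiffOn_det (contDiffOn_metricMatrix p)).sqrt
    fun y hy ↦ (posDef_metricMatrix hy).det_pos.ne'
  have hG0 : G y₀ ≠ 0 := (Real.sqrt_pos.2 (posDef_metricMatrix hy₀t).det_pos).ne'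
  have hW : ∀ i, partialDeriv i (fun y ↦ G y * ∑ j, B i j y * ξ j y) y₀ =
      G y₀ * ∑ j, B i j y₀ * partialDeriv i (ξ j) y₀ := fun i ↦ by
    refine partialDeriv_eq_of_line
      (hdiff (hGs.mul (ContDiffOn.sum fun j _ ↦ (hBs i j).mul (hξs j))) hy₀t) ?_
    have d := (hasDerivAt_line (hdiff hGs hy₀t) i).fun_mul
      (HasDerivAt.fun_sum (u := Finset.univ) fun j _ ↦
        (hasDerivAt_line (hdiff (hBs i j) hy₀t) i).fun_mul (hasDerivAt_line (hdiff (hξs j) hy₀t) i))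
    simpa only [zero_smul, add_zero, hξ0, mul_zero, zero_add, Finset.sum_const_zero] using d
  have hlap : laplacian (n := n) F p = (G y₀)⁻¹ *
      ∑ i, partialDeriv i (fun y ↦ G y * ∑ j, B i j y * ξ j y) y₀ := rfl
  rw [hlap]
  simp only [hW]
  rw [← Finset.mul_sum, inv_mul_cancel_left₀ hG0]
  simp only [trace, diag_apply, mul_apply]
  refine Finset.sum_congr rfl fun i _ ↦ Finset.sum_congr rfl fun j _ ↦ ?_
  have h1 : A j i = A i j := congrFun (congrFun hsymm i) j
  rw [h1]
  rfl

end IsoData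

end Laplacian



/-! ### The mean curvature function is a profile -/

section Endpoint

open MeasureTheory intervalIntegral

variable {f f' : ℝ → ℝ} {a b c D : ℝ} {m : ℕ}

/-- A derivative on the open interval that extends continuously is a derivative on the closed
interval. -/
lemma hasDerivWithinAt_Icc_of_Ioo (hf : ContinuousOn f (Icc a b))
    (hf' : ContinuousOn f' (Icc a b)) (h : ∀ x ∈ Ioo a b, HasDerivAt f (f' x) x) :
    ∀ x ∈ Icc a b, HasDerivWithinAt f (f' x) (Icc a b) x := by
  intro x hx
  have hab : a ≤ b := hx.1.trans hx.2
  set g' : ℝ → ℝ := IccExtend hab ((Icc a b).domRestrict f') with hg'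
  have hgc : Continuous g' := (continuousOn_iff_continuous_domRestrict.1 hf').Icc_extend'
  have hg'e : EqOn g' f' (Icc a b) := fun x hx ↦ by
    rw [hg', IccExtend_of_mem _ _ hx]; rfl
  have h1 : EqOn f (fun x ↦ f a + ∫ s in a..x, g' s) (Icc a b) := fun y hy ↦ by
    have h2 : ∫ s in a..y, g' s = f y - f a := by
      refine integral_eq_sub_of_hasDerivAt_of_le hy.1 (hf.mono (Icc_subset_Icc_right hy.2))
        (fun s hs ↦ ?_) (hgc.intervalIntegrable _ _)
      have hs' : s ∈ Ioo a b := ⟨hs.1, hs.2.trans_le hy.2⟩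
      rw [hg'e (Ioo_subset_Icc_self hs')]
      exact h s hs'
    simp only [h2]; ring
  rw [← hg'e hx]
  exact (((hgc.integral_hasStrictDerivAt a x).hasDerivAt.const_add _).hasDerivWithinAt).congr
    h1 (h1 hx)

lemma contDiffOn_succ_of_hasDerivWithinAt {k : ℕ} (hab : a < b)
    (h : ∀ x ∈ Icc a b, HasDerivWithinAt f (f' x) (Icc a b) x)
    (hf' : ContDiffOn ℝ k f' (Icc a b)) : ContDiffOn ℝ (k + 1 : ℕ) f (Icc a b) := by
  rw [Nat.cast_add, Nat.cast_one, contDiffOn_succ_iff_derivWithin (uniqueDiffOn_Icc hab)]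
  exact ⟨fun x hx ↦ (h x hx).differentiableWithinAt, by simp, hf'.congr fun x hx ↦
    (h x hx).derivWithin (uniqueDiffOn_Icc hab x hx)⟩

lemma contDiffOn_avg (hc : 0 < c) (hf : ContDiffOn ℝ ∞ f (Icc 0 c)) :
    ContDiffOn ℝ ∞ (avg m f) (Icc 0 c) := by
  refine contDiffOn_infty.2 fun k ↦ ?_
  induction k generalizing m f with
  | zero => exact contDiffOn_zero.2 (continuousOn_avg hc.le m hf.continuousOn)
  | succ k ih =>
    have hd : ContDiffOn ℝ ∞ (derivWithin f (Icc 0 c)) (Icc 0 c) :=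
      hf.derivWithin (uniqueDiffOn_Icc hc) (by simp)
    exact contDiffOn_succ_of_hasDerivWithinAt hc (fun x hx ↦ hasDerivWithinAt_avg hc.le m
      hd.continuousOn (fun y hy ↦ (hf.differentiableOn (by simp) y hy).hasDerivWithinAt) hx)
      (ih hd)

/-- The quotient of `N` by a function `P` with a simple zero at `0` has a simple pole there, and no
constant term if `P''` and `N'` vanish at `0`. -/
lemma exists_quotient_eq {P P' N : ℝ → ℝ} (hD : 0 < D) (hP' : ContDiffOn ℝ ∞ P' (Icc 0 D))
    (hP : ∀ t ∈ Icc 0 D, HasDerivWithinAt P (P' t) (Icc 0 D) t)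
    (hN : ContDiffOn ℝ ∞ N (Icc 0 D)) (hP0 : P 0 = 0) (hpos : ∀ t ∈ Ioo 0 D, 0 < P t)
    (hP'0 : 0 < P' 0) (hN0 : N 0 = m * P' 0) (hP2 : derivWithin P' (Icc 0 D) 0 = 0)
    (hN1 : derivWithin N (Icc 0 D) 0 = 0) :
    ∃ ρ : ℝ → ℝ, ContDiffOn ℝ ∞ ρ (Ico 0 D) ∧ ρ 0 = 0 ∧ ∀ t ∈ Ioo 0 D, N t / P t = m / t + ρ t := by
  have h0 : (0 : ℝ) ∈ Icc 0 D := left_mem_Icc.2 hD.le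
  have hu := uniqueDiffOn_Icc hD
  have hA : ContDiffOn ℝ ∞ (avg 0 P') (Icc 0 D) := contDiffOn_avg hD hP'
  have hPA : ∀ t ∈ Icc 0 D, P t = t * avg 0 P' t := fun t ht ↦
    eq_mul_avg_of_hasDerivWithinAt hP hP'.continuousOn hP0 ht
  have hA0 : avg 0 P' 0 = P' 0 := by simp [avg_zero]
  have hApos : ∀ t ∈ Ico 0 D, 0 < avg 0 P' t := fun t ht ↦ by
    rcases ht.1.eq_or_lt with rfl | h
    · rwa [hA0]
    · have := hpos t ⟨h, ht.2⟩
      rw [hPA t ⟨ht.1, ht.2.le⟩] at this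
      exact pos_of_mul_pos_right this h.le
  -- with `P = t A` the remainder is `(N - m A) / (t A)`, and `N - m A` vanishes to second order
  set E : ℝ → ℝ := fun t ↦ N t - m * avg 0 P' t with hE
  have hEs : ContDiffOn ℝ ∞ E (Icc 0 D) := hN.sub (contDiffOn_const.mul hA)
  have hE' : ContDiffOn ℝ ∞ (derivWithin E (Icc 0 D)) (Icc 0 D) := hEs.derivWithin hu (by simp)
  have hEd : ∀ t ∈ Icc 0 D, E t = t * avg 0 (derivWithin E (Icc 0 D)) t := fun t ht ↦
    eq_mul_avg_of_hasDerivWithinAt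
      (fun x hx ↦ (hEs.differentiableOn (by simp) x hx).hasDerivWithinAt)
      hE'.continuousOn (by simp [hE, hA0, hN0]) ht
  have hE0 : derivWithin E (Icc 0 D) 0 = 0 := by
    have h1 := hasDerivWithinAt_avg hD.le 0 (hP'.derivWithin hu (by simp) : ContDiffOn ℝ ∞ _ _).continuousOn
      (fun y hy ↦ (hP'.differentiableOn (by simp) y hy).hasDerivWithinAt) h0
    rw [avg_zero, hP2, zero_div] at h1
    have h2 := (hN.differentiableOn (by simp) 0 h0).hasDerivWithinAt
    rw [hN1] at h2
    have h3 : HasDerivWithinAt E (0 - m * 0) (Icc 0 D) 0 := h2.sub (h1.const_mul (m : ℝ))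
    rw [h3.derivWithin (hu 0 h0), mul_zero, sub_zero]
  refine ⟨fun t ↦ avg 0 (derivWithin E (Icc 0 D)) t / avg 0 P' t,
    ((contDiffOn_avg hD hE').mono Ico_subset_Icc_self).div (hA.mono Ico_subset_Icc_self)
      fun t ht ↦ (hApos t ht).ne', by simp [avg_zero, hE0], fun t ht ↦ ?_⟩
  have ht' := Ioo_subset_Icc_self ht
  have h1 := hEd t ht'
  have h2 := (hApos t ⟨ht.1.le, ht.2⟩).ne'
  have h3 := ht.1.ne'
  have h4 : N t = t * avg 0 (derivWithin E (Icc 0 D)) t + m * avg 0 P' t := by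
    rw [← h1]; simp [hE]
  rw [hPA t ht', h4]
  field_simp
  ring

/-- Expansions of `h` at the two endpoints, valid on the whole interval, combine to a profile: away
from one endpoint `κ` is smooth by the expansion at the other. -/
lemma exists_profile_of_ends {m₀ m₁ : ℕ} {h ρ₀ ρ₁ : ℝ → ℝ} (hD : 0 < D)
    (hρ₀ : ContDiffOn ℝ ∞ ρ₀ (Ico 0 D)) (hρ₁ : ContDiffOn ℝ ∞ ρ₁ (Ico 0 D)) (h₀ : ρ₀ 0 = 0)
    (h₁ : ρ₁ 0 = 0) (hl : ∀ t ∈ Ioo 0 D, h t = m₀ / t + ρ₀ t)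
    (hr : ∀ t ∈ Ioo 0 D, h t = -(m₁ / (D - t) + ρ₁ (D - t))) :
    ∃ K κ, Profile D m₀ m₁ K κ h := by
  set κ : ℝ → ℝ := fun t ↦ if t < D then ρ₀ t + m₁ / (D - t) else -(m₀ / D) with hκ
  have hκl : EqOn κ (fun t ↦ ρ₀ t + m₁ / (D - t)) (Ico 0 D) := fun t ht ↦ if_pos ht.2
  have hκr : EqOn κ (fun t ↦ -ρ₁ (D - t) - m₀ / t) (Ioc 0 D) := fun t ht ↦ by
    rcases ht.2.lt_or_eq with h2 | rfl
    · have h3 := hl t ⟨ht.1, h2⟩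
      rw [hr t ⟨ht.1, h2⟩] at h3
      simp only [hκ, if_pos h2]
      linarith
    · simp [hκ, h₁]
  have hs : ContDiffOn ℝ ∞ κ (Icc 0 D) := fun t ht ↦ by
    rcases ht.2.lt_or_eq with h2 | rfl
    · have h3 : ContDiffOn ℝ ∞ κ (Ico 0 D) :=
        (hρ₀.add (contDiffOn_const.div (by fun_prop) fun x hx ↦ (sub_pos.2 hx.2).ne')).congr hκl
      refine (h3 t ⟨ht.1, h2⟩).mono_of_mem_nhdsWithin ?_
      filter_upwards [self_mem_nhdsWithin, nhdsWithin_le_nhds (Iio_mem_nhds h2)] with x hx hx2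
      exact ⟨hx.1, hx2⟩
    · have h3 : ContDiffOn ℝ ∞ κ (Ioc 0 t) := by
        refine ContDiffOn.congr (ContDiffOn.sub (ContDiffOn.neg ?_) ?_) hκr
        · exact hρ₁.comp (by fun_prop) fun x hx ↦ ⟨sub_nonneg.2 hx.2, by linarith [hx.1]⟩
        · exact contDiffOn_const.div contDiffOn_id fun x hx ↦ hx.1.ne'
      refine (h3 t ⟨hD, le_rfl⟩).mono_of_mem_nhdsWithin ?_
      filter_upwards [self_mem_nhdsWithin, nhdsWithin_le_nhds (Ioi_mem_nhds hD)] with x hx hx2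
      exact ⟨hx2, hx.2⟩
  set g : ℝ → ℝ := IccExtend hD.le ((Icc 0 D).domRestrict κ) with hg
  have hgc : Continuous g := (continuousOn_iff_continuous_domRestrict.1 hs.continuousOn).Icc_extend'
  have hK : ∀ t ∈ Icc 0 D, HasDerivWithinAt (fun t ↦ ∫ s in (0 : ℝ)..t, g s) (κ t) (Icc 0 D) t :=
    fun t ht ↦ by
      have h3 := (hgc.integral_hasStrictDerivAt 0 t).hasDerivAt.hasDerivWithinAt (s := Icc 0 D)
      rwa [hg, IccExtend_of_mem _ _ ht] at h3
  refine ⟨fun t ↦ ∫ s in (0 : ℝ)..t, g s, κ, hD, ?_, hs, hK, fun t ht ↦ ?_, ?_, ?_⟩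
  · refine contDiffOn_infty.2 fun k ↦ ContDiffOn.of_le
      (contDiffOn_succ_of_hasDerivWithinAt hD hK (contDiffOn_infty.1 hs k)) (by norm_cast; omega)
  · rw [hκl ⟨ht.1.le, ht.2⟩, hl t ht]
    ring
  · simp [hκ, hD, h₀]
  · simp [hκ]

end Endpoint

section Isoparametric

open Matrix Manifold

variable {n : ℕ} {M : Type*} [MetricSpace M] [ChartedSpace (EuclideanSpace ℝ (Fin n)) M]
  [IsManifold (𝓡 n) ∞ M] [Bundle.RiemannianBundle (fun x : M ↦ TangentSpace (𝓡 n) x)]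
  [IsContMDiffRiemannianBundle (𝓡 n) ∞ (EuclideanSpace ℝ (Fin n))
    (fun x : M ↦ TangentSpace (𝓡 n) x)]
  [CompactSpace M] [IsRiemannianManifold (𝓡 n) M]
  {F : M → ℝ} {t₀ t₁ : ℝ} {β α : ℝ → ℝ} {x p : M}

namespace IsoData

/-- The value of the isoparametric function at distance `t` from the focal set. -/
lemma exists_inverse_arc (hF : IsoData n F t₀ t₁ β α) :
    ∃ Φ : ℝ → ℝ, ContinuousOn Φ (Icc 0 (arc β t₀ t₁)) ∧ Φ 0 = t₀ ∧ Φ (arc β t₀ t₁) = t₁ ∧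
      ∀ t ∈ Ioo 0 (arc β t₀ t₁), Φ t ∈ Ioo t₀ t₁ ∧ arc β t₀ (Φ t) = t ∧
        HasDerivAt Φ (√(β (Φ t))) t := by
  set D := arc β t₀ t₁ with hDdef
  have h0 := left_mem_Icc.2 hF.lt.le
  have h1 := right_mem_Icc.2 hF.lt.le
  have hmono := hF.strictMonoOn_arc
  have hbij : BijOn (arc β t₀) (Icc t₀ t₁) (Icc 0 D) := by
    refine ⟨fun s hs ↦ ⟨?_, hmono.monotoneOn hs h1 hs.2⟩, hmono.injOn, ?_⟩
    · rw [← arc_left (β := β) (t₀ := t₀)]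
      exact hmono.monotoneOn h0 hs hs.1
    · have := intermediate_value_Icc hF.lt.le hF.continuousOn_arc
      rwa [arc_left] at this
  set e : Icc t₀ t₁ ≃ Icc 0 D := hbij.equiv with he
  have hec : Continuous e := by
    refine Continuous.subtype_mk (continuousOn_iff_continuous_domRestrict.1 hF.continuousOn_arc) _
  have hD0 : 0 ≤ D := (hbij.mapsTo h0).1.trans (hbij.mapsTo h0).2
  set H := hec.homeoOfEquivCompactToT2 with hH
  set Φ : ℝ → ℝ := fun t ↦ (H.symm (projIcc 0 D hD0 t) : ℝ) with hΦ
  have hΦc : Continuous Φ := continuous_subtype_val.comp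
    (H.symm.continuous.comp continuous_projIcc)
  have hΦmem : ∀ t, Φ t ∈ Icc t₀ t₁ := fun t ↦ (H.symm (projIcc 0 D hD0 t)).2
  have hinv : ∀ t ∈ Icc 0 D, arc β t₀ (Φ t) = t := fun t ht ↦ by
    have h2 : (H (H.symm (projIcc 0 D hD0 t)) : ℝ) = projIcc 0 D hD0 t := by
      rw [H.apply_symm_apply]
    rw [projIcc_of_mem hD0 ht] at h2
    simp only [hΦ, projIcc_of_mem hD0 ht]
    exact h2
  have hΦ0 : Φ 0 = t₀ := hmono.injOn (hΦmem 0) h0 (by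
    rw [hinv 0 (left_mem_Icc.2 hD0), arc_left])
  have hΦD : Φ D = t₁ := hmono.injOn (hΦmem D) h1 (hinv D (right_mem_Icc.2 hD0))
  refine ⟨Φ, hΦc.continuousOn, hΦ0, hΦD, fun t ht ↦ ?_⟩
  have hti := hinv t (Ioo_subset_Icc_self ht)
  have hmem : Φ t ∈ Ioo t₀ t₁ := by
    refine ⟨(hΦmem t).1.lt_of_ne fun h2 ↦ ht.1.ne ?_, (hΦmem t).2.lt_of_ne fun h2 ↦ ht.2.ne ?_⟩
    · rw [← hti, ← h2, arc_left]
    · rw [← hti, h2]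
  refine ⟨hmem, hti, ?_⟩
  have h2 := (hF.hasDerivAt_arc hmem).of_local_left_inverse (g := Φ) hΦc.continuousAt
    (inv_ne_zero (Real.sqrt_pos.2 (hF.pos hmem)).ne')
    (by filter_upwards [Ioo_mem_nhds ht.1 ht.2] with y hy using hinv y (Ioo_subset_Icc_self hy))
  rwa [inv_inv] at h2

/-- As `M` is connected, the focal set has a boundary point; the Laplacian is constant on the focal
set. -/
lemma exists_rank_left [ConnectedSpace M] (hF : IsoData n F t₀ t₁ β α) :
    ∃ r : ℕ, 1 ≤ r ∧ α t₀ = derivWithin β (Icc t₀ t₁) t₀ / 2 * r := by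
  by_contra hno
  have hop : IsOpen (F ⁻¹' {t₀}) := isOpen_iff_mem_nhds.2 fun p hp ↦ by
    have h1 : ¬∃ᶠ z in 𝓝 p, t₀ < F z := fun h ↦ hno (hF.exists_rank_of_frontier hp h)
    filter_upwards [not_frequently.1 h1] with z hz
    exact le_antisymm (not_lt.1 hz) (hF.mem_Icc z).1
  have hcl : IsClosed (F ⁻¹' {t₀}) := isClosed_singleton.preimage hF.smooth.continuous
  rcases isClopen_iff.1 ⟨hcl, hop⟩ with h | h
  · exact hF.nonempty_left.ne_empty h
  · obtain ⟨x, hx⟩ := hF.exists_eq (right_mem_Icc.2 hF.lt.le)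
    have h2 : x ∈ F ⁻¹' {t₀} := h ▸ mem_univ x
    exact hF.lt.ne (h2.symm.trans hx)

lemma derivWithin_reflect (hF : IsoData n F t₀ t₁ β α) :
    derivWithin (fun s ↦ β (-s)) (Icc (-t₁) (-t₀)) (-t₁) = -derivWithin β (Icc t₀ t₁) t₁ := by
  have h1 : HasDerivWithinAt β (derivWithin β (Icc t₀ t₁) t₁) (Icc t₀ t₁) (-(-t₁)) := by
    rw [neg_neg]; exact hF.hasDerivWithinAt (right_mem_Icc.2 hF.lt.le)
  have h2 := h1.comp (-t₁) (hasDerivWithinAt_neg (-t₁) (Icc (-t₁) (-t₀))) fun s hs ↦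
    ⟨by linarith [hs.2], by linarith [hs.1]⟩
  rw [mul_neg_one] at h2
  exact h2.derivWithin (uniqueDiffOn_Icc (neg_lt_neg hF.lt) _
    (left_mem_Icc.2 (neg_le_neg hF.lt.le)))

/-- The mean curvature of the level sets has simple poles at the ends of the interval; the residues
are the ranks of the Hessian of `F` on the focal sets, diminished by one. -/
theorem exists_profile [ConnectedSpace M] (hF : IsoData n F t₀ t₁ β α) :
    ∃ m₀ m₁ K κ, Profile (arc β t₀ t₁) m₀ m₁ K κ (meanCurvature (n := n) F t₀) := by
  obtain ⟨Φ, hΦc, hΦ0, hΦD, hΦ⟩ := hF.exists_inverse_arc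
  have hD : 0 < arc β t₀ t₁ := by
    rw [← arc_left (β := β) (t₀ := t₀)]
    exact hF.strictMonoOn_arc (left_mem_Icc.2 hF.lt.le) (right_mem_Icc.2 hF.lt.le) hF.lt
  set D := arc β t₀ t₁ with hDdef
  set I := Icc t₀ t₁ with hI
  have hu := uniqueDiffOn_Icc hD
  set g : ℝ → ℝ := fun s ↦ derivWithin β I s / 2 with hg
  have hgs : ContDiffOn ℝ ∞ g I :=
    (hF.smooth_β.derivWithin (uniqueDiffOn_Icc hF.lt) (by simp)).div_const 2
  have hmaps : MapsTo Φ (Icc 0 D) I := fun t ht ↦ by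
    rcases ht.1.eq_or_lt with rfl | h2
    · rw [hΦ0]; exact left_mem_Icc.2 hF.lt.le
    rcases ht.2.eq_or_lt with rfl | h3
    · rw [hΦD]; exact right_mem_Icc.2 hF.lt.le
    exact Ioo_subset_Icc_self (hΦ t ⟨h2, h3⟩).1
  set P : ℝ → ℝ := fun t ↦ √(β (Φ t)) with hP
  have hPc : ContinuousOn P (Icc 0 D) := (hF.smooth_β.continuousOn.comp hΦc hmaps).sqrt
  have hPpos : ∀ t ∈ Ioo 0 D, 0 < P t := fun t ht ↦ Real.sqrt_pos.2 (hF.pos (hΦ t ht).1)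
  have hΦd : ∀ t ∈ Icc 0 D, HasDerivWithinAt Φ (P t) (Icc 0 D) t :=
    hasDerivWithinAt_Icc_of_Ioo hΦc hPc fun t ht ↦ (hΦ t ht).2.2
  have hPd : ∀ t ∈ Icc 0 D, HasDerivWithinAt P (g (Φ t)) (Icc 0 D) t := by
    refine hasDerivWithinAt_Icc_of_Ioo hPc (hgs.continuousOn.comp hΦc hmaps) fun t ht ↦ ?_
    have hm := (hΦ t ht).1
    have h1 := (((hF.hasDerivWithinAt (Ioo_subset_Icc_self hm)).hasDerivAt
      (Icc_mem_nhds hm.1 hm.2)).comp t (hΦ t ht).2.2).sqrt (hF.pos hm).ne'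
    refine h1.congr_deriv ?_
    have := (hPpos t ht).ne'
    simp only [hg, hP, hI, Function.comp_apply] at this ⊢
    field_simp
  -- `Φ' = P` and `P' = β'(Φ) / 2`: a system with smooth right-hand side
  have hΦs : ContDiffOn ℝ ∞ Φ (Icc 0 D) := contDiffOn_infty.2 fun k ↦ by
    induction k with
    | zero => exact contDiffOn_zero.2 hΦc
    | succ k ih =>
      exact contDiffOn_succ_of_hasDerivWithinAt hD hΦd ((contDiffOn_succ_of_hasDerivWithinAt hD hPd
        ((contDiffOn_infty.1 hgs k).comp ih hmaps)).of_le (by norm_cast; omega))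
  have hgΦ : ContDiffOn ℝ ∞ (fun t ↦ g (Φ t)) (Icc 0 D) := hgs.comp hΦs hmaps
  set N : ℝ → ℝ := fun t ↦ α (Φ t) - g (Φ t) with hN
  have hNs : ContDiffOn ℝ ∞ N (Icc 0 D) := (hF.smooth_α.comp hΦs hmaps).sub hgΦ
  have hh : ∀ t ∈ Ioo 0 D, meanCurvature (n := n) F t₀ t = N t / P t := fun t ht ↦ by
    rw [← (hΦ t ht).2.1, hF.meanCurvature_arc (hΦ t ht).1, (hΦ t ht).2.1]
  -- functions of `Φ` have vanishing derivative at both ends, where `Φ' = P` vanishes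
  have hcomp : ∀ {ψ : ℝ → ℝ}, ContDiffOn ℝ ∞ ψ I → ∀ t ∈ Icc 0 D, P t = 0 →
      HasDerivWithinAt (fun t ↦ ψ (Φ t)) 0 (Icc 0 D) t := fun {ψ} hψ t ht h0 ↦ by
    have h1 := ((hψ.differentiableOn (by simp) _ (hmaps ht)).hasDerivWithinAt).comp t
      (hΦd t ht) hmaps
    rwa [h0, mul_zero] at h1
  have h0 := left_mem_Icc.2 hD.le
  have h1 := right_mem_Icc.2 hD.le
  have hP0 : P 0 = 0 := by simp [hP, hΦ0, hF.left_eq_zero]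
  have hPD : P D = 0 := by
    have := hF.neg.left_eq_zero
    rw [neg_neg] at this
    simp [hP, hΦD, this]
  obtain ⟨r₀, hr₀, hα₀⟩ := hF.exists_rank_left
  obtain ⟨r₁, hr₁, hα₁⟩ := hF.neg.exists_rank_left
  have hg₁ := hF.neg.deriv_left_pos
  rw [hF.derivWithin_reflect] at hα₁ hg₁
  rw [neg_neg] at hα₁
  obtain ⟨ρ₀, hρ₀, hz₀, hl⟩ := exists_quotient_eq (m := r₀ - 1) hD hgΦ hPd hNs hP0 hPpos
    (by simp only [hΦ0, hg]; linarith [hF.deriv_left_pos])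
    (by simp only [hN, hg, hΦ0, hα₀, Nat.cast_sub hr₀, Nat.cast_one, hI]; ring)
    ((hcomp hgs 0 h0 hP0).derivWithin (hu 0 h0))
    ((hcomp (hF.smooth_α.sub hgs) 0 h0 hP0).derivWithin (hu 0 h0))
  have hrefl : MapsTo (fun t ↦ D - t) (Icc 0 D) (Icc 0 D) := mapsTo_reflect
  have hrd : ∀ t, HasDerivWithinAt (fun t ↦ D - t) (-1) (Icc 0 D) t := fun t ↦
    ((hasDerivAt_id t).const_sub D).hasDerivWithinAt
  have hrefl0 : ∀ {ψ : ℝ → ℝ}, HasDerivWithinAt ψ 0 (Icc 0 D) D →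
      derivWithin (fun t ↦ -ψ (D - t)) (Icc 0 D) 0 = 0 := fun {ψ} hψ ↦ by
    rw [← sub_zero D] at hψ
    have h2 := (HasDerivWithinAt.comp (h₂ := ψ) (0 : ℝ) (by simpa using hψ) (hrd 0) hrefl).neg
    rw [zero_mul, neg_zero] at h2
    exact h2.derivWithin (hu 0 h0)
  obtain ⟨ρ₁, hρ₁, hz₁, hr⟩ := exists_quotient_eq (m := r₁ - 1) (P := fun t ↦ P (D - t))
    (P' := fun t ↦ -g (Φ (D - t))) (N := fun t ↦ -N (D - t)) hD
    (hgΦ.comp (by fun_prop) hrefl).neg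
    (fun t ht ↦ ((hPd _ (hrefl ht)).comp t (hrd t) hrefl).congr_deriv (by ring))
    (hNs.comp (by fun_prop) hrefl).neg (by simp [hPD])
    (fun t ht ↦ hPpos _ ⟨sub_pos.2 ht.2, by linarith [ht.1]⟩)
    (by simp only [sub_zero, hΦD, hg]; linarith)
    (by simp only [hN, hg, sub_zero, hΦD, Nat.cast_sub hr₁, Nat.cast_one]; linarith)
    (hrefl0 (hcomp hgs D h1 hPD)) (hrefl0 (hcomp (hF.smooth_α.sub hgs) D h1 hPD))
  refine ⟨r₀ - 1, r₁ - 1, exists_profile_of_ends hD hρ₀ hρ₁ hz₀ hz₁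
    (fun t ht ↦ by rw [hh t ht, hl t ht]) fun t ht ↦ ?_⟩
  have h2 := hr (D - t) ⟨sub_pos.2 ht.2, by linarith [ht.1]⟩
  rw [sub_sub_cancel] at h2
  rw [hh t ht, ← h2, neg_div, neg_neg]

end IsoData

end Isoparametric

end PaneitzBifurcation

theorem mainTheorem5
    -- a closed connected Riemannian manifold `(M, g)` of dimension `n`
    (n : ℕ) (M : Type*) [MetricSpace M] [ChartedSpace (EuclideanSpace ℝ (Fin n)) M]
    [IsManifold (𝓡 n) ∞ M] [CompactSpace M] [ConnectedSpace M]
    [Bundle.RiemannianBundle (fun x : M ↦ TangentSpace (𝓡 n) x)]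
    [IsContMDiffRiemannianBundle (𝓡 n) ∞ (EuclideanSpace ℝ (Fin n))
      (fun x : M ↦ TangentSpace (𝓡 n) x)]
    [IsRiemannianManifold (𝓡 n) M]
    -- an isoparametric function, with its width `D` and mean curvature function `h`
    (F : M → ℝ) (t₀ t₁ : ℝ) (hF : PaneitzBifurcation.IsIsoparametric (n := n) F t₀ t₁)
    (D : ℝ) (hD : D = PaneitzBifurcation.focalWidth F t₀ t₁)
    (h : ℝ → ℝ) (hh : h = PaneitzBifurcation.meanCurvature (n := n) F t₀)
    -- the Hölder exponent and the exponent of the equation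
    (θ : ℝ≥0) (hθ₀ : 0 < θ) (hθ₁ : θ < 1) (q : ℝ) (hq : 1 < q)
    -- the coefficient functions
    (a b : ℝ → ℝ) (ha : ContDiffOn ℝ ∞ a (Ioi 0)) (hb : ContDiffOn ℝ ∞ b (Ioi 0))
    (ha_pos : ∀ t, 0 < t → 0 < a t) (hb_pos : ∀ t, 0 < t → 0 < b t)
    (ha_mono : MonotoneOn a (Ioi 0)) (hb_mono : MonotoneOn b (Ioi 0))
    (hab : ∀ t, 0 < t → 4 * b t < a t ^ 2)
    (ha_zero : Tendsto a (𝓝[>] 0) (𝓝 0)) (hb_zero : Tendsto b (𝓝[>] 0) (𝓝 0))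
    (ha_top : Tendsto a atTop atTop) (hb_top : Tendsto b atTop atTop)
    (hφ_anti : StrictAntiOn (PaneitzBifurcation.phi q a b) (Ioi 0))
    (hφ_zero : Tendsto (PaneitzBifurcation.phi q a b) (𝓝[>] 0) (𝓝 0))
    (hφ_bot : Tendsto (PaneitzBifurcation.phi q a b) atTop atBot)
    -- transversality at every `t` for which `φ(t)` is an eigenvalue of `L`
    (htrans : ∀ t, 0 < t →
      PaneitzBifurcation.IsEigenvalue h D θ (PaneitzBifurcation.phi q a b t) →
      -deriv a t * PaneitzBifurcation.phi q a b t + deriv b t * (1 - q) ≠ 0) :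
    -- the eigenvalues of `L` are `0 = lam 0 > lam 1 > lam 2 > ⋯ → -∞`
    ∃ lam : ℕ → ℝ, lam 0 = 0 ∧ StrictAnti lam ∧ Tendsto lam atTop atBot ∧
      (∀ μ, PaneitzBifurcation.IsEigenvalue h D θ μ ↔ ∃ i, lam i = μ) ∧
    -- the instants `0 < τ 1 < τ 2 < ⋯ → ∞`, where `τ i` is the unique solution of `φ(t) = lam i`
    ∃ τ : ℕ → ℝ, (∀ i, 1 ≤ i → 0 < τ i) ∧ StrictMonoOn τ (Ici 1) ∧ Tendsto τ atTop atTop ∧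
      (∀ i, 1 ≤ i → ∀ t, 0 < t → (PaneitzBifurcation.phi q a b t = lam i ↔ t = τ i)) ∧
      -- the bifurcation points are exactly the points `(1, τ i)`
      (∀ t, PaneitzBifurcation.IsBifurcationPoint h D θ q a b t ↔ ∃ i, 1 ≤ i ∧ τ i = t) ∧
      -- for each `i ≥ 1` and each eigenfunction `v` with eigenvalue `lam i`
      ∀ i, 1 ≤ i → ∀ v, PaneitzBifurcation.IsEigenfunction h D θ (lam i) v →
        PaneitzBifurcation.IsSimpleWithKernel h D θ q a b (τ i) v ∧
        PaneitzBifurcation.HasNondegenerateCriticalPoints D (i + 1) v ∧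
        ∃ (ε : ℝ) (U : ℝ → ℝ → ℝ) (T : ℝ → ℝ), 0 < ε ∧
          PaneitzBifurcation.IsBifurcationCurve h D θ q a b (τ i) v ε U T ∧
          ∀ s ∈ Ioo (-ε) ε, s ≠ 0 →
            PaneitzBifurcation.HasNondegenerateCriticalPoints D (i + 1) (U s) := by
  obtain ⟨β, hβ, hgrad⟩ := hF.gradient
  obtain ⟨α, hα, hlap⟩ := hF.laplace
  have hiso : PaneitzBifurcation.IsoData n F t₀ t₁ β α :=
    ⟨hF.lt, hF.range_eq, hF.smooth, hβ, hgrad, hα, hlap⟩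
  obtain ⟨m₀, m₁, K, κ, hp⟩ := hiso.exists_profile
  subst hh
  rw [hiso.focalWidth_eq] at hD
  subst hD
  exact hp.bifurcation hθ₀ hθ₁ hq ha hb ha_pos hb_pos hφ_anti hφ_zero hφ_bot htrans
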